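/- Let $S$ be a finite set of pairwise disjoint (closed, nondegenerate) line segments in the plane whose endpoints do not all lie on one line. A \emph{circumscribing polygon} of $S$ is a simple polygon $P$ whose vertex set is exactly the set of endpoints of the segments in $S$ (angles of $180^\circ$ at a vertex are allowed), such that every segment of $S$ is either an edge of $P$ or an internal diagonal of $P$, that is, its relative interior lies in the interior of $P$. We say that $S$ \emph{admits escape routes} if its segments can be ordered and oriented as $a_1b_1,\ldots,a_nb_n$, where $n=|S|$, such that the following holds. For $i=1,\ldots,n$ in turn, shoot a ray from $b_i$ in direction $\overrightarrow{a_ib_i}$; it stops at the first point where it hits one of the previously shot (and stopped) rays, and goes to infinity if there is no such point. Then the part of the $i$-th ray traversed in this way, including its end, meets no segment of $S$ other than $a_ib_i$, for every $i$. We say that $S$ is \emph{extensible to rays} if there is a set of $n$ pairwise disjoint rays, each of which contains a segment of $S$. If $S$ admits escape routes, then $S$ has a circumscribing polygon. In particular, if $S$ is extensible to rays, then $S$ has a circumscribing polygon. -/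

import Mathlib

/-- The Euclidean plane. -/
abbrev Plane : Type := EuclideanSpace ℝ (Fin 2)

/-- The closed line segment spanned by an unordered pair of endpoints. -/
def segPts (e : Sym2 Plane) : Set Plane := convexHull ℝ (e : Set Plane)

theorem segPts_mk (x y : Plane) : segPts s(x, y) = segment ℝ x y := by
  simp [segPts, convexHull_pair]

/-- A set of pairwise disjoint nondegenerate closed line segments in the plane, each given by
its unordered pair of endpoints. -/
def IsDisjointSegments (S : Finset (Sym2 Plane)) : Prop :=
  (∀ e ∈ S, ¬ e.IsDiag) ∧ ∀ e ∈ S, ∀ f ∈ S, e ≠ f → Disjoint (segPts e) (segPts f)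

/-- The set of all segment endpoints. -/
def endpoints (S : Finset (Sym2 Plane)) : Set Plane := {x | ∃ e ∈ S, x ∈ e}

/-- The closed ray from `p` in direction `d`. -/
def rayFrom (p d : Plane) : Set Plane := {x | ∃ t : ℝ, 0 ≤ t ∧ x = p + t • d}

/-- `S` is extensible to rays: there are as many pairwise disjoint rays as there are segments,
each of which contains a segment of `S`. -/
def ExtensibleToRays (S : Finset (Sym2 Plane)) : Prop :=
  ∃ R : Finset (Set Plane), R.card = S.card ∧
    (∀ r ∈ R, ∃ p d : Plane, d ≠ 0 ∧ r = rayFrom p d) ∧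
    (∀ r ∈ R, ∀ r' ∈ R, r ≠ r' → Disjoint r r') ∧
    ∀ r ∈ R, ∃ e ∈ S, segPts e ⊆ r

/-- The trace of a ray shot from `p` in direction `d` with (closed) obstacle set `B`: the part
of the ray up to and including its first point in `B`, or the whole ray if it never meets `B`. -/
def shot (B : Set Plane) (p d : Plane) : Set Plane :=
  {x | ∃ t : ℝ, 0 ≤ t ∧ x = p + t • d ∧ ∀ u : ℝ, 0 ≤ u → u < t → p + u • d ∉ B}

/-- `S` admits escape routes: the segments can be ordered and oriented as `a i, b i` such that,
when for `i = 0, 1, …` a ray is shot from `b i` in direction `b i - a i` until it hits the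
trace of a previously shot ray (or else goes to infinity), no trace meets another segment. -/
def AdmitsEscapeRoutes (S : Finset (Sym2 Plane)) : Prop :=
  ∃ (a b : Fin S.card → Plane) (trace : Fin S.card → Set Plane),
    (S : Set (Sym2 Plane)) = Set.range (fun i => s(a i, b i)) ∧
    (∀ i, trace i = shot (⋃ j, ⋃ (_ : j < i), trace j) (b i) (b i - a i)) ∧
    ∀ i, ∀ e ∈ S, e ≠ s(a i, b i) → Disjoint (trace i) (segPts e)

/-- A simple polygon: at least three vertices, all distinct, and two distinct edges meet only
in common endpoints. (Angles of 180 degrees at a vertex are allowed.) -/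
def IsSimplePolygon {m : ℕ} (P : Polygon Plane m) : Prop :=
  3 ≤ m ∧ Function.Injective P.vertices ∧
    ∀ i j : Fin m, i ≠ j →
      P.edgeSet ℝ i ∩ P.edgeSet ℝ j =
        {P i, P (finRotate m i)} ∩ {P j, P (finRotate m j)}

/-- The interior of a simple polygon: the points of the complement of the boundary
whose connected component in the complement is bounded. -/
def polygonInterior {m : ℕ} (P : Polygon Plane m) : Set Plane :=
  {x | x ∉ P.boundary ℝ ∧ Bornology.IsBounded (connectedComponentIn (P.boundary ℝ)ᶜ x)}

/-- `P` is a circumscribing polygon for `S`: a simple polygon whose vertex set is the set of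
segment endpoints, such that every segment of `S` is an edge of `P` or an internal diagonal
of `P` (without its endpoints, it lies in the interior of `P`). -/
def IsCircumscribingPolygon {m : ℕ} (P : Polygon Plane m) (S : Finset (Sym2 Plane)) : Prop :=
  IsSimplePolygon P ∧ Set.range P.vertices = endpoints S ∧
    ∀ e ∈ S, (∃ i, e = s(P i, P (finRotate m i))) ∨
      segPts e \ (e : Set Plane) ⊆ polygonInterior P

/-! A polygon is shrunk until it passes through all endpoints. A state (`St`) is a simple polygon
with an open bounded region `G` to the left of its edges, such that every endpoint is a vertex or
lies in `G`, and every segment is an edge or has its relative interior in `G`. A state whose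
vertices are exactly the endpoints is a circumscribing polygon (`exists_circumscribing`). The moves
subdivide an edge, cut a triangle off `G` at an edge, or cut off a convex corner.

The central notion is `HalfFree`: a point has a free half disc, and one of the two rays bounding
this half disc starts in `G`. No vertex is ever half free with respect to `G` minus the segments.
This survives shrinking `G`, so it has to be checked only at new vertices.

Reaching the endpoints `b i`. Start with a large triangle. In the given order, the ray from `b i`
runs inside `G` until it hits an edge, and a thin wedge around this piece of the ray is cut out
(`St.wedge`). Then `b i` is a vertex, at the price of two auxiliary vertices on the edge. The escape
condition guarantees that no wedge meets a foreign segment, and a route that has left `G` does not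
come back before it stops (`RouteState.step`). The auxiliary vertices are convex corners. Each is
removed by replacing its two edges by a chain of tangents around the endpoints inside its corner
(`St.sweep`, `St.cutAll`). A tangent could fail to run inside `G` only if edges lie along it. Since
no vertex is half free, the whole polygon would then be a flat triangle with all endpoints on one
line (`Sweep.chord_free`). Further wedges are cut until the extension of every unvisited endpoint
meets a segment before it leaves `G` (`exists_extensionsHit`).

Decomposing the rest. Now only some tips `a i` are missing. Each such segment is prolonged beyond
its tip to a wall that stops at the first other wall (`exists_walls`). No boundary point of the free
region between the walls is half free, so the components of this region, the cells, are convex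
(`convex_connectedComponentIn`): a view blocked for the first time would be blocked at a half free
point.

Every missing tip lies in the closure of a cell bounded by a real edge, that is, a polygon edge that
is not a segment (`WallSetup.exists_good_cell`). Indeed, consider the cells on the two sides of its
wall. If neither had a real edge, they would be bounded by walls only. Cyclic chains of walls
running in the wrong direction being impossible, the wall on which the given wall ends would have to
continue to both sides, hence straight on; then it starts at a vertex which is half free
(`WallSetup.sides_false`).

Inserting the tips. Each missing tip is assigned to such a cell, with its real edge as base
(`WallSetup.exists_tipState`). The tip nearest to a base `p q` is inserted between `p` and `q`; the
lines from it to `p` and `q` divide the other tips of the cell into two groups, with bases the two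
new edges (`TipState.step`). Iteration reaches all tips.

Pairwise disjoint rays containing the segments are themselves escape routes in any order
(`admitsEscapeRoutes_of_extensible`). -/

section CircumscribingPolygon

open Set Filter Topology
open scoped Classical

/-! ### Signed areas and parametrised lines -/

/-- Twice the signed area of the triangle `p q r`. -/
def ori (p q r : Plane) : ℝ := (q 0 - p 0) * (r 1 - p 1) - (q 1 - p 1) * (r 0 - p 0)

/-- The point at parameter `t` on the line from `p` to `q`. -/
def pt (p q : Plane) (t : ℝ) : Plane := p + t • (q - p)

/-- The closed triangle with counterclockwise vertices `u x v`. -/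
def tri (u x v : Plane) : Set Plane := {y | 0 ≤ ori u x y ∧ 0 ≤ ori x v y ∧ 0 ≤ ori v u y}

theorem plane_ext {p q : Plane} (h0 : p 0 = q 0) (h1 : p 1 = q 1) : p = q := by
  ext i; fin_cases i <;> assumption

theorem pt_apply (p q : Plane) (t : ℝ) (i : Fin 2) : pt p q t i = p i + t * (q i - p i) := by
  simp [pt]

@[simp] theorem pt_zero (p q : Plane) : pt p q 0 = p := by simp [pt]
@[simp] theorem pt_one (p q : Plane) : pt p q 1 = q := by simp [pt]

theorem mem_segment_pt {p q y : Plane} :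
    y ∈ segment ℝ p q ↔ ∃ t : ℝ, 0 ≤ t ∧ t ≤ 1 ∧ y = pt p q t := by
  rw [segment_eq_image']
  constructor
  · rintro ⟨t, ⟨h0, h1⟩, rfl⟩; exact ⟨t, h0, h1, rfl⟩
  · rintro ⟨t, h0, h1, rfl⟩; exact ⟨t, ⟨h0, h1⟩, rfl⟩

theorem mem_openSegment_pt {p q y : Plane} :
    y ∈ openSegment ℝ p q ↔ ∃ t : ℝ, 0 < t ∧ t < 1 ∧ y = pt p q t := by
  rw [openSegment_eq_image']
  constructor
  · rintro ⟨t, ⟨h0, h1⟩, rfl⟩; exact ⟨t, h0, h1, rfl⟩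
  · rintro ⟨t, h0, h1, rfl⟩; exact ⟨t, ⟨h0, h1⟩, rfl⟩

theorem ori_pt (p q a b : Plane) (t : ℝ) :
    ori p q (pt a b t) = (1 - t) * ori p q a + t * ori p q b := by
  simp only [ori, pt_apply]; ring

theorem ori_rot (p q r : Plane) : ori p q r = ori q r p := by simp only [ori]; ring
theorem ori_swap (p q r : Plane) : ori p q r = -ori q p r := by simp only [ori]; ring
theorem ori_swap' (p q r : Plane) : ori p q r = -ori p r q := by simp only [ori]; ring
@[simp] theorem ori_self_left (p q : Plane) : ori p q p = 0 := by simp only [ori]; ring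
@[simp] theorem ori_self_right (p q : Plane) : ori p q q = 0 := by simp only [ori]; ring
@[simp] theorem ori_self_self (p q : Plane) : ori p p q = 0 := by simp only [ori]; ring

theorem ori_sum (u x v y : Plane) : ori u x y + ori x v y + ori v u y = ori u x v := by
  simp only [ori]; ring

theorem ori_pt_mid (p q m : Plane) (t : ℝ) : ori p (pt p q t) m = t * ori p q m := by
  simp only [ori, pt_apply]; ring

@[fun_prop] theorem continuous_ori (p q : Plane) : Continuous (fun y => ori p q y) := by
  unfold ori; fun_prop

@[fun_prop] theorem continuous_pt (p q : Plane) : Continuous (fun t => pt p q t) := by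
  unfold pt; fun_prop

theorem pt_mem_segment {p q : Plane} {t : ℝ} (h0 : 0 ≤ t) (h1 : t ≤ 1) :
    pt p q t ∈ segment ℝ p q := mem_segment_pt.2 ⟨t, h0, h1, rfl⟩

theorem pt_mem_openSegment {p q : Plane} {t : ℝ} (h0 : 0 < t) (h1 : t < 1) :
    pt p q t ∈ openSegment ℝ p q := mem_openSegment_pt.2 ⟨t, h0, h1, rfl⟩

theorem pt_symm (p q : Plane) (t : ℝ) : pt p q t = pt q p (1 - t) := by
  apply plane_ext <;> simp only [pt_apply] <;> ring

theorem pt_pt (p q : Plane) (s t : ℝ) : pt p (pt p q s) t = pt p q (s * t) := by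
  apply plane_ext <;> simp only [pt_apply] <;> ring

theorem pt_pt_pt (p q : Plane) (r s t : ℝ) :
    pt (pt p q r) (pt p q s) t = pt p q (r + t * (s - r)) := by
  apply plane_ext <;> simp only [pt_apply] <;> ring

theorem pt_inj {p q : Plane} (h : p ≠ q) {s t : ℝ} (e : pt p q s = pt p q t) : s = t := by
  by_contra hst
  apply h
  have h0 : ∀ i, (s - t) * (q i - p i) = 0 := fun i => by
    have := congrArg (fun y : Plane => y i) e
    simp only [pt_apply] at this; linarith
  apply plane_ext
  · rcases mul_eq_zero.1 (h0 0) with h | h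
    · exact absurd (sub_eq_zero.1 h) hst
    · linarith
  · rcases mul_eq_zero.1 (h0 1) with h | h
    · exact absurd (sub_eq_zero.1 h) hst
    · linarith

theorem left_notMem_openSegment {p q : Plane} (h : p ≠ q) : p ∉ openSegment ℝ p q := by
  rintro hp
  obtain ⟨t, h0, _, e⟩ := mem_openSegment_pt.1 hp
  have := pt_inj h (s := 0) (t := t) (by simpa using e)
  linarith

theorem right_notMem_openSegment {p q : Plane} (h : p ≠ q) : q ∉ openSegment ℝ p q := by
  rw [openSegment_symm]; exact left_notMem_openSegment h.symm

theorem mem_segment_cases {p q y : Plane} (h : y ∈ segment ℝ p q) :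
    y = p ∨ y = q ∨ y ∈ openSegment ℝ p q := by
  obtain ⟨t, h0, h1, rfl⟩ := mem_segment_pt.1 h
  rcases h0.eq_or_lt with rfl | h0
  · simp
  rcases h1.eq_or_lt with rfl | h1
  · simp
  · exact Or.inr (Or.inr (pt_mem_openSegment h0 h1))

theorem mem_line_of_ori_eq_zero {p q y : Plane} (h : p ≠ q) (hy : ori p q y = 0) :
    ∃ t, y = pt p q t := by
  by_cases h0 : q 0 - p 0 = 0
  · have h1 : q 1 - p 1 ≠ 0 := fun h1 => h (plane_ext (by linarith) (by linarith))
    refine ⟨(y 1 - p 1) / (q 1 - p 1), plane_ext ?_ ?_⟩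
    · rw [pt_apply, h0]
      simp only [ori, h0] at hy
      have : (q 1 - p 1) * (y 0 - p 0) = 0 := by linarith
      rcases mul_eq_zero.1 this with h | h
      · exact absurd h h1
      · linarith
    · rw [pt_apply]; field_simp; ring
  · refine ⟨(y 0 - p 0) / (q 0 - p 0), plane_ext ?_ ?_⟩
    · rw [pt_apply]; field_simp; ring
    · rw [pt_apply]; simp only [ori] at hy; field_simp; linarith

theorem ne_of_ori_ne {p q r : Plane} (h : ori p q r ≠ 0) : p ≠ q ∧ q ≠ r ∧ p ≠ r := by
  refine ⟨?_, ?_, ?_⟩ <;> rintro rfl <;> simp at h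

/-! ### Half planes, triangles and barycentric coordinates -/

theorem isClosed_tri (u x v : Plane) : IsClosed (tri u x v) := by
  apply IsClosed.inter (isClosed_le continuous_const (continuous_ori _ _))
  exact (isClosed_le continuous_const (continuous_ori _ _)).inter
    (isClosed_le continuous_const (continuous_ori _ _))

theorem ori_combo {p q a b : Plane} {s t : ℝ} (hst : s + t = 1) :
    ori p q (s • a + t • b) = s * ori p q a + t * ori p q b := by
  obtain rfl : s = 1 - t := by linarith
  simp [ori]; ring

theorem convex_ori_pos (p q : Plane) : Convex ℝ {y | 0 < ori p q y} := by
  intro a ha b hb s t hs ht hst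
  simp only [mem_ofPred_eq] at *
  rw [ori_combo hst]
  rcases hs.eq_or_lt with rfl | hs
  · simp_all
  · have := mul_pos hs ha; have := mul_nonneg ht hb.le; linarith

theorem convex_ori_nonneg (p q : Plane) : Convex ℝ {y | 0 ≤ ori p q y} := by
  intro a ha b hb s t hs ht hst
  simp only [mem_ofPred_eq] at *
  rw [ori_combo hst]; positivity

theorem convex_ori_neg (p q : Plane) : Convex ℝ {y | ori p q y < 0} := by
  have := convex_ori_pos q p
  convert this using 3 with y
  rw [ori_swap]; simp

theorem convex_tri (u x v : Plane) : Convex ℝ (tri u x v) :=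
  (convex_ori_nonneg u x).inter ((convex_ori_nonneg x v).inter (convex_ori_nonneg v u))

theorem tri_rot (u x v : Plane) : tri u x v = tri x v u := by
  ext y; simp only [tri, mem_ofPred_eq]; tauto

theorem left_mem_tri {u x v : Plane} (h : 0 ≤ ori u x v) : u ∈ tri u x v := by
  refine ⟨by simp, ?_, by simp⟩
  rw [← ori_rot]; exact h

theorem mid_mem_tri {u x v : Plane} (h : 0 ≤ ori u x v) : x ∈ tri u x v := by
  rw [tri_rot]; exact left_mem_tri (by rwa [← ori_rot])

theorem right_mem_tri {u x v : Plane} (h : 0 ≤ ori u x v) : v ∈ tri u x v := by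
  rw [tri_rot]; exact mid_mem_tri (by rwa [← ori_rot])

theorem segment_subset_tri {u x v : Plane} (h : 0 ≤ ori u x v) :
    segment ℝ u x ⊆ tri u x v ∧ segment ℝ x v ⊆ tri u x v ∧ segment ℝ u v ⊆ tri u x v :=
  ⟨(convex_tri u x v).segment_subset (left_mem_tri h) (mid_mem_tri h),
   (convex_tri u x v).segment_subset (mid_mem_tri h) (right_mem_tri h),
   (convex_tri u x v).segment_subset (left_mem_tri h) (right_mem_tri h)⟩

/-- A point of the triangle on the line of its first side lies on that side. -/
theorem mem_segment_of_tri {u x v y : Plane} (h : 0 < ori u x v) (hy : y ∈ tri u x v)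
    (h0 : ori u x y = 0) : y ∈ segment ℝ u x := by
  have hne := (ne_of_ori_ne h.ne').1
  obtain ⟨t, rfl⟩ := mem_line_of_ori_eq_zero hne h0
  obtain ⟨-, h2, h3⟩ := hy
  rw [ori_pt] at h2 h3
  simp only [ori_self_left, ori_self_right, mul_zero, add_zero, zero_add] at h2 h3
  rw [← ori_rot] at h2
  rw [ori_rot v u x] at h3
  refine pt_mem_segment ?_ ?_
  · by_contra hc; push Not at hc; nlinarith
  · by_contra hc; push Not at hc; nlinarith

theorem mem_segment_of_tri₂ {u x v y : Plane} (h : 0 < ori u x v) (hy : y ∈ tri u x v)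
    (h0 : ori x v y = 0) : y ∈ segment ℝ x v :=
  mem_segment_of_tri (v := u) (by rwa [← ori_rot]) (by rwa [← tri_rot]) h0

theorem mem_segment_of_tri₃ {u x v y : Plane} (h : 0 < ori u x v) (hy : y ∈ tri u x v)
    (h0 : ori v u y = 0) : y ∈ segment ℝ u v := by
  rw [segment_symm]
  exact mem_segment_of_tri₂ (u := x) (by rwa [← ori_rot]) (by rwa [← tri_rot]) h0

/-- Barycentric coordinates. -/
theorem eq_bary {u x v : Plane} (h : ori u x v ≠ 0) (y : Plane) :
    y = (ori x v y / ori u x v) • u + (ori v u y / ori u x v) • x +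
      (ori u x y / ori u x v) • v := by
  apply plane_ext <;> simp only [PiLp.add_apply, PiLp.smul_apply, smul_eq_mul] <;>
    field_simp <;> simp only [ori] <;> ring

theorem tri_subset_of_convex {u x v : Plane} (h : 0 < ori u x v) {C : Set Plane}
    (hC : Convex ℝ C) (hu : u ∈ C) (hx : x ∈ C) (hv : v ∈ C) : tri u x v ⊆ C := by
  intro y hy
  rw [eq_bary h.ne' y]
  have h1 := div_nonneg hy.1 h.le
  have h2 := div_nonneg hy.2.1 h.le
  have h3 := div_nonneg hy.2.2 h.le
  have hs : ori x v y / ori u x v + ori v u y / ori u x v + ori u x y / ori u x v = 1 := by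
    rw [← add_div, ← add_div, div_eq_one_iff_eq h.ne', ← ori_sum u x v y]; ring
  have := hC.sum_mem (t := Finset.univ)
    (w := ![ori x v y / ori u x v, ori v u y / ori u x v, ori u x y / ori u x v])
    (z := ![u, x, v]) (by intro i _; fin_cases i <;> assumption)
    (by simpa [Fin.sum_univ_three] using hs)
    (by intro i _; fin_cases i <;> assumption)
  simpa [Fin.sum_univ_three] using this

theorem frontier_tri {u x v y : Plane} (hy : y ∈ frontier (tri u x v)) :
    ori u x y = 0 ∨ ori x v y = 0 ∨ ori v u y = 0 := by
  have hT : y ∈ tri u x v := (isClosed_tri u x v).frontier_subset hy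
  by_contra! hc
  obtain ⟨h1, h2, h3⟩ := hc
  have e1 := hT.1.lt_of_ne' h1
  have e2 := hT.2.1.lt_of_ne' h2
  have e3 := hT.2.2.lt_of_ne' h3
  apply hy.2
  rw [mem_interior_iff_mem_nhds]
  filter_upwards [(continuous_ori u x).continuousAt.eventually (lt_mem_nhds e1),
    (continuous_ori x v).continuousAt.eventually (lt_mem_nhds e2),
    (continuous_ori v u).continuousAt.eventually (lt_mem_nhds e3)] with z a b c
  exact ⟨a.le, b.le, c.le⟩

/-! ### Local sign conditions and connectedness arguments -/

theorem eventually_ori_pos {p q y : Plane} (h : 0 < ori p q y) : ∀ᶠ z in 𝓝 y, 0 < ori p q z :=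
  (continuous_ori p q).continuousAt.eventually (lt_mem_nhds h)

theorem eventually_ori_neg {p q y : Plane} (h : ori p q y < 0) : ∀ᶠ z in 𝓝 y, ori p q z < 0 :=
  (continuous_ori p q).continuousAt.eventually (gt_mem_nhds h)

theorem tendsto_pt_zero (y r : Plane) : Tendsto (fun t : ℝ => pt y r t) (𝓝[>] 0) (𝓝 y) := by
  have := (continuous_pt y r).tendsto 0
  rw [pt_zero] at this
  exact this.mono_left nhdsWithin_le_nhds

/-- A property that holds near `y` holds for some point of the ray from `y` to `r` near `y`. -/
theorem exists_pt_of_eventually {y : Plane} (r : Plane) {Q : Plane → Prop}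
    (h : ∀ᶠ z in 𝓝 y, Q z) {ε : ℝ} (hε : 0 < ε) : ∃ t, 0 < t ∧ t < ε ∧ Q (pt y r t) := by
  have h1 := (tendsto_pt_zero y r).eventually h
  have h2 : ∀ᶠ t : ℝ in 𝓝[>] 0, t ∈ Ioo 0 ε := Ioo_mem_nhdsGT hε
  obtain ⟨t, a, b⟩ := (h1.and h2).exists
  exact ⟨t, b.1, b.2, a⟩

theorem exists_ori_pos {p q : Plane} (h : p ≠ q) : ∃ r, 0 < ori p q r := by
  refine ⟨WithLp.toLp 2 ![p 0 - (q 1 - p 1), p 1 + (q 0 - p 0)], ?_⟩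
  simp only [ori, Matrix.cons_val_zero, Matrix.cons_val_one]
  have : 0 < (q 0 - p 0) ^ 2 + (q 1 - p 1) ^ 2 := by
    by_contra hc
    apply h
    apply plane_ext <;> nlinarith [sq_nonneg (q 0 - p 0), sq_nonneg (q 1 - p 1)]
  nlinarith

theorem exists_mem_frontier {s C : Set Plane} (hC : IsPreconnected C)
    (h1 : (C ∩ s).Nonempty) (h2 : (C ∩ sᶜ).Nonempty) : (C ∩ frontier s).Nonempty := by
  by_contra hc
  have hd : ∀ y ∈ C, y ∉ frontier s := fun y hy hf => hc ⟨y, hy, hf⟩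
  obtain ⟨y, hy, hys⟩ := h1
  obtain ⟨z, hz, hzs⟩ := h2
  have hyi : y ∈ interior s := by
    by_contra hi; exact hd y hy ⟨subset_closure hys, hi⟩
  have hzi : z ∈ (closure s)ᶜ := fun hi => hd z hz ⟨hi, fun h => hzs (interior_subset h)⟩
  obtain ⟨a, -, ha1, ha2⟩ := hC (interior s) (closure s)ᶜ isOpen_interior
    isClosed_closure.isOpen_compl (fun a ha => by
      by_cases h : a ∈ interior s
      · exact Or.inl h
      · exact Or.inr fun hcl => hd a ha ⟨hcl, h⟩) ⟨y, hy, hyi⟩ ⟨z, hz, hzi⟩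
  exact ha2 (subset_closure (interior_subset ha1))

/-- A connected set that avoids the frontier of `G` and meets `G` lies in `G`. -/
theorem subset_of_avoid_frontier {G C : Set Plane} (hC : IsPreconnected C)
    (h : Disjoint C (frontier G)) (hne : (C ∩ G).Nonempty) : C ⊆ G := by
  by_contra hc
  obtain ⟨y, hy, hyG⟩ := Set.not_subset.1 hc
  obtain ⟨z, hz⟩ := exists_mem_frontier hC hne ⟨y, hy, hyG⟩
  exact h.le_bot hz

/-! ### Polygons with a region on their left -/

/-- A simple polygon with vertex set `A`, given by its successor function `nx`, together with a
bounded open region `G` that lies to the left of every edge and is bounded by the edges. -/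
structure PolyRegion (nx : Plane → Plane) (A : Finset Plane) (G : Set Plane) : Prop where
  maps : ∀ p ∈ A, nx p ∈ A
  inj : ∀ p ∈ A, ∀ q ∈ A, nx p = nx q → p = q
  -- This says that `nx` is a single cycle on `A`, in a form that insertions and deletions preserve
  -- by plain set arguments.
  trans : ∀ B ⊆ A, B.Nonempty → (∀ b ∈ B, nx b ∈ B) → B = A
  nonempty : A.Nonempty
  ne : ∀ p ∈ A, nx p ≠ p
  simple : ∀ p ∈ A, ∀ q ∈ A, p ≠ q →
    Disjoint (openSegment ℝ p (nx p)) (segment ℝ q (nx q))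
  isOpen : IsOpen G
  bdd : Bornology.IsBounded G
  disj : ∀ p ∈ A, Disjoint G (segment ℝ p (nx p))
  -- Only one inclusion is required; that every edge lies in the closure of `G` follows from `loc`
  -- (`segment_subset_closure`).
  front : ∀ y ∈ closure G, y ∉ G → ∃ p ∈ A, y ∈ segment ℝ p (nx p)
  loc : ∀ p ∈ A, ∀ m ∈ openSegment ℝ p (nx p), ∀ᶠ y in 𝓝 m, (y ∈ G ↔ 0 < ori p (nx p) y)

/-- The successor function after inserting `w` behind `u`. -/
noncomputable def insNext (nx : Plane → Plane) (u w p : Plane) : Plane :=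
  if p = w then nx u else if p = u then w else nx p

/-- The successor function after deleting the successor of `u`. -/
noncomputable def delNext (nx : Plane → Plane) (u p : Plane) : Plane :=
  if p = u then nx (nx u) else nx p

theorem insNext_new (nx : Plane → Plane) (u w : Plane) : insNext nx u w w = nx u := by
  simp [insNext]

theorem insNext_left (nx : Plane → Plane) {u w : Plane} (h : u ≠ w) : insNext nx u w u = w := by
  simp [insNext, h]

theorem insNext_of_ne (nx : Plane → Plane) {u w p : Plane} (h : p ≠ w) (h' : p ≠ u) :
    insNext nx u w p = nx p := by simp [insNext, h, h']

theorem delNext_left (nx : Plane → Plane) (u : Plane) : delNext nx u u = nx (nx u) := by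
  simp [delNext]

theorem delNext_of_ne (nx : Plane → Plane) {u p : Plane} (h : p ≠ u) :
    delNext nx u p = nx p := by simp [delNext, h]

theorem ori_pt_left_pos {p q r : Plane} (h : 0 < ori p q r) {t : ℝ} (h1 : t < 1) :
    0 < ori q r (pt p q t) := by
  rw [ori_pt, ori_self_left, mul_zero, add_zero, ← ori_rot]
  exact mul_pos (by linarith) h

theorem ori_pt_right_pos {p q r : Plane} (h : 0 < ori p q r) {t : ℝ} (h1 : 0 < t) :
    0 < ori r p (pt p q t) := by
  rw [ori_pt, ori_self_right, mul_zero, zero_add, ori_rot r p q]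
  exact mul_pos h1 h

namespace PolyRegion

variable {nx : Plane → Plane} {A : Finset Plane} {G : Set Plane}

theorem notMem_of_vertex (h : PolyRegion nx A G) {p : Plane} (hp : p ∈ A) : p ∉ G := fun hG =>
  (h.disj p hp).le_bot ⟨hG, left_mem_segment ℝ _ _⟩

theorem vertex_notMem_open (h : PolyRegion nx A G) {p q : Plane} (hp : p ∈ A) (hq : q ∈ A) :
    q ∉ openSegment ℝ p (nx p) := by
  intro hm
  by_cases e : p = q
  · subst e; exact left_notMem_openSegment (h.ne p hp).symm hm
  · exact (h.simple p hp q hq e).le_bot ⟨hm, left_mem_segment ℝ _ _⟩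

theorem eq_or_of_vertex_mem (h : PolyRegion nx A G) {p q : Plane} (hp : p ∈ A) (hq : q ∈ A)
    (hm : q ∈ segment ℝ p (nx p)) : q = p ∨ q = nx p := by
  rcases mem_segment_cases hm with e | e | e
  · exact Or.inl e
  · exact Or.inr e
  · exact absurd e (h.vertex_notMem_open hp hq)

theorem nx_nx_ne (h : PolyRegion nx A G) {p : Plane} (hp : p ∈ A) : nx (nx p) ≠ p := by
  intro e
  have := h.simple p hp (nx p) (h.maps p hp) (h.ne p hp).symm
  rw [e, segment_symm] at this
  have hm : pt p (nx p) (1/2) ∈ openSegment ℝ p (nx p) :=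
    pt_mem_openSegment (by norm_num) (by norm_num)
  exact this.le_bot ⟨hm, openSegment_subset_segment ℝ _ _ hm⟩

theorem segment_subset_closure (h : PolyRegion nx A G) {p : Plane} (hp : p ∈ A) :
    segment ℝ p (nx p) ⊆ closure G := by
  rw [← closure_openSegment]
  apply closure_minimal _ isClosed_closure
  intro m hm
  rw [mem_closure_iff_frequently]
  intro hev
  obtain ⟨r, hr⟩ := exists_ori_pos (h.ne p hp).symm
  obtain ⟨t, ht0, -, h1, h2⟩ :=
    exists_pt_of_eventually r ((h.loc p hp m hm).and hev) one_pos
  apply h2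
  rw [h1, ori_pt]
  obtain ⟨s, -, -, rfl⟩ := mem_openSegment_pt.1 hm
  rw [ori_pt]
  simp only [ori_self_left, ori_self_right, mul_zero, add_zero, zero_add]
  exact mul_pos ht0 hr

theorem frontier_subset (h : PolyRegion nx A G) {y : Plane} (hy : y ∈ frontier G) :
    ∃ p ∈ A, y ∈ segment ℝ p (nx p) := by
  rw [h.isOpen.frontier_eq] at hy
  exact h.front y hy.1 hy.2

theorem exists_prev (h : PolyRegion nx A G) {p : Plane} (hp : p ∈ A) : ∃ q ∈ A, nx q = p := by
  have hi : Set.InjOn nx A := fun a ha b hb e => h.inj a ha b hb e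
  have hs : A.image nx ⊆ A := by
    intro q hq
    obtain ⟨a, ha, rfl⟩ := Finset.mem_image.1 hq
    exact h.maps a ha
  have he : A.image nx = A := Finset.eq_of_subset_of_card_le hs (Finset.card_image_of_injOn hi).ge
  rw [← he] at hp
  obtain ⟨q, hq, e⟩ := Finset.mem_image.1 hp
  exact ⟨q, hq, e⟩

/-- Near a vertex, only its two edges are present. -/
theorem eventually_notMem_edges (h : PolyRegion nx A G) {u : Plane} (hu : u ∈ A) :
    ∀ᶠ y in 𝓝 (nx u), ∀ p ∈ A, p ≠ u → p ≠ nx u → y ∉ segment ℝ p (nx p) := by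
  rw [Finset.eventually_all]
  intro p hp
  by_cases hpu : p = u
  · simp [hpu]
  by_cases hpx : p = nx u
  · simp [hpx]
  have hc : IsClosed (segment ℝ p (nx p)) := by
    rw [← closure_openSegment]; exact isClosed_closure
  have : nx u ∉ segment ℝ p (nx p) := by
    intro hm
    rcases h.eq_or_of_vertex_mem hp (h.maps u hu) hm with e | e
    · exact hpx e.symm
    · exact hpu (h.inj p hp u hu e.symm)
  filter_upwards [hc.isOpen_compl.mem_nhds this] with y hy _ _ using hy

/-- Near a convex vertex the region lies in the angle. -/
theorem corner (h : PolyRegion nx A G) {u : Plane} (hu : u ∈ A)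
    (ho : 0 < ori u (nx u) (nx (nx u))) :
    ∀ᶠ y in 𝓝 (nx u), y ∈ G → 0 ≤ ori u (nx u) y ∧ 0 ≤ ori (nx u) (nx (nx u)) y := by
  set x := nx u with hx
  set v := nx x with hv
  have hxA : x ∈ A := h.maps u hu
  obtain ⟨ε, hε, hB⟩ := Metric.eventually_nhds_iff_ball.1 (h.eventually_notMem_edges hu)
  -- The half ball to the right of the line `a b` meets no edge: both edges at `x` lie on the other
  -- side, the remaining ones miss the ball. If it met `G` it would lie in `G`, contradicting `loc`
  -- at an inner point of the edge `a b`.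
  have key : ∀ a b : Plane, a ∈ A → b = nx a → (a = u ∨ a = x) →
      (∀ t : ℝ, 0 ≤ t → 0 ≤ ori a b (pt x u t)) → (∀ t : ℝ, 0 ≤ t → 0 ≤ ori a b (pt x v t)) →
      ∀ y ∈ Metric.ball x ε, ori a b y < 0 → y ∉ G := by
    intro a b ha hb hax h1 h2 y hy hneg hyG
    have hC : IsPreconnected (Metric.ball x ε ∩ {y | ori a b y < 0}) :=
      ((convex_ball x ε).inter (convex_ori_neg a b)).isPreconnected
    have hsub : Metric.ball x ε ∩ {y | ori a b y < 0} ⊆ G := by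
      refine subset_of_avoid_frontier hC ?_ ⟨y, ⟨hy, hneg⟩, hyG⟩
      rw [Set.disjoint_left]
      rintro z ⟨hz1, hz2⟩ hz3
      obtain ⟨p, hp, hzp⟩ := h.frontier_subset hz3
      have hz2 : ori a b z < 0 := hz2
      by_cases hpu : p = u
      · subst hpu
        rw [segment_symm] at hzp
        obtain ⟨t, t0, -, rfl⟩ := mem_segment_pt.1 hzp
        exact absurd (h1 t t0) (not_le.2 hz2)
      by_cases hpx : p = x
      · subst hpx
        obtain ⟨t, t0, -, rfl⟩ := mem_segment_pt.1 hzp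
        exact absurd (h2 t t0) (not_le.2 hz2)
      · exact hB z hz1 p hp hpu hpx hzp
    have hab : a ≠ b := by rw [hb]; exact (h.ne a ha).symm
    obtain ⟨m, hm1, hm2⟩ : ∃ m ∈ openSegment ℝ a b, m ∈ Metric.ball x ε := by
      have hxcl : x ∈ closure (openSegment ℝ a b) := by
        rw [closure_openSegment]
        rcases hax with rfl | rfl
        · rw [hb]; exact right_mem_segment ℝ _ _
        · exact left_mem_segment ℝ _ _
      obtain ⟨m, hm, hd⟩ := Metric.mem_closure_iff.1 hxcl ε hε
      exact ⟨m, hm, by rw [Metric.mem_ball, dist_comm]; exact hd⟩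
    obtain ⟨r, hr⟩ := exists_ori_pos hab.symm
    rw [hb] at hm1
    obtain ⟨t, ht, -, h3, h4⟩ := exists_pt_of_eventually r
      ((h.loc a ha m hm1).and (Metric.isOpen_ball.mem_nhds hm2)) one_pos
    rw [← hb] at h3 hm1
    have h5 : ori a b (pt m r t) < 0 := by
      rw [ori_pt]
      obtain ⟨s, -, -, rfl⟩ := mem_openSegment_pt.1 hm1
      rw [ori_pt, ori_swap a b r]
      simp only [ori_self_left, ori_self_right, mul_zero, add_zero, zero_add]
      have := mul_pos ht hr
      linarith
    have := h3.1 (hsub ⟨h4, h5⟩)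
    linarith
  filter_upwards [Metric.ball_mem_nhds x hε] with y hy hyG
  constructor
  · by_contra hc
    refine key u x hu rfl (Or.inl rfl) ?_ ?_ y hy (not_le.1 hc) hyG
    · intro t _; rw [ori_pt]; simp
    · intro t ht; rw [ori_pt]; simp only [ori_self_right, mul_zero, zero_add]; positivity
  · by_contra hc
    refine key x v hxA rfl (Or.inr rfl) ?_ ?_ y hy (not_le.1 hc) hyG
    · intro t ht; rw [ori_pt, ← ori_rot u x v]
      simp only [ori_self_left, mul_zero, zero_add]; positivity
    · intro t _; rw [ori_pt]; simp

/-! ### Elementary moves: insertion of a vertex, subdivision, removal of a convex corner -/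

/-- Cutting off the triangle `u (nx u) w` from the region inserts the vertex `w`. -/
theorem insert (h : PolyRegion nx A G) {u w : Plane} (hu : u ∈ A) (hw : w ∉ A)
    (ho : 0 < ori u (nx u) w) (hT : tri u (nx u) w \ segment ℝ u (nx u) ⊆ G) :
    PolyRegion (insNext nx u w) (insert w A) (G \ tri u (nx u) w) := by
  obtain ⟨hux, hxw, huw⟩ := ne_of_ori_ne ho.ne'
  have hAw : ∀ p ∈ A, p ≠ w := fun p hp e => hw (e ▸ hp)
  have hxA : nx u ∈ A := h.maps u hu
  have eu : insNext nx u w u = w := insNext_left nx huw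
  have ew : insNext nx u w w = nx u := insNext_new nx u w
  have ep : ∀ p ∈ A, p ≠ u → insNext nx u w p = nx p := fun p hp hpu =>
    insNext_of_ne nx (hAw p hp) hpu
  set x := nx u with hx
  have hwG : w ∈ G := hT ⟨right_mem_tri ho.le, fun hm => by
    obtain ⟨t, -, -, e⟩ := mem_segment_pt.1 hm
    rw [e, ori_pt] at ho; simp at ho⟩
  have huwG : openSegment ℝ u w ⊆ G := by
    intro m hm
    refine hT ⟨(segment_subset_tri ho.le).2.2 (openSegment_subset_segment ℝ _ _ hm), fun hm' => ?_⟩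
    obtain ⟨t, t0, -, rfl⟩ := mem_openSegment_pt.1 hm
    obtain ⟨s, -, -, e⟩ := mem_segment_pt.1 hm'
    have := congrArg (ori u x) e
    rw [ori_pt, ori_pt] at this
    simp only [ori_self_left, ori_self_right, mul_zero, add_zero, zero_add] at this
    have := mul_pos t0 ho
    linarith
  have hwxG : openSegment ℝ w x ⊆ G := by
    intro m hm
    refine hT ⟨(segment_subset_tri ho.le).2.1 (segment_symm ℝ x w ▸
      openSegment_subset_segment ℝ _ _ hm), fun hm' => ?_⟩
    obtain ⟨t, -, t1, rfl⟩ := mem_openSegment_pt.1 hm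
    obtain ⟨s, -, -, e⟩ := mem_segment_pt.1 hm'
    have := congrArg (ori u x) e
    rw [ori_pt, ori_pt] at this
    simp only [ori_self_left, ori_self_right, mul_zero, add_zero] at this
    have := mul_pos (sub_pos.2 t1) ho
    linarith
  have huw_int : ∀ y ∈ G, y ∉ segment ℝ u x := fun y hy hm => (h.disj u hu).le_bot ⟨hy, hm⟩
  have e1 : ∀ y ∈ segment ℝ u w, y = u ∨ y ∈ G := by
    intro y hy
    rcases mem_segment_cases hy with rfl | rfl | hy
    · exact Or.inl rfl
    · exact Or.inr hwG
    · exact Or.inr (huwG hy)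
  have e2 : ∀ y ∈ segment ℝ w x, y = x ∨ y ∈ G := by
    intro y hy
    rcases mem_segment_cases hy with rfl | rfl | hy
    · exact Or.inr hwG
    · exact Or.inl rfl
    · exact Or.inr (hwxG hy)
  have hdisj : ∀ y ∈ G, ∀ p ∈ A, y ∉ segment ℝ p (nx p) := fun y hy p hp hm =>
    (h.disj p hp).le_bot ⟨hy, hm⟩
  have hTA : ∀ p ∈ A, p ≠ u → ∀ m ∈ openSegment ℝ p (nx p), m ∉ tri u x w := by
    intro p hp hpu m hm hmT
    have hms := openSegment_subset_segment ℝ _ _ hm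
    by_cases hmx : m ∈ segment ℝ u x
    · exact (h.simple p hp u hu hpu).le_bot ⟨hm, hmx⟩
    · exact hdisj m (hT ⟨hmT, hmx⟩) p hp hms
  refine ⟨?_, ?_, ?_, ⟨w, by simp⟩, ?_, ?_, ?_, h.bdd.subset sdiff_subset, ?_, ?_, ?_⟩
  · intro p hp
    rcases Finset.mem_insert.1 hp with rfl | hp
    · rw [ew]; simp [hxA]
    · by_cases hpu : p = u
      · subst hpu; rw [eu]; simp
      · rw [ep p hp hpu]; simp [h.maps p hp]
  · intro p hp0 q hq0 e
    rcases Finset.mem_insert.1 hp0 with rfl | hp <;> rcases Finset.mem_insert.1 hq0 with hq | hq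
    · exact hq.symm
    · rw [ew] at e
      by_cases hqu : q = u
      · subst hqu; rw [eu] at e; exact absurd e hxw
      · rw [ep q hq hqu] at e; exact absurd (h.inj u hu q hq e).symm hqu
    · subst hq; rw [ew] at e
      by_cases hqu : p = u
      · subst hqu; rw [eu] at e; exact absurd e.symm hxw
      · rw [ep p hp hqu] at e; exact absurd (h.inj p hp u hu e) hqu
    · by_cases hpu : p = u <;> by_cases hqu : q = u
      · rw [hpu, hqu]
      · subst hpu; rw [eu, ep q hq hqu] at e; exact absurd e.symm (hAw _ (h.maps q hq))
      · subst hqu; rw [eu, ep p hp hpu] at e; exact absurd e (hAw _ (h.maps p hp))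
      · rw [ep p hp hpu, ep q hq hqu] at e; exact h.inj p hp q hq e
  -- Two new steps `u → w → x` compose to the old step `u → x`, so the old vertices in a closed set
  -- are closed under `nx`.
  · intro B hB hne hcl
    have hBA : B.filter (· ∈ A) = A := by
      apply h.trans _ (fun p hp => (Finset.mem_filter.1 hp).2)
      · obtain ⟨b, hb⟩ := hne
        rcases Finset.mem_insert.1 (hB hb) with rfl | hbA
        · exact ⟨x, Finset.mem_filter.2 ⟨by have := hcl _ hb; rwa [ew] at this, hxA⟩⟩
        · exact ⟨b, Finset.mem_filter.2 ⟨hb, hbA⟩⟩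
      · intro b hb
        obtain ⟨hb, hbA⟩ := Finset.mem_filter.1 hb
        refine Finset.mem_filter.2 ⟨?_, h.maps b hbA⟩
        by_cases hbu : b = u
        · subst hbu
          have h1 := hcl _ hb
          rw [eu] at h1
          have h2 := hcl _ h1
          rwa [ew] at h2
        · have := hcl _ hb; rwa [ep b hbA hbu] at this
    have hAB : A ⊆ B := fun p hp => (Finset.mem_filter.1 (hBA.symm ▸ hp)).1
    apply Finset.Subset.antisymm hB
    intro p hp
    rcases Finset.mem_insert.1 hp with rfl | hp
    · have := hcl u (hAB hu); rwa [eu] at this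
    · exact hAB hp
  · intro p hp
    rcases Finset.mem_insert.1 hp with rfl | hp
    · rw [ew]; exact hxw
    · by_cases hpu : p = u
      · subst hpu; rw [eu]; exact huw.symm
      · rw [ep p hp hpu]; exact h.ne p hp
  · intro p hp0 q hq0 hpq
    rw [Set.disjoint_left]
    rcases Finset.mem_insert.1 hp0 with rfl | hp
    · rw [ew]
      intro y hy
      have hyG := hwxG hy
      rcases Finset.mem_insert.1 hq0 with hq | hq
      · exact absurd hq.symm hpq
      · by_cases hqu : q = u
        · subst hqu; rw [eu]
          intro hy'
          obtain ⟨t, -, t1, rfl⟩ := mem_openSegment_pt.1 hy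
          obtain ⟨s, -, s1, e⟩ := mem_segment_pt.1 hy'
          have := congrArg (ori q p) e
          rw [ori_pt, ori_pt] at this
          simp only [ori_self_left, ori_self_right, mul_zero, add_zero, zero_add] at this
          rw [← ori_rot, ← ori_rot] at this
          obtain ⟨t0, -⟩ : 0 < t ∧ True := by
            obtain ⟨t', t0', _, e'⟩ := mem_openSegment_pt.1 hy
            rw [pt_inj hxw.symm e']; exact ⟨t0', trivial⟩
          rw [ori_swap'] at this
          rcases mul_eq_zero.1 this with h | h
          · linarith
          · rw [← ori_rot] at ho; linarith [ori_rot p q x]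
        · rw [ep q hq hqu]; exact hdisj y hyG q hq
    · by_cases hpu : p = u
      · subst hpu; rw [eu]
        intro y hy
        have hyG := huwG hy
        rcases Finset.mem_insert.1 hq0 with hq | hq
        · subst hq; rw [ew]
          intro hy'
          obtain ⟨t, t0, t1, rfl⟩ := mem_openSegment_pt.1 hy
          obtain ⟨s, -, s1, e⟩ := mem_segment_pt.1 hy'
          have := congrArg (ori q x) e
          rw [ori_pt, ori_pt] at this
          simp only [ori_self_left, ori_self_right, mul_zero, add_zero] at this
          rw [ori_swap, ← ori_rot] at this
          rcases mul_eq_zero.1 this with h | h <;> linarith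
        · rw [ep q hq (Ne.symm hpq)]; exact hdisj y hyG q hq
      · rw [ep p hp hpu]
        intro y hy
        have hys := openSegment_subset_segment ℝ _ _ hy
        rcases Finset.mem_insert.1 hq0 with hq | hq
        · subst hq; rw [ew]; intro hy'
          rcases e2 y hy' with rfl | hyG
          · exact h.vertex_notMem_open hp hxA hy
          · exact hdisj y hyG p hp hys
        · by_cases hqu : q = u
          · subst hqu; rw [eu]; intro hy'
            rcases e1 y hy' with rfl | hyG
            · exact h.vertex_notMem_open hp hq hy
            · exact hdisj y hyG p hp hys
          · rw [ep q hq hqu]; exact fun hy' => (h.simple p hp q hq hpq).le_bot ⟨hy, hy'⟩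
  · exact h.isOpen.sdiff (isClosed_tri _ _ _)
  · intro p hp
    rw [Set.disjoint_left]
    rintro y ⟨hyG, hyT⟩ hy
    rcases Finset.mem_insert.1 hp with rfl | hp
    · rw [ew] at hy
      exact hyT ((segment_subset_tri ho.le).2.1 (segment_symm ℝ p x ▸ hy))
    · by_cases hpu : p = u
      · subst hpu; rw [eu] at hy; exact hyT ((segment_subset_tri ho.le).2.2 hy)
      · rw [ep p hp hpu] at hy; exact hdisj y hyG p hp hy
  · intro y hy hyn
    have hmemw : y ∈ segment ℝ w x → ∃ p ∈ Insert.insert w A, y ∈ segment ℝ p (insNext nx u w p) :=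
      fun hm => ⟨w, by simp, by rwa [ew]⟩
    have hmemu : y ∈ segment ℝ u w → ∃ p ∈ Insert.insert w A, y ∈ segment ℝ p (insNext nx u w p) :=
      fun hm => ⟨u, by simp [hu], by rwa [eu]⟩
    by_cases hyG : y ∈ G
    · have hyT : y ∈ tri u x w := by by_contra hc; exact hyn ⟨hyG, hc⟩
      have hyf : y ∈ frontier (tri u x w) := by
        refine ⟨subset_closure hyT, fun hi => ?_⟩
        obtain ⟨z, hz1, hz2⟩ := mem_closure_iff.1 hy _ isOpen_interior hi
        exact hz2.2 (interior_subset hz1)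
      rcases frontier_tri hyf with h0 | h0 | h0
      · exact absurd (mem_segment_of_tri ho hyT h0) (huw_int y hyG)
      · apply hmemw; rw [segment_symm]; exact mem_segment_of_tri₂ ho hyT h0
      · exact hmemu (mem_segment_of_tri₃ ho hyT h0)
    · obtain ⟨p, hp, hyp⟩ := h.front y (closure_mono sdiff_subset hy) hyG
      by_cases hpu : p = u
      · subst hpu
        rcases mem_segment_cases hyp with rfl | rfl | hyo
        · exact hmemu (left_mem_segment ℝ _ _)
        · exact hmemw (right_mem_segment ℝ _ _)
        -- Near an inner point of the old edge `u x`, every point of `G` lies to its left and thus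
        -- in the removed triangle.
        · exfalso
          obtain ⟨t, t0, t1, e⟩ := mem_openSegment_pt.1 hyo
          have a1 : 0 < ori x w y := by rw [e]; exact ori_pt_left_pos ho t1
          have a2 : 0 < ori w p y := by rw [e]; exact ori_pt_right_pos ho t0
          obtain ⟨z, hz, hz'⟩ := ((mem_closure_iff_frequently.1 hy).and_eventually
            ((h.loc p hp y hyo).and ((eventually_ori_pos a1).and (eventually_ori_pos a2)))).exists
          exact hz.2 ⟨(hz'.1.1 hz.1).le, hz'.2.1.le, hz'.2.2.le⟩
      · exact ⟨p, by simp [hp], by rwa [ep p hp hpu]⟩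
  · intro p hp m hm
    rcases Finset.mem_insert.1 hp with rfl | hp
    · rw [ew] at hm ⊢
      obtain ⟨t, t0, t1, e⟩ := mem_openSegment_pt.1 hm
      have ho' : 0 < ori x p u := by rwa [← ori_rot]
      have e' : m = pt x p (1 - t) := by rw [e, pt_symm]
      have a1 : 0 < ori p u m := by rw [e']; exact ori_pt_left_pos ho' (by linarith)
      have a2 : 0 < ori u x m := by rw [e']; exact ori_pt_right_pos ho' (by linarith)
      filter_upwards [h.isOpen.mem_nhds (hwxG hm), eventually_ori_pos a1, eventually_ori_pos a2]
        with y hy b1 b2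
      constructor
      · rintro ⟨-, hyT⟩
        by_contra hc
        exact hyT ⟨b2.le, by rw [ori_swap]; linarith, b1.le⟩
      · intro hpos
        refine ⟨hy, fun hyT => ?_⟩
        have := hyT.2.1
        rw [ori_swap] at this; linarith
    · by_cases hpu : p = u
      · subst hpu
        rw [eu] at hm ⊢
        obtain ⟨t, t0, t1, e⟩ := mem_openSegment_pt.1 hm
        have ho' : 0 < ori w p x := by rw [ori_rot]; exact ho
        have e' : m = pt w p (1 - t) := by rw [e, pt_symm]
        have a1 : 0 < ori p x m := by rw [e']; exact ori_pt_left_pos ho' (by linarith)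
        have a2 : 0 < ori x w m := by rw [e']; exact ori_pt_right_pos ho' (by linarith)
        filter_upwards [h.isOpen.mem_nhds (huwG hm), eventually_ori_pos a1, eventually_ori_pos a2]
          with y hy b1 b2
        constructor
        · rintro ⟨-, hyT⟩
          by_contra hc
          exact hyT ⟨b1.le, b2.le, by rw [ori_swap]; linarith⟩
        · intro hpos
          refine ⟨hy, fun hyT => ?_⟩
          have := hyT.2.2
          rw [ori_swap] at this; linarith
      · rw [ep p hp hpu] at hm ⊢
        filter_upwards [h.loc p hp m hm,
          (isClosed_tri u x w).isOpen_compl.mem_nhds (hTA p hp hpu m hm)] with y hy hy'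
        rw [← hy]
        exact ⟨fun a => a.1, fun a => ⟨a, hy'⟩⟩

end PolyRegion

theorem openSegment_pt_left {p q : Plane} {s : ℝ} (s0 : 0 < s) (s1 : s < 1) :
    openSegment ℝ p (pt p q s) ⊆ openSegment ℝ p q := by
  intro m hm
  obtain ⟨t, t0, t1, rfl⟩ := mem_openSegment_pt.1 hm
  rw [pt_pt]
  exact pt_mem_openSegment (by positivity) (by nlinarith)

theorem openSegment_pt_right {p q : Plane} {s : ℝ} (s0 : 0 < s) (s1 : s < 1) :
    openSegment ℝ (pt p q s) q ⊆ openSegment ℝ p q := by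
  rw [openSegment_symm, openSegment_symm ℝ p q, pt_symm]
  exact openSegment_pt_left (by linarith) (by linarith)

theorem segment_split {p q x : Plane} (hx : x ∈ openSegment ℝ p q) :
    segment ℝ p q = segment ℝ p x ∪ segment ℝ x q := by
  obtain ⟨s, s0, s1, rfl⟩ := mem_openSegment_pt.1 hx
  ext m
  constructor
  · intro hm
    obtain ⟨t, t0, t1, rfl⟩ := mem_segment_pt.1 hm
    rcases le_total t s with hts | hts
    · left
      refine mem_segment_pt.2 ⟨t / s, by positivity, by rw [div_le_one s0]; exact hts, ?_⟩
      rw [pt_pt]; congr 1; field_simp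
    · right
      rw [segment_symm, pt_symm p q s, pt_symm p q t]
      have s1' : 0 < 1 - s := by linarith
      refine mem_segment_pt.2 ⟨(1 - t) / (1 - s), div_nonneg (by linarith) s1'.le,
        by rw [div_le_one s1']; linarith, ?_⟩
      rw [pt_pt]; congr 1; field_simp
  · have hxm : pt p q s ∈ segment ℝ p q := pt_mem_segment s0.le s1.le
    rintro (hm | hm)
    · exact (convex_segment p q).segment_subset (left_mem_segment ℝ _ _) hxm hm
    · exact (convex_segment p q).segment_subset hxm (right_mem_segment ℝ _ _) hm

theorem notMem_segment_left {p q x : Plane} (hpq : p ≠ q) (hx : x ∈ openSegment ℝ p q)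
    {m : Plane} (hm : m ∈ openSegment ℝ p x) : m ∉ segment ℝ x q := by
  obtain ⟨s, s0, s1, rfl⟩ := mem_openSegment_pt.1 hx
  obtain ⟨t, t0, t1, rfl⟩ := mem_openSegment_pt.1 hm
  rw [pt_pt]
  intro h
  obtain ⟨r, r0, r1, e⟩ := mem_segment_pt.1 h
  have e2 : pt (pt p q s) q r = pt p q (s + r * (1 - s)) := by
    apply plane_ext <;> simp only [pt_apply] <;> ring
  rw [e2] at e
  have := pt_inj hpq e
  have h1 : s * t < s := by nlinarith
  have h2 : 0 ≤ r * (1 - s) := by nlinarith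
  linarith

namespace PolyRegion

variable {nx : Plane → Plane} {A : Finset Plane} {G : Set Plane}

/-- Subdividing an edge. -/
theorem split (h : PolyRegion nx A G) {u w : Plane} (hu : u ∈ A)
    (hw : w ∈ openSegment ℝ u (nx u)) : PolyRegion (insNext nx u w) (Insert.insert w A) G := by
  have hux : u ≠ nx u := (h.ne u hu).symm
  have hwA : w ∉ A := fun hA => h.vertex_notMem_open hu hA hw
  have hAw : ∀ p ∈ A, p ≠ w := fun p hp e => hwA (e ▸ hp)
  have huw : u ≠ w := hAw u hu
  have hxA : nx u ∈ A := h.maps u hu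
  have hxw : nx u ≠ w := hAw _ hxA
  have eu : insNext nx u w u = w := insNext_left nx huw
  have ew : insNext nx u w w = nx u := insNext_new nx u w
  have ep : ∀ p ∈ A, p ≠ u → insNext nx u w p = nx p := fun p hp hpu =>
    insNext_of_ne nx (hAw p hp) hpu
  have hsp := segment_split hw
  set x := nx u with hx
  obtain ⟨s, s0, s1, es⟩ := mem_openSegment_pt.1 hw
  have o1 : openSegment ℝ u w ⊆ openSegment ℝ u x := by rw [es]; exact openSegment_pt_left s0 s1
  have o2 : openSegment ℝ w x ⊆ openSegment ℝ u x := by rw [es]; exact openSegment_pt_right s0 s1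
  have c1 : segment ℝ u w ⊆ segment ℝ u x := by rw [hsp]; exact subset_union_left
  have c2 : segment ℝ w x ⊆ segment ℝ u x := by rw [hsp]; exact subset_union_right
  refine ⟨?_, ?_, ?_, ⟨w, by simp⟩, ?_, ?_, h.isOpen, h.bdd, ?_, ?_, ?_⟩
  · intro p hp
    rcases Finset.mem_insert.1 hp with rfl | hp
    · rw [ew]; simp [hxA]
    · by_cases hpu : p = u
      · subst hpu; rw [eu]; simp
      · rw [ep p hp hpu]; simp [h.maps p hp]
  · intro p hp0 q hq0 e
    rcases Finset.mem_insert.1 hp0 with rfl | hp <;> rcases Finset.mem_insert.1 hq0 with hq | hq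
    · exact hq.symm
    · rw [ew] at e
      by_cases hqu : q = u
      · subst hqu; rw [eu] at e; exact absurd e hxw
      · rw [ep q hq hqu] at e; exact absurd (h.inj u hu q hq e).symm hqu
    · subst hq; rw [ew] at e
      by_cases hqu : p = u
      · subst hqu; rw [eu] at e; exact absurd e.symm hxw
      · rw [ep p hp hqu] at e; exact absurd (h.inj p hp u hu e) hqu
    · by_cases hpu : p = u <;> by_cases hqu : q = u
      · rw [hpu, hqu]
      · subst hpu; rw [eu, ep q hq hqu] at e; exact absurd e.symm (hAw _ (h.maps q hq))
      · subst hqu; rw [eu, ep p hp hpu] at e; exact absurd e (hAw _ (h.maps p hp))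
      · rw [ep p hp hpu, ep q hq hqu] at e; exact h.inj p hp q hq e
  · intro B hB hne hcl
    have hBA : B.filter (· ∈ A) = A := by
      apply h.trans _ (fun p hp => (Finset.mem_filter.1 hp).2)
      · obtain ⟨b, hb⟩ := hne
        rcases Finset.mem_insert.1 (hB hb) with rfl | hbA
        · exact ⟨x, Finset.mem_filter.2 ⟨by have := hcl _ hb; rwa [ew] at this, hxA⟩⟩
        · exact ⟨b, Finset.mem_filter.2 ⟨hb, hbA⟩⟩
      · intro b hb
        obtain ⟨hb, hbA⟩ := Finset.mem_filter.1 hb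
        refine Finset.mem_filter.2 ⟨?_, h.maps b hbA⟩
        by_cases hbu : b = u
        · subst hbu
          have h1 := hcl _ hb
          rw [eu] at h1
          have h2 := hcl _ h1
          rwa [ew] at h2
        · have := hcl _ hb; rwa [ep b hbA hbu] at this
    have hAB : A ⊆ B := fun p hp => (Finset.mem_filter.1 (hBA.symm ▸ hp)).1
    apply Finset.Subset.antisymm hB
    intro p hp
    rcases Finset.mem_insert.1 hp with rfl | hp
    · have := hcl u (hAB hu); rwa [eu] at this
    · exact hAB hp
  · intro p hp
    rcases Finset.mem_insert.1 hp with rfl | hp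
    · rw [ew]; exact hxw
    · by_cases hpu : p = u
      · subst hpu; rw [eu]; exact huw.symm
      · rw [ep p hp hpu]; exact h.ne p hp
  · intro p hp0 q hq0 hpq
    rw [Set.disjoint_left]
    intro y
    rcases Finset.mem_insert.1 hp0 with hp | hp
    · rw [hp, ew]
      intro hy
      rcases Finset.mem_insert.1 hq0 with hq | hq
      · exact absurd (hp.trans hq.symm) hpq
      · by_cases hqu : q = u
        · subst hqu; rw [eu, segment_symm]
          rw [openSegment_symm] at hy
          exact notMem_segment_left hux.symm (openSegment_symm ℝ q x ▸ hw) hy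
        · rw [ep q hq hqu]; exact fun hy' => (h.simple u hu q hq (Ne.symm hqu)).le_bot ⟨o2 hy, hy'⟩
    · by_cases hpu : p = u
      · rw [hpu, eu]
        intro hy
        rcases Finset.mem_insert.1 hq0 with hq | hq
        · rw [hq, ew]; exact notMem_segment_left hux hw hy
        · rw [ep q hq (fun e => hpq (hpu.trans e.symm))]
          exact fun hy' => (h.simple u hu q hq (fun e => hpq (hpu.trans e))).le_bot ⟨o1 hy, hy'⟩
      · rw [ep p hp hpu]
        intro hy hy'
        refine (h.simple p hp u hu hpu).le_bot ⟨hy, ?_⟩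
        rcases Finset.mem_insert.1 hq0 with hq | hq
        · rw [hq, ew] at hy'; exact c2 hy'
        · by_cases hqu : q = u
          · rw [hqu, eu] at hy'; exact c1 hy'
          · rw [ep q hq hqu] at hy'
            exact absurd hy' (Set.disjoint_left.1 (h.simple p hp q hq hpq) hy)
  · intro p hp
    rcases Finset.mem_insert.1 hp with hp | hp
    · rw [hp, ew]; exact (h.disj u hu).mono_right c2
    · by_cases hpu : p = u
      · rw [hpu, eu]; exact (h.disj u hu).mono_right c1
      · rw [ep p hp hpu]; exact h.disj p hp
  · intro y hy hyG
    obtain ⟨p, hp, hyp⟩ := h.front y hy hyG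
    by_cases hpu : p = u
    · subst hpu
      have hyp : y ∈ segment ℝ p x := hyp
      rw [hsp] at hyp
      rcases hyp with hyp | hyp
      · exact ⟨p, by simp [hu], by rwa [eu]⟩
      · exact ⟨w, by simp, by rwa [ew]⟩
    · exact ⟨p, by simp [hp], by rwa [ep p hp hpu]⟩
  · intro p hp m hm
    rcases Finset.mem_insert.1 hp with hp | hp
    · rw [hp, ew] at hm ⊢
      filter_upwards [h.loc u hu m (o2 hm)] with y hy
      have e : ori w x y = (1 - s) * ori u x y := by
        rw [es]; simp only [ori, pt_apply]; ring
      rw [hy, e]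
      exact (mul_pos_iff_of_pos_left (by linarith)).symm
    · by_cases hpu : p = u
      · rw [hpu, eu] at hm ⊢
        filter_upwards [h.loc u hu m (o1 hm)] with y hy
        rw [hy, es, ori_pt_mid]
        exact (mul_pos_iff_of_pos_left s0).symm
      · rw [ep p hp hpu] at hm ⊢; exact h.loc p hp m hm

/-- Cutting off a convex corner of the polygon. -/
theorem delete (h : PolyRegion nx A G) {u : Plane} (hu : u ∈ A)
    (ho : 0 < ori u (nx u) (nx (nx u)))
    (hT : tri u (nx u) (nx (nx u)) \ (segment ℝ u (nx u) ∪ segment ℝ (nx u) (nx (nx u))) ⊆ G) :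
    PolyRegion (delNext nx u) (A.erase (nx u)) (G \ tri u (nx u) (nx (nx u))) ∧
      nx u ∉ closure (G \ tri u (nx u) (nx (nx u))) := by
  have hcorner := h.corner hu ho
  obtain ⟨hux, hxv, huv⟩ := ne_of_ori_ne ho.ne'
  have hxA : nx u ∈ A := h.maps u hu
  have hvA : nx (nx u) ∈ A := h.maps _ hxA
  have eu : delNext nx u u = nx (nx u) := delNext_left nx u
  have ep : ∀ p, p ≠ u → delNext nx u p = nx p := fun p hpu => delNext_of_ne nx hpu
  set x := nx u with hx
  set v := nx x with hv
  have hmemA : ∀ p, p ∈ A.erase x ↔ p ≠ x ∧ p ∈ A := fun p => Finset.mem_erase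
  have huvG : openSegment ℝ u v ⊆ G := by
    intro m hm
    obtain ⟨t, t0, t1, rfl⟩ := mem_openSegment_pt.1 hm
    refine hT ⟨(segment_subset_tri ho.le).2.2 (openSegment_subset_segment ℝ _ _ hm), ?_⟩
    rintro (hm' | hm')
    · obtain ⟨s, -, -, e⟩ := mem_segment_pt.1 hm'
      have := congrArg (ori u x) e
      rw [ori_pt, ori_pt] at this
      simp only [ori_self_left, ori_self_right, mul_zero, add_zero, zero_add] at this
      have := mul_pos t0 ho
      linarith
    · obtain ⟨s, -, -, e⟩ := mem_segment_pt.1 hm'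
      have := congrArg (ori x v) e
      rw [ori_pt, ori_pt] at this
      simp only [ori_self_left, ori_self_right, mul_zero, add_zero] at this
      rw [← ori_rot] at this
      have := mul_pos (sub_pos.2 t1) ho
      linarith
  have hdisj : ∀ y ∈ G, ∀ p ∈ A, y ∉ segment ℝ p (nx p) := fun y hy p hp hm =>
    (h.disj p hp).le_bot ⟨hy, hm⟩
  -- By `corner` the region near `x` lies in the angle at `x`, which near `x` coincides with the
  -- triangle.
  have hxcl : x ∉ closure (G \ tri u x v) := by
    intro hc
    have a3 : 0 < ori v u x := by rw [ori_rot]; exact ho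
    obtain ⟨z, hz, hz'⟩ := ((mem_closure_iff_frequently.1 hc).and_eventually
      (hcorner.and (eventually_ori_pos a3))).exists
    have := hz'.1 hz.1
    exact hz.2 ⟨this.1, this.2, hz'.2.le⟩
  have hTA : ∀ p ∈ A, p ≠ u → p ≠ x → ∀ m ∈ openSegment ℝ p (nx p), m ∉ tri u x v := by
    intro p hp hpu hpx m hm hmT
    have hms := openSegment_subset_segment ℝ _ _ hm
    by_cases hmx : m ∈ segment ℝ u x ∪ segment ℝ x v
    · rcases hmx with hmx | hmx
      · exact (h.simple p hp u hu hpu).le_bot ⟨hm, hmx⟩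
      · exact (h.simple p hp x hxA hpx).le_bot ⟨hm, hmx⟩
    · exact hdisj m (hT ⟨hmT, hmx⟩) p hp hms
  refine ⟨⟨?_, ?_, ?_, ⟨u, by simp [hu, hux]⟩, ?_, ?_, h.isOpen.sdiff (isClosed_tri _ _ _),
    h.bdd.subset sdiff_subset, ?_, ?_, ?_⟩, hxcl⟩
  · intro p hp
    obtain ⟨hpx, hp⟩ := (hmemA p).1 hp
    by_cases hpu : p = u
    · rw [hpu, eu]; exact (hmemA _).2 ⟨hxv.symm, hvA⟩
    · rw [ep p hpu]
      exact (hmemA _).2 ⟨fun e => hpu (h.inj p hp u hu e), h.maps p hp⟩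
  · intro p hp q hq e
    obtain ⟨hpx, hp⟩ := (hmemA p).1 hp
    obtain ⟨hqx, hq⟩ := (hmemA q).1 hq
    by_cases hpu : p = u <;> by_cases hqu : q = u
    · rw [hpu, hqu]
    · rw [hpu, eu, ep q hqu] at e; exact absurd (h.inj x hxA q hq e).symm hqx
    · rw [hqu, eu, ep p hpu] at e; exact absurd (h.inj p hp x hxA e) hpx
    · rw [ep p hpu, ep q hqu] at e; exact h.inj p hp q hq e
  · intro B hB hne hcl
    have hBA : ∀ b ∈ B, b ≠ x ∧ b ∈ A := fun b hb => (hmemA b).1 (hB hb)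
    -- A closed set without `u` would be closed under the old successor and so be all of `A`. With
    -- `u` in it, adding `x` back gives an old closed set.
    have huB : u ∈ B := by
      by_contra hub
      have : B = A := h.trans B (fun b hb => (hBA b hb).2) hne (fun b hb => by
        have h1 : b ≠ u := fun e => hub (e ▸ hb)
        have := hcl b hb
        rwa [ep b h1] at this)
      exact hub (this ▸ hu)
    have : Insert.insert x B = A := by
      apply h.trans
      · intro b hb
        rcases Finset.mem_insert.1 hb with rfl | hb
        · exact hxA
        · exact (hBA b hb).2
      · exact ⟨x, by simp⟩
      · intro b hb
        rcases Finset.mem_insert.1 hb with hb | hb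
        · rw [hb]
          have := hcl u huB
          rw [eu] at this
          exact Finset.mem_insert_of_mem this
        · by_cases hbu : b = u
          · rw [hbu]; exact Finset.mem_insert_self _ _
          · have := hcl b hb
            rw [ep b hbu] at this
            exact Finset.mem_insert_of_mem this
    rw [← this, Finset.erase_insert]
    exact fun hxB => (hBA x hxB).1 rfl
  · intro p hp
    obtain ⟨hpx, hp⟩ := (hmemA p).1 hp
    by_cases hpu : p = u
    · rw [hpu, eu]; exact huv.symm
    · rw [ep p hpu]; exact h.ne p hp
  · intro p hp q hq hpq
    obtain ⟨hpx, hp⟩ := (hmemA p).1 hp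
    obtain ⟨hqx, hq⟩ := (hmemA q).1 hq
    rw [Set.disjoint_left]
    intro y
    by_cases hpu : p = u
    · rw [hpu, eu, ep q (fun e => hpq (hpu.trans e.symm))]
      exact fun hy => hdisj y (huvG hy) q hq
    · rw [ep p hpu]
      by_cases hqu : q = u
      · rw [hqu, eu]
        intro hy hy'
        rcases mem_segment_cases hy' with e | e | hy'
        · exact h.vertex_notMem_open hp hu (e ▸ hy)
        · exact h.vertex_notMem_open hp hvA (e ▸ hy)
        · exact hdisj y (huvG hy') p hp (openSegment_subset_segment ℝ _ _ hy)
      · rw [ep q hqu]; exact fun hy hy' => (h.simple p hp q hq hpq).le_bot ⟨hy, hy'⟩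
  · intro p hp
    obtain ⟨hpx, hp⟩ := (hmemA p).1 hp
    rw [Set.disjoint_left]
    rintro y ⟨hyG, hyT⟩
    by_cases hpu : p = u
    · rw [hpu, eu]; exact fun hy => hyT ((segment_subset_tri ho.le).2.2 hy)
    · rw [ep p hpu]; exact hdisj y hyG p hp
  · intro y hy hyn
    have hmemu : y ∈ segment ℝ u v → ∃ p ∈ A.erase x, y ∈ segment ℝ p (delNext nx u p) :=
      fun hm => ⟨u, (hmemA u).2 ⟨hux, hu⟩, by rwa [eu]⟩
    by_cases hyG : y ∈ G
    · have hyT : y ∈ tri u x v := by by_contra hc; exact hyn ⟨hyG, hc⟩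
      have hyf : y ∈ frontier (tri u x v) := by
        refine ⟨subset_closure hyT, fun hi => ?_⟩
        obtain ⟨z, hz1, hz2⟩ := mem_closure_iff.1 hy _ isOpen_interior hi
        exact hz2.2 (interior_subset hz1)
      rcases frontier_tri hyf with h0 | h0 | h0
      · exact absurd (mem_segment_of_tri ho hyT h0) (hdisj y hyG u hu)
      · exact absurd (mem_segment_of_tri₂ ho hyT h0) (hdisj y hyG x hxA)
      · exact hmemu (mem_segment_of_tri₃ ho hyT h0)
    · obtain ⟨p, hp, hyp⟩ := h.front y (closure_mono sdiff_subset hy) hyG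
      by_cases hpu : p = u
      · subst hpu
        rcases mem_segment_cases hyp with rfl | rfl | hyo
        · exact hmemu (left_mem_segment ℝ _ _)
        · exact absurd hy hxcl
        · exfalso
          obtain ⟨t, t0, t1, e⟩ := mem_openSegment_pt.1 hyo
          have a1 : 0 < ori x v y := by rw [e]; exact ori_pt_left_pos ho t1
          have a2 : 0 < ori v p y := by rw [e]; exact ori_pt_right_pos ho t0
          obtain ⟨z, hz, hz'⟩ := ((mem_closure_iff_frequently.1 hy).and_eventually
            ((h.loc p hp y hyo).and ((eventually_ori_pos a1).and (eventually_ori_pos a2)))).exists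
          exact hz.2 ⟨(hz'.1.1 hz.1).le, hz'.2.1.le, hz'.2.2.le⟩
      by_cases hpx : p = x
      · rw [hpx] at hyp
        rcases mem_segment_cases hyp with rfl | rfl | hyo
        · exact absurd hy hxcl
        · exact hmemu (right_mem_segment ℝ _ _)
        · exfalso
          have ho' : 0 < ori x v u := by rwa [← ori_rot]
          obtain ⟨t, t0, t1, e⟩ := mem_openSegment_pt.1 hyo
          have a1 : 0 < ori v u y := by rw [e]; exact ori_pt_left_pos ho' t1
          have a2 : 0 < ori u x y := by rw [e]; exact ori_pt_right_pos ho' t0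
          obtain ⟨z, hz, hz'⟩ := ((mem_closure_iff_frequently.1 hy).and_eventually
            ((h.loc x hxA y hyo).and ((eventually_ori_pos a1).and (eventually_ori_pos a2)))).exists
          exact hz.2 ⟨hz'.2.2.le, (hz'.1.1 hz.1).le, hz'.2.1.le⟩
      · exact ⟨p, (hmemA p).2 ⟨hpx, hp⟩, by rwa [ep p hpu]⟩
  · intro p hp m hm
    obtain ⟨hpx, hp⟩ := (hmemA p).1 hp
    by_cases hpu : p = u
    · rw [hpu, eu] at hm ⊢
      obtain ⟨t, t0, t1, e⟩ := mem_openSegment_pt.1 hm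
      have ho' : 0 < ori v u x := by rw [ori_rot]; exact ho
      have e' : m = pt v u (1 - t) := by rw [e, pt_symm]
      have a1 : 0 < ori u x m := by rw [e']; exact ori_pt_left_pos ho' (by linarith)
      have a2 : 0 < ori x v m := by rw [e']; exact ori_pt_right_pos ho' (by linarith)
      filter_upwards [h.isOpen.mem_nhds (huvG hm), eventually_ori_pos a1, eventually_ori_pos a2]
        with y hy b1 b2
      constructor
      · rintro ⟨-, hyT⟩
        by_contra hc
        exact hyT ⟨b1.le, b2.le, by rw [ori_swap]; linarith⟩
      · intro hpos
        refine ⟨hy, fun hyT => ?_⟩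
        have := hyT.2.2
        rw [ori_swap] at this; linarith
    · rw [ep p hpu] at hm ⊢
      filter_upwards [h.loc p hp m hm,
        (isClosed_tri u x v).isOpen_compl.mem_nhds (hTA p hp hpu hpx m hm)] with y hy hy'
      rw [← hy]
      exact ⟨fun a => a.1, fun a => ⟨a, hy'⟩⟩

end PolyRegion

/-! ### Segment systems, half free points and convex corners -/

/-- A finite system of pairwise disjoint segments with endpoint set `V`. -/
structure SegSys (V : Finset Plane) (Sg : Plane → Plane → Prop) : Prop where
  symm : ∀ {a b}, Sg a b → Sg b a
  ne : ∀ {a b}, Sg a b → a ≠ b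
  mem : ∀ {a b}, Sg a b → a ∈ V
  mate : ∀ a ∈ V, ∃ b, Sg a b
  meet : ∀ {a b c d y}, Sg a b → Sg c d → y ∈ segment ℝ a b → y ∈ segment ℝ c d →
    (c = a ∧ d = b) ∨ (c = b ∧ d = a)

/-- The union of the segments. -/
def segUnion (Sg : Plane → Plane → Prop) : Set Plane := {m | ∃ a b, Sg a b ∧ m ∈ segment ℝ a b}

theorem isClosed_segment (p q : Plane) : IsClosed (segment ℝ p q) := by
  rw [← closure_openSegment]; exact isClosed_closure

namespace SegSys
variable {V : Finset Plane} {Sg : Plane → Plane → Prop}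

theorem mem' (h : SegSys V Sg) {a b : Plane} (hab : Sg a b) : b ∈ V := h.mem (h.symm hab)

theorem isClosed_sub (h : SegSys V Sg) (Q : Plane → Plane → Prop) :
    IsClosed {m | ∃ a b, (Sg a b ∧ Q a b) ∧ m ∈ segment ℝ a b} := by
  have : {m | ∃ a b, (Sg a b ∧ Q a b) ∧ m ∈ segment ℝ a b} =
      ⋃ e ∈ (V ×ˢ V).filter (fun e => Sg e.1 e.2 ∧ Q e.1 e.2), segment ℝ e.1 e.2 := by
    ext m
    simp only [mem_ofPred_eq, Finset.mem_filter, Finset.mem_product, mem_iUnion, exists_prop,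
      Prod.exists]
    exact ⟨fun ⟨a, b, hab, hm⟩ => ⟨a, b, ⟨⟨h.mem hab.1, h.mem' hab.1⟩, hab⟩, hm⟩,
      fun ⟨a, b, hab, hm⟩ => ⟨a, b, hab.2, hm⟩⟩
  rw [this]
  exact isClosed_biUnion_finset fun e _ => isClosed_segment _ _

theorem isClosed_segUnion (h : SegSys V Sg) : IsClosed (segUnion Sg) := by
  have := h.isClosed_sub (fun _ _ => True)
  simpa [segUnion] using this

theorem mem_segUnion (h : SegSys V Sg) {y : Plane} (hy : y ∈ V) : y ∈ segUnion Sg := by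
  obtain ⟨b, hb⟩ := h.mate y hy
  exact ⟨y, b, hb, left_mem_segment ℝ _ _⟩

theorem eq_or_of_mem (h : SegSys V Sg) {a b y : Plane} (hab : Sg a b) (hy : y ∈ V)
    (hm : y ∈ segment ℝ a b) : y = a ∨ y = b := by
  obtain ⟨c, hc⟩ := h.mate y hy
  rcases h.meet hab hc hm (left_mem_segment ℝ _ _) with e | e
  · exact Or.inl e.1
  · exact Or.inr e.1

theorem notMem_open (h : SegSys V Sg) {a b y : Plane} (hab : Sg a b) (hy : y ∈ V) :
    y ∉ openSegment ℝ a b := by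
  intro hm
  rcases h.eq_or_of_mem hab hy (openSegment_subset_segment ℝ _ _ hm) with rfl | rfl
  · exact left_notMem_openSegment (h.ne hab) hm
  · exact right_notMem_openSegment (h.ne hab) hm

theorem mate_unique (h : SegSys V Sg) {a b c : Plane} (hb : Sg a b) (hc : Sg a c) : c = b := by
  rcases h.meet hb hc (left_mem_segment ℝ _ _) (left_mem_segment ℝ _ _) with e | e
  · exact e.2
  · exact absurd e.1 (h.ne hb)

end SegSys

/-- `y` has a half disc in `F` and, on its bounding line, a ray starting in `G`. -/
def HalfFree (F G : Set Plane) (y : Plane) : Prop :=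
  ∃ r, r ≠ y ∧ ∃ s : ℝ, s ≠ 0 ∧ (∀ᶠ m in 𝓝 y, 0 < s * ori y r m → m ∈ F) ∧
    ∀ᶠ t in 𝓝[>] (0 : ℝ), pt y r t ∈ G

theorem HalfFree.mono {F F' G G' : Set Plane} {y : Plane} (h : HalfFree F G y) (hF : F ⊆ F')
    (hG : G ⊆ G') : HalfFree F' G' y := by
  obtain ⟨r, hr, s, hs, h1, h2⟩ := h
  exact ⟨r, hr, s, hs, h1.mono fun m hm hp => hF (hm hp), h2.mono fun t ht => hG ht⟩

/-- Points close to `y` on the line through `y` and `r`, on either side. -/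
theorem exists_small_pt {y r : Plane} {Q : Plane → Prop} (h : ∀ᶠ z in 𝓝 y, Q z) {σ : ℝ}
    (hσ : σ ≠ 0) : ∃ t, 0 < t * σ ∧ Q (pt y r t) := by
  obtain ⟨t, t0, -, ht⟩ := exists_pt_of_eventually (pt y r σ) h one_pos
  rw [pt_pt] at ht
  refine ⟨σ * t, ?_, ht⟩
  have : 0 < σ ^ 2 := by positivity
  nlinarith

/-- If the bounding line of a free half disc is the line `y r`, its ray starting in `G` is blocked.
Otherwise the line `y r`, which is blocked too, enters the half disc. -/
theorem not_halfFree_of_blocked {F G : Set Plane} {y r : Plane} (hF : F ⊆ G)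
    (hb : ∀ᶠ m in 𝓝 y, ori y r m ≤ 0 → m ∉ G) : ¬ HalfFree F G y := by
  rintro ⟨r', hr', s, hs, h1, h2⟩
  by_cases h0 : ori y r r' = 0
  · obtain ⟨t, ht, ht'⟩ := (h2.and ((tendsto_pt_zero y r').eventually hb)).exists
    refine ht' ?_ ht
    rw [ori_pt, h0]; simp
  · have hσ : s * ori y r' r ≠ 0 := by
      rw [ori_swap']; simp [hs, h0]
    obtain ⟨t, ht, ht1, ht2⟩ := exists_small_pt (r := r) (h1.and hb) hσ
    refine ht2 (by rw [ori_pt]; simp) (hF (ht1 ?_))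
    rw [ori_pt]; simp only [ori_self_left, mul_zero, zero_add]; linarith

/-- The region `G` is locally contained in a convex angle with apex `x`. -/
def ConvexCorner (G : Set Plane) (x : Plane) : Prop :=
  ∃ p b, 0 < ori p x b ∧ ∀ᶠ m in 𝓝 x, m ∈ G → 0 ≤ ori p x m ∧ 0 ≤ ori x b m

theorem ConvexCorner.mono {G G' : Set Plane} {x : Plane} (h : ConvexCorner G x) (hG : G' ⊆ G) :
    ConvexCorner G' x := by
  obtain ⟨p, b, h0, h1⟩ := h
  exact ⟨p, b, h0, h1.mono fun m hm hp => hm (hG hp)⟩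

theorem eq_of_ori_eq_zero {p x b m : Plane} (h : ori p x b ≠ 0) (h1 : ori p x m = 0)
    (h2 : ori x b m = 0) : m = x := by
  obtain ⟨t, rfl⟩ := mem_line_of_ori_eq_zero (ne_of_ori_ne h).1 h1
  rw [ori_pt] at h2
  simp only [ori_self_left, mul_zero, add_zero] at h2
  rw [← ori_rot] at h2
  rcases mul_eq_zero.1 h2 with e | e
  · rw [show t = 1 by linarith, pt_one]
  · exact absurd e h

/-- The line through `x` in direction `b - p` supports the convex angle `p x b` and touches it only
in the apex. -/
theorem ori_add_eq (p x b m : Plane) : ori x (x + (b - p)) m = ori p x m + ori x b m := by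
  simp [ori]; ring

theorem ConvexCorner.blocked {G : Set Plane} {x : Plane} (h : ConvexCorner G x) (hx : x ∉ G) :
    ∃ r, ∀ᶠ m in 𝓝 x, ori x r m ≤ 0 → m ∉ G := by
  obtain ⟨p, b, h0, h1⟩ := h
  refine ⟨x + (b - p), h1.mono fun m hm hle hmG => ?_⟩
  obtain ⟨a1, a2⟩ := hm hmG
  rw [ori_add_eq] at hle
  exact hx (eq_of_ori_eq_zero h0.ne' (by linarith) (by linarith) ▸ hmG)

theorem ConvexCorner.closure {G : Set Plane} {x : Plane} (h : ConvexCorner G x) :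
    ConvexCorner (closure G) x := by
  obtain ⟨p, b, h0, h1⟩ := h
  refine ⟨p, b, h0, h1.eventually_nhds.mono fun m hm hmc => ⟨?_, ?_⟩⟩
  · by_contra hc
    obtain ⟨z, hz, hz1, hz2⟩ := ((mem_closure_iff_frequently.1 hmc).and_eventually
      (hm.and (eventually_ori_neg (not_le.1 hc)))).exists
    linarith [(hz1 hz).1]
  · by_contra hc
    obtain ⟨z, hz, hz1, hz2⟩ := ((mem_closure_iff_frequently.1 hmc).and_eventually
      (hm.and (eventually_ori_neg (not_le.1 hc)))).exists
    linarith [(hz1 hz).2]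

namespace PolyRegion
variable {nx : Plane → Plane} {A : Finset Plane} {G : Set Plane}

/-- At a reflex vertex the half disc to the left of the outgoing edge lies in the region. -/
theorem reflex (h : PolyRegion nx A G) {u : Plane} (hu : u ∈ A)
    (ho : ori u (nx u) (nx (nx u)) < 0) :
    ∀ᶠ y in 𝓝 (nx u), 0 < ori (nx u) (nx (nx u)) y → y ∈ G := by
  have hxA : nx u ∈ A := h.maps u hu
  obtain ⟨ε, hε, hB⟩ := Metric.eventually_nhds_iff_ball.1 (h.eventually_notMem_edges hu)
  set x := nx u with hx
  set v := nx x with hv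
  have hxv : x ≠ v := (h.ne x hxA).symm
  -- At a right turn the incoming edge is not to the left of the line `x v`, so this half ball meets
  -- no edge; it contains points of `G` next to the outgoing edge.
  have hsub : Metric.ball x ε ∩ {y | 0 < ori x v y} ⊆ G := by
    refine subset_of_avoid_frontier
      ((convex_ball x ε).inter (convex_ori_pos x v)).isPreconnected ?_ ?_
    · rw [Set.disjoint_left]
      rintro z ⟨hz1, hz2⟩ hz3
      have hz2 : 0 < ori x v z := hz2
      obtain ⟨p, hp, hzp⟩ := h.frontier_subset hz3
      by_cases hpu : p = u
      · rw [hpu] at hzp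
        have hzp : z ∈ segment ℝ u x := hzp
        rw [segment_symm] at hzp
        obtain ⟨t, t0, -, rfl⟩ := mem_segment_pt.1 hzp
        rw [ori_pt, ← ori_rot u x v] at hz2
        simp only [ori_self_left, mul_zero, zero_add] at hz2
        nlinarith
      by_cases hpx : p = x
      · rw [hpx] at hzp
        have hzp : z ∈ segment ℝ x v := hzp
        obtain ⟨t, t0, -, rfl⟩ := mem_segment_pt.1 hzp
        rw [ori_pt] at hz2
        simp at hz2
      · exact hB z hz1 p hp hpu hpx hzp
    · obtain ⟨t, t0, t1, ht⟩ := exists_pt_of_eventually v (Metric.ball_mem_nhds x hε) one_pos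
      obtain ⟨r, hr⟩ := exists_ori_pos hxv
      obtain ⟨t', t0', -, h3, h4⟩ := exists_pt_of_eventually r
        ((h.loc x hxA _ (pt_mem_openSegment t0 t1)).and (Metric.isOpen_ball.mem_nhds ht)) one_pos
      have h5 : 0 < ori x v (pt (pt x v t) r t') := by
        rw [ori_pt, ori_pt]
        simp only [ori_self_left, ori_self_right, mul_zero, add_zero, zero_add]
        positivity
      exact ⟨_, ⟨h4, h5⟩, h3.2 h5⟩
  filter_upwards [Metric.ball_mem_nhds x hε] with y hy hpos using hsub ⟨hy, hpos⟩

/-- A vertex at which the region is locally contained in a convex angle is a left turn. -/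
theorem ori_pos_of_convexCorner (h : PolyRegion nx A G) {u : Plane} (hu : u ∈ A)
    (hc : ConvexCorner G (nx u)) : 0 < ori u (nx u) (nx (nx u)) := by
  have hxA : nx u ∈ A := h.maps u hu
  obtain ⟨p, b, h0, h1⟩ := hc.closure
  obtain ⟨r, hr⟩ := hc.blocked (h.notMem_of_vertex hxA)
  set x := nx u with hx
  set v := nx x with hv
  have hxv : x ≠ v := (h.ne x hxA).symm
  have hux : u ≠ x := (h.ne u hu).symm
  -- Both edges at `x` lie in the closure of `G`, so both neighbours of `x` lie in the closed angle.
  have key : ∀ q, segment ℝ x q ⊆ _root_.closure G → 0 ≤ ori p x q ∧ 0 ≤ ori x b q := by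
    intro q hq
    obtain ⟨t, t0, t1, ht⟩ := exists_pt_of_eventually q h1 one_pos
    have := ht (hq (pt_mem_segment t0.le t1.le))
    rw [ori_pt, ori_pt] at this
    simp only [ori_self_left, ori_self_right, mul_zero, zero_add] at this
    exact ⟨nonneg_of_mul_nonneg_right this.1 t0, nonneg_of_mul_nonneg_right this.2 t0⟩
  obtain ⟨v1, v2⟩ := key v (h.segment_subset_closure hxA)
  obtain ⟨u1, u2⟩ := key u (by rw [segment_symm]; exact h.segment_subset_closure hu)
  by_contra hcon
  rcases (not_lt.1 hcon).lt_or_eq with hlt | heq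
  -- Right turn: the half disc to the left of `x v` lies in `G` and contains points of the
  -- supporting line in direction `p - b`. There the two functionals defining the angle are
  -- nonnegative with sum zero, so such a point is `x`.
  · obtain ⟨p', b', h0', h1'⟩ := hc
    have hv0 : 0 < ori p x v + ori x b v := by
      rcases (add_nonneg v1 v2).eq_or_lt with e | e
      · exact absurd (eq_of_ori_eq_zero h0.ne' (by linarith) (by linarith)) hxv.symm
      · exact e
    obtain ⟨t, ht, ht1, ht2⟩ := exists_small_pt (r := x + (b - p)) (σ := -1)
      ((h.reflex hu hlt).and (h1)) (by norm_num)
    have hpos : 0 < ori x v (pt x (x + (b - p)) t) := by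
      have : ori x v (pt x (x + (b - p)) t) = -t * (ori p x v + ori x b v) := by
        simp [ori, pt_apply]; ring
      rw [this]; nlinarith
    have hin := ht1 hpos
    obtain ⟨a1, a2⟩ := ht2 (subset_closure hin)
    have e : ori p x (pt x (x + (b - p)) t) + ori x b (pt x (x + (b - p)) t) = 0 := by
      simp [ori, pt_apply]; ring
    have := eq_of_ori_eq_zero h0.ne' (show ori p x (pt x (x + (b - p)) t) = 0 by linarith)
      (by linarith)
    rw [this] at hin
    exact h.notMem_of_vertex hxA hin
  -- Collinear case: neighbours in opposite directions do not fit into an angle below 180 degrees,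
  -- and neighbours in the same direction make the two edges overlap.
  · have hl : ori x u v = 0 := by rw [ori_swap]; linarith
    obtain ⟨c, hcv⟩ := mem_line_of_ori_eq_zero hux.symm hl
    rcases lt_trichotomy c 0 with hc0 | hc0 | hc0
    · rw [hcv, ori_pt] at v1 v2
      simp only [ori_self_left, ori_self_right, mul_zero, zero_add] at v1 v2
      exact hux (eq_of_ori_eq_zero h0.ne' (by nlinarith) (by nlinarith))
    · rw [hc0, pt_zero] at hcv; exact hxv hcv.symm
    · set t := min (1 / 2) (c / 2) with ht
      have t0 : 0 < t := by positivity
      have t1 : t < 1 := (min_le_left _ _).trans_lt (by norm_num)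
      have t2 : t < c := (min_le_right _ _).trans_lt (by linarith)
      have m1 : pt x u t ∈ openSegment ℝ u x := by
        rw [openSegment_symm]; exact pt_mem_openSegment t0 t1
      have m2 : pt x u t ∈ segment ℝ x v := by
        have : pt x u t = pt x v (t / c) := by
          rw [hcv, pt_pt, mul_div_cancel₀ _ hc0.ne']
        rw [this]
        exact pt_mem_segment (by positivity) ((div_le_one hc0).2 t2.le)
      exact (h.simple u hu x hxA hux).le_bot ⟨m1, m2⟩

end PolyRegion

/-! ### Polygon states that carry the segments -/

/-- A polygon through some of the endpoints of a segment system, with region `G`, such that all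
endpoints are in the region or are vertices, and all segments are diagonals or edges. -/
structure St (V : Finset Plane) (Sg : Plane → Plane → Prop) (nx : Plane → Plane)
    (A : Finset Plane) (G : Set Plane) : Prop extends PolyRegion nx A G where
  cover : ∀ y ∈ V, y ∈ G ∨ y ∈ A
  seg : ∀ a b, Sg a b → openSegment ℝ a b ⊆ G ∨ (a ∈ A ∧ nx a = b) ∨ (b ∈ A ∧ nx b = a)

namespace St
variable {V : Finset Plane} {Sg : Plane → Plane → Prop} {nx : Plane → Plane} {A : Finset Plane}
  {G : Set Plane}

/-- The region stays the same, and the only edge that gets lost is not a segment. -/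
theorem split (h : St V Sg nx A G) (hS : SegSys V Sg) {u w : Plane} (hu : u ∈ A)
    (hw : w ∈ openSegment ℝ u (nx u)) (hs : ¬ Sg u (nx u)) :
    St V Sg (insNext nx u w) (insert w A) G := by
  have hwA : w ∉ A := fun hA => h.vertex_notMem_open hu hA hw
  refine ⟨h.toPolyRegion.split hu hw, fun y hy => ?_, fun a b hab => ?_⟩
  · rcases h.cover y hy with e | e
    · exact Or.inl e
    · exact Or.inr (Finset.mem_insert_of_mem e)
  · have key : ∀ a b, Sg a b → a ∈ A → nx a = b → a ∈ insert w A ∧ insNext nx u w a = b := by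
      intro a b hab ha e
      refine ⟨Finset.mem_insert_of_mem ha, ?_⟩
      rw [insNext_of_ne nx (show a ≠ w from fun e' => hwA (e' ▸ ha)), e]
      rintro rfl
      exact hs (e ▸ hab)
    rcases h.seg a b hab with e | e | e
    · exact Or.inl e
    · exact Or.inr (Or.inl (key a b hab e.1 e.2))
    · exact Or.inr (Or.inr (key b a (hS.symm hab) e.1 e.2))

/-- The alternatives in `hseg` cover a diagonal that turns into one of the two new edges; every
other diagonal has to avoid the removed triangle. -/
theorem insert (h : St V Sg nx A G) (hS : SegSys V Sg) {u w : Plane} (hu : u ∈ A) (hw : w ∉ A)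
    (ho : 0 < ori u (nx u) w) (hT : tri u (nx u) w \ segment ℝ u (nx u) ⊆ G)
    (hs : ¬ Sg u (nx u)) (hV : ∀ y ∈ V, y ∈ G → y ∈ tri u (nx u) w → y = w)
    (hseg : ∀ a b, Sg a b → openSegment ℝ a b ⊆ G →
      Disjoint (openSegment ℝ a b) (tri u (nx u) w) ∨
        (a = u ∧ b = w) ∨ (a = w ∧ b = u) ∨ (a = w ∧ b = nx u) ∨ (a = nx u ∧ b = w)) :
    St V Sg (insNext nx u w) (Insert.insert w A) (G \ tri u (nx u) w) := by
  have huw : u ≠ w := fun e => hw (e ▸ hu)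
  refine ⟨h.toPolyRegion.insert hu hw ho hT, fun y hy => ?_, fun a b hab => ?_⟩
  · rcases h.cover y hy with e | e
    · by_cases hyT : y ∈ tri u (nx u) w
      · exact Or.inr (by rw [hV y hy e hyT]; exact Finset.mem_insert_self _ _)
      · exact Or.inl ⟨e, hyT⟩
    · exact Or.inr (Finset.mem_insert_of_mem e)
  · have key : ∀ a b, Sg a b → a ∈ A → nx a = b →
        a ∈ Insert.insert w A ∧ insNext nx u w a = b := by
      intro a b hab ha e
      refine ⟨Finset.mem_insert_of_mem ha, ?_⟩
      rw [insNext_of_ne nx (show a ≠ w from fun e' => hw (e' ▸ ha)), e]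
      rintro rfl
      exact hs (e ▸ hab)
    have h1 : u ∈ Insert.insert w A ∧ insNext nx u w u = w :=
      ⟨Finset.mem_insert_of_mem hu, insNext_left nx huw⟩
    have h2 : w ∈ Insert.insert w A ∧ insNext nx u w w = nx u :=
      ⟨Finset.mem_insert_self _ _, insNext_new nx u w⟩
    rcases h.seg a b hab with e | e | e
    · rcases hseg a b hab e with d | ⟨rfl, rfl⟩ | ⟨rfl, rfl⟩ | ⟨rfl, rfl⟩ | ⟨rfl, rfl⟩
      · exact Or.inl fun y hy => ⟨e hy, fun hyT => d.le_bot ⟨hy, hyT⟩⟩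
      · exact Or.inr (Or.inl h1)
      · exact Or.inr (Or.inr h1)
      · exact Or.inr (Or.inl h2)
      · exact Or.inr (Or.inr h2)
    · exact Or.inr (Or.inl (key a b hab e.1 e.2))
    · exact Or.inr (Or.inr (key b a (hS.symm hab) e.1 e.2))

theorem delete (h : St V Sg nx A G) (hS : SegSys V Sg) {u : Plane} (hu : u ∈ A)
    (hxV : nx u ∉ V) (ho : 0 < ori u (nx u) (nx (nx u)))
    (hT : tri u (nx u) (nx (nx u)) \ (segment ℝ u (nx u) ∪ segment ℝ (nx u) (nx (nx u))) ⊆ G)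
    (hV : ∀ y ∈ V, y ∈ G → y ∉ tri u (nx u) (nx (nx u)))
    (hseg : ∀ a b, Sg a b → openSegment ℝ a b ⊆ G →
      Disjoint (openSegment ℝ a b) (tri u (nx u) (nx (nx u))) ∨
        (a = u ∧ b = nx (nx u)) ∨ (a = nx (nx u) ∧ b = u)) :
    St V Sg (delNext nx u) (A.erase (nx u)) (G \ tri u (nx u) (nx (nx u))) := by
  obtain ⟨hux, hxv, huv⟩ := ne_of_ori_ne ho.ne'
  refine ⟨(h.toPolyRegion.delete hu ho hT).1, fun y hy => ?_, fun a b hab => ?_⟩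
  · rcases h.cover y hy with e | e
    · exact Or.inl ⟨e, hV y hy e⟩
    · exact Or.inr (Finset.mem_erase.2 ⟨fun e' => hxV (e' ▸ hy), e⟩)
  · have key : ∀ a b, Sg a b → a ∈ A → nx a = b →
        a ∈ A.erase (nx u) ∧ delNext nx u a = b := by
      intro a b hab ha e
      refine ⟨Finset.mem_erase.2 ⟨fun e' => hxV (e' ▸ hS.mem hab), ha⟩, ?_⟩
      rw [delNext_of_ne nx, e]
      rintro rfl
      exact hxV (e ▸ hS.mem' hab)
    have h1 : u ∈ A.erase (nx u) ∧ delNext nx u u = nx (nx u) :=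
      ⟨Finset.mem_erase.2 ⟨hux, hu⟩, delNext_left nx u⟩
    rcases h.seg a b hab with e | e | e
    · rcases hseg a b hab e with d | ⟨rfl, rfl⟩ | ⟨rfl, rfl⟩
      · exact Or.inl fun y hy => ⟨e hy, fun hyT => d.le_bot ⟨hy, hyT⟩⟩
      · exact Or.inr (Or.inl h1)
      · exact Or.inr (Or.inr h1)
    · exact Or.inr (Or.inl (key a b hab e.1 e.2))
    · exact Or.inr (Or.inr (key b a (hS.symm hab) e.1 e.2))

end St

/-! ### The tangent from one end of a convex auxiliary corner -/

/-- The Grassmann–Plücker relation for directions at `u`; it compares angles at `u` through signs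
only, in `Sweep.memT` and `exists_tangent`. -/
theorem ori_plucker (u x v w y : Plane) :
    ori u w y * ori u x v = ori u w v * ori u x y + ori u x w * ori u v y := by
  simp only [ori]; ring

theorem ori_pt_pt (u w m : Plane) (s t : ℝ) :
    ori (pt u w s) (pt u w t) m = (t - s) * ori u w m := by
  simp only [ori, pt_apply]; ring

theorem pt_between {p q : Plane} {a b c : ℝ} (h1 : a < c) (h2 : c < b) :
    pt p q c ∈ openSegment ℝ (pt p q a) (pt p q b) := by
  have hab : 0 < b - a := by linarith
  refine mem_openSegment_pt.2 ⟨(c - a) / (b - a), div_pos (by linarith) hab,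
    (div_lt_one hab).2 (by linarith), ?_⟩
  rw [pt_pt_pt, div_mul_cancel₀ _ hab.ne']; congr 1; ring

/-- A point of the line inside an open interval is strictly between the parameters. -/
theorem between_of_mem {p q : Plane} (hpq : p ≠ q) {a b c : ℝ}
    (h : pt p q c ∈ openSegment ℝ (pt p q a) (pt p q b)) : (a < c ∧ c < b) ∨ (b < c ∧ c < a) ∨
      (a = c ∧ b = c) := by
  obtain ⟨t, t0, t1, e⟩ := mem_openSegment_pt.1 h
  rw [pt_pt_pt] at e
  have := pt_inj hpq e
  rcases lt_trichotomy a b with hab | hab | hab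
  · left; constructor <;> nlinarith
  · subst hab; right; right; constructor <;> linarith
  · right; left; constructor <;> nlinarith

namespace PolyRegion
variable {nx : Plane → Plane} {A : Finset Plane} {G : Set Plane}

/-- The region lies in every closed half plane that contains the vertices. -/
theorem ori_nonneg_of_vertices (h : PolyRegion nx A G) {a b : Plane} (hab : a ≠ b)
    (hA : ∀ p ∈ A, 0 ≤ ori a b p) {y : Plane} (hy : y ∈ G) : 0 ≤ ori a b y := by
  by_contra hc
  -- The opposite open half plane meets no edge, so if it met `G` it would lie in `G`, which is
  -- bounded.
  have hsub : {y | ori a b y < 0} ⊆ G := by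
    refine subset_of_avoid_frontier (convex_ori_neg a b).isPreconnected ?_ ⟨y, not_le.1 hc, hy⟩
    rw [Set.disjoint_left]
    intro z hz hzf
    obtain ⟨p, hp, hzp⟩ := h.frontier_subset hzf
    have : 0 ≤ ori a b z :=
      (convex_ori_nonneg a b).segment_subset (hA p hp) (hA _ (h.maps p hp)) hzp
    exact absurd this (not_le.2 hz)
  obtain ⟨R, hR⟩ := h.bdd.exists_norm_le
  have hd : 0 < ‖b - a‖ := norm_pos_iff.2 (sub_ne_zero.2 hab.symm)
  have hR0 : 0 ≤ R := (norm_nonneg y).trans (hR y hy)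
  set t : ℝ := (2 * R + 1) / ‖b - a‖ with ht
  have hmem : y + t • (b - a) ∈ G := by
    apply hsub
    have : ori a b (y + t • (b - a)) = ori a b y := by simp [ori]; ring
    rw [mem_ofPred_eq, this]; exact not_le.1 hc
  have h1 := hR _ hmem
  have h2 := hR _ hy
  have h3 : ‖t • (b - a)‖ = 2 * R + 1 := by
    rw [norm_smul, Real.norm_of_nonneg (by positivity), ht, div_mul_cancel₀ _ hd.ne']
  have h4 : ‖t • (b - a)‖ ≤ ‖y + t • (b - a)‖ + ‖y‖ := by
    have := norm_sub_le (y + t • (b - a)) y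
    simpa using this
  linarith

end PolyRegion

/-- A convex auxiliary corner `u, nx u, nx (nx u)` with the tangent point `w` from `u`. -/
structure Sweep (V : Finset Plane) (Sg : Plane → Plane → Prop) (nx : Plane → Plane)
    (A : Finset Plane) (G : Set Plane) (u w : Plane) : Prop extends St V Sg nx A G where
  sys : SegSys V Sg
  memA : u ∈ A
  xV : nx u ∉ V
  turn : 0 < ori u (nx u) (nx (nx u))
  wpos : 0 < ori u (nx u) w
  wT : w ∈ tri u (nx u) (nx (nx u))
  tang : ∀ p, (p ∈ A ∨ p ∈ V) → p ∈ tri u (nx u) (nx (nx u)) → p ≠ nx u → 0 ≤ ori u w p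
  near : ∀ p, (p ∈ A ∨ p ∈ V) → p ∉ openSegment ℝ u w

namespace Sweep
variable {V : Finset Plane} {Sg : Plane → Plane → Prop} {nx : Plane → Plane} {A : Finset Plane}
  {G : Set Plane} {u w : Plane}

/-- Since `w` lies in the triangle, so does the part of the angle at `nx u` on the side of `nx u` of
the line `u w`. The third side condition comes from `ori_plucker`. -/
theorem memT (h : Sweep V Sg nx A G u w) {y : Plane} (h1 : 0 ≤ ori u (nx u) y)
    (h2 : 0 ≤ ori (nx u) (nx (nx u)) y) (h3 : ori u w y ≤ 0) :
    y ∈ tri u (nx u) (nx (nx u)) := by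
  refine ⟨h1, h2, ?_⟩
  have e := ori_plucker u (nx u) (nx (nx u)) w y
  have h4 := h.wT.2.2
  rw [ori_rot] at h4
  have h5 := h.wpos
  have h6 := h.turn
  rw [ori_swap]
  have a1 : 0 ≤ ori u w (nx (nx u)) * ori u (nx u) y := mul_nonneg h4 h1
  have a2 : ori u w y * ori u (nx u) (nx (nx u)) ≤ 0 := mul_nonpos_of_nonpos_of_nonneg h3 h6.le
  by_contra hc
  have : 0 < ori u (nx u) w * ori u (nx (nx u)) y := mul_pos h5 (by linarith)
  linarith

theorem uw_ne (h : Sweep V Sg nx A G u w) : u ≠ w := (ne_of_ori_ne h.wpos.ne').2.2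

theorem x_neg (h : Sweep V Sg nx A G u w) : ori u w (nx u) < 0 := by
  rw [ori_swap']; linarith [h.wpos]

/-- A segment between endpoints or vertices that does not cross the two sides of the corner
does not meet the open region below the tangent. -/
theorem avoid (h : Sweep V Sg nx A G u w) {c d : Plane} (hc : c ∈ A ∨ c ∈ V) (hd : d ∈ A ∨ d ∈ V)
    (hcx : c ≠ nx u) (hdx : d ≠ nx u)
    (ho : ∀ m ∈ openSegment ℝ c d, m ∉ segment ℝ u (nx u) ∧ m ∉ segment ℝ (nx u) (nx (nx u)))
    {m : Plane} (hm : m ∈ segment ℝ c d) (h1 : 0 < ori u (nx u) m)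
    (h2 : 0 < ori (nx u) (nx (nx u)) m) : 0 ≤ ori u w m := by
  -- Walk from `m` to the lower end `d`, staying strictly below the tangent. By tangency `d` is not
  -- in the angle `Q`, so the walk leaves `Q` at a point of the triangle. This point is an end of
  -- the segment, excluded by tangency, or lies on a side of the corner, excluded by `ho`.
  have key : ∀ c d, (c ∈ A ∨ c ∈ V) → (d ∈ A ∨ d ∈ V) → c ≠ nx u → d ≠ nx u →
      (∀ m ∈ openSegment ℝ c d,
        m ∉ segment ℝ u (nx u) ∧ m ∉ segment ℝ (nx u) (nx (nx u))) →
      m ∈ segment ℝ c d → ori u w d ≤ ori u w c → 0 ≤ ori u w m := by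
    intro c d hc hd hcx hdx ho hm hle
    by_contra hneg
    have hneg := not_le.1 hneg
    have hmd : ∀ y ∈ segment ℝ m d, ori u w y < 0 := by
      intro y hy
      obtain ⟨t, t0, t1, rfl⟩ := mem_segment_pt.1 hm
      rw [ori_pt] at hneg
      have hd0 : ori u w d < 0 := by nlinarith
      have hm0 : ori u w (pt c d t) < 0 := by rw [ori_pt]; exact hneg
      exact (convex_ori_neg u w).segment_subset hm0 hd0 hy
    have hend : ∀ e, (e ∈ A ∨ e ∈ V) → e ≠ nx u → ori u w e < 0 → 0 ≤ ori u (nx u) e →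
        0 ≤ ori (nx u) (nx (nx u)) e → False := fun e he hex he0 a b =>
      absurd (h.tang e he (h.memT a b he0.le) hex) (not_le.2 he0)
    set Q : Set Plane := {y | 0 < ori u (nx u) y ∧ 0 < ori (nx u) (nx (nx u)) y} with hQ
    have hQo : IsOpen Q := (isOpen_lt continuous_const (continuous_ori _ _)).inter
      (isOpen_lt continuous_const (continuous_ori _ _))
    have hdQ : d ∉ Q := fun hdQ =>
      hend d hd hdx (hmd d (right_mem_segment ℝ _ _)) hdQ.1.le hdQ.2.le
    obtain ⟨y, hy, hyf⟩ := exists_mem_frontier (convex_segment m d).isPreconnected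
      ⟨m, left_mem_segment ℝ _ _, (⟨h1, h2⟩ : m ∈ Q)⟩ ⟨d, right_mem_segment ℝ _ _, hdQ⟩
    rw [hQo.frontier_eq] at hyf
    have hcl : IsClosed {y | 0 ≤ ori u (nx u) y ∧ 0 ≤ ori (nx u) (nx (nx u)) y} :=
      (isClosed_le continuous_const (continuous_ori _ _)).inter
      (isClosed_le continuous_const (continuous_ori _ _))
    have hyc := closure_minimal (fun y (hy : y ∈ Q) => (⟨hy.1.le, hy.2.le⟩ :
      0 ≤ ori u (nx u) y ∧ 0 ≤ ori (nx u) (nx (nx u)) y)) hcl hyf.1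
    have hyT := h.memT hyc.1 hyc.2 (hmd y hy).le
    have hycd : y ∈ segment ℝ c d :=
      (convex_segment c d).segment_subset hm (right_mem_segment ℝ _ _) hy
    rcases mem_segment_cases hycd with e | e | hyo
    · exact hend c hc hcx (e ▸ hmd y hy) (e ▸ hyc.1) (e ▸ hyc.2)
    · exact hend d hd hdx (e ▸ hmd y hy) (e ▸ hyc.1) (e ▸ hyc.2)
    · rcases hyc.1.eq_or_lt with e | e
      · exact (ho y hyo).1 (mem_segment_of_tri h.turn hyT e.symm)
      rcases hyc.2.eq_or_lt with e' | e'
      · exact (ho y hyo).2 (mem_segment_of_tri₂ h.turn hyT e'.symm)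
      · exact hyf.2 ⟨e, e'⟩
  rcases le_total (ori u w d) (ori u w c) with hle | hle
  · exact key c d hc hd hcx hdx ho hm hle
  · exact key d c hd hc hdx hcx (by rwa [openSegment_symm]) (by rwa [segment_symm]) hle

theorem edge_avoid (h : Sweep V Sg nx A G u w) {p : Plane} (hp : p ∈ A) {m : Plane}
    (hm : m ∈ segment ℝ p (nx p)) (h1 : 0 < ori u (nx u) m)
    (h2 : 0 < ori (nx u) (nx (nx u)) m) : p ≠ u ∧ p ≠ nx u ∧ 0 ≤ ori u w m := by
  have hpu : p ≠ u := by
    rintro rfl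
    obtain ⟨t, -, -, rfl⟩ := mem_segment_pt.1 hm
    rw [ori_pt] at h1; simp at h1
  have hpx : p ≠ nx u := by
    rintro rfl
    obtain ⟨t, -, -, rfl⟩ := mem_segment_pt.1 hm
    rw [ori_pt] at h2; simp at h2
  have hxA := h.maps u h.memA
  refine ⟨hpu, hpx, h.avoid (Or.inl hp) (Or.inl (h.maps p hp)) hpx
    (fun e => hpu (h.inj p hp u h.memA e)) (fun m hm => ⟨?_, ?_⟩) hm h1 h2⟩
  · exact fun hm' => (h.simple p hp u h.memA hpu).le_bot ⟨hm, hm'⟩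
  · exact fun hm' => (h.simple p hp _ hxA hpx).le_bot ⟨hm, hm'⟩

theorem seg_avoid (h : Sweep V Sg nx A G u w) {a b : Plane} (hab : Sg a b) {m : Plane}
    (hm : m ∈ segment ℝ a b) (h1 : 0 < ori u (nx u) m)
    (h2 : 0 < ori (nx u) (nx (nx u)) m) : 0 ≤ ori u w m := by
  rcases h.seg a b hab with e | ⟨e, rfl⟩ | ⟨e, rfl⟩
  · have hx : ∀ y ∈ V, y ≠ nx u := fun y hy e => h.xV (e ▸ hy)
    refine h.avoid (Or.inr (h.sys.mem hab)) (Or.inr (h.sys.mem' hab)) (hx _ (h.sys.mem hab))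
      (hx _ (h.sys.mem' hab)) (fun m hm => ⟨?_, ?_⟩) hm h1 h2
    · exact fun hm' => (h.disj u h.memA).le_bot ⟨e hm, hm'⟩
    · exact fun hm' => (h.disj _ (h.maps u h.memA)).le_bot ⟨e hm, hm'⟩
  · exact (h.edge_avoid e hm h1 h2).2.2
  · exact (h.edge_avoid e (by rwa [segment_symm]) h1 h2).2.2

/-- The open region below the tangent is free. -/
theorem free (h : Sweep V Sg nx A G u w) {y : Plane} (h1 : 0 < ori u (nx u) y)
    (h2 : 0 < ori (nx u) (nx (nx u)) y) (h3 : ori u w y < 0) : y ∈ G \ segUnion Sg := by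
  refine ⟨?_, fun ⟨a, b, hab, hm⟩ => absurd (h.seg_avoid hab hm h1 h2) (not_le.2 h3)⟩
  -- The region below the tangent is convex, meets no edge by `edge_avoid`, and contains points of
  -- `G` next to the edge from `u` to `nx u`.
  set Q : Set Plane := {y | 0 < ori u (nx u) y} ∩
    ({y | 0 < ori (nx u) (nx (nx u)) y} ∩ {y | ori u w y < 0}) with hQ
  have hsub : Q ⊆ G := by
    refine subset_of_avoid_frontier ((convex_ori_pos _ _).inter
      ((convex_ori_pos _ _).inter (convex_ori_neg _ _))).isPreconnected ?_ ?_
    · rw [Set.disjoint_left]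
      rintro z ⟨a, b, c⟩ hzf
      obtain ⟨p, hp, hzp⟩ := h.frontier_subset hzf
      exact absurd (h.edge_avoid hp hzp a b).2.2 (not_le.2 c)
    · have hmo := pt_mem_openSegment (p := u) (q := nx u) (t := 1/2) (by norm_num) (by norm_num)
      set m := pt u (nx u) (1/2) with hm
      have b1 : 0 < ori (nx u) (nx (nx u)) m := by
        rw [hm, ori_pt, ← ori_rot]; simp only [ori_self_left]; linarith [h.turn]
      have b2 : ori u w m < 0 := by
        rw [hm, ori_pt]; simp only [ori_self_left]; linarith [h.x_neg]
      obtain ⟨t, t0, -, h5, h6, h7⟩ := exists_pt_of_eventually (nx (nx u))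
        ((h.loc u h.memA m hmo).and ((eventually_ori_pos b1).and (eventually_ori_neg b2))) one_pos
      have h8 : 0 < ori u (nx u) (pt m (nx (nx u)) t) := by
        rw [ori_pt, hm, ori_pt]
        simp only [ori_self_left, ori_self_right, mul_zero, add_zero, zero_add]
        exact mul_pos t0 h.turn
      exact ⟨_, ⟨h8, h6, h7⟩, h5.2 h8⟩
  exact hsub ⟨h1, h2, h3⟩

/-- The points of the open chord from `u` through `w`. -/
def OnChord (nx : Plane → Plane) (u w y : Plane) : Prop :=
  ori u w y = 0 ∧ 0 < ori u (nx u) y ∧ 0 < ori (nx u) (nx (nx u)) y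

theorem mem_closure (h : Sweep V Sg nx A G u w) {y : Plane} (hy : OnChord nx u w y) :
    y ∈ closure G := by
  rw [mem_closure_iff_frequently]
  intro hev
  obtain ⟨t, t0, -, h1, h2, h3⟩ := exists_pt_of_eventually (nx u)
    (hev.and ((eventually_ori_pos hy.2.1).and (eventually_ori_pos hy.2.2))) one_pos
  refine h1 (h.free h2 h3 ?_).1
  rw [ori_pt, hy.1]; have := mul_neg_of_pos_of_neg t0 h.x_neg; linarith

theorem eq_pt (h : Sweep V Sg nx A G u w) {y : Plane} (hy : ori u w y = 0) : ∃ t, y = pt u w t :=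
  mem_line_of_ori_eq_zero h.uw_ne hy

theorem ori_ux_pt (u x w : Plane) (t : ℝ) : ori u x (pt u w t) = t * ori u x w := by
  rw [ori_pt]; simp

/-- A segment that touches the chord from above in an inner point is collinear with it. -/
theorem tangent {c d m : Plane}
    (hav : ∀ y ∈ segment ℝ c d, 0 < ori u (nx u) y → 0 < ori (nx u) (nx (nx u)) y →
      0 ≤ ori u w y)
    (hm : m ∈ openSegment ℝ c d) (hc : OnChord nx u w m) : ori u w c = 0 ∧ ori u w d = 0 := by
  have key : ∀ c d, (∀ y ∈ segment ℝ c d, 0 < ori u (nx u) y →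
      0 < ori (nx u) (nx (nx u)) y → 0 ≤ ori u w y) → m ∈ openSegment ℝ c d →
      0 ≤ ori u w d := by
    intro c d hav hm
    by_contra hneg
    obtain ⟨t, t0, t1, h1, h2⟩ := exists_pt_of_eventually d
      ((eventually_ori_pos hc.2.1).and (eventually_ori_pos hc.2.2)) one_pos
    have := hav (pt m d t) ((convex_segment c d).segment_subset
      (openSegment_subset_segment ℝ _ _ hm) (right_mem_segment ℝ _ _)
      (pt_mem_segment t0.le t1.le)) h1 h2
    rw [ori_pt, hc.1] at this
    nlinarith [not_le.1 hneg]
  have hd := key c d hav hm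
  have hc' := key d c (by rwa [segment_symm]) (by rwa [openSegment_symm])
  obtain ⟨t, t0, t1, rfl⟩ := mem_openSegment_pt.1 hm
  have := hc.1
  rw [ori_pt] at this
  have a1 : 0 ≤ (1 - t) * ori u w c := mul_nonneg (by linarith) hc'
  have a2 : 0 ≤ t * ori u w d := mul_nonneg t0.le hd
  constructor
  · rcases mul_eq_zero.1 (show (1 - t) * ori u w c = 0 by linarith) with e | e
    · linarith
    · exact e
  · rcases mul_eq_zero.1 (show t * ori u w d = 0 by linarith) with e | e
    · linarith
    · exact e

/-- An end of an edge along the chord is on the chord or is `u` or `nx (nx u)`. -/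
theorem locate (h : Sweep V Sg nx A G u w) {p m q r : Plane} (hp : p ∈ A)
    (hm : m ∈ segment ℝ q r) (hqr : openSegment ℝ q r = openSegment ℝ p (nx p))
    (hc : OnChord nx u w m) (hmp : m ∈ segment ℝ p (nx p)) (hqA : q ∈ A) (hq : ori u w q = 0) :
    OnChord nx u w q ∨ q = u ∨ q = nx (nx u) := by
  obtain ⟨hpu, hpx, -⟩ := h.edge_avoid hp hmp hc.2.1 hc.2.2
  have hxA := h.maps u h.memA
  by_cases hmq : m = q
  · exact Or.inl (hmq ▸ hc)
  obtain ⟨tq, rfl⟩ := h.eq_pt hq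
  obtain ⟨tm, rfl⟩ := h.eq_pt hc.1
  have htm : 0 < tm := by
    have := hc.2.1; rw [ori_ux_pt] at this
    exact pos_of_mul_pos_left this h.wpos.le
  have hsub : openSegment ℝ (pt u w tq) (pt u w tm) ⊆ openSegment ℝ p (nx p) := by
    rw [← hqr]
    intro y hy
    obtain ⟨s, s0, s1, hs⟩ := mem_segment_pt.1 hm
    obtain ⟨t, t0, t1, rfl⟩ := mem_openSegment_pt.1 hy
    rw [hs, pt_pt]
    rcases s0.eq_or_lt with e | s0
    · rw [← e, pt_zero] at hs; exact absurd hs hmq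
    · exact pt_mem_openSegment (by positivity) (by nlinarith)
  -- An end before `u` would put the vertex `u` inside the edge; an end beyond the line of the
  -- second side would make the edge cross this side. Both contradict simplicity.
  rcases lt_trichotomy tq 0 with h0 | h0 | h0
  · exfalso
    have : u ∈ openSegment ℝ p (nx p) := hsub (by
      have := pt_between (p := u) (q := w) h0 htm; rwa [pt_zero] at this)
    exact h.vertex_notMem_open hp h.memA this
  · right; left; rw [h0, pt_zero]
  · have q1 : 0 < ori u (nx u) (pt u w tq) := by rw [ori_ux_pt]; exact mul_pos h0 h.wpos
    have onside : ∀ y, 0 < ori u (nx u) y → ori u w y = 0 →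
        ori (nx u) (nx (nx u)) y = 0 → y ∈ segment ℝ (nx u) (nx (nx u)) := fun y a b c =>
      mem_segment_of_tri₂ h.turn (h.memT a.le c.ge b.le) c
    rcases lt_trichotomy (ori (nx u) (nx (nx u)) (pt u w tq)) 0 with h1 | h1 | h1
    · exfalso
      set f := fun y => ori (nx u) (nx (nx u)) y with hf
      have f1 : f (pt u w tq) < 0 := h1
      have f2 : 0 < f (pt u w tm) := hc.2.2
      have hden : 0 < f (pt u w tm) - f (pt u w tq) := by linarith
      set σ := -f (pt u w tq) / (f (pt u w tm) - f (pt u w tq)) with hσ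
      have s0 : 0 < σ := div_pos (by linarith) hden
      have s1 : σ < 1 := (div_lt_one hden).2 (by linarith)
      have hz := hsub (pt_mem_openSegment s0 s1)
      set z := pt (pt u w tq) (pt u w tm) σ with hzdef
      have z0 : ori (nx u) (nx (nx u)) z = 0 := by
        rw [hzdef, ori_pt]
        change (1 - σ) * f (pt u w tq) + σ * f (pt u w tm) = 0
        rw [hσ]; field_simp; ring
      have z1 : 0 < ori u (nx u) z :=
        (convex_ori_pos _ _).segment_subset q1 hc.2.1 (pt_mem_segment s0.le s1.le)
      have z2 : ori u w z = 0 := by rw [hzdef, ori_pt, hc.1, hq]; ring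
      exact (h.simple p hp _ hxA hpx).le_bot ⟨hz, onside z z1 z2 z0⟩
    · right; right
      rcases h.eq_or_of_vertex_mem hxA hqA (onside _ q1 hq h1) with e | e
      · have := h.x_neg; rw [← e, hq] at this; exact absurd this (lt_irrefl 0)
      · exact e
    · exact Or.inl ⟨hq, q1, h1⟩

end Sweep

namespace Sweep
variable {V : Finset Plane} {Sg : Plane → Plane → Prop} {nx : Plane → Plane} {A : Finset Plane}
  {G : Set Plane} {u w : Plane}

/-- A vertex on the chord has a neighbour in either direction of the chord. -/
theorem neighbour (h : Sweep V Sg nx A G u w) {t τ : ℝ} (hτ : τ = 1 ∨ τ = -1)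
    (hb : OnChord nx u w (pt u w t)) (hbA : pt u w t ∈ A)
    (hAP : ¬ HalfFree (G \ segUnion Sg) G (pt u w t)) :
    ∃ tq, 0 < τ * (tq - t) ∧ pt u w tq ∈ A ∧
      (nx (pt u w t) = pt u w tq ∨ nx (pt u w tq) = pt u w t) ∧
      (OnChord nx u w (pt u w tq) ∨ pt u w tq = u ∨ pt u w tq = nx (nx u)) := by
  have hτ0 : τ ≠ 0 := by rcases hτ with rfl | rfl <;> norm_num
  have hττ : τ * τ = 1 := by rcases hτ with rfl | rfl <;> norm_num
  set b := pt u w t with hbdef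
  set r := pt u w (t + τ) with hr
  have hpos : ∀ s : ℝ, pt b r s = pt u w (t + s * τ) := fun s => by
    rw [hbdef, hr, pt_pt_pt]; congr 1; ring
  -- The half disc below the chord is free, so a ray along the chord that starts in `G` would make
  -- `b` half free. Hence points of the chord outside `G` accumulate at `b`. They lie in the closure
  -- of `G`, thus on edges, and near `b` only its own two edges are present.
  have hfreq : ∃ᶠ s in 𝓝[>] (0 : ℝ), pt b r s ∉ G := by
    rw [Filter.frequently_iff_forall_eventually_exists_and]
    intro Q hQ
    by_contra hcon
    push Not at hcon
    refine hAP ⟨r, fun e => ?_, -τ, neg_ne_zero.2 hτ0, ?_, hQ.mono fun s hs => by_contra fun hn => hcon s hn hs⟩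
    · have := pt_inj h.uw_ne e; exact hτ0 (by linarith)
    · filter_upwards [eventually_ori_pos hb.2.1, eventually_ori_pos hb.2.2] with m h1 h2 h3
      refine h.free h1 h2 ?_
      rw [hbdef, hr, ori_pt_pt] at h3
      have : -τ * ((t + τ - t) * ori u w m) = -(τ * τ) * ori u w m := by ring
      rw [this, hττ] at h3; linarith
  obtain ⟨v0, hv0, ev0⟩ := h.exists_prev hbA
  have hedges := h.eventually_notMem_edges hv0
  rw [ev0] at hedges
  obtain ⟨s, hs, ⟨hs0, hs1, hs2⟩, hs3⟩ := (hfreq.and_eventually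
    (((tendsto_pt_zero b r).eventually ((eventually_ori_pos hb.2.1).and
      ((eventually_ori_pos hb.2.2).and hedges))).and self_mem_nhdsWithin)).exists
  have hs3 : 0 < s := hs3
  set y := pt b r s with hy
  have hyc : OnChord nx u w y := ⟨by rw [hy, hpos, ori_pt]; simp, hs0, hs1⟩
  obtain ⟨p, hp, hyp⟩ := h.front y (h.mem_closure hyc) hs
  have key : ∀ q, q ∈ A → y ∈ segment ℝ b q → openSegment ℝ q b = openSegment ℝ p (nx p) →
      segment ℝ q b = segment ℝ p (nx p) → (nx b = q ∨ nx q = b) →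
      ∃ tq, 0 < τ * (tq - t) ∧ pt u w tq ∈ A ∧ (nx b = pt u w tq ∨ nx (pt u w tq) = b) ∧
      (OnChord nx u w (pt u w tq) ∨ pt u w tq = u ∨ pt u w tq = nx (nx u)) := by
    intro q hqA hyq ho hc hn
    obtain ⟨σ, σ0, -, e⟩ := mem_segment_pt.1 hyq
    have hyb : y ≠ b := by
      rw [hy, hpos]; intro e; have := pt_inj h.uw_ne e
      rcases mul_eq_zero.1 (show s * τ = 0 by linarith) with e | e
      · linarith
      · exact hτ0 e
    have hσ : 0 < σ := σ0.lt_of_ne (by rintro rfl; rw [pt_zero] at e; exact hyb e)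
    have hq0 : ori u w q = 0 := by
      have := congrArg (ori u w) e
      rw [hyc.1, ori_pt, hb.1, mul_zero, zero_add] at this
      exact (mul_eq_zero.1 this.symm).resolve_left hσ.ne'
    obtain ⟨tq, rfl⟩ := h.eq_pt hq0
    refine ⟨tq, ?_, hqA, hn, ?_⟩
    · rw [hy, hpos, hbdef, pt_pt_pt] at e
      have e := pt_inj h.uw_ne e
      have e2 : σ * (tq - t) = s * τ := by linarith
      have e3 : σ * (τ * (tq - t)) = s := by
        calc σ * (τ * (tq - t)) = τ * (σ * (tq - t)) := by ring
          _ = s * (τ * τ) := by rw [e2]; ring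
          _ = s := by rw [hττ, mul_one]
      exact pos_of_mul_pos_right (by rw [e3]; exact hs3) hσ.le
    · exact h.locate hp (right_mem_segment ℝ _ _) ho hb
        (hc ▸ right_mem_segment ℝ (pt u w tq) b) hqA hq0
  by_cases hpb : p = b
  · subst hpb
    exact key (nx b) (h.maps _ hp) hyp (openSegment_symm ℝ _ _) (segment_symm ℝ _ _) (Or.inl rfl)
  by_cases hpv : p = v0
  · subst hpv
    rw [ev0] at hyp
    exact key p hp (by rwa [segment_symm]) (by rw [ev0]) (by rw [ev0]) (Or.inr ev0)
  · exact absurd hyp (hs2 p hp hpv hpb)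

/-- The chord is not met by edges. -/
theorem chord_free (h : Sweep V Sg nx A G u w)
    (hnc : ∀ p q : Plane, p ≠ q → ∃ y ∈ V, ori p q y ≠ 0)
    (hAP : ∀ y ∈ A, y ∈ tri u (nx u) (nx (nx u)) → y ≠ u → ¬ HalfFree (G \ segUnion Sg) G y)
    {y : Plane} (hy : OnChord nx u w y) : y ∈ G := by
  by_contra hyG
  obtain ⟨p, hp, hyp⟩ := h.front y (h.mem_closure hy) hyG
  obtain ⟨hpu, hpx, -⟩ := h.edge_avoid hp hyp hy.2.1 hy.2.2
  have hxA := h.maps u h.memA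
  set x := nx u with hx
  set v := nx x with hv
  have hvA : v ∈ A := h.maps x hxA
  -- Suppose some edge meets the chord. The vertices on the chord have neighbours in both directions
  -- of the chord, so together with `u`, `x`, `v` they are closed under `nx` and are all vertices of
  -- the polygon.
  set D := A.filter (OnChord nx u w) with hD
  have hDm : ∀ q, q ∈ D ↔ q ∈ A ∧ OnChord nx u w q := fun q => Finset.mem_filter
  have hvc : ¬ OnChord nx u w v := fun hc => by have := hc.2.2; simp [← hx, ← hv] at this
  have hxc : ¬ OnChord nx u w x := fun hc => by have := hc.2.1; simp [← hx] at this
  have huc : ¬ OnChord nx u w u := fun hc => by have := hc.2.1; simp at this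
  have hAPc : ∀ q ∈ D, ¬ HalfFree (G \ segUnion Sg) G q := fun q hq => by
    obtain ⟨hqA, hqc⟩ := (hDm q).1 hq
    exact hAP q hqA (h.memT hqc.2.1.le hqc.2.2.le hqc.1.le) (by rintro rfl; exact huc hqc)
  have hDn : ∀ q ∈ D, nx q ∈ D ∨ nx q = u ∨ nx q = v := by
    intro q hq
    obtain ⟨hqA, hqc⟩ := (hDm q).1 hq
    obtain ⟨t, rfl⟩ := h.eq_pt hqc.1
    obtain ⟨t1, a1, b1, c1, d1⟩ := h.neighbour (τ := 1) (Or.inl rfl) hqc hqA (hAPc _ hq)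
    obtain ⟨t2, a2, b2, c2, d2⟩ := h.neighbour (τ := -1) (Or.inr rfl) hqc hqA (hAPc _ hq)
    rcases c1 with c1 | c1
    · rw [c1, hDm]; exact d1.imp (fun e => ⟨b1, e⟩) id
    rcases c2 with c2 | c2
    · rw [c2, hDm]; exact d2.imp (fun e => ⟨b2, e⟩) id
    · have := pt_inj h.uw_ne (h.inj _ b1 _ b2 (c1.trans c2.symm))
      linarith
  -- On the chord `ori u x` grows with the distance from `u`, so the outer neighbour of the farthest
  -- vertex can only be `v`. If there is no vertex on the chord, the edge meeting it runs along it
  -- from `v` to `u`.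
  have hmain : (nx v ∈ D ∨ nx v = u) ∧ ori u w v = 0 := by
    by_cases hDe : D.Nonempty
    · obtain ⟨d, hd, hmax⟩ := D.exists_max_image (fun q => ori u x q) hDe
      obtain ⟨hdA, hdc⟩ := (hDm d).1 hd
      obtain ⟨t, rfl⟩ := h.eq_pt hdc.1
      obtain ⟨t1, a1, b1, c1, d1⟩ := h.neighbour (τ := 1) (Or.inl rfl) hdc hdA (hAPc _ hd)
      have ht0 : 0 < t := by
        have := hdc.2.1; rw [ori_ux_pt] at this
        exact pos_of_mul_pos_left this h.wpos.le
      rcases d1 with d1 | d1 | d1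
      · have := hmax _ ((hDm _).2 ⟨b1, d1⟩)
        rw [ori_ux_pt, ori_ux_pt] at this
        have h0 := h.wpos
        have := le_of_mul_le_mul_right this h0
        linarith
      · have : pt u w t1 = pt u w 0 := by rw [d1, pt_zero]
        have := pt_inj h.uw_ne this
        linarith
      · refine ⟨Or.inl ?_, by change ori u w (nx (nx u)) = 0; rw [← d1, ori_pt]; simp⟩
        rcases c1 with c1 | c1
        · exfalso
          have := h.inj _ hdA x hxA (by rw [c1, d1])
          exact hxc (this ▸ hdc)
        · rw [d1] at c1
          change nx (nx (nx u)) ∈ D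
          rw [c1]; exact hd
    · have hDe : ∀ q ∈ A, ¬ OnChord nx u w q := fun q hq hc => hDe ⟨q, (hDm q).2 ⟨hq, hc⟩⟩
      have hyo : y ∈ openSegment ℝ p (nx p) := by
        rcases mem_segment_cases hyp with e | e | e
        · exact absurd (e ▸ hy) (hDe p hp)
        · exact absurd (e ▸ hy) (hDe _ (h.maps p hp))
        · exact e
      obtain ⟨g1, g2⟩ := tangent (fun z hz a b => (h.edge_avoid hp hz a b).2.2) hyo hy
      have l1 := h.locate hp hyp rfl hy hyp hp g1
      have l2 := h.locate hp (by rwa [segment_symm]) (openSegment_symm ℝ _ _) hy hyp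
        (h.maps p hp) g2
      have e1 : p = v := (l1.resolve_left (hDe p hp)).resolve_left hpu
      have e2 := l2.resolve_left (hDe _ (h.maps p hp))
      rw [e1] at e2 g1
      refine ⟨Or.inr (e2.resolve_right (h.ne v hvA)), g1⟩
  obtain ⟨hnv, hgv⟩ := hmain
  have hB : insert u (insert x (insert v D)) = A := by
    apply h.trans
    · intro q hq
      simp only [Finset.mem_insert] at hq
      rcases hq with rfl | rfl | rfl | hq
      · exact h.memA
      · exact hxA
      · exact hvA
      · exact ((hDm q).1 hq).1
    · exact ⟨u, by simp⟩
    · intro q hq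
      simp only [Finset.mem_insert] at hq ⊢
      rcases hq with e | e | e | hq
      · rw [e]; tauto
      · rw [e]; tauto
      · rw [e]; tauto
      · have := hDn q hq; tauto
  have hline : ∀ q ∈ A, q ≠ x → ori u w q = 0 := by
    intro q hq hqx
    rw [← hB] at hq
    simp only [Finset.mem_insert] at hq
    rcases hq with e | e | e | hq
    · rw [e]; simp
    · exact absurd e hqx
    · rw [e]; exact hgv
    · exact ((hDm q).1 hq).2.1
  have hT : ∀ q ∈ A, q ∈ tri u x v := by
    intro q hq
    rw [← hB] at hq
    simp only [Finset.mem_insert] at hq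
    rcases hq with e | e | e | hq
    · rw [e]; exact left_mem_tri h.turn.le
    · rw [e]; exact mid_mem_tri h.turn.le
    · rw [e]; exact right_mem_tri h.turn.le
    · have hc := ((hDm q).1 hq).2
      exact h.memT hc.2.1.le hc.2.2.le hc.1.le
  obtain ⟨n1, n2, n3⟩ := ne_of_ori_ne h.turn.ne'
  -- All vertices except `x` lie on the line `u w`. An endpoint in `G` lies in the triangle, which
  -- is on one side of that line because `v` is on it, and by tangency on the other side. So all
  -- endpoints would be collinear.
  obtain ⟨z, hz, hz0⟩ := hnc u w h.uw_ne
  rcases h.cover z hz with hzG | hzA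
  · have zT : z ∈ tri u x v :=
      ⟨h.ori_nonneg_of_vertices n1 (fun q hq => (hT q hq).1) hzG,
       h.ori_nonneg_of_vertices n2 (fun q hq => (hT q hq).2.1) hzG,
       h.ori_nonneg_of_vertices n3.symm (fun q hq => (hT q hq).2.2) hzG⟩
    have h1 := h.tang z (Or.inr hz) zT (fun e => h.xV (e ▸ hz))
    obtain ⟨t, ht⟩ := h.eq_pt hgv
    have ht0 : 0 < t := by
      have h0 := h.turn
      change 0 < ori u x v at h0
      rw [ht, ori_ux_pt] at h0
      exact pos_of_mul_pos_left h0 h.wpos.le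
    have h2 := zT.2.2
    rw [ori_swap, ht, ori_pt_mid] at h2
    apply hz0
    nlinarith
  · exact hz0 (hline z hzA (fun e => h.xV (by rw [← hx, ← e]; exact hz)))

theorem chord_of_mem {y : Plane} (hy : y ∈ tri u (nx u) w)
    (h0 : 0 < ori u (nx u) y) (h2 : 0 < ori (nx u) (nx (nx u)) y) :
    ori u w y < 0 ∨ OnChord nx u w y := by
  have := hy.2.2
  rw [ori_swap] at this
  rcases (show ori u w y ≤ 0 by linarith).lt_or_eq with e | e
  · exact Or.inl e
  · exact Or.inr ⟨e, h0, h2⟩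

/-- A segment in the region that meets the removed triangle is its third side. -/
theorem seg_cases (h : Sweep V Sg nx A G u w) {a b m : Plane} (hab : Sg a b)
    (hG : openSegment ℝ a b ⊆ G) (hw : w ∉ openSegment ℝ a b) (hm : m ∈ openSegment ℝ a b)
    (hmT : m ∈ tri u (nx u) w) (h2 : 0 < ori (nx u) (nx (nx u)) m) :
    (a = u ∧ b = w) ∨ (a = w ∧ b = u) := by
  have hms := openSegment_subset_segment ℝ _ _ hm
  have h0 : 0 < ori u (nx u) m := by
    rcases hmT.1.eq_or_lt with e | e
    · exact absurd (mem_segment_of_tri h.wpos hmT e.symm)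
        (fun hh => (h.disj u h.memA).le_bot ⟨hG hm, hh⟩)
    · exact e
  rcases chord_of_mem hmT h0 h2 with e | hc
  · exact absurd (h.seg_avoid hab hms h0 h2) (not_le.2 e)
  -- The segment is collinear with the chord and overlaps it between `u` and `w`. Its ends are not
  -- strictly between `u` and `w`, and neither `u` nor `w` is inside it, so it joins `u` and `w`.
  obtain ⟨ga, gb⟩ := tangent (fun y hy a b => h.seg_avoid hab hy a b) hm hc
  have hmw := mem_segment_of_tri₃ h.wpos hmT (by rw [ori_swap, hc.1, neg_zero])
  have huG : u ∉ openSegment ℝ a b := fun hh => h.notMem_of_vertex h.memA (hG hh)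
  have na := h.near a (Or.inr (h.sys.mem hab))
  have nb := h.near b (Or.inr (h.sys.mem' hab))
  obtain ⟨tm, m0, m1, em⟩ := mem_segment_pt.1 hmw
  have m0 : 0 < tm := m0.lt_of_ne (by
    rintro rfl; rw [pt_zero] at em; exact huG (em ▸ hm))
  have m1 : tm < 1 := m1.lt_of_ne (by
    rintro rfl; rw [pt_one] at em; exact hw (em ▸ hm))
  obtain ⟨ta, ea⟩ := h.eq_pt ga
  obtain ⟨tb, eb⟩ := h.eq_pt gb
  have hu0 : u = pt u w 0 := (pt_zero u w).symm
  have hw0 : w = pt u w 1 := (pt_one u w).symm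
  have key : ∀ s : ℝ, pt u w s ∉ openSegment ℝ u w → ¬ (0 < s ∧ s < 1) := fun s hs hh =>
    hs (pt_mem_openSegment hh.1 hh.2)
  rw [ea] at na
  rw [eb] at nb
  have na := key _ na
  have nb := key _ nb
  rw [ea, eb] at huG hw
  rw [em, ea, eb] at hm
  have b1 : ta < tb → ¬ (ta < 0 ∧ 0 < tb) ∧ ¬ (ta < 1 ∧ 1 < tb) := fun _ =>
    ⟨fun hh => huG (by have := pt_between (p := u) (q := w) hh.1 hh.2; rwa [pt_zero] at this),
     fun hh => hw (by have := pt_between (p := u) (q := w) hh.1 hh.2; rwa [pt_one] at this)⟩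
  have b2 : tb < ta → ¬ (tb < 0 ∧ 0 < ta) ∧ ¬ (tb < 1 ∧ 1 < ta) := fun _ =>
    ⟨fun hh => huG (by
      rw [openSegment_symm]
      have := pt_between (p := u) (q := w) hh.1 hh.2; rwa [pt_zero] at this),
     fun hh => hw (by
      rw [openSegment_symm]
      have := pt_between (p := u) (q := w) hh.1 hh.2; rwa [pt_one] at this)⟩
  rcases between_of_mem h.uw_ne hm with ⟨c1, c2⟩ | ⟨c1, c2⟩ | ⟨c1, c2⟩
  · have := b1 (c1.trans c2)
    have e1 : ta = 0 := by
      by_contra hne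
      rcases lt_or_gt_of_ne hne with g | g
      · exact this.1 ⟨g, by linarith⟩
      · exact na ⟨g, by linarith⟩
    have e2 : tb = 1 := by
      by_contra hne
      rcases lt_or_gt_of_ne hne with g | g
      · exact nb ⟨by linarith, g⟩
      · exact this.2 ⟨by linarith, g⟩
    left; rw [ea, eb, e1, e2, pt_zero, pt_one]; exact ⟨rfl, rfl⟩
  · have := b2 (c1.trans c2)
    have e1 : tb = 0 := by
      by_contra hne
      rcases lt_or_gt_of_ne hne with g | g
      · exact this.1 ⟨g, by linarith⟩
      · exact nb ⟨g, by linarith⟩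
    have e2 : ta = 1 := by
      by_contra hne
      rcases lt_or_gt_of_ne hne with g | g
      · exact na ⟨by linarith, g⟩
      · exact this.2 ⟨by linarith, g⟩
    right; rw [ea, eb, e1, e2, pt_zero, pt_one]; exact ⟨rfl, rfl⟩
  · exact absurd ⟨by rw [c1]; exact m0, by rw [c1]; exact m1⟩ na

end Sweep

/-! ### Removal of the auxiliary vertices by convex chains -/

/-- Near a vertex `w` of a convex chain `u w w₁` cut off from the corner `x`. -/
theorem blocked_of_tri {G : Set Plane} {u x w w₁ : Plane} (h1 : 0 < ori u x w)
    (h2 : 0 < ori w x w₁) (h3 : 0 ≤ ori u w w₁) (d1 : Disjoint (tri u x w) G)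
    (d2 : Disjoint (tri w x w₁) G) : ∀ᶠ m in 𝓝 w, ori u w m ≤ 0 → m ∉ G := by
  have h2' : 0 < ori x w₁ w := by rwa [← ori_rot]
  filter_upwards [eventually_ori_pos h1, eventually_ori_pos h2'] with m a b hle hmG
  -- The line `x w` separates the two removed triangles, and each covers its part of the half disc
  -- at `w`; for the second one this uses that `u w w₁` is not a right turn.
  rcases le_or_gt 0 (ori x w m) with c | c
  · exact d1.le_bot ⟨⟨a.le, c, by rw [ori_swap]; linarith⟩, hmG⟩
  · have c' : 0 < ori w x m := by rw [ori_swap]; linarith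
    refine d2.le_bot ⟨⟨c'.le, b.le, ?_⟩, hmG⟩
    have e : ori u x w * ori w₁ w m = -(ori u w m) * ori w x w₁ + ori u w w₁ * ori w x m := by
      simp only [ori]; ring
    have : 0 ≤ ori u x w * ori w₁ w m := by
      rw [e]
      have := mul_nonneg (show 0 ≤ -ori u w m by linarith) h2.le
      have := mul_nonneg h3 c'.le
      linarith
    exact nonneg_of_mul_nonneg_right this h1

/-- The endpoints and vertices in the triangle of a corner, other than its corners. -/
noncomputable def inCorner (V A : Finset Plane) (u x v : Plane) : Finset Plane :=
  (A ∪ V).filter fun p => p ∈ tri u x v ∧ p ≠ u ∧ p ≠ x ∧ p ≠ v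

theorem mem_inCorner {V A : Finset Plane} {u x v p : Plane} :
    p ∈ inCorner V A u x v ↔ (p ∈ A ∨ p ∈ V) ∧ p ∈ tri u x v ∧ p ≠ u ∧ p ≠ x ∧ p ≠ v := by
  simp [inCorner]

/-- The tangent point from `u`. -/
theorem exists_tangent {W : Finset Plane} (hW : W.Nonempty) {u x v : Plane} (ho : 0 < ori u x v)
    (h1 : ∀ p ∈ W, 0 < ori u x p) :
    ∃ w ∈ W, (∀ p ∈ W, 0 ≤ ori u w p) ∧ ∀ p ∈ W, p ∉ openSegment ℝ u w := by
  -- This quotient decreases with the angle from `u x`, so its maximum is attained at a point first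
  -- met by a ray turning around `u` from `x` towards `v`.
  obtain ⟨w, hw, hmax⟩ := W.exists_max_image (fun p => ori v u p / ori u x p) hW
  have ht : ∀ p ∈ W, 0 ≤ ori u w p := by
    intro p hp
    have e := ori_plucker u x v w p
    have := hmax p hp
    rw [div_le_div_iff₀ (h1 p hp) (h1 w hw)] at this
    rw [← ori_rot v u w, ori_swap u v p] at e
    have : 0 ≤ ori u w p * ori u x v := by rw [e]; nlinarith
    exact nonneg_of_mul_nonneg_left this ho
  have huw : u ≠ w := (ne_of_ori_ne (h1 w hw).ne').2.2
  -- Among the points on this first ray, take the one nearest to `u`.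
  obtain ⟨w', hw', hmin⟩ := (W.filter fun p => ori u w p = 0).exists_min_image
    (fun p => ori u x p) ⟨w, by simp [hw]⟩
  obtain ⟨hw', h0⟩ := Finset.mem_filter.1 hw'
  obtain ⟨t, ht'⟩ := mem_line_of_ori_eq_zero huw h0
  have t0 : 0 < t := by
    have := h1 w' hw'
    rw [ht', ori_pt] at this
    simp only [ori_self_left, mul_zero, zero_add] at this
    exact pos_of_mul_pos_left this (h1 w hw).le
  refine ⟨w', hw', fun p hp => ?_, fun p hp hpo => ?_⟩
  · rw [ht', ori_pt_mid]; exact mul_nonneg t0.le (ht p hp)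
  · obtain ⟨s, s0, s1, es⟩ := mem_openSegment_pt.1 hpo
    have hp0 : ori u w p = 0 := by rw [es, ht', pt_pt, ori_pt]; simp
    have := hmin p (Finset.mem_filter.2 ⟨hp, hp0⟩)
    rw [es, ori_pt] at this
    simp only [ori_self_left, mul_zero, zero_add] at this
    nlinarith [h1 w' hw']

namespace St
variable {V : Finset Plane} {Sg : Plane → Plane → Prop} {nx : Plane → Plane} {A : Finset Plane}
  {G : Set Plane}

/-- A point of `V` on an edge is not in `G`, hence a vertex, and the only vertices on an edge are
its ends. So no such point lies on the two edges of the corner. -/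
theorem inCorner_pos (h : St V Sg nx A G) {u p : Plane} (hu : u ∈ A)
    (ho : 0 < ori u (nx u) (nx (nx u))) (hp : p ∈ inCorner V A u (nx u) (nx (nx u))) :
    0 < ori u (nx u) p ∧ 0 < ori (nx u) (nx (nx u)) p := by
  obtain ⟨hm, hT, n1, n2, n3⟩ := mem_inCorner.1 hp
  have hxA := h.maps u hu
  have hA : ∀ q ∈ A, p ∈ segment ℝ q (nx q) → p ∈ A := by
    intro q hq hpq
    rcases hm with e | e
    · exact e
    · exact (h.cover p e).resolve_left fun hG => (h.disj q hq).le_bot ⟨hG, hpq⟩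
  constructor
  · refine hT.1.lt_of_ne fun e => ?_
    have := mem_segment_of_tri ho hT e.symm
    rcases h.eq_or_of_vertex_mem hu (hA u hu this) this with e | e
    · exact n1 e
    · exact n2 e
  · refine hT.2.1.lt_of_ne fun e => ?_
    have := mem_segment_of_tri₂ ho hT e.symm
    rcases h.eq_or_of_vertex_mem hxA (hA _ hxA this) this with e | e
    · exact n2 e
    · exact n3 e

/-- Removing a convex auxiliary vertex by shrinking the region around the points in its corner. -/
theorem sweep (hS : SegSys V Sg) (hnc : ∀ p q : Plane, p ≠ q → ∃ y ∈ V, ori p q y ≠ 0)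
    (n : ℕ) : ∀ (nx : Plane → Plane) (A : Finset Plane) (G : Set Plane) (u : Plane),
    St V Sg nx A G → u ∈ A → nx u ∉ V → 0 < ori u (nx u) (nx (nx u)) →
    (∀ y ∈ A, y ∈ tri u (nx u) (nx (nx u)) → y ≠ u → ¬ HalfFree (G \ segUnion Sg) G y) →
    (inCorner V A u (nx u) (nx (nx u))).card ≤ n →
    ∃ nx' A' G', St V Sg nx' A' G' ∧ G' ⊆ G ∧ A.erase (nx u) ⊆ A' ∧ A' ⊆ A.erase (nx u) ∪ V ∧
      (∀ y ∈ A', y ∉ A → ¬ HalfFree (G' \ segUnion Sg) G' y) ∧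
      ∃ w₁, (w₁ ∈ A ∨ w₁ ∈ V) ∧ w₁ ∈ tri u (nx u) (nx (nx u)) ∧ 0 < ori u (nx u) w₁ ∧
        Disjoint (tri u (nx u) w₁) G' := by
  induction n with
  | zero =>
    intro nx A G u h hu hxV ho hAP hcard
    have hW : ∀ p, (p ∈ A ∨ p ∈ V) → p ∈ tri u (nx u) (nx (nx u)) →
        p = u ∨ p = nx u ∨ p = nx (nx u) := by
      intro p hp hpT
      by_contra hc
      push Not at hc
      have : p ∈ inCorner V A u (nx u) (nx (nx u)) := mem_inCorner.2 ⟨hp, hpT, hc⟩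
      rw [Finset.card_eq_zero.1 (Nat.le_zero.1 hcard)] at this
      simp at this
    obtain ⟨n1, n2, n3⟩ := ne_of_ori_ne ho.ne'
    have hxA := h.maps u hu
    have hvA := h.maps _ hxA
    have hsw : Sweep V Sg nx A G u (nx (nx u)) := by
      refine ⟨h, hS, hu, hxV, ho, ho, right_mem_tri ho.le, fun p hp hpT hpx => ?_,
        fun p hp hpo => ?_⟩
      · rcases hW p hp hpT with rfl | rfl | rfl
        · simp
        · exact absurd rfl hpx
        · simp
      · have hpT := (segment_subset_tri ho.le).2.2 (openSegment_subset_segment ℝ _ _ hpo)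
        rcases hW p hp hpT with e | e | e
        · exact left_notMem_openSegment n3 (e ▸ hpo)
        · obtain ⟨t, t0, -, et⟩ := mem_openSegment_pt.1 hpo
          have := congrArg (ori u (nx u)) et
          rw [e, Sweep.ori_ux_pt, ori_self_right] at this
          nlinarith
        · exact right_notMem_openSegment n3 (e ▸ hpo)
    have hpos : ∀ y ∈ tri u (nx u) (nx (nx u)),
        y ∉ segment ℝ u (nx u) ∪ segment ℝ (nx u) (nx (nx u)) →
        0 < ori u (nx u) y ∧ 0 < ori (nx u) (nx (nx u)) y := by
      intro y hy hn
      exact ⟨hy.1.lt_of_ne fun e => hn (Or.inl (mem_segment_of_tri ho hy e.symm)),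
        hy.2.1.lt_of_ne fun e => hn (Or.inr (mem_segment_of_tri₂ ho hy e.symm))⟩
    have hGn : ∀ y ∈ G, y ∉ segment ℝ u (nx u) ∪ segment ℝ (nx u) (nx (nx u)) := by
      rintro y hy (hh | hh)
      · exact (h.disj u hu).le_bot ⟨hy, hh⟩
      · exact (h.disj _ hxA).le_bot ⟨hy, hh⟩
    -- The corner is empty, so its two edges are replaced by the chord, with the third corner as the
    -- next chain vertex.
    refine ⟨_, _, _, h.delete hS hu hxV ho ?_ ?_ ?_, sdiff_subset, Finset.Subset.refl _,
      Finset.subset_union_left, fun y hy hyA => absurd (Finset.mem_of_mem_erase hy) hyA,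
      nx (nx u), Or.inl hvA, right_mem_tri ho.le, ho, disjoint_sdiff_right⟩
    · rintro y ⟨hy, hn⟩
      obtain ⟨a, b⟩ := hpos y hy hn
      rcases Sweep.chord_of_mem hy a b with e | e
      · exact (hsw.free a b e).1
      · exact hsw.chord_free hnc hAP e
    · intro y hy hyG hyT
      rcases hW y (Or.inr hy) hyT with rfl | rfl | rfl
      · exact h.notMem_of_vertex hu hyG
      · exact h.notMem_of_vertex hxA hyG
      · exact h.notMem_of_vertex hvA hyG
    · intro a b hab hG
      by_cases hd : Disjoint (openSegment ℝ a b) (tri u (nx u) (nx (nx u)))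
      · exact Or.inl hd
      · right
        obtain ⟨m, hm, hmT⟩ := Set.not_disjoint_iff.1 hd
        exact hsw.seg_cases hab hG (fun hh => h.notMem_of_vertex hvA (hG hh)) hm hmT
          (hpos m hmT (hGn m (hG hm))).2
  | succ n ih =>
    intro nx A G u h hu hxV ho hAP hcard
    by_cases hW : (inCorner V A u (nx u) (nx (nx u))).Nonempty
    swap
    · refine ih nx A G u h hu hxV ho hAP ?_
      rw [Finset.not_nonempty_iff_eq_empty.1 hW]; simp
    obtain ⟨w, hw, htang, hnear⟩ := exists_tangent hW ho
      (fun p hp => (h.inCorner_pos hu ho hp).1)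
    obtain ⟨w1, w2⟩ := h.inCorner_pos hu ho hw
    obtain ⟨hwm, hwT, nwu, nwx, nwv⟩ := mem_inCorner.1 hw
    obtain ⟨n1, n2, n3⟩ := ne_of_ori_ne ho.ne'
    have hxA := h.maps u hu
    have hvA := h.maps _ hxA
    have huT := left_mem_tri ho.le
    have hsw : Sweep V Sg nx A G u w := by
      refine ⟨h, hS, hu, hxV, ho, w1, hwT, fun p hp hpT hpx => ?_, fun p hp hpo => ?_⟩
      · by_cases hpu : p = u
        · rw [hpu]; simp
        by_cases hpv : p = nx (nx u)
        · rw [hpv, ← ori_rot]; exact hwT.2.2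
        · exact htang p (mem_inCorner.2 ⟨hp, hpT, hpu, hpx, hpv⟩)
      · have hpT := (convex_tri _ _ _).segment_subset huT hwT
          (openSegment_subset_segment ℝ _ _ hpo)
        obtain ⟨t, t0, t1, et⟩ := mem_openSegment_pt.1 hpo
        refine hnear p (mem_inCorner.2 ⟨hp, hpT, fun e => left_notMem_openSegment nwu.symm (e ▸ hpo),
          fun e => ?_, fun e => ?_⟩) hpo
        · have := congrArg (ori u (nx u)) et
          rw [e, Sweep.ori_ux_pt, ori_self_right] at this
          nlinarith
        · have := congrArg (ori (nx u) (nx (nx u))) et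
          rw [e, ori_pt, ori_self_right, ← ori_rot] at this
          nlinarith
    have hchord := fun {y} => hsw.chord_free hnc hAP (y := y)
    have hwc : Sweep.OnChord nx u w w := ⟨by simp, w1, w2⟩
    have hwG : w ∈ G := hchord hwc
    have hwA : w ∉ A := fun hA => h.notMem_of_vertex hA hwG
    have hwV : w ∈ V := hwm.resolve_left hwA
    have hpos2 : ∀ y ∈ tri u (nx u) w, 0 < ori u (nx u) y → 0 < ori (nx u) (nx (nx u)) y := by
      intro y hy h0
      have e : ori (nx u) (nx (nx u)) y * ori u (nx u) w = ori (nx u) w y *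
          ori u (nx u) (nx (nx u)) + ori u (nx u) y * ori (nx u) (nx (nx u)) w := by
        simp only [ori]; ring
      have : 0 < ori (nx u) (nx (nx u)) y * ori u (nx u) w := by
        rw [e]
        have := mul_nonneg hy.2.1 ho.le
        have := mul_pos h0 w2
        linarith
      exact pos_of_mul_pos_left this w1.le
    have hTG : tri u (nx u) w \ segment ℝ u (nx u) ⊆ G := by
      rintro y ⟨hy, hn⟩
      have a := hy.1.lt_of_ne fun e => hn (mem_segment_of_tri w1 hy e.symm)
      rcases Sweep.chord_of_mem hy a (hpos2 y hy a) with e | e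
      · exact (hsw.free a (hpos2 y hy a) e).1
      · exact hchord e
    have hposG : ∀ y ∈ G, y ∈ tri u (nx u) w → 0 < ori u (nx u) y := fun y hyG hy =>
      hy.1.lt_of_ne fun e => (h.disj u hu).le_bot ⟨hyG, mem_segment_of_tri w1 hy e.symm⟩
    -- Cut off the triangle up to the tangent point; the remaining corner at `nx u` starts at `w`
    -- and contains fewer points.
    have h1 : St V Sg (insNext nx u w) (Insert.insert w A) (G \ tri u (nx u) w) := by
      refine h.insert hS hu hwA w1 hTG (fun hs => hxV (hS.mem' hs)) ?_ ?_
      · intro y hyV hyG hyT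
        have a := hposG y hyG hyT
        rcases Sweep.chord_of_mem hyT a (hpos2 y hyT a) with e | e
        · exact absurd (hS.mem_segUnion hyV) (hsw.free a (hpos2 y hyT a) e).2
        · have hm := mem_segment_of_tri₃ w1 hyT (by rw [ori_swap, e.1, neg_zero])
          rcases mem_segment_cases hm with e' | e' | e'
          · exact absurd (e' ▸ hyG) (h.notMem_of_vertex hu)
          · exact e'
          · exact absurd e' (hsw.near y (Or.inr hyV))
      · intro a b hab hG
        by_cases hd : Disjoint (openSegment ℝ a b) (tri u (nx u) w)
        · exact Or.inl hd
        · right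
          obtain ⟨m, hm, hmT⟩ := Set.not_disjoint_iff.1 hd
          rcases hsw.seg_cases hab hG (hS.notMem_open hab hwV) hm hmT
            (hpos2 m hmT (hposG m (hG hm) hmT)) with e | e
          · exact Or.inl e
          · exact Or.inr (Or.inl e)
    have ew : insNext nx u w w = nx u := insNext_new nx u w
    have ex : insNext nx u w (nx u) = nx (nx u) := insNext_of_ne nx nwx.symm n1.symm
    have ho' : 0 < ori w (nx u) (nx (nx u)) := by rw [ori_rot]; exact w2
    have hsub : tri w (nx u) (nx (nx u)) ⊆ tri u (nx u) (nx (nx u)) :=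
      tri_subset_of_convex ho' (convex_tri _ _ _) hwT (mid_mem_tri ho.le) (right_mem_tri ho.le)
    have hun : u ∉ tri w (nx u) (nx (nx u)) := by
      intro hh
      have := hh.1
      rw [← ori_rot, ori_swap'] at this; linarith
    obtain ⟨nx', A', G', h2, g1, g2, g3, g4, w₁, m1, m2, m3, m4⟩ := ih (insNext nx u w)
      (Insert.insert w A) (G \ tri u (nx u) w) w h1 (Finset.mem_insert_self _ _)
      (by rw [ew]; exact hxV) (by rw [ew, ex]; exact ho')
      (by
        rw [ew, ex]
        -- The first vertex of a corner is exempt from the hypothesis on half free points. This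
        -- covers the new vertex `w`, while the old first vertex `u` lies outside the smaller
        -- triangle.
        intro y hy hyT hyw hH
        refine hAP y ((Finset.mem_insert.1 hy).resolve_left hyw) (hsub hyT) ?_
          (hH.mono (sdiff_subset_sdiff_left sdiff_subset) sdiff_subset)
        rintro rfl; exact hun hyT)
      (by
        rw [ew, ex]
        have hlt : (inCorner V (Insert.insert w A) w (nx u) (nx (nx u))).card <
            (inCorner V A u (nx u) (nx (nx u))).card := by
          apply Finset.card_lt_card
          refine Finset.ssubset_iff_of_subset ?_ |>.2 ⟨w, hw, ?_⟩
          · intro p hp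
            obtain ⟨a, b, c, d, e⟩ := mem_inCorner.1 hp
            refine mem_inCorner.2 ⟨?_, hsub b, ?_, d, e⟩
            · rcases a with a | a
              · exact Or.inl ((Finset.mem_insert.1 a).resolve_left c)
              · exact Or.inr a
            · rintro rfl; exact hun b
          · intro hp; exact (mem_inCorner.1 hp).2.2.1 rfl
        omega)
    rw [ew] at g2 g3 m2 m3 m4
    rw [ex] at m2
    have hA'1 : A.erase (nx u) ⊆ A' := fun p hp => g2 (by
      obtain ⟨a, b⟩ := Finset.mem_erase.1 hp
      exact Finset.mem_erase.2 ⟨a, Finset.mem_insert_of_mem b⟩)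
    refine ⟨nx', A', G', h2, g1.trans sdiff_subset, hA'1, ?_, ?_, w, Or.inr hwV, hwT, w1, ?_⟩
    · intro p hp
      rcases Finset.mem_union.1 (g3 hp) with e | e
      · obtain ⟨a, b⟩ := Finset.mem_erase.1 e
        rcases Finset.mem_insert.1 b with rfl | b
        · exact Finset.mem_union_right _ hwV
        · exact Finset.mem_union_left _ (Finset.mem_erase.2 ⟨a, b⟩)
      · exact Finset.mem_union_right _ e
    · intro y hy hyA
      by_cases hyw : y = w
      -- The induction hypothesis exports the vertex `w₁` following `w` on the chain. The triangles
      -- cut off on both sides of `w` then block a closed half disc at `w`.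
      · rw [hyw]
        have nw1 : w₁ ≠ w := by rintro rfl; simp at m3
        have nw1x : w₁ ≠ nx u := by rintro rfl; simp at m3
        have er : ∀ m, ori w (pt u w 2) m = ori u w m := fun m => by
          have := ori_pt_pt u w m 1 2
          rw [pt_one] at this; rw [this]; ring
        refine not_halfFree_of_blocked (r := pt u w 2) sdiff_subset ?_
        simp only [er]
        refine blocked_of_tri w1 m3 ?_ ?_ m4
        · refine hsw.tang w₁ ?_ (hsub m2) nw1x
          exact m1.imp (fun e => (Finset.mem_insert.1 e).resolve_left nw1) id
        · exact Set.disjoint_left.2 fun z hz hzG => (g1 hzG).2 hz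
      · exact g4 y hy fun e => hyA ((Finset.mem_insert.1 e).resolve_left hyw)
    · exact Set.disjoint_left.2 fun z hz hzG => (g1 hzG).2 hz

end St

namespace St
variable {V : Finset Plane} {Sg : Plane → Plane → Prop} {nx : Plane → Plane} {A : Finset Plane}
  {G : Set Plane}

/-- All auxiliary vertices can be removed. -/
theorem cutAll (hS : SegSys V Sg) (hnc : ∀ p q : Plane, p ≠ q → ∃ y ∈ V, ori p q y ≠ 0)
    (n : ℕ) : ∀ (nx : Plane → Plane) (A : Finset Plane) (G : Set Plane),
    St V Sg nx A G → (∀ y ∈ A, ¬ HalfFree (G \ segUnion Sg) G y) →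
    (∀ y ∈ A, y ∉ V → ConvexCorner G y) → (A \ V).card ≤ n →
    ∃ nx' A' G', St V Sg nx' A' G' ∧ G' ⊆ G ∧ A' ⊆ V ∧ A ∩ V ⊆ A' ∧
      ∀ y ∈ A', ¬ HalfFree (G' \ segUnion Sg) G' y := by
  induction n with
  | zero =>
    intro nx A G h hAP _ hc
    refine ⟨nx, A, G, h, Subset.rfl, ?_, Finset.inter_subset_left, hAP⟩
    exact Finset.sdiff_eq_empty_iff_subset.1 (Finset.card_eq_zero.1 (Nat.le_zero.1 hc))
  | succ n ih =>
    intro nx A G h hAP hCC hc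
    by_cases he : (A \ V).Nonempty
    swap
    · refine ih nx A G h hAP hCC ?_
      rw [Finset.not_nonempty_iff_eq_empty.1 he]; simp
    obtain ⟨x, hx⟩ := he
    obtain ⟨hxA, hxV⟩ := Finset.mem_sdiff.1 hx
    obtain ⟨u, hu, rfl⟩ := h.exists_prev hxA
    have ho := h.ori_pos_of_convexCorner hu (hCC _ hxA hxV)
    -- Only endpoints enter as new vertices, so the number of auxiliary ones drops; the others
    -- remain convex corners because the region shrinks.
    obtain ⟨nx', A', G', h', g1, g2, g3, g4, -⟩ := sweep hS hnc _ nx A G u h hu hxV ho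
      (fun y hy _ _ => hAP y hy) le_rfl
    have hnew : ∀ y ∈ A', y ∉ V → y ∈ A.erase (nx u) := fun y hy hyV =>
      (Finset.mem_union.1 (g3 hy)).resolve_right hyV
    obtain ⟨nx₂, A₂, G₂, h₂, k1, k2, k3, k4⟩ := ih nx' A' G' h' (fun y hy => by
        by_cases hyA : y ∈ A
        · exact fun hH => hAP y hyA (hH.mono (sdiff_subset_sdiff_left g1) g1)
        · exact g4 y hy hyA)
      (fun y hy hyV => (hCC y (Finset.mem_of_mem_erase (hnew y hy hyV)) hyV).mono g1)
      (by
        have : (A' \ V).card < (A \ V).card := by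
          apply Finset.card_lt_card
          refine (Finset.ssubset_iff_of_subset ?_).2 ⟨nx u, hx, ?_⟩
          · intro y hy
            obtain ⟨a, b⟩ := Finset.mem_sdiff.1 hy
            exact Finset.mem_sdiff.2 ⟨Finset.mem_of_mem_erase (hnew y a b), b⟩
          · intro hh
            obtain ⟨a, b⟩ := Finset.mem_sdiff.1 hh
            exact (Finset.mem_erase.1 (hnew _ a b)).1 rfl
        omega)
    refine ⟨nx₂, A₂, G₂, h₂, k1.trans g1, k2, fun y hy => ?_, k4⟩
    obtain ⟨a, b⟩ := Finset.mem_inter.1 hy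
    exact k3 (Finset.mem_inter.2 ⟨g2 (Finset.mem_erase.2 ⟨fun e => hxV (e ▸ b), a⟩), b⟩)

end St

/-! ### Thin wedges from an edge to an endpoint -/

/-- If the points in direction `d` are not in `F`, then `d` is not in the free half plane. -/
theorem ori_nonpos_of_halfFree {F : Set Plane} {z r d : Plane} {s : ℝ}
    (h : ∀ᶠ m in 𝓝 z, 0 < s * ori z r m → m ∈ F)
    (hd : ∀ t : ℝ, 0 < t → t < 1 → pt z d t ∉ F) : s * ori z r d ≤ 0 := by
  by_contra hc
  obtain ⟨t, t0, t1, ht⟩ := exists_pt_of_eventually d h one_pos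
  refine hd t t0 t1 (ht ?_)
  rw [ori_pt]
  simp only [ori_self_left, mul_zero, zero_add]
  have := mul_pos t0 (not_le.1 hc)
  linarith

/-- The points `z'`, `x₁`, `x₂` all lie in the closed half plane opposite to a free half disc at
`z`. As `z` is between `z'` and `x`, and `x` between `x₁` and `x₂`, all of them lie on its bounding
line, although `x₁ x₂ z` is a proper triangle. -/
theorem not_halfFree_wedge {F G : Set Plane} {z z' x x₁ x₂ : Plane}
    (ho : 0 < ori x₁ x₂ z) (hx : x ∈ openSegment ℝ x₁ x₂) (hz : z ∈ openSegment ℝ z' x)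
    (hz' : Disjoint (segment ℝ z' z) F) (hT : Disjoint (tri x₁ x₂ z) F) : ¬ HalfFree F G z := by
  rintro ⟨r, hr, s, hs, h1, -⟩
  have hsub := segment_subset_tri ho.le
  have d1 := ori_nonpos_of_halfFree h1 (d := z') fun t t0 t1 hh =>
    hz'.le_bot ⟨segment_symm ℝ z z' ▸ pt_mem_segment t0.le t1.le, hh⟩
  have d2 := ori_nonpos_of_halfFree h1 (d := x₁) fun t t0 t1 hh =>
    hT.le_bot ⟨hsub.2.2 (segment_symm ℝ z x₁ ▸ pt_mem_segment t0.le t1.le), hh⟩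
  have d3 := ori_nonpos_of_halfFree h1 (d := x₂) fun t t0 t1 hh =>
    hT.le_bot ⟨hsub.2.1 (segment_symm ℝ z x₂ ▸ pt_mem_segment t0.le t1.le), hh⟩
  obtain ⟨σ, σ0, σ1, rfl⟩ := mem_openSegment_pt.1 hx
  obtain ⟨τ, τ0, τ1, e⟩ := mem_openSegment_pt.1 hz
  have e0 := congrArg (fun y => s * ori z r y) e
  simp only [ori_self_left, mul_zero, ori_pt] at e0
  have a1 : (1 - τ) * (s * ori z r z') ≤ 0 := mul_nonpos_of_nonneg_of_nonpos (by linarith) d1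
  have a2 : (1 - σ) * (s * ori z r x₁) ≤ 0 := mul_nonpos_of_nonneg_of_nonpos (by linarith) d2
  have a3 : σ * (s * ori z r x₂) ≤ 0 := mul_nonpos_of_nonneg_of_nonpos (by linarith) d3
  have a4 : τ * ((1 - σ) * (s * ori z r x₁) + σ * (s * ori z r x₂)) = -((1 - τ) * (s * ori z r z')) := by
    linarith
  have a5 : 0 ≤ (1 - σ) * (s * ori z r x₁) + σ * (s * ori z r x₂) :=
    nonneg_of_mul_nonneg_right (by linarith) τ0
  have b1 : ori z r x₁ = 0 := by
    have : (1 - σ) * (s * ori z r x₁) = 0 := by linarith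
    rcases mul_eq_zero.1 this with h | h
    · linarith
    · exact (mul_eq_zero.1 h).resolve_left hs
  have b2 : ori z r x₂ = 0 := by
    have : σ * (s * ori z r x₂) = 0 := by linarith
    rcases mul_eq_zero.1 this with h | h
    · linarith
    · exact (mul_eq_zero.1 h).resolve_left hs
  obtain ⟨c1, rfl⟩ := mem_line_of_ori_eq_zero hr.symm b1
  obtain ⟨c2, rfl⟩ := mem_line_of_ori_eq_zero hr.symm b2
  rw [ori_pt_pt] at ho
  simp at ho

/-- A parameter in an interval at which finitely many nonzero affine functions do not vanish. -/
theorem exists_generic_pt (L : Finset (Plane × Plane)) {p q : Plane}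
    (hL : ∀ l ∈ L, ori l.1 l.2 p ≠ 0 ∨ ori l.1 l.2 q ≠ 0) {a b : ℝ} (hab : a < b) :
    ∃ s, a < s ∧ s < b ∧ ∀ l ∈ L, ori l.1 l.2 (pt p q s) ≠ 0 := by
  have hfin : (⋃ l ∈ L, {s : ℝ | ori l.1 l.2 (pt p q s) = 0}).Finite := by
    refine L.finite_toSet.biUnion fun l hl => Set.Subsingleton.finite fun s hs t ht => ?_
    simp only [mem_ofPred_eq, ori_pt] at hs ht
    by_contra hst
    have e : (s - t) * (ori l.1 l.2 q - ori l.1 l.2 p) = 0 := by linarith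
    have e' := (mul_eq_zero.1 e).resolve_left (sub_ne_zero.2 hst)
    have e1 : ori l.1 l.2 q = ori l.1 l.2 p := by linarith
    have e2 : ori l.1 l.2 p = 0 := by rw [e1] at hs; linarith
    rcases hL l hl with h | h
    · exact h e2
    · exact h (e1.trans e2)
  obtain ⟨s, hs, hn⟩ := ((Set.Ioo_infinite hab).sdiff hfin).nonempty
  refine ⟨s, hs.1, hs.2, fun l hl h0 => hn ?_⟩
  simp only [mem_iUnion]
  exact ⟨l, hl, h0⟩

namespace St
variable {V : Finset Plane} {Sg : Plane → Plane → Prop} {nx : Plane → Plane} {A : Finset Plane}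
  {G : Set Plane}

/-- Cutting a thin wedge from an edge to an endpoint along the extension of its segment. -/
theorem wedge (h : St V Sg nx A G) (hS : SegSys V Sg) {z z' p x : Plane} (hzG : z ∈ G)
    (hzz : Sg z z') (hp : p ∈ A) (hx : x ∈ openSegment ℝ p (nx p)) (hxs : x ∉ segUnion Sg)
    (hdir : z ∈ openSegment ℝ z' x) (hzx : openSegment ℝ z x ⊆ G) {F : Set Plane}
    (hFc : IsClosed F) (hF : Disjoint F (segment ℝ z x))
    (hFS : ∀ a b, Sg a b → a ≠ z → b ≠ z → segment ℝ a b ⊆ F) (L : Finset (Plane × Plane))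
    (hL : ∀ l ∈ L, ori l.1 l.2 p ≠ 0 ∨ ori l.1 l.2 (nx p) ≠ 0)
    (hAP : ∀ y ∈ A, ¬ HalfFree (G \ segUnion Sg) G y)
    (hCC : ∀ y ∈ A, y ∉ V → ConvexCorner G y) :
    ∃ nx' A' T, St V Sg nx' A' (G \ T) ∧ IsClosed T ∧ Convex ℝ T ∧ segment ℝ z x ⊆ T ∧
      Disjoint F T ∧ A ⊆ A' ∧ z ∈ A' ∧
      (∀ y ∈ A', y ∈ A ∨ y = z ∨ y ∉ V ∧ ∀ l ∈ L, ori l.1 l.2 y ≠ 0) ∧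
      (∀ y ∈ A', y ∉ V ∨ nx' y ∉ V ∨ (y ∈ A ∧ nx' y = nx y)) ∧
      (∀ y ∈ A', ¬ HalfFree ((G \ T) \ segUnion Sg) (G \ T) y) ∧
      ∀ y ∈ A', y ∉ V → ConvexCorner (G \ T) y := by
  have hpq : p ≠ nx p := (h.ne p hp).symm
  have hqA := h.maps p hp
  have hloc := h.loc p hp x hx
  set q := nx p with hq
  have hzV := hS.mem hzz
  obtain ⟨N, hN, hNo, hxN⟩ := eventually_nhds_iff.1
    (hloc.and (hS.isClosed_segUnion.isOpen_compl.mem_nhds hxs))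
  have hzpos : 0 < ori p q z := by
    obtain ⟨t, t0, t1, ht⟩ := exists_pt_of_eventually z hloc one_pos
    have := ht.1 (hzx (by rw [openSegment_symm]; exact pt_mem_openSegment t0 t1))
    obtain ⟨s, -, -, rfl⟩ := mem_openSegment_pt.1 hx
    rw [ori_pt, ori_pt] at this
    simp only [ori_self_left, ori_self_right, mul_zero, add_zero, zero_add] at this
    exact pos_of_mul_pos_right this t0.le
  have hcomp : IsCompact (segment ℝ z x) := by
    rw [segment_eq_image']; exact isCompact_Icc.image (by fun_prop)
  -- A thin neighbourhood of the segment `z x` misses `F` and lies in `G`, except near `x`, where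
  -- `G` is the left side of the edge.
  obtain ⟨δ, δ0, hδ⟩ := hcomp.exists_thickening_subset_open
    (hFc.isOpen_compl.inter (h.isOpen.union hNo)) (by
      intro y hy
      refine ⟨fun hyF => hF.le_bot ⟨hyF, hy⟩, ?_⟩
      rcases mem_segment_cases hy with rfl | rfl | e
      · exact Or.inl hzG
      · exact Or.inr hxN
      · exact Or.inl (hzx e))
  obtain ⟨s, s0, s1, hs⟩ := mem_openSegment_pt.1 hx
  have hev : ∀ᶠ t in 𝓝 s, pt p q t ∈ Metric.ball x δ ∧ t ∈ Ioo (0:ℝ) 1 := by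
    refine ((continuous_pt p q).continuousAt.eventually ?_).and (Ioo_mem_nhds s0 s1)
    change ∀ᶠ y in 𝓝 (pt p q s), y ∈ Metric.ball x δ
    rw [← hs]; exact Metric.ball_mem_nhds x δ0
  obtain ⟨η, η0, hη⟩ := Metric.eventually_nhds_iff.1 hev
  -- The mouth of the wedge: points of the edge close to `x` on either side, off the lines of `L`.
  obtain ⟨s₁, a1, a2, a3⟩ := exists_generic_pt L hL (show s - η < s by linarith)
  obtain ⟨s₂, b1, b2, b3⟩ := exists_generic_pt L hL (show s < s + η by linarith)
  obtain ⟨c1, c2⟩ := hη (show dist s₁ s < η by rw [Real.dist_eq, abs_lt]; constructor <;> linarith)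
  obtain ⟨d1, d2⟩ := hη (show dist s₂ s < η by rw [Real.dist_eq, abs_lt]; constructor <;> linarith)
  have hx₁ : pt p q s₁ ∈ openSegment ℝ p q := pt_mem_openSegment c2.1 c2.2
  have hx₂ : pt p q s₂ ∈ openSegment ℝ p q := pt_mem_openSegment d2.1 d2.2
  have hxx : x ∈ openSegment ℝ (pt p q s₁) (pt p q s₂) := by rw [hs]; exact pt_between a2 b1
  have hx₂' : pt p q s₂ ∈ openSegment ℝ (pt p q s₁) q := by
    have := pt_between (p := p) (q := q) (a := s₁) (b := 1) (c := s₂) (by linarith) d2.2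
    rwa [pt_one] at this
  have o1 : ori p (pt p q s₁) z = s₁ * ori p q z := ori_pt_mid _ _ _ _
  have o2 : ori z (pt p q s₂) q = (1 - s₂) * ori p q z := by simp only [ori, pt_apply]; ring
  have o3 : ∀ m, ori (pt p q s₁) (pt p q s₂) m = (s₂ - s₁) * ori p q m := fun m => ori_pt_pt _ _ _ _ _
  set x₁ := pt p q s₁ with ex₁
  set x₂ := pt p q s₂ with ex₂
  have ho : 0 < ori x₁ x₂ z := by rw [o3]; exact mul_pos (by linarith) hzpos
  have hnotV : ∀ y ∈ openSegment ℝ p q, y ∉ V ∧ y ∉ A := by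
    intro y hy
    have hyA : y ∉ A := fun hA => h.vertex_notMem_open hp hA hy
    exact ⟨fun hV => hyA ((h.cover y hV).resolve_left fun hG =>
      (h.disj p hp).le_bot ⟨hG, openSegment_subset_segment ℝ _ _ hy⟩), hyA⟩
  obtain ⟨v1, v1A⟩ := hnotV _ hx₁
  obtain ⟨v2, v2A⟩ := hnotV _ hx₂
  obtain ⟨n12, n2z, n1z⟩ := ne_of_ori_ne ho.ne'
  set T := tri x₁ x₂ z with hTdef
  have hTO : T ⊆ Fᶜ ∩ (G ∪ N) := by
    refine (tri_subset_of_convex ho ((convex_segment z x).thickening δ) ?_ ?_ ?_).trans hδ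
    · exact Metric.ball_subset_thickening (right_mem_segment ℝ z x) δ c1
    · exact Metric.ball_subset_thickening (right_mem_segment ℝ z x) δ d1
    · exact Metric.self_subset_thickening δ0 _ (left_mem_segment ℝ z x)
  have hFT : Disjoint F T := Set.disjoint_left.2 fun y hy hyT => (hTO hyT).1 hy
  have hTG : T \ segment ℝ x₁ x₂ ⊆ G := by
    rintro m ⟨hm, hn⟩
    have hpos : 0 < ori p q m := by
      have := hm.1.lt_of_ne fun e => hn (mem_segment_of_tri ho hm e.symm)
      rw [o3] at this
      exact pos_of_mul_pos_right this (by linarith)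
    rcases (hTO hm).2 with e | e
    · exact e
    · exact (hN m e).1.2 hpos
  -- On the wedge the distance from the edge is largest at `z`, and it increases further from `z`
  -- towards the mate `z'`.
  have hown : ∀ y ∈ openSegment ℝ z' z, y ∉ T ∧ z' ∉ T := by
    intro y hy
    have hx0 : ori x₁ x₂ x = 0 := by
      obtain ⟨t, -, -, rfl⟩ := mem_openSegment_pt.1 hxx; rw [ori_pt]; simp
    obtain ⟨τ, τ0, τ1, e⟩ := mem_openSegment_pt.1 hdir
    have e0 := congrArg (ori x₁ x₂) e
    rw [ori_pt, hx0, mul_zero, add_zero] at e0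
    have hgt : ori x₁ x₂ z < ori x₁ x₂ z' := by
      by_contra hle
      have : (1 - τ) * ori x₁ x₂ z' ≤ (1 - τ) * ori x₁ x₂ z :=
        mul_le_mul_of_nonneg_left (not_lt.1 hle) (by linarith)
      nlinarith
    have hle : ∀ m ∈ T, ori x₁ x₂ m ≤ ori x₁ x₂ z := fun m hm => by
      have := ori_sum x₁ x₂ z m
      linarith [hm.2.1, hm.2.2]
    refine ⟨fun hyT => ?_, fun hT => absurd (hle _ hT) (not_le.2 hgt)⟩
    have := hle y hyT
    obtain ⟨t, t0, t1, rfl⟩ := mem_openSegment_pt.1 hy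
    rw [ori_pt] at this
    nlinarith
  have hz'T : z' ∉ T := (hown _ (pt_mem_openSegment (t := 1/2) (by norm_num) (by norm_num))).2
  have h1 := h.split hS hp hx₁ (fun hs => hxs ⟨p, q, hs, openSegment_subset_segment ℝ _ _ hx⟩)
  have e11 : insNext nx p x₁ x₁ = q := insNext_new nx p x₁
  have h2 := h1.split hS (u := x₁) (w := x₂) (Finset.mem_insert_self _ _) (by rwa [e11])
    (fun hs => v1 (hS.mem hs))
  set nx₂ := insNext (insNext nx p x₁) x₁ x₂ with hnx₂
  have e21 : nx₂ x₁ = x₂ := insNext_left _ n12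
  have hzA : z ∉ A := fun hA => h.notMem_of_vertex hA hzG
  have hz2 : z ∉ Insert.insert x₂ (Insert.insert x₁ A) := by
    simp only [Finset.mem_insert, not_or]; exact ⟨n2z.symm, n1z.symm, hzA⟩
  have hx12 : x₁ ∈ Insert.insert x₂ (Insert.insert x₁ A) := by simp
  have hcase : ∀ a b, Sg a b → (a = z ∧ b = z') ∨ (a = z' ∧ b = z) ∨ segment ℝ a b ⊆ F := by
    intro a b hab
    by_cases ha : a = z
    · subst ha; exact Or.inl ⟨rfl, hS.mate_unique hzz hab⟩
    by_cases hb : b = z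
    · subst hb; exact Or.inr (Or.inl ⟨hS.mate_unique hzz (hS.symm hab), rfl⟩)
    · exact Or.inr (Or.inr (hFS a b hab ha hb))
  have h3 := h2.insert hS (u := x₁) (w := z) hx12 hz2 (by rwa [e21]) (by rwa [e21])
    (fun hs => v1 (hS.mem hs))
    (by
      rw [e21]
      intro y hyV hyG hyT
      obtain ⟨y', hy'⟩ := hS.mate y hyV
      rcases hcase y y' hy' with e | e | e
      · exact e.1
      · exact absurd (e.1 ▸ hyT) hz'T
      · exact absurd (e (left_mem_segment ℝ _ _)) (fun hh => hFT.le_bot ⟨hh, hyT⟩))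
    (by
      rw [e21]
      intro a b hab _
      left
      rw [Set.disjoint_left]
      intro y hy hyT
      rcases hcase a b hab with e | e | e
      · rw [e.1, e.2, openSegment_symm] at hy; exact (hown y hy).1 hyT
      · rw [e.1, e.2] at hy; exact (hown y hy).1 hyT
      · exact hFT.le_bot ⟨e (openSegment_subset_segment ℝ _ _ hy), hyT⟩)
  rw [e21] at h3
  set nx₃ := insNext nx₂ x₁ z with hnx₃
  set A₃ := Insert.insert z (Insert.insert x₂ (Insert.insert x₁ A)) with hA₃
  have npz : p ≠ z := fun e => hzA (e ▸ hp)
  have np1 : p ≠ x₁ := fun e => v1A (e ▸ hp)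
  have np2 : p ≠ x₂ := fun e => v2A (e ▸ hp)
  have f1 : nx₃ x₁ = z := insNext_left _ n1z
  have fz : nx₃ z = x₂ := by rw [hnx₃, insNext_new, e21]
  have f2 : nx₃ x₂ = q := by
    rw [hnx₃, insNext_of_ne _ n2z n12.symm, hnx₂, insNext_new, e11]
  have fp : nx₃ p = x₁ := by
    rw [hnx₃, insNext_of_ne _ npz np1, hnx₂, insNext_of_ne _ np2 np1, insNext_left _ np1]
  have fy : ∀ y ∈ A, y ≠ p → nx₃ y = nx y := by
    intro y hy hyp
    have m1 : y ≠ x₁ := fun e => v1A (e ▸ hy)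
    have m2 : y ≠ x₂ := fun e => v2A (e ▸ hy)
    have m3 : y ≠ z := fun e => hzA (e ▸ hy)
    rw [hnx₃, insNext_of_ne _ m3 m1, hnx₂, insNext_of_ne _ m2 m1, insNext_of_ne _ m1 hyp]
  have hA₃m : ∀ y ∈ A₃, y = z ∨ y = x₂ ∨ y = x₁ ∨ y ∈ A := fun y hy => by
    simpa [hA₃] using hy
  -- After the cut the polygon turns left at both new points of the edge, so `corner` applies to
  -- them.
  have k1 : ConvexCorner (G \ T) x₁ := by
    have := h3.toPolyRegion.corner (u := p) (by simp [hA₃, hp])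
      (by rw [fp, f1, o1]; exact mul_pos c2.1 hzpos)
    rw [fp, f1] at this
    exact ⟨p, z, by rw [o1]; exact mul_pos c2.1 hzpos, this⟩
  have k2 : ConvexCorner (G \ T) x₂ := by
    have hpos : 0 < (1 - s₂) * ori p q z := mul_pos (by linarith [d2.2]) hzpos
    have := h3.toPolyRegion.corner (u := z) (by simp [hA₃]) (by rw [fz, f2, o2]; exact hpos)
    rw [fz, f2] at this
    exact ⟨z, q, by rw [o2]; exact hpos, this⟩
  have hsubT : segment ℝ z x ⊆ T := (convex_tri _ _ _).segment_subset (right_mem_tri ho.le)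
    ((segment_subset_tri ho.le).1 (openSegment_subset_segment ℝ _ _ hxx))
  have hn : ∀ y ∈ A₃, y ∉ G \ T := fun y hy => h3.notMem_of_vertex hy
  refine ⟨nx₃, A₃, T, h3, isClosed_tri _ _ _, convex_tri _ _ _, hsubT, hFT, ?_, by simp [hA₃],
    ?_, ?_, ?_, ?_⟩
  · intro y hy; simp [hA₃, hy]
  · intro y hy
    rcases hA₃m y hy with e | e | e | e
    · exact Or.inr (Or.inl e)
    · right; right; rw [e]; exact ⟨v2, b3⟩
    · right; right; rw [e]; exact ⟨v1, a3⟩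
    · exact Or.inl e
  · intro y hy
    rcases hA₃m y hy with e | e | e | e
    · rw [e, fz]; exact Or.inr (Or.inl v2)
    · rw [e]; exact Or.inl v2
    · rw [e]; exact Or.inl v1
    · by_cases hyp : y = p
      · rw [hyp, fp]; exact Or.inr (Or.inl v1)
      · exact Or.inr (Or.inr ⟨e, fy y e hyp⟩)
  · intro y hy
    rcases hA₃m y hy with e | e | e | e
    · rw [e]
      refine not_halfFree_wedge ho hxx hdir ?_ ?_
      · exact Set.disjoint_left.2 fun m hm hmG =>
          hmG.2 ⟨z', z, hS.symm hzz, hm⟩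
      · exact Set.disjoint_left.2 fun m hm hmG => hmG.1.2 hm
    · obtain ⟨r, hr⟩ := k2.blocked (hn x₂ (by simp [hA₃]))
      rw [e]; exact not_halfFree_of_blocked sdiff_subset hr
    · obtain ⟨r, hr⟩ := k1.blocked (hn x₁ (by simp [hA₃]))
      rw [e]; exact not_halfFree_of_blocked sdiff_subset hr
    · exact fun hH => hAP y e (hH.mono (sdiff_subset_sdiff_left sdiff_subset) sdiff_subset)
  · intro y hy hyV
    rcases hA₃m y hy with e | e | e | e
    · exact absurd (e ▸ hzV) hyV
    · rw [e]; exact k2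
    · rw [e]; exact k1
    · exact (hCC y e hyV).mono sdiff_subset

end St

/-! ### Cutting out the escape routes -/

/-- The first exit of a ray from a bounded open set. -/
theorem exists_exit {G : Set Plane} (hG : IsOpen G) (hb : Bornology.IsBounded G) {a b : Plane}
    (hab : a ≠ b) (hbG : b ∈ G) :
    ∃ T : ℝ, 1 < T ∧ pt a b T ∉ G ∧ ∀ t, 1 ≤ t → t < T → pt a b t ∈ G := by
  set E : Set ℝ := {t | 1 ≤ t ∧ pt a b t ∉ G} with hE
  have hEc : IsClosed E := isClosed_Ici.inter
    (hG.isClosed_compl.preimage (continuous_pt a b))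
  have hEn : E.Nonempty := by
    obtain ⟨R, hR⟩ := hb.exists_norm_le
    have hd : 0 < ‖b - a‖ := norm_pos_iff.2 (sub_ne_zero.2 hab.symm)
    refine ⟨1 + (2 * |R| + 1) / ‖b - a‖, by simp; positivity, fun hm => ?_⟩
    set s := (2 * |R| + 1) / ‖b - a‖ with hs
    have h1 := hR _ hm
    have h2 := hR _ hbG
    have e : pt a b (1 + s) = b + s • (b - a) := by
      apply plane_ext <;> simp [pt_apply] <;> ring
    rw [e] at h1
    have h3 : ‖s • (b - a)‖ = 2 * |R| + 1 := by
      rw [norm_smul, Real.norm_of_nonneg (by positivity), hs, div_mul_cancel₀ _ hd.ne']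
    have h4 : ‖s • (b - a)‖ ≤ ‖b + s • (b - a)‖ + ‖b‖ := by
      have := norm_sub_le (b + s • (b - a)) b
      simpa using this
    have := le_abs_self R
    linarith
  have hbd : BddBelow E := ⟨1, fun t ht => ht.1⟩
  have hmem := hEc.csInf_mem hEn hbd
  refine ⟨sInf E, hmem.1.lt_of_ne fun e => hmem.2 (by rw [← e, pt_one]; exact hbG), hmem.2,
    fun t h1 h2 => ?_⟩
  by_contra hn
  exact absurd (csInf_le hbd ⟨h1, hn⟩) (not_le.2 h2)

/-- Closedness of the traces allows a wedge to be kept away from every route that its axis misses.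
-/
theorem isClosed_shot (B : Set Plane) {p d : Plane} (hd : d ≠ 0) : IsClosed (shot B p d) := by
  have e : shot B p d = (fun t : ℝ => p + t • d) ''
      {t | 0 ≤ t ∧ ∀ u : ℝ, 0 ≤ u → u < t → p + u • d ∉ B} := by
    ext x; constructor
    · rintro ⟨t, h0, rfl, h⟩; exact ⟨t, ⟨h0, h⟩, rfl⟩
    · rintro ⟨t, ⟨h0, h⟩, rfl⟩; exact ⟨t, h0, rfl, h⟩
  rw [e]
  have hemb : IsClosedEmbedding (fun t : ℝ => p + t • d) :=
    (Homeomorph.addLeft p).isClosedEmbedding.comp (isClosedEmbedding_smul_left hd)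
  apply hemb.isClosedMap
  have : {t : ℝ | 0 ≤ t ∧ ∀ u : ℝ, 0 ≤ u → u < t → p + u • d ∉ B} =
      Ici 0 ∩ ⋂ u ∈ {u : ℝ | 0 ≤ u ∧ p + u • d ∈ B}, Iic u := by
    ext t
    simp only [mem_ofPred_eq, mem_inter_iff, mem_Ici, mem_iInter, mem_Iic]
    refine and_congr_right fun _ => ⟨fun h u hu => ?_, fun h u hu hut hB => ?_⟩
    · by_contra hc; exact h u hu.1 (not_le.1 hc) hu.2
    · exact absurd (h u ⟨hu, hB⟩) (not_le.2 hut)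
  rw [this]
  exact isClosed_Ici.inter (isClosed_biInter fun u _ => isClosed_Iic)

section
variable {V : Finset Plane} {Sg : Plane → Plane → Prop}

/-- Oriented segments with their escape routes. -/
structure Routes (V : Finset Plane) (Sg : Plane → Plane → Prop) {n : ℕ} (a b : Fin n → Plane)
    (trace : Fin n → Set Plane) : Prop where
  sg : ∀ i, Sg (a i) (b i)
  inj : Function.Injective b
  shot : ∀ i, trace i = shot (⋃ j, ⋃ (_ : j < i), trace j) (b i) (b i - a i)
  disj : ∀ i c d, Sg c d → c ≠ b i → d ≠ b i → Disjoint (trace i) (segment ℝ c d)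

/-- The state after the first `k` routes have been cut out of the open triangle `Δ`. -/
structure RouteState (V : Finset Plane) (Sg : Plane → Plane → Prop) {n : ℕ} (a b : Fin n → Plane)
    (trace : Fin n → Set Plane) (Δ : Set Plane) (k : ℕ) (nx : Plane → Plane) (A : Finset Plane)
    (G : Set Plane) : Prop extends St V Sg nx A G where
  half : ∀ y ∈ A, ¬ HalfFree (G \ segUnion Sg) G y
  conv : ∀ y ∈ A, y ∉ V → ConvexCorner G y
  old : ∀ y ∈ A, y ∈ V → ∃ j : Fin n, j.1 < k ∧ y = b j
  done : ∀ j : Fin n, j.1 < k → b j ∈ A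
  -- No ray runs into an auxiliary vertex, so it leaves the polygon at an inner point of an edge.
  generic : ∀ y ∈ A, y ∉ V → ∀ j, ori (a j) (b j) y ≠ 0
  -- An edge with an auxiliary end does not lie on the line of a segment, as the generic choice of
  -- points on it requires.
  aux : ∀ y ∈ A, y ∉ V ∨ nx y ∉ V
  sub : G ⊆ Δ
  out : ∀ j : Fin n, j.1 < k → Disjoint (trace j) G
  -- A later route that has left `G` inside `Δ` does not return: a wedge touches such a route only
  -- if its axis does, the wedge is convex, and the route ends where it meets the earlier one.
  stay : ∀ y ∈ Δ, y ∉ G → ∀ j : Fin n, k ≤ j.1 → y ∈ trace j →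
    ∃ e ∈ trace j, (∃ i : Fin n, i.1 < k ∧ e ∈ trace i) ∧ Disjoint (segment ℝ y e) G

/-- Up to its first exit `x` from `G` the ray meets no earlier trace, so this piece belongs to the
trace and meets no foreign segment. Hence `x` is not an endpoint, and by `generic` not an auxiliary
vertex, so it is inside an edge and `St.wedge` applies. -/
theorem RouteState.step {n : ℕ} {a b : Fin n → Plane} {trace : Fin n → Set Plane} {Δ : Set Plane}
    (hS : SegSys V Sg) (hR : Routes V Sg a b trace) (hΔ : Convex ℝ Δ) {k : ℕ} (hk : k < n)
    {nx : Plane → Plane} {A : Finset Plane} {G : Set Plane}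
    (h : RouteState V Sg a b trace Δ k nx A G) :
    ∃ nx' A' G', RouteState V Sg a b trace Δ (k + 1) nx' A' G' := by
  obtain ⟨i, hi⟩ : ∃ i : Fin n, i.1 = k := ⟨⟨k, hk⟩, rfl⟩
  have hab := hR.sg i
  have hne := hS.ne hab
  have hzV := hS.mem' hab
  have hzG : b i ∈ G := (h.cover _ hzV).resolve_right fun hA => by
    obtain ⟨j, hj, e⟩ := h.old _ hA hzV
    rw [hR.inj e] at hi; omega
  obtain ⟨T, hT1, hTG, hTin⟩ := exists_exit h.isOpen h.bdd hne hzG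
  have hpar : ∀ t : ℝ, b i + t • (b i - a i) = pt (a i) (b i) (1 + t) := fun t => by
    apply plane_ext <;> simp [pt_apply] <;> ring
  have htr : ∀ y, y ∈ trace i ↔ ∃ t, 1 ≤ t ∧ y = pt (a i) (b i) t ∧
      ∀ u, 1 ≤ u → u < t → ∀ j : Fin n, j.1 < k → pt (a i) (b i) u ∉ trace j := by
    intro y
    rw [hR.shot i]
    constructor
    · rintro ⟨t, t0, e, hu⟩
      refine ⟨1 + t, by linarith, by rw [e, hpar], fun u hu1 hut j hj hm => ?_⟩
      refine hu (u - 1) (by linarith) (by linarith) ?_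
      rw [hpar, add_sub_cancel]
      simp only [mem_iUnion]
      exact ⟨j, by rw [Fin.lt_def]; omega, hm⟩
    · rintro ⟨t, t0, e, hu⟩
      refine ⟨t - 1, by linarith, by rw [e, hpar, add_sub_cancel], fun u hu1 hut hm => ?_⟩
      simp only [mem_iUnion] at hm
      obtain ⟨j, hj, hm⟩ := hm
      rw [hpar] at hm
      exact hu (1 + u) (by linarith) (by linarith) j (by rw [Fin.lt_def] at hj; omega) hm
  have hgn : ∀ u, 1 ≤ u → u < T → ∀ j : Fin n, j.1 < k → pt (a i) (b i) u ∉ trace j :=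
    fun u h1 h2 j hj hm => (h.out j hj).le_bot ⟨hm, hTin u h1 h2⟩
  have hseg : ∀ y ∈ segment ℝ (b i) (pt (a i) (b i) T), ∃ t, 1 ≤ t ∧ t ≤ T ∧ y = pt (a i) (b i) t := by
    intro y hy
    obtain ⟨t, t0, t1, e⟩ := mem_segment_pt.1 hy
    refine ⟨1 + t * (T - 1), by nlinarith, by nlinarith, ?_⟩
    rw [e]
    apply plane_ext <;> simp only [pt_apply] <;> ring
  have hsub : segment ℝ (b i) (pt (a i) (b i) T) ⊆ trace i := by
    intro y hy
    obtain ⟨t, t1, tT, e⟩ := hseg y hy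
    exact (htr y).2 ⟨t, t1, e, fun u h1 h2 => hgn u h1 (by linarith)⟩
  set x := pt (a i) (b i) T with hx
  have hxtr : x ∈ trace i := hsub (right_mem_segment ℝ _ _)
  have hopen : openSegment ℝ (b i) x ⊆ G := by
    intro y hy
    obtain ⟨t, t0, t1, e⟩ := mem_openSegment_pt.1 hy
    have : y = pt (a i) (b i) (1 + t * (T - 1)) := by
      rw [e]
      apply plane_ext <;> simp only [hx, pt_apply] <;> ring
    rw [this]
    exact hTin _ (by nlinarith) (by nlinarith)
  have hxs : x ∉ segUnion Sg := by
    rintro ⟨c, d, hcd, hm⟩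
    have own : x ∉ segment ℝ (a i) (b i) := fun hm => by
      obtain ⟨t, -, t1, e⟩ := mem_segment_pt.1 hm
      have := pt_inj hne e; linarith
    by_cases hc : c = b i
    · rw [hc] at hcd hm
      rw [hS.mate_unique (hS.symm hab) hcd, segment_symm] at hm
      exact own hm
    by_cases hd : d = b i
    · rw [hd] at hcd hm
      rw [hS.mate_unique (hS.symm hab) (hS.symm hcd)] at hm
      exact own hm
    · exact (hR.disj i c d hcd hc hd).le_bot ⟨hxtr, hm⟩
  have hxcl : x ∈ closure G := by
    have : x ∈ closure (openSegment ℝ (b i) x) := by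
      rw [closure_openSegment]; exact right_mem_segment ℝ _ _
    exact closure_mono hopen this
  obtain ⟨p, hp, hxp⟩ := h.front x hxcl hTG
  have hxA : x ∉ A := fun hA => by
    by_cases hV : x ∈ V
    · exact hxs (hS.mem_segUnion hV)
    · exact h.generic x hA hV i (by rw [hx, ori_pt]; simp)
  have hxo : x ∈ openSegment ℝ p (nx p) := by
    rcases mem_segment_cases hxp with e | e | e
    · exact absurd (e ▸ hp) hxA
    · exact absurd (e ▸ h.maps p hp) hxA
    · exact e
  set F₁ : Set Plane := {m | ∃ c d, (Sg c d ∧ (c ≠ b i ∧ d ≠ b i)) ∧ m ∈ segment ℝ c d} with hF₁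
  -- The wedge has to avoid every route that misses its axis; this is what preserves `stay`.
  set J : Finset (Fin n) := Finset.univ.filter fun j => Disjoint (trace j) (segment ℝ (b i) x)
    with hJ
  have htrc : ∀ j, IsClosed (trace j) := fun j => by
    rw [hR.shot j]
    exact isClosed_shot _ (sub_ne_zero.2 (hS.ne (hR.sg j)).symm)
  obtain ⟨nx', A', W, h', w1, w2, w3, w4, w5, w6, w7, w8, w9, w10⟩ := h.toSt.wedge hS
    (z' := a i) hzG (hS.symm hab) hp hxo hxs
    (by
      have := pt_between (p := a i) (q := b i) (a := 0) (b := T) (c := 1) one_pos hT1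
      rwa [pt_zero, pt_one] at this) hopen
    (F := F₁ ∪ ⋃ j ∈ J, trace j)
    ((hS.isClosed_sub _).union (isClosed_biUnion_finset fun j _ => htrc j))
    (by
      rw [Set.disjoint_left]
      rintro m (⟨c, d, ⟨hcd, hc, hd⟩, hm⟩ | hm) hm'
      · exact (hR.disj i c d hcd hc hd).le_bot ⟨hsub hm', hm⟩
      · simp only [mem_iUnion] at hm
        obtain ⟨j, hj, hm⟩ := hm
        exact (Finset.mem_filter.1 hj).2.le_bot ⟨hm, hm'⟩)
    (fun c d hcd hc hd m hm => Or.inl ⟨c, d, ⟨hcd, hc, hd⟩, hm⟩)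
    (Finset.univ.image fun j => (a j, b j))
    (by
      intro l hl
      obtain ⟨j, -, rfl⟩ := Finset.mem_image.1 hl
      rcases h.aux p hp with e | e
      · exact Or.inl (h.generic p hp e j)
      · exact Or.inr (h.generic _ (h.maps p hp) e j))
    h.half h.conv
  refine ⟨nx', A', G \ W, h', w9, w10, ?_, ?_, ?_, ?_, sdiff_subset.trans h.sub, ?_, ?_⟩
  · intro y hy hyV
    rcases w7 y hy with e | e | e
    · obtain ⟨j, hj, e⟩ := h.old y e hyV; exact ⟨j, by omega, e⟩
    · exact ⟨i, by omega, e⟩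
    · exact absurd hyV e.1
  · intro j hj
    by_cases hjk : j.1 < k
    · exact w5 (h.done j hjk)
    · have : j = i := Fin.ext (by omega)
      rw [this]; exact w6
  · intro y hy hyV j
    rcases w7 y hy with e | e | e
    · exact h.generic y e hyV j
    · exact absurd (e ▸ hzV) hyV
    · exact e.2 (a j, b j) (Finset.mem_image.2 ⟨j, Finset.mem_univ _, rfl⟩)
  · intro y hy
    rcases w8 y hy with e | e | ⟨e1, e2⟩
    · exact Or.inl e
    · exact Or.inr e
    · rw [e2]; exact h.aux y e1
  · intro j hj
    by_cases hjk : j.1 < k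
    · exact (h.out j hjk).mono_right sdiff_subset
    · have : j = i := Fin.ext (by omega)
      rw [this, Set.disjoint_left]
      rintro y hy ⟨hyG, hyW⟩
      obtain ⟨t, t1, e, hu⟩ := (htr y).1 hy
      -- Up to the exit `x` the route lies in the wedge. If `x` is in `Δ`, then `stay` keeps the
      -- rest off `G` up to an earlier route, where it stops. If not, the ray has left the convex
      -- set `Δ` for good.
      rcases le_or_gt t T with htT | htT
      · apply hyW; apply w3
        rw [e, hx]
        refine mem_segment_pt.2 ⟨(t - 1) / (T - 1), div_nonneg (by linarith) (by linarith),
          (div_le_one (by linarith)).2 (by linarith), ?_⟩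
        have : (T - 1) ≠ 0 := by linarith
        apply plane_ext <;> simp only [pt_apply] <;> field_simp <;> ring
      · by_cases hxΔ : x ∈ Δ
        · obtain ⟨e', he', ⟨l, hl, hel⟩, hd⟩ := h.stay x hxΔ hTG i (by omega) hxtr
          obtain ⟨te, te1, ee, -⟩ := (htr e').1 he'
          have q1 : T ≤ te := by
            by_contra hc
            exact hgn te te1 (not_le.1 hc) l hl (ee ▸ hel)
          have q2 : t ≤ te := by
            by_contra hc
            exact hu te te1 (not_le.1 hc) l hl (ee ▸ hel)
          refine hd.le_bot ⟨?_, hyG⟩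
          rw [e, ee, hx]
          rcases q2.eq_or_lt with q2 | q2
          · rw [q2]; exact right_mem_segment ℝ _ _
          · exact openSegment_subset_segment ℝ _ _ (pt_between htT q2)
        · apply hxΔ
          refine hΔ.segment_subset (h.sub hzG) (h.sub hyG) (openSegment_subset_segment ℝ _ _ ?_)
          have := pt_between (p := a i) (q := b i) hT1 htT
          rwa [pt_one, ← e] at this
  · intro y hyΔ hyn j hj hyj
    by_cases hyG : y ∈ G
    · have hyW : y ∈ W := by by_contra hc; exact hyn ⟨hyG, hc⟩
      have : ¬ Disjoint (trace j) (segment ℝ (b i) x) := fun hd => by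
        refine w4.le_bot ⟨Or.inr ?_, hyW⟩
        simp only [mem_iUnion]
        exact ⟨j, Finset.mem_filter.2 ⟨Finset.mem_univ _, hd⟩, hyj⟩
      obtain ⟨e, he, he'⟩ := Set.not_disjoint_iff.1 this
      refine ⟨e, he, ⟨i, by omega, hsub he'⟩, Set.disjoint_left.2 fun m hm hm' => ?_⟩
      exact hm'.2 (w2.segment_subset hyW (w3 he') hm)
    · obtain ⟨e, he, ⟨l, hl, hel⟩, hd⟩ := h.stay y hyΔ hyG j (by omega) hyj
      exact ⟨e, he, ⟨l, by omega, hel⟩, hd.mono_right sdiff_subset⟩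

theorem RouteState.all {n : ℕ} {a b : Fin n → Plane} {trace : Fin n → Set Plane} {Δ : Set Plane}
    (hS : SegSys V Sg) (hR : Routes V Sg a b trace) (hΔ : Convex ℝ Δ)
    {nx : Plane → Plane} {A : Finset Plane} {G : Set Plane}
    (h : RouteState V Sg a b trace Δ 0 nx A G) (k : ℕ) (hk : k ≤ n) :
    ∃ nx' A' G', RouteState V Sg a b trace Δ k nx' A' G' := by
  induction k with
  | zero => exact ⟨nx, A, G, h⟩
  | succ k ih =>
    obtain ⟨nx', A', G', h'⟩ := ih (by omega)
    exact h'.step hS hR hΔ (by omega)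

/-! ### Saturation: every remaining extension meets a segment -/

/-- The extension of every unvisited segment end meets a segment inside the region. -/
def ExtensionsHit (Sg : Plane → Plane → Prop) (V : Finset Plane) (G : Set Plane) : Prop :=
  ∀ z ∈ V, z ∈ G → ∀ z', Sg z z' → ∃ T : ℝ, 1 < T ∧ pt z' z T ∈ segUnion Sg ∧
    ∀ t, 1 ≤ t → t < T → pt z' z t ∈ G

/-- An endpoint whose extension reaches the boundary without meeting a segment can be made a vertex
by a wedge followed by `St.cutAll`, which lowers the number of unvisited endpoints. No vertex in `V`
is ever lost, hence the set `B` is kept. -/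
theorem exists_extensionsHit (hS : SegSys V Sg)
    (hnc : ∀ p q : Plane, p ≠ q → ∃ y ∈ V, ori p q y ≠ 0) (B : Finset Plane) (N : ℕ) :
    ∀ (nx : Plane → Plane) (A : Finset Plane) (G : Set Plane), St V Sg nx A G → A ⊆ V → B ⊆ A →
    (∀ y ∈ A, ¬ HalfFree (G \ segUnion Sg) G y) → (V \ A).card ≤ N →
    ∃ nx' A' G', St V Sg nx' A' G' ∧ A' ⊆ V ∧ B ⊆ A' ∧
      (∀ y ∈ A', ¬ HalfFree (G' \ segUnion Sg) G' y) ∧ ExtensionsHit Sg V G' := by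
  induction N with
  | zero =>
    intro nx A G h hAV hBA hAP hc
    refine ⟨nx, A, G, h, hAV, hBA, hAP, fun z hz hzG => ?_⟩
    have := Finset.sdiff_eq_empty_iff_subset.1 (Finset.card_eq_zero.1 (Nat.le_zero.1 hc))
    exact absurd hzG (h.notMem_of_vertex (this hz))
  | succ N ih =>
    intro nx A G h hAV hBA hAP hc
    by_cases hE : ExtensionsHit Sg V G
    · exact ⟨nx, A, G, h, hAV, hBA, hAP, hE⟩
    unfold ExtensionsHit at hE
    push Not at hE
    obtain ⟨z, hzV, hzG, z', hzz, hno⟩ := hE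
    have hne := (hS.ne hzz).symm
    obtain ⟨T, hT1, hTG, hTin⟩ := exists_exit h.isOpen h.bdd hne hzG
    have hnos : ∀ t, 1 < t → t ≤ T → pt z' z t ∉ segUnion Sg := fun t t1 tT hm => by
      obtain ⟨u, u1, u2, u3⟩ := hno t t1 hm
      exact u3 (hTin u u1 (by linarith))
    have hcl : IsClosed {m | ∃ c d, (Sg c d ∧ (c ≠ z ∧ d ≠ z)) ∧ m ∈ segment ℝ c d} :=
      hS.isClosed_sub _
    have hpar : ∀ t : ℝ, pt z (pt z' z T) t = pt z' z (1 + t * (T - 1)) := fun t => by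
      apply plane_ext <;> simp only [pt_apply] <;> ring
    have hopen : openSegment ℝ z (pt z' z T) ⊆ G := by
      intro y hy
      obtain ⟨t, t0, t1, e⟩ := mem_openSegment_pt.1 hy
      rw [e, hpar]
      exact hTin _ (by nlinarith) (by nlinarith)
    have hxs := hnos T hT1 le_rfl
    have hxcl : pt z' z T ∈ closure G := by
      have : pt z' z T ∈ closure (openSegment ℝ z (pt z' z T)) := by
        rw [closure_openSegment]; exact right_mem_segment ℝ _ _
      exact closure_mono hopen this
    obtain ⟨p, hp, hxp⟩ := h.front _ hxcl hTG
    have hxA : pt z' z T ∉ A := fun hA => hxs (hS.mem_segUnion (hAV hA))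
    have hxo : pt z' z T ∈ openSegment ℝ p (nx p) := by
      rcases mem_segment_cases hxp with e | e | e
      · exact absurd (e ▸ hp) hxA
      · exact absurd (e ▸ h.maps p hp) hxA
      · exact e
    obtain ⟨nx', A', W, h', w1, w2, w3, w4, w5, w6, w7, w8, w9, w10⟩ := h.wedge hS
      (z' := z') hzG hzz hp hxo hxs
      (by
        have := pt_between (p := z') (q := z) (a := 0) (b := T) (c := 1) one_pos hT1
        rwa [pt_zero, pt_one] at this) hopen hcl
      (by
        rw [Set.disjoint_left]
        rintro m ⟨c, d, ⟨hcd, hc, hd⟩, hm⟩ hm'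
        obtain ⟨t, t0, t1, e⟩ := mem_segment_pt.1 hm'
        rcases t0.eq_or_lt with t0 | t0
        · rw [← t0, pt_zero] at e
          rcases hS.eq_or_of_mem hcd hzV (e ▸ hm) with e | e
          · exact hc e.symm
          · exact hd e.symm
        · rw [hpar] at e
          have hms : m ∈ segUnion Sg := ⟨c, d, hcd, hm⟩
          exact hnos (1 + t * (T - 1)) (by nlinarith) (by nlinarith) (e ▸ hms))
      (fun c d hcd hc hd m hm => ⟨c, d, ⟨hcd, hc, hd⟩, hm⟩) ∅ (by simp) hAP
      (fun y hy hyV => absurd (hAV hy) hyV)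
    obtain ⟨nx₂, A₂, G₂, h₂, k1, k2, k3, k4⟩ := St.cutAll hS hnc _ nx' A' _ h' w9 w10 le_rfl
    have hAA : A ⊆ A₂ := fun y hy => k3 (Finset.mem_inter.2 ⟨w5 hy, hAV hy⟩)
    refine ih nx₂ A₂ G₂ h₂ k2 (hBA.trans hAA) k4 ?_
    have : (V \ A₂).card < (V \ A).card := by
      apply Finset.card_lt_card
      refine (Finset.ssubset_iff_of_subset (Finset.sdiff_subset_sdiff Subset.rfl hAA)).2
        ⟨z, Finset.mem_sdiff.2 ⟨hzV, fun hA => h.notMem_of_vertex hA hzG⟩, fun hh => ?_⟩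
      exact (Finset.mem_sdiff.1 hh).2 (k3 (Finset.mem_inter.2 ⟨w6, hzV⟩))
    omega
end

/-! ### The initial triangle -/

/-- The interior of a triangle. -/
def triInt (u x v : Plane) : Set Plane := {y | 0 < ori u x y ∧ 0 < ori x v y ∧ 0 < ori v u y}

/-- The successor function of a triangle. -/
noncomputable def triNext (u x v p : Plane) : Plane :=
  if p = u then x else if p = x then v else u

theorem convex_triInt (u x v : Plane) : Convex ℝ (triInt u x v) :=
  (convex_ori_pos u x).inter ((convex_ori_pos x v).inter (convex_ori_pos v u))

theorem triInt_rot (u x v : Plane) : triInt u x v = triInt x v u := by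
  ext y; simp only [triInt, mem_ofPred_eq]; tauto

theorem isOpen_triInt (u x v : Plane) : IsOpen (triInt u x v) :=
  (isOpen_lt continuous_const (continuous_ori _ _)).inter
    ((isOpen_lt continuous_const (continuous_ori _ _)).inter
      (isOpen_lt continuous_const (continuous_ori _ _)))

theorem openSegment_ori {u x v m : Plane} (ho : 0 < ori u x v) (hm : m ∈ openSegment ℝ u x) :
    0 < ori x v m ∧ 0 < ori v u m := by
  obtain ⟨t, t0, t1, rfl⟩ := mem_openSegment_pt.1 hm
  exact ⟨ori_pt_left_pos ho t1, ori_pt_right_pos ho t0⟩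

theorem ori_of_mem_segment {u x m : Plane} (hm : m ∈ segment ℝ u x) : ori u x m = 0 := by
  obtain ⟨t, -, -, rfl⟩ := mem_segment_pt.1 hm; rw [ori_pt]; simp

theorem triangle_loc {u x v m : Plane} (ho : 0 < ori u x v) (hm : m ∈ openSegment ℝ u x) :
    ∀ᶠ y in 𝓝 m, (y ∈ triInt u x v ↔ 0 < ori u x y) := by
  obtain ⟨a, b⟩ := openSegment_ori ho hm
  filter_upwards [eventually_ori_pos a, eventually_ori_pos b] with y ha hb
  exact ⟨fun h => h.1, fun h => ⟨h, ha, hb⟩⟩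

/-- A triangle with its interior. -/
theorem polyRegion_triangle {u x v : Plane} (ho : 0 < ori u x v) :
    PolyRegion (triNext u x v) {u, x, v} (triInt u x v) := by
  obtain ⟨n1, n2, n3⟩ := ne_of_ori_ne ho.ne'
  have eu : triNext u x v u = x := by simp [triNext]
  have ex : triNext u x v x = v := by simp [triNext, n1.symm]
  have ev : triNext u x v v = u := by simp [triNext, n3.symm, n2.symm]
  have hA : ∀ p, p ∈ ({u, x, v} : Finset Plane) → p = u ∨ p = x ∨ p = v := fun p hp => by
    simpa using hp
  have ho2 : 0 < ori x v u := by rwa [← ori_rot]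
  have ho3 : 0 < ori v u x := by rwa [← ori_rot]
  have hT : triInt u x v ⊆ tri u x v := fun y hy => ⟨hy.1.le, hy.2.1.le, hy.2.2.le⟩
  refine ⟨?_, ?_, ?_, ⟨u, by simp⟩, ?_, ?_, isOpen_triInt _ _ _, ?_, ?_, ?_, ?_⟩
  · intro p hp
    rcases hA p hp with rfl | rfl | rfl
    · rw [eu]; simp
    · rw [ex]; simp
    · rw [ev]; simp
  · intro p hp q hq e
    rcases hA p hp with rfl | rfl | rfl <;> rcases hA q hq with rfl | rfl | rfl <;>
      simp only [eu, ex, ev] at e <;> first | rfl | exact absurd e (by tauto)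
  · intro B hB hne hcl
    have k1 : u ∈ B → x ∈ B := fun h => by have := hcl _ h; rwa [eu] at this
    have k2 : x ∈ B → v ∈ B := fun h => by have := hcl _ h; rwa [ex] at this
    have k3 : v ∈ B → u ∈ B := fun h => by have := hcl _ h; rwa [ev] at this
    apply Finset.Subset.antisymm hB
    obtain ⟨b, hb⟩ := hne
    have : u ∈ B ∧ x ∈ B ∧ v ∈ B := by
      rcases hA b (hB hb) with rfl | rfl | rfl <;> tauto
    intro p hp
    rcases hA p hp with rfl | rfl | rfl <;> tauto
  · intro p hp
    rcases hA p hp with rfl | rfl | rfl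
    · rw [eu]; exact n1.symm
    · rw [ex]; exact n2.symm
    · rw [ev]; exact n3
  · intro p hp q hq hpq
    rw [Set.disjoint_left]
    intro y hy hy'
    rcases hA p hp with rfl | rfl | rfl <;> rcases hA q hq with rfl | rfl | rfl <;>
      simp only [eu, ex, ev] at hy hy' <;> first
        | exact hpq rfl
        | (have h1 := openSegment_ori ho hy; have h2 := ori_of_mem_segment hy'; linarith [h1.1, h1.2])
        | (have h1 := openSegment_ori ho2 hy; have h2 := ori_of_mem_segment hy'; linarith [h1.1, h1.2])
        | (have h1 := openSegment_ori ho3 hy; have h2 := ori_of_mem_segment hy'; linarith [h1.1, h1.2])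
  · set R := dist x u + dist v u + 1 with hR
    have d1 : 0 ≤ dist x u := dist_nonneg
    have d2 : 0 ≤ dist v u := dist_nonneg
    refine Metric.isBounded_ball.subset (hT.trans (tri_subset_of_convex ho (convex_ball u R) ?_ ?_ ?_))
    · rw [Metric.mem_ball, dist_self]; linarith
    · rw [Metric.mem_ball]; linarith
    · rw [Metric.mem_ball]; linarith
  · intro p hp
    rw [Set.disjoint_left]
    intro y hy hy'
    rcases hA p hp with rfl | rfl | rfl <;> simp only [eu, ex, ev] at hy' <;>
      have h2 := ori_of_mem_segment hy' <;> linarith [hy.1, hy.2.1, hy.2.2]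
  · intro y hy hyn
    have hyT : y ∈ tri u x v := closure_minimal hT (isClosed_tri _ _ _) hy
    by_cases h1 : ori u x y = 0
    · exact ⟨u, by simp, by rw [eu]; exact mem_segment_of_tri ho hyT h1⟩
    by_cases h2 : ori x v y = 0
    · exact ⟨x, by simp, by rw [ex]; exact mem_segment_of_tri₂ ho hyT h2⟩
    by_cases h3 : ori v u y = 0
    · exact ⟨v, by simp, by rw [ev, segment_symm]; exact mem_segment_of_tri₃ ho hyT h3⟩
    · exact absurd ⟨hyT.1.lt_of_ne' h1, hyT.2.1.lt_of_ne' h2, hyT.2.2.lt_of_ne' h3⟩ hyn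
  · intro p hp m hm
    rcases hA p hp with rfl | rfl | rfl
    · rw [eu] at hm ⊢; exact triangle_loc ho hm
    · rw [ex] at hm ⊢; rw [triInt_rot]; exact triangle_loc ho2 hm
    · rw [ev] at hm ⊢; rw [triInt_rot, triInt_rot]; exact triangle_loc ho3 hm

/-- Points off finitely many lines are dense. -/
theorem exists_generic (L : Finset (Plane × Plane)) (hL : ∀ l ∈ L, l.1 ≠ l.2) :
    ∀ (t : Plane) (Q : Plane → Prop), (∀ᶠ c in 𝓝 t, Q c) →
      ∃ c, Q c ∧ ∀ l ∈ L, ori l.1 l.2 c ≠ 0 := by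
  induction L using Finset.induction_on with
  | empty => intro t Q h; exact ⟨t, h.self_of_nhds, by simp⟩
  | insert l L hl ih =>
    intro t Q h
    obtain ⟨c, hc, hg⟩ := ih (fun l' hl' => hL l' (Finset.mem_insert_of_mem hl')) t _
      h.eventually_nhds
    by_cases h0 : ori l.1 l.2 c = 0
    · obtain ⟨r, hr⟩ := exists_ori_pos (hL l (Finset.mem_insert_self _ _))
      have hev : ∀ᶠ c' in 𝓝 c, ∀ l' ∈ L, ori l'.1 l'.2 c' ≠ 0 := by
        rw [Finset.eventually_all]
        intro l' hl'
        exact (continuous_ori _ _).continuousAt.eventually_ne (hg l' hl')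
      obtain ⟨s, s0, -, h1, h2⟩ := exists_pt_of_eventually r (hc.and hev) one_pos
      refine ⟨_, h1, fun l' hl' => ?_⟩
      rcases Finset.mem_insert.1 hl' with rfl | hl'
      · rw [ori_pt, h0, mul_zero, zero_add]; exact (mul_pos s0 hr).ne'
      · exact h2 l' hl'
    · refine ⟨c, hc.self_of_nhds, fun l' hl' => ?_⟩
      rcases Finset.mem_insert.1 hl' with rfl | hmem
      · exact h0
      · exact hg l' hmem

/-- A large triangle in general position. -/
theorem exists_triangle (V : Finset Plane) (L : Finset (Plane × Plane)) (hL : ∀ l ∈ L, l.1 ≠ l.2) :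
    ∃ u x v : Plane, (∀ y ∈ V, y ∈ triInt u x v) ∧ ∀ l ∈ L,
      ori l.1 l.2 u ≠ 0 ∧ ori l.1 l.2 x ≠ 0 ∧ ori l.1 l.2 v ≠ 0 := by
  obtain ⟨R, R0, hR⟩ : ∃ R : ℝ, 0 < R ∧ ∀ y ∈ V, |y 0| < R ∧ |y 1| < R := by
    refine ⟨1 + ∑ y ∈ V, (|y 0| + |y 1|), by positivity, fun y hy => ?_⟩
    have := Finset.single_le_sum (f := fun y : Plane => |y 0| + |y 1|)
      (fun y _ => by positivity) hy
    have h0 := abs_nonneg (y 0)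
    have h1 := abs_nonneg (y 1)
    simp only at this
    constructor <;> linarith
  set t₁ : Plane := WithLp.toLp 2 ![-4 * R, -2 * R] with ht₁
  set t₂ : Plane := WithLp.toLp 2 ![4 * R, -2 * R] with ht₂
  set t₃ : Plane := WithLp.toLp 2 ![0, 4 * R] with ht₃
  have h0 : ∀ y ∈ V, y ∈ triInt t₁ t₂ t₃ := by
    intro y hy
    obtain ⟨a, b⟩ := hR y hy
    rw [abs_lt] at a b
    refine ⟨?_, ?_, ?_⟩ <;>
      simp only [ori, ht₁, ht₂, ht₃, Matrix.cons_val_zero, Matrix.cons_val_one] <;> nlinarith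
  -- Containing `V` is an open condition on each corner, so the corners can be moved into general
  -- position one at a time.
  obtain ⟨u, hu, gu⟩ := exists_generic L hL t₁ (fun c => ∀ y ∈ V, y ∈ triInt c t₂ t₃) (by
    rw [Finset.eventually_all]
    intro y hy
    obtain ⟨a, b, c⟩ := h0 y hy
    rw [ori_rot] at a
    rw [← ori_rot] at c
    filter_upwards [eventually_ori_pos a, eventually_ori_pos c] with z ha hc
    exact ⟨by rwa [ori_rot], b, by rwa [← ori_rot]⟩)
  obtain ⟨x, hx, gx⟩ := exists_generic L hL t₂ (fun c => ∀ y ∈ V, y ∈ triInt u c t₃) (by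
    rw [Finset.eventually_all]
    intro y hy
    obtain ⟨a, b, c⟩ := hu y hy
    rw [← ori_rot] at a
    rw [ori_rot] at b
    filter_upwards [eventually_ori_pos a, eventually_ori_pos b] with z ha hb
    exact ⟨by rwa [← ori_rot], by rwa [ori_rot], c⟩)
  obtain ⟨v, hv, gv⟩ := exists_generic L hL t₃ (fun c => ∀ y ∈ V, y ∈ triInt u x c) (by
    rw [Finset.eventually_all]
    intro y hy
    obtain ⟨a, b, c⟩ := hx y hy
    rw [← ori_rot] at b
    rw [ori_rot] at c
    filter_upwards [eventually_ori_pos b, eventually_ori_pos c] with z hb hc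
    exact ⟨a, by rwa [← ori_rot], by rwa [ori_rot]⟩)
  exact ⟨u, x, v, hv, fun l hl => ⟨gu l hl, gx l hl, gv l hl⟩⟩

/-- Here `Δ` is the region itself, which makes `stay` vacuous; the three corners are auxiliary. -/
theorem exists_routeState_zero {V : Finset Plane} {Sg : Plane → Plane → Prop} (hS : SegSys V Sg)
    (hV : V.Nonempty) {n : ℕ} {a b : Fin n → Plane} {trace : Fin n → Set Plane}
    (hR : Routes V Sg a b trace) :
    ∃ Δ nx A G, Convex ℝ Δ ∧ RouteState V Sg a b trace Δ 0 nx A G := by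
  obtain ⟨u, x, v, hin, hg⟩ := exists_triangle V (Finset.univ.image fun j => (a j, b j)) (by
    intro l hl
    obtain ⟨j, -, rfl⟩ := Finset.mem_image.1 hl
    exact hS.ne (hR.sg j))
  have ho : 0 < ori u x v := by
    obtain ⟨y, hy⟩ := hV
    obtain ⟨a, b, c⟩ := hin y hy
    rw [← ori_sum u x v y]; linarith
  have hP := polyRegion_triangle ho
  obtain ⟨n1, n2, n3⟩ := ne_of_ori_ne ho.ne'
  have eu : triNext u x v u = x := by simp [triNext]
  have ex : triNext u x v x = v := by simp [triNext, n1.symm]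
  have ev : triNext u x v v = u := by simp [triNext, n3.symm, n2.symm]
  have ho2 : 0 < ori x v u := by rwa [← ori_rot]
  have ho3 : 0 < ori v u x := by rwa [← ori_rot]
  have hA : ∀ p, p ∈ ({u, x, v} : Finset Plane) → p = u ∨ p = x ∨ p = v := fun p hp => by
    simpa using hp
  have hnV : ∀ p ∈ ({u, x, v} : Finset Plane), p ∉ V := fun p hp hpV =>
    hP.notMem_of_vertex hp (hin p hpV)
  have hCC : ∀ p ∈ ({u, x, v} : Finset Plane), ConvexCorner (triInt u x v) p := by
    intro p hp
    rcases hA p hp with e | e | e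
    · have := hP.corner (u := v) (by simp) (by rw [ev, eu]; exact ho3)
      rw [ev, eu] at this
      rw [e]; exact ⟨v, x, ho3, this⟩
    · have := hP.corner (u := u) (by simp) (by rw [eu, ex]; exact ho)
      rw [eu, ex] at this
      rw [e]; exact ⟨u, v, ho, this⟩
    · have := hP.corner (u := x) (by simp) (by rw [ex, ev]; exact ho2)
      rw [ex, ev] at this
      rw [e]; exact ⟨x, u, ho2, this⟩
  refine ⟨triInt u x v, _, _, _, convex_triInt _ _ _, ⟨hP, fun y hy => Or.inl (hin y hy),
    fun c d hcd => Or.inl ((openSegment_subset_segment ℝ _ _).trans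
      ((convex_triInt _ _ _).segment_subset (hin _ (hS.mem hcd)) (hin _ (hS.mem' hcd))))⟩,
    ?_, fun y hy _ => hCC y hy, fun y hy hyV => absurd hyV (hnV y hy), by simp, ?_,
    fun y hy => Or.inl (hnV y hy), Subset.rfl, by simp, fun y hy hy' => absurd hy hy'⟩
  · intro y hy
    obtain ⟨r, hr⟩ := (hCC y hy).blocked (hP.notMem_of_vertex hy)
    exact not_halfFree_of_blocked sdiff_subset hr
  · intro y hy _ j
    have := hg (a j, b j) (Finset.mem_image.2 ⟨j, Finset.mem_univ _, rfl⟩)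
    rcases hA y hy with e | e | e
    · rw [e]; exact this.1
    · rw [e]; exact this.2.1
    · rw [e]; exact this.2.2

/-- There is a polygon through endpoints, among them all `b i`, such that the extensions of all
other segment ends meet segments before they leave the polygon. -/
theorem exists_visited {V : Finset Plane} {Sg : Plane → Plane → Prop} (hS : SegSys V Sg)
    (hnc : ∀ p q : Plane, p ≠ q → ∃ y ∈ V, ori p q y ≠ 0) (hV : V.Nonempty)
    {n : ℕ} {a b : Fin n → Plane} {trace : Fin n → Set Plane} (hR : Routes V Sg a b trace) :
    ∃ nx A G, St V Sg nx A G ∧ A ⊆ V ∧ (∀ i, b i ∈ A) ∧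
      (∀ y ∈ A, ¬ HalfFree (G \ segUnion Sg) G y) ∧ ExtensionsHit Sg V G := by
  obtain ⟨Δ, nx, A, G, hΔ, h0⟩ := exists_routeState_zero hS hV hR
  obtain ⟨nx₁, A₁, G₁, h1⟩ := h0.all hS hR hΔ n le_rfl
  obtain ⟨nx₂, A₂, G₂, h2, -, k2, k3, k4⟩ := St.cutAll hS hnc _ nx₁ A₁ G₁ h1.toSt h1.half h1.conv
    le_rfl
  obtain ⟨nx₃, A₃, G₃, h3, l1, l2, l3, l4⟩ := exists_extensionsHit hS hnc
    (Finset.univ.image b) _ nx₂ A₂ G₂ h2 k2 (by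
      intro y hy
      obtain ⟨i, -, rfl⟩ := Finset.mem_image.1 hy
      exact k3 (Finset.mem_inter.2 ⟨h1.done i i.2, hS.mem' (hR.sg i)⟩)) k4 le_rfl
  exact ⟨nx₃, A₃, G₃, h3, l1, fun i => l2 (Finset.mem_image.2 ⟨i, Finset.mem_univ _, rfl⟩), l3, l4⟩

/-! ### Convexity of components without half free boundary points -/

theorem segment_subset_of_collinear {y m₀ m₁ : Plane} (h : ori y m₀ m₁ = 0) :
    segment ℝ y m₁ ⊆ segment ℝ y m₀ ∪ segment ℝ m₀ m₁ := by
  by_cases hy : y = m₀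
  · rw [hy]; exact subset_union_right
  obtain ⟨c, rfl⟩ := mem_line_of_ori_eq_zero hy h
  intro z hz
  obtain ⟨t, t0, t1, rfl⟩ := mem_segment_pt.1 hz
  rw [pt_pt]
  by_cases h1 : 0 ≤ c * t ∧ c * t ≤ 1
  · exact Or.inl (pt_mem_segment h1.1 h1.2)
  · right
    have hc : c ≠ 1 := by rintro rfl; exact h1 ⟨by linarith, by linarith⟩
    refine mem_segment_pt.2 ⟨(c * t - 1) / (c - 1), ?_, ?_, ?_⟩
    · rcases lt_or_gt_of_ne hc with g | g
      · apply div_nonneg_of_nonpos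
        · by_contra hh
          exact h1 ⟨by nlinarith, by nlinarith⟩
        · linarith
      · apply div_nonneg
        · by_contra hh
          exact h1 ⟨by nlinarith, by nlinarith⟩
        · linarith
    · rcases lt_or_gt_of_ne hc with g | g
      · rw [div_le_one_of_neg (by linarith)]
        by_cases c0 : c < 0
        · nlinarith
        · exact absurd ⟨by nlinarith, by nlinarith⟩ h1
      · rw [div_le_one (by linarith)]; nlinarith
    · have : pt m₀ (pt y m₀ c) ((c * t - 1) / (c - 1)) =
          pt y m₀ (1 + (c * t - 1) / (c - 1) * (c - 1)) := by
        apply plane_ext <;> simp only [pt_apply] <;> ring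
      rw [this, div_mul_cancel₀ _ (sub_ne_zero.2 hc)]; congr 1; ring

theorem eventually_segment_subset {F : Set Plane} (hF : IsOpen F) {y m : Plane}
    (h : segment ℝ y m ⊆ F) : ∀ᶠ m' in 𝓝 m, segment ℝ y m' ⊆ F := by
  have hcomp : IsCompact (segment ℝ y m) := by
    rw [segment_eq_image']; exact isCompact_Icc.image (by fun_prop)
  obtain ⟨δ, δ0, hδ⟩ := hcomp.exists_thickening_subset_open hF h
  filter_upwards [Metric.ball_mem_nhds m δ0] with m' hball
  refine (((convex_segment y m).thickening δ).segment_subset ?_ ?_).trans hδ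
  · exact Metric.self_subset_thickening δ0 _ (left_mem_segment ℝ y m)
  · exact Metric.ball_subset_thickening (right_mem_segment ℝ y m) δ hball

/-- Points of a triangle near its third side are seen from `y` on the opposite side. -/
theorem exists_pt_pt {y m₀ m z : Plane} (h1 : 0 ≤ ori m₀ m z / ori y m₀ m)
    (h2 : 0 < ori m y z / ori y m₀ m) (h3 : 0 < ori y m₀ z / ori y m₀ m) (hD : ori y m₀ m ≠ 0) :
    ∃ σ t : ℝ, 0 < σ ∧ σ < 1 ∧ 0 < t ∧ t ≤ 1 ∧ z = pt y (pt m₀ m σ) t := by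
  have e := eq_bary hD z
  have hs : ori m₀ m z / ori y m₀ m + ori m y z / ori y m₀ m + ori y m₀ z / ori y m₀ m = 1 := by
    rw [← add_div, ← add_div, div_eq_one_iff_eq hD, ← ori_sum y m₀ m z]; ring
  set α := ori m₀ m z / ori y m₀ m
  set β := ori m y z / ori y m₀ m
  set γ := ori y m₀ z / ori y m₀ m
  have hbg : 0 < β + γ := by linarith
  refine ⟨γ / (β + γ), β + γ, div_pos h3 hbg, (div_lt_one hbg).2 (by linarith), hbg,
    by linarith, ?_⟩
  rw [e]
  have : α = 1 - β - γ := by linarith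
  apply plane_ext <;>
    simp only [pt_apply, PiLp.add_apply, PiLp.smul_apply, smul_eq_mul] <;> rw [this] <;>
    field_simp <;> ring

/-- Visibility is preserved when moving inside the set. -/
theorem segment_subset_of_not_halfFree {F : Set Plane} (hF : IsOpen F)
    (hH : ∀ e, e ∉ F → ¬ HalfFree F F e) {y m₀ m₁ : Plane} (h0 : segment ℝ y m₀ ⊆ F)
    (h1 : segment ℝ m₀ m₁ ⊆ F) : segment ℝ y m₁ ⊆ F := by
  by_cases hcol : ori y m₀ m₁ = 0
  · exact (segment_subset_of_collinear hcol).trans (union_subset h0 h1)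
  by_contra hn
  -- The infimum of `E` is the first moment at which the view from `y` to the moving point is
  -- blocked.
  set E : Set ℝ := {τ | 0 ≤ τ ∧ τ ≤ 1 ∧ ¬ segment ℝ y (pt m₀ m₁ τ) ⊆ F} with hE
  have hEc : IsClosed E := by
    have : E = Icc 0 1 ∩ {τ | ¬ segment ℝ y (pt m₀ m₁ τ) ⊆ F} := by
      ext τ; simp only [hE, mem_ofPred_eq, mem_inter_iff, mem_Icc]; tauto
    rw [this]
    refine isClosed_Icc.inter ?_
    rw [← isOpen_compl_iff, isOpen_iff_mem_nhds]
    intro τ hτ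
    have hτ : segment ℝ y (pt m₀ m₁ τ) ⊆ F := by
      by_contra hc; exact hτ hc
    filter_upwards [(continuous_pt m₀ m₁).continuousAt.eventually
      (eventually_segment_subset hF hτ)] with τ' hτ' hc using hc hτ'
  have hE1 : (1 : ℝ) ∈ E := ⟨zero_le_one, le_rfl, by rwa [pt_one]⟩
  have hbd : BddBelow E := ⟨0, fun τ hτ => hτ.1⟩
  obtain ⟨s0, s1, s2⟩ := hEc.csInf_mem ⟨1, hE1⟩ hbd
  set τ := sInf E with hτ
  have hlt : ∀ τ', 0 ≤ τ' → τ' < τ → segment ℝ y (pt m₀ m₁ τ') ⊆ F := by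
    intro τ' a b
    by_contra hc
    exact absurd (csInf_le hbd (show τ' ∈ E from ⟨a, by linarith, hc⟩)) (not_le.2 b)
  have hτ0 : 0 < τ := s0.lt_of_ne (by
    intro e; apply s2; rw [← e, pt_zero]; exact h0)
  set m := pt m₀ m₁ τ with hm
  have hD : ori y m₀ m ≠ 0 := by
    rw [hm, ori_pt, ori_self_right, mul_zero, zero_add]; exact mul_ne_zero hτ0.ne' hcol
  have hmF : m ∈ F := h1 (pt_mem_segment s0 s1)
  have hyF : y ∈ F := h0 (left_mem_segment ℝ _ _)
  -- Let `e` be the blocked point farthest from `y` on this line of sight. The earlier lines of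
  -- sight swept a half disc at `e` on the side of `m₀`, and the ray from `e` towards `m` starts in
  -- `F`, so `e` is half free.
  set K : Set ℝ := {t | 0 ≤ t ∧ t ≤ 1 ∧ pt y m t ∉ F} with hK
  have hKc : IsClosed K := by
    have : K = Icc 0 1 ∩ (fun t => pt y m t) ⁻¹' Fᶜ := by
      ext t; simp only [hK, mem_ofPred_eq, mem_inter_iff, mem_Icc, mem_preimage, mem_compl_iff]
      tauto
    rw [this]
    exact isClosed_Icc.inter (hF.isClosed_compl.preimage (continuous_pt y m))
  have hKn : K.Nonempty := by
    obtain ⟨z, hz, hzF⟩ := Set.not_subset.1 s2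
    obtain ⟨t, t0, t1, rfl⟩ := mem_segment_pt.1 hz
    exact ⟨t, t0, t1, hzF⟩
  have hKb : BddAbove K := ⟨1, fun t ht => ht.2.1⟩
  obtain ⟨t0, t1, t2⟩ := hKc.csSup_mem hKn hKb
  set t := sSup K with ht
  have hgt : ∀ t', t < t' → t' ≤ 1 → pt y m t' ∈ F := by
    intro t' a b
    by_contra hc
    exact absurd (le_csSup hKb (show t' ∈ K from ⟨by linarith, b, hc⟩)) (not_le.2 a)
  have t0 : 0 < t := t0.lt_of_ne (by intro e; apply t2; rw [← e, pt_zero]; exact hyF)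
  have t1 : t < 1 := t1.lt_of_ne (by intro e; apply t2; rw [e, pt_one]; exact hmF)
  set e := pt y m t with he
  have hym : y ≠ m := (ne_of_ori_ne hD).2.2
  have hs : ori y m m₀ ≠ 0 := by rw [ori_swap']; exact neg_ne_zero.2 hD
  refine hH e t2 ⟨m, ?_, ori y m m₀, hs, ?_, ?_⟩
  · intro hh
    have : pt y m 1 = pt y m t := by rw [pt_one]; exact hh
    have := pt_inj hym this
    linarith
  · have c1 : 0 < ori m₀ m e / ori y m₀ m := by
      have : ori m₀ m e = (1 - t) * ori y m₀ m := by
        rw [he, ori_pt, ori_self_right, mul_zero, add_zero, ← ori_rot]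
      rw [this, mul_div_assoc, div_self hD, mul_one]; linarith
    have c3 : 0 < ori y m₀ e / ori y m₀ m := by
      have : ori y m₀ e = t * ori y m₀ m := by
        rw [he, ori_pt, ori_self_left, mul_zero, zero_add]
      rw [this, mul_div_assoc, div_self hD, mul_one]; linarith
    have k1 : ∀ᶠ z in 𝓝 e, 0 < ori m₀ m z / ori y m₀ m :=
      ((continuous_ori m₀ m).div_const _).continuousAt.eventually (lt_mem_nhds c1)
    have k3 : ∀ᶠ z in 𝓝 e, 0 < ori y m₀ z / ori y m₀ m :=
      ((continuous_ori y m₀).div_const _).continuousAt.eventually (lt_mem_nhds c3)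
    filter_upwards [k1, k3] with z z1 z3 hz
    have z2 : 0 < ori m y z / ori y m₀ m := by
      have e1 : ori e m z = (1 - t) * ori y m z := by
        rw [he]; simp only [ori, pt_apply]; ring
      rw [e1] at hz
      have hz' : 0 < ori y m m₀ * ori y m z := by
        have : ori y m m₀ * ((1 - t) * ori y m z) = (1 - t) * (ori y m m₀ * ori y m z) := by ring
        rw [this] at hz
        exact pos_of_mul_pos_right hz (by linarith)
      rw [ori_swap m y z, ori_swap' y m₀ m, neg_div_neg_eq]
      rw [div_pos_iff]
      rcases mul_pos_iff.1 hz' with q | q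
      · exact Or.inl ⟨q.2, q.1⟩
      · exact Or.inr ⟨q.2, q.1⟩
    obtain ⟨σ, t', σ0, σ1, t0', t1', ez⟩ := exists_pt_pt z1.le z2 z3 hD
    rw [hm, pt_pt] at ez
    rw [ez]
    exact hlt (τ * σ) (by positivity) (by nlinarith) (pt_mem_segment t0'.le t1')
  · have : ∀ᶠ s : ℝ in 𝓝[>] 0, s ∈ Ioo (0:ℝ) 1 := Ioo_mem_nhdsGT one_pos
    filter_upwards [this] with s hs
    have e1 : pt e m s = pt y m (t + s * (1 - t)) := by
      rw [he]; apply plane_ext <;> simp only [pt_apply] <;> ring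
    rw [e1]
    exact hgt _ (by nlinarith [hs.1]) (by nlinarith [hs.1, hs.2])

/-- The components of an open set without half free boundary points are convex. -/
theorem convex_connectedComponentIn {F : Set Plane} (hF : IsOpen F)
    (hH : ∀ e, e ∉ F → ¬ HalfFree F F e) (c : Plane) : Convex ℝ (connectedComponentIn F c) := by
  rw [convex_iff_segment_subset]
  intro y hy m hm
  have hyc : connectedComponentIn F y = connectedComponentIn F c :=
    (connectedComponentIn_eq hy).symm
  rw [← hyc] at hm ⊢
  have hyF : y ∈ F := connectedComponentIn_subset F c hy
  set C := connectedComponentIn F y with hC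
  have hCo : IsOpen C := hF.connectedComponentIn
  have hCF : C ⊆ F := connectedComponentIn_subset F y
  have hCp : IsPreconnected C := isPreconnected_connectedComponentIn
  have hyC : y ∈ C := mem_connectedComponentIn hyF
  -- Within the component, the points seen from `y` form an open set by compactness, and so do the
  -- unseen ones by `segment_subset_of_not_halfFree`. Connectedness leaves only the former.
  have hU : IsOpen {m | segment ℝ y m ⊆ F} := isOpen_iff_mem_nhds.2 fun m hm =>
    eventually_segment_subset hF hm
  have hU2 : IsOpen {m | m ∈ C ∧ ¬ segment ℝ y m ⊆ F} := by
    rw [Metric.isOpen_iff]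
    rintro m ⟨hmC, hmn⟩
    obtain ⟨ε, ε0, hε⟩ := Metric.isOpen_iff.1 hCo m hmC
    refine ⟨ε, ε0, fun m' hm' => ⟨hε hm', fun hs => hmn ?_⟩⟩
    refine segment_subset_of_not_halfFree hF hH hs (((convex_ball m ε).segment_subset hm' ?_).trans
      (hε.trans hCF))
    exact Metric.mem_ball_self ε0
  have key : segment ℝ y m ⊆ F := by
    by_contra hn
    obtain ⟨z, -, h1, h2⟩ := hCp _ _ hU hU2 (fun z hz => by
      by_cases h : segment ℝ y z ⊆ F
      · exact Or.inl h
      · exact Or.inr ⟨hz, h⟩) ⟨y, hyC, by simpa using hyF⟩ ⟨m, hm, hm, hn⟩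
    exact h2.2 h1
  exact (convex_segment y m).isPreconnected.subset_connectedComponentIn
    (left_mem_segment ℝ _ _) key

/-! ### Convex open sets and chords of their closures -/

section
variable {C : Set Plane}

theorem openSegment_subset_of_mem_closure (hC : Convex ℝ C) (ho : IsOpen C) {c p : Plane}
    (hc : c ∈ C) (hp : p ∈ closure C) : openSegment ℝ c p ⊆ C := by
  have := hC.openSegment_interior_closure_subset_interior (by rwa [ho.interior_eq]) hp
  rwa [ho.interior_eq] at this

theorem openSegment_subset_of_line (hC : Convex ℝ C) (ho : IsOpen C) {p q k : Plane}
    (hp : p ∈ closure C) (hq : q ∈ closure C) (hk : k ∈ C) (hl : ori p q k = 0) (hpq : p ≠ q) :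
    openSegment ℝ p q ⊆ C := by
  have h1 := openSegment_subset_of_mem_closure hC ho hk hp
  have h2 := openSegment_subset_of_mem_closure hC ho hk hq
  obtain ⟨c, rfl⟩ := mem_line_of_ori_eq_zero hpq hl
  intro m hm
  obtain ⟨t, t0, t1, rfl⟩ := mem_openSegment_pt.1 hm
  rcases lt_trichotomy t c with h | h | h
  · apply h1
    rw [openSegment_symm]
    have := pt_between (p := p) (q := q) t0 h
    rwa [pt_zero] at this
  · rwa [h]
  · apply h2
    have := pt_between (p := p) (q := q) h t1
    rwa [pt_one] at this

/-- A convex open set lies strictly on one side of a chord of its closure not contained in it. -/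
theorem one_side (hC : Convex ℝ C) (ho : IsOpen C) {p q m : Plane} (hpq : p ≠ q)
    (hp : p ∈ closure C) (hq : q ∈ closure C) (hm : m ∈ openSegment ℝ p q) (hmC : m ∉ C) :
    (∀ c ∈ C, 0 < ori p q c) ∨ ∀ c ∈ C, ori p q c < 0 := by
  have h0 : ∀ c ∈ C, ori p q c ≠ 0 := fun c hc h =>
    hmC (openSegment_subset_of_line hC ho hp hq hc h hpq hm)
  by_contra hcon
  push Not at hcon
  obtain ⟨⟨a, ha, ha'⟩, b, hb, hb'⟩ := hcon
  have ha' := ha'.lt_of_ne (h0 a ha)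
  have hb' := hb'.lt_of_ne (h0 b hb).symm
  have hd : 0 < ori p q b - ori p q a := by linarith
  set σ := -ori p q a / (ori p q b - ori p q a) with hσ
  have hmem : pt a b σ ∈ C := hC.segment_subset ha hb (pt_mem_segment
    (div_nonneg (by linarith) hd.le) ((div_le_one hd).2 (by linarith)))
  refine h0 _ hmem ?_
  rw [ori_pt, hσ]; field_simp; ring

/-- Each point inside the triangle is strictly between `c` and a point of the chord `p q`, which is
in the closure of `C`. The quotients make the statement independent of the orientation. -/
theorem triInt_subset (hC : Convex ℝ C) (ho : IsOpen C) {p q c z : Plane}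
    (hp : p ∈ closure C) (hq : q ∈ closure C) (hc : c ∈ C)
    (h1 : 0 < ori q c z / ori p q c) (h2 : 0 < ori c p z / ori p q c)
    (h3 : 0 < ori p q z / ori p q c) (hD : ori p q c ≠ 0) : z ∈ C := by
  have r : ∀ a, ori c p a = ori p a c := fun a => ori_rot _ _ _
  have e1 : ori p q c = ori c p q := by rw [ori_rot p q c, ori_rot q c p]
  rw [e1] at h1 h2 h3 hD
  obtain ⟨σ, t, σ0, σ1, t0, t1, e⟩ := exists_pt_pt (y := c) (m₀ := p) (m := q) (z := z)
    h3.le h1 h2 hD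
  have hk : pt p q σ ∈ closure C :=
    hC.closure.segment_subset hp hq (pt_mem_segment σ0.le σ1.le)
  rcases t1.eq_or_lt with h | h
  · exfalso
    rw [h, pt_one] at e
    have : ori p q z = 0 := by rw [e, ori_pt]; simp
    rw [this] at h3; simp at h3
  · rw [e]
    exact openSegment_subset_of_mem_closure hC ho hc hk (pt_mem_openSegment t0 h)

/-- Half discs of a convex open set at inner points of a chord of its closure. -/
theorem eventually_mem_of_chord (hC : Convex ℝ C) (ho : IsOpen C) {p q c m : Plane}
    (hp : p ∈ closure C) (hq : q ∈ closure C) (hc : c ∈ C) (hD : ori p q c ≠ 0)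
    (hm : m ∈ openSegment ℝ p q) : ∀ᶠ z in 𝓝 m, 0 < ori p q c * ori p q z → z ∈ C := by
  obtain ⟨t, t0, t1, rfl⟩ := mem_openSegment_pt.1 hm
  have c1 : 0 < ori q c (pt p q t) / ori p q c := by
    have : ori q c (pt p q t) = (1 - t) * ori p q c := by
      rw [ori_pt, ori_self_left, mul_zero, add_zero, ← ori_rot]
    rw [this, mul_div_assoc, div_self hD, mul_one]; linarith
  have c2 : 0 < ori c p (pt p q t) / ori p q c := by
    have : ori c p (pt p q t) = t * ori p q c := by
      rw [ori_pt, ori_self_right, mul_zero, zero_add, ori_rot c p q]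
    rw [this, mul_div_assoc, div_self hD, mul_one]; linarith
  filter_upwards [((continuous_ori q c).div_const _).continuousAt.eventually (lt_mem_nhds c1),
    ((continuous_ori c p).div_const _).continuousAt.eventually (lt_mem_nhds c2)] with z z1 z2 hz
  refine triInt_subset hC ho hp hq hc z1 z2 ?_ hD
  rw [div_pos_iff]
  rcases mul_pos_iff.1 hz with h | h
  · exact Or.inl ⟨h.2, h.1⟩
  · exact Or.inr ⟨h.2, h.1⟩

end

/-! ### Prolonging the segments to walls -/

/-- Every segment is listed exactly once, with an orientation. -/
structure Labels (Sg : Plane → Plane → Prop) {n : ℕ} (a b : Fin n → Plane) : Prop where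
  sg : ∀ i, Sg (b i) (a i)
  cover : ∀ y y', Sg y y' → ∃ i, (y = a i ∧ y' = b i) ∨ (y = b i ∧ y' = a i)
  disj : ∀ i j, i ≠ j → Disjoint (segment ℝ (b i) (a i)) (segment ℝ (b j) (a j))

/-- The segments `b i, a i` are prolonged to `b i, x i`, until they hit another one. -/
structure Walls (V : Finset Plane) (Sg : Plane → Plane → Prop) (A : Finset Plane) (G : Set Plane)
    {n : ℕ} (a b x : Fin n → Plane) : Prop where
  ne : ∀ i, b i ≠ x i
  tip : ∀ i, a i ∈ segment ℝ (b i) (x i) ∧ a i ≠ b i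
  isOpen : ∀ i, a i ∈ G → openSegment ℝ (b i) (x i) ⊆ G
  sub : ∀ i, x i ∈ G ∨ x i ∈ segUnion Sg
  visited : ∀ i, a i ∉ G → x i = a i
  meet : ∀ i j m, i ≠ j → m ∈ segment ℝ (b i) (x i) → m ∈ segment ℝ (b j) (x j) →
    m = x i ∨ m = x j
  -- Walls run straight through every unvisited tip; the continuation may be covered by a wall other
  -- than that of the tip.
  germ : ∀ i, a i ∈ G → ∃ t : ℝ, 1 < t ∧
    segment ℝ (b i) (pt (b i) (a i) t) ⊆ ⋃ j, segment ℝ (b j) (x j)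
  -- This keeps wall ends from being half free: an end is a vertex or is passed by a straight piece
  -- of walls.
  straight : ∀ i, a i ∈ G → x i ∈ A ∨ ∃ p q, p ≠ q ∧ x i ∈ openSegment ℝ p q ∧
    segment ℝ p q ⊆ ⋃ j, segment ℝ (b j) (x j)

/-- The walls when only the segments of `K` have been prolonged, by the factors `T`. -/
structure PreWalls (Sg : Plane → Plane → Prop) (A : Finset Plane) (G : Set Plane)
    {n : ℕ} (a b : Fin n → Plane) (K : Finset (Fin n)) (T : Fin n → ℝ) : Prop where
  one_le : ∀ i, 1 ≤ T i
  eq_one : ∀ i, i ∉ K ∨ a i ∉ G → T i = 1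
  mem : ∀ i, a i ∈ G → ∀ t, 1 ≤ t → t < T i → pt (b i) (a i) t ∈ G
  sub : ∀ i, pt (b i) (a i) (T i) ∈ G ∨ pt (b i) (a i) (T i) ∈ segUnion Sg
  -- The factor above 1 records that only the end of a wall that has really been prolonged can be a
  -- meeting point.
  meet : ∀ i j m, i ≠ j → m ∈ segment ℝ (b i) (pt (b i) (a i) (T i)) →
    m ∈ segment ℝ (b j) (pt (b j) (a j) (T j)) →
    (m = pt (b i) (a i) (T i) ∧ 1 < T i) ∨ (m = pt (b j) (a j) (T j) ∧ 1 < T j)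
  germ : ∀ i ∈ K, a i ∈ G → ∃ t : ℝ, 1 < t ∧ segment ℝ (b i) (pt (b i) (a i) t) ⊆
    ⋃ j, segment ℝ (b j) (pt (b j) (a j) (T j))
  -- The last alternative is temporary: the wall ends at a tip that has not been treated yet, and
  -- treating that tip makes the point an inner point of a straight piece.
  straight : ∀ i ∈ K, a i ∈ G → pt (b i) (a i) (T i) ∈ A ∨
    (∃ p q, p ≠ q ∧ pt (b i) (a i) (T i) ∈ openSegment ℝ p q ∧
      segment ℝ p q ⊆ ⋃ j, segment ℝ (b j) (pt (b j) (a j) (T j))) ∨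
    ∃ j, j ∉ K ∧ a j ∈ G ∧ pt (b i) (a i) (T i) = a j

theorem mem_segment_pt_iff {p q : Plane} {T : ℝ} (hT : 1 ≤ T) {m : Plane} :
    m ∈ segment ℝ p (pt p q T) ↔ ∃ t, 0 ≤ t ∧ t ≤ T ∧ m = pt p q t := by
  rw [mem_segment_pt]
  constructor
  · rintro ⟨t, t0, t1, rfl⟩
    exact ⟨T * t, by positivity, by nlinarith, pt_pt _ _ _ _⟩
  · rintro ⟨t, t0, t1, rfl⟩
    refine ⟨t / T, by positivity, (div_le_one (by linarith)).2 t1, ?_⟩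
    rw [pt_pt, mul_div_cancel₀ _ (by linarith)]

section
variable {V : Finset Plane} {Sg : Plane → Plane → Prop} {nx : Plane → Plane} {A : Finset Plane}
  {G : Set Plane} {n : ℕ} {a b : Fin n → Plane}

theorem preWalls_empty (hL : Labels Sg a b) : PreWalls Sg A G a b ∅ fun _ => 1 where
  one_le _ := le_rfl
  eq_one _ _ := rfl
  mem i _ t h1 h2 := absurd h2 (not_lt.2 h1)
  sub i := Or.inr ⟨b i, a i, hL.sg i, by rw [pt_one]; exact right_mem_segment ℝ _ _⟩
  meet i j m hij hi hj := by
    rw [pt_one] at hi hj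
    exact absurd hj (disjoint_left.1 (hL.disj i j hij) hi)
  germ i hi := absurd hi (Finset.notMem_empty i)
  straight i hi := absurd hi (Finset.notMem_empty i)

/-- The wall `k` is prolonged until it first hits another wall, which by `ExtensionsHit` happens
before it leaves `G`. If the prolongation starts along another wall, then the tip is already passed
straight and the wall stays as it is. -/
theorem PreWalls.step (hS : SegSys V Sg) (hL : Labels Sg a b) (hb : ∀ i, b i ∈ A)
    (hVA : ∀ i, a i ∈ G ∨ a i ∈ A)
    (hE : ExtensionsHit Sg V G) {K : Finset (Fin n)} {T : Fin n → ℝ}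
    (h : PreWalls Sg A G a b K T) {k : Fin n} (hk : k ∉ K) :
    ∃ T', PreWalls Sg A G a b (insert k K) T' := by
  have hTk : T k = 1 := h.eq_one k (Or.inl hk)
  by_cases hkG : a k ∈ G
  swap
  · refine ⟨T, h.one_le, fun i hi => ?_, h.mem, h.sub, h.meet, fun i hi hiG => ?_,
      fun i hi hiG => ?_⟩
    · rcases hi with hi | hi
      · exact h.eq_one i (Or.inl fun hc => hi (Finset.mem_insert_of_mem hc))
      · exact h.eq_one i (Or.inr hi)
    · rcases Finset.mem_insert.1 hi with rfl | hi
      · exact absurd hiG hkG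
      · exact h.germ i hi hiG
    · rcases Finset.mem_insert.1 hi with rfl | hi
      · exact absurd hiG hkG
      · rcases h.straight i hi hiG with g | g | ⟨j, j1, j2, j3⟩
        · exact Or.inl g
        · exact Or.inr (Or.inl g)
        · refine Or.inr (Or.inr ⟨j, fun hc => ?_, j2, j3⟩)
          rcases Finset.mem_insert.1 hc with rfl | hc
          · exact hkG j2
          · exact j1 hc
  have hne : b k ≠ a k := hS.ne (hL.sg k)
  have ne_pt : ∀ {t : ℝ}, 0 < t → b k ≠ pt (b k) (a k) t := by
    intro t ht e
    have : pt (b k) (a k) 0 = pt (b k) (a k) t := by rw [pt_zero]; exact e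
    have := pt_inj hne this
    linarith
  set O : Set Plane := ⋃ j ∈ Finset.univ.erase k, segment ℝ (b j) (pt (b j) (a j) (T j)) with hO
  have hOc : IsClosed O := isClosed_biUnion_finset fun j _ => isClosed_segment _ _
  have memO : ∀ m, m ∈ O ↔ ∃ j, j ≠ k ∧ m ∈ segment ℝ (b j) (pt (b j) (a j) (T j)) := by
    intro m; simp [hO]
  by_cases hgerm : ∃ᶠ t in 𝓝[>] (1 : ℝ), pt (b k) (a k) t ∈ O
  · -- the germ of the prolongation is covered by an opposite wall
    have : ∃ j, j ≠ k ∧ ∃ᶠ t in 𝓝[>] (1 : ℝ),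
        pt (b k) (a k) t ∈ segment ℝ (b j) (pt (b j) (a j) (T j)) := by
      by_contra hcon
      push Not at hcon
      have : ∀ᶠ t in 𝓝[>] (1 : ℝ), ∀ j, j ≠ k →
          pt (b k) (a k) t ∉ segment ℝ (b j) (pt (b j) (a j) (T j)) := by
        rw [eventually_all]
        intro j
        by_cases hj : j = k
        · exact Eventually.of_forall fun t ht => absurd hj ht
        · exact (hcon j hj).mono fun t ht _ => ht
      obtain ⟨t, ht, ht'⟩ := (hgerm.and_eventually this).exists
      obtain ⟨j, j1, j2⟩ := (memO _).1 ht
      exact ht' j j1 j2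
    obtain ⟨j, hj, hf⟩ := this
    have hak : a k ∈ segment ℝ (b j) (pt (b j) (a j) (T j)) := by
      refine (isClosed_segment _ _).closure_subset
        ((mem_closure_iff_frequently).2 ?_)
      have ht : Tendsto (fun t : ℝ => pt (b k) (a k) t) (𝓝[>] 1) (𝓝 (a k)) := by
        have := (continuous_pt (b k) (a k)).continuousAt (x := (1 : ℝ))
        rw [ContinuousAt, pt_one] at this
        exact this.mono_left nhdsWithin_le_nhds
      exact ht.frequently hf
    obtain ⟨t, ht, ht1⟩ := (hf.and_eventually self_mem_nhdsWithin).exists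
    have ht1 : 1 < t := ht1
    have hsub : segment ℝ (b k) (pt (b k) (a k) t) ⊆
        ⋃ j, segment ℝ (b j) (pt (b j) (a j) (T j)) := by
      intro m hm
      obtain ⟨s, s0, s1, rfl⟩ := (mem_segment_pt_iff ht1.le).1 hm
      rcases le_total s 1 with hs | hs
      · refine mem_iUnion.2 ⟨k, ?_⟩
        rw [hTk, pt_one]; exact pt_mem_segment s0 hs
      · refine mem_iUnion.2 ⟨j, (convex_segment _ _).segment_subset hak ht ?_⟩
        refine mem_segment_pt.2 ⟨(s - 1) / (t - 1), div_nonneg (by linarith) (by linarith),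
          (div_le_one (by linarith)).2 (by linarith), ?_⟩
        have : pt (a k) (pt (b k) (a k) t) ((s - 1) / (t - 1)) =
            pt (b k) (a k) (1 + (s - 1) / (t - 1) * (t - 1)) := by
          apply plane_ext <;> simp only [pt_apply] <;> ring
        rw [this, div_mul_cancel₀ _ (by linarith)]; congr 1; ring
    have hstr : ∃ p q, p ≠ q ∧ a k ∈ openSegment ℝ p q ∧
        segment ℝ p q ⊆ ⋃ j, segment ℝ (b j) (pt (b j) (a j) (T j)) := by
      refine ⟨b k, pt (b k) (a k) t, ne_pt (by linarith), ?_, ?_⟩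
      · refine mem_openSegment_pt.2 ⟨1 / t, by positivity, (div_lt_one (by linarith)).2 ht1, ?_⟩
        rw [pt_pt, mul_one_div_cancel (by linarith), pt_one]
      · exact hsub
    refine ⟨T, h.one_le, fun i hi => ?_, h.mem, h.sub, h.meet, fun i hi hiG => ?_,
      fun i hi hiG => ?_⟩
    · rcases hi with hi | hi
      · exact h.eq_one i (Or.inl fun hc => hi (Finset.mem_insert_of_mem hc))
      · exact h.eq_one i (Or.inr hi)
    · rcases Finset.mem_insert.1 hi with rfl | hi
      · exact ⟨t, ht1, hsub⟩
      · exact h.germ i hi hiG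
    · rcases Finset.mem_insert.1 hi with rfl | hi
      · rw [hTk, pt_one]; exact Or.inr (Or.inl hstr)
      · rcases h.straight i hi hiG with g | g | ⟨j', j1, j2, j3⟩
        · exact Or.inl g
        · exact Or.inr (Or.inl g)
        · by_cases hc : j' = k
          · rw [j3, hc]; exact Or.inr (Or.inl hstr)
          · refine Or.inr (Or.inr ⟨j', fun hc' => ?_, j2, j3⟩)
            exact (Finset.mem_insert.1 hc').elim hc j1
  -- The parameter 1 has to be left out, because an earlier wall may end at the tip `a k`. Beyond
  -- `δ` the first hit is attained.
  · obtain ⟨δ, hδ1, hδ⟩ : ∃ δ : ℝ, 1 < δ ∧ ∀ t, 1 < t → t < δ → pt (b k) (a k) t ∉ O := by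
      have := not_frequently.1 hgerm
      obtain ⟨δ, hδ, hδ'⟩ := mem_nhdsGT_iff_exists_Ioo_subset.1 this
      exact ⟨δ, hδ, fun t t1 t2 => hδ' ⟨t1, t2⟩⟩
    set E : Set ℝ := {t | δ ≤ t ∧ pt (b k) (a k) t ∈ O} with hEd
    have hEc : IsClosed E := by
      have : E = Ici δ ∩ (fun t => pt (b k) (a k) t) ⁻¹' O := by ext; rfl
      rw [this]; exact isClosed_Ici.inter (hOc.preimage (continuous_pt _ _))
    obtain ⟨T₁, hT₁, hT₁S, hT₁G⟩ := hE (a k) (hS.mem' (hL.sg k)) hkG (b k) (hS.symm (hL.sg k))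
    have hT₁O : pt (b k) (a k) T₁ ∈ O := by
      obtain ⟨y, y', hy, hm⟩ := hT₁S
      obtain ⟨j, hj⟩ := hL.cover y y' hy
      have hmj : pt (b k) (a k) T₁ ∈ segment ℝ (b j) (a j) := by
        rcases hj with ⟨rfl, rfl⟩ | ⟨rfl, rfl⟩
        · rwa [segment_symm]
        · exact hm
      refine (memO _).2 ⟨j, ?_, ?_⟩
      · rintro rfl
        obtain ⟨t, t0, t1, e⟩ := mem_segment_pt.1 hmj
        have := pt_inj hne e
        linarith
      · obtain ⟨t, t0, t1, e⟩ := mem_segment_pt.1 hmj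
        exact (mem_segment_pt_iff (h.one_le j)).2 ⟨t, t0, t1.trans (h.one_le j), e⟩
    have hT₁E : T₁ ∈ E := ⟨by by_contra hc; exact hδ T₁ hT₁ (not_le.1 hc) hT₁O, hT₁O⟩
    have hbd : BddBelow E := ⟨δ, fun t ht => ht.1⟩
    obtain ⟨q1, q2⟩ := hEc.csInf_mem ⟨_, hT₁E⟩ hbd
    have q3 : sInf E ≤ T₁ := csInf_le hbd hT₁E
    have q4 : ∀ t, 1 < t → t < sInf E → pt (b k) (a k) t ∉ O := by
      intro t t1 t2 ht
      rcases lt_or_ge t δ with g | g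
      · exact hδ t t1 g ht
      · exact absurd (csInf_le hbd (show t ∈ E from ⟨g, ht⟩)) (not_le.2 t2)
    set τ := sInf E with hτ
    have hτ1 : 1 < τ := by linarith
    set T' := Function.update T k τ with hT'
    have ek : T' k = τ := Function.update_self _ _ _
    have en : ∀ i, i ≠ k → T' i = T i := fun i hi => Function.update_of_ne hi _ _
    have hone : ∀ i, 1 ≤ T' i := by
      intro i
      by_cases hi : i = k
      · rw [hi, ek]; exact hτ1.le
      · rw [en i hi]; exact h.one_le i
    have hle : ∀ i, T i ≤ T' i := by
      intro i
      by_cases hi : i = k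
      · rw [hi, ek, hTk]; exact hτ1.le
      · rw [en i hi]
    have hsub : ∀ j, segment ℝ (b j) (pt (b j) (a j) (T j)) ⊆
        segment ℝ (b j) (pt (b j) (a j) (T' j)) := by
      intro j m hm
      obtain ⟨t, t0, t1, e⟩ := (mem_segment_pt_iff (h.one_le j)).1 hm
      exact (mem_segment_pt_iff (hone j)).2 ⟨t, t0, t1.trans (hle j), e⟩
    have hmk : ∀ j m, j ≠ k → m ∈ segment ℝ (b k) (pt (b k) (a k) τ) →
        m ∈ segment ℝ (b j) (pt (b j) (a j) (T j)) →
        (m = pt (b k) (a k) τ ∧ 1 < τ) ∨ (m = pt (b j) (a j) (T j) ∧ 1 < T j) := by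
      intro j m hj hm hmj
      obtain ⟨t, t0, t1, rfl⟩ := (mem_segment_pt_iff hτ1.le).1 hm
      rcases le_or_gt t 1 with g | g
      · rcases h.meet k j (pt (b k) (a k) t) hj.symm (by rw [hTk, pt_one]; exact pt_mem_segment t0 g)
          hmj with ⟨-, e⟩ | e
        · rw [hTk] at e; exact absurd e (lt_irrefl _)
        · exact Or.inr e
      · rcases t1.lt_or_eq with g' | g'
        · exact absurd ((memO _).2 ⟨j, hj, hmj⟩) (q4 t g g')
        · exact Or.inl ⟨by rw [g'], hτ1⟩
    have haks : a k ∈ openSegment ℝ (b k) (pt (b k) (a k) τ) := by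
      refine mem_openSegment_pt.2 ⟨1 / τ, by positivity, (div_lt_one (by linarith)).2 hτ1, ?_⟩
      rw [pt_pt, mul_one_div_cancel (by linarith), pt_one]
    refine ⟨T', hone, ?_, ?_, ?_, ?_, ?_, ?_⟩
    · intro i hi
      have : i ≠ k := by
        rintro rfl
        rcases hi with hi | hi
        · exact hi (Finset.mem_insert_self _ _)
        · exact hi hkG
      rw [en i this]
      exact h.eq_one i (hi.imp_left fun hi hc => hi (Finset.mem_insert_of_mem hc))
    · intro i hiG t t1 t2
      by_cases hi : i = k
      · subst hi
        rw [ek] at t2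
        exact hT₁G t t1 (by linarith)
      · rw [en i hi] at t2; exact h.mem i hiG t t1 t2
    · intro i
      by_cases hi : i = k
      · subst hi
        rw [ek]
        rcases q3.lt_or_eq with g | g
        · exact Or.inl (hT₁G _ hτ1.le g)
        · rw [g]; exact Or.inr hT₁S
      · rw [en i hi]; exact h.sub i
    · intro i j m hij hi hj
      by_cases hik : i = k
      · subst hik
        have hji : j ≠ i := hij.symm
        rw [ek] at hi ⊢
        rw [en j hji] at hj ⊢
        exact hmk j m hji hi hj
      · by_cases hjk : j = k
        · subst hjk
          rw [ek] at hj ⊢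
          rw [en i hik] at hi ⊢
          exact (hmk i m hik hj hi).symm
        · rw [en i hik] at hi ⊢
          rw [en j hjk] at hj ⊢
          exact h.meet i j m hij hi hj
    · intro i hi hiG
      by_cases hik : i = k
      · subst hik
        exact ⟨τ, hτ1, ek ▸ subset_iUnion (fun j => segment ℝ (b j) (pt (b j) (a j) (T' j))) i⟩
      · obtain ⟨t, t1, t2⟩ := h.germ i ((Finset.mem_insert.1 hi).resolve_left hik) hiG
        exact ⟨t, t1, t2.trans (iUnion_mono hsub)⟩
    · have hmono : ∀ m, (∃ p q, p ≠ q ∧ m ∈ openSegment ℝ p q ∧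
          segment ℝ p q ⊆ ⋃ j, segment ℝ (b j) (pt (b j) (a j) (T j))) →
          ∃ p q, p ≠ q ∧ m ∈ openSegment ℝ p q ∧
          segment ℝ p q ⊆ ⋃ j, segment ℝ (b j) (pt (b j) (a j) (T' j)) := by
        rintro m ⟨p, q, h0, h1, h2⟩
        exact ⟨p, q, h0, h1, h2.trans (iUnion_mono hsub)⟩
      -- Ends of earlier walls at the tip `a k` are now inner points of the wall `k`.
      have old : ∀ i ∈ K, a i ∈ G → pt (b i) (a i) (T i) ∈ A ∨
          (∃ p q, p ≠ q ∧ pt (b i) (a i) (T i) ∈ openSegment ℝ p q ∧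
            segment ℝ p q ⊆ ⋃ j, segment ℝ (b j) (pt (b j) (a j) (T' j))) ∨
          ∃ j, j ∉ insert k K ∧ a j ∈ G ∧ pt (b i) (a i) (T i) = a j := by
        intro i hi hiG
        rcases h.straight i hi hiG with g | g | ⟨j, j1, j2, j3⟩
        · exact Or.inl g
        · exact Or.inr (Or.inl (hmono _ g))
        · by_cases hc : j = k
          · refine Or.inr (Or.inl ⟨b k, pt (b k) (a k) τ, ne_pt (by linarith), ?_, ?_⟩)
            · rw [j3, hc]; exact haks
            · rw [← ek]; exact subset_iUnion (fun j => segment ℝ (b j) (pt (b j) (a j) (T' j))) k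
          · exact Or.inr (Or.inr ⟨j, fun hc' => (Finset.mem_insert.1 hc').elim hc j1, j2, j3⟩)
      intro i hi hiG
      by_cases hik : i = k
      · subst hik
        rw [ek]
        obtain ⟨j, hj, hm⟩ := (memO _).1 q2
        rcases mem_segment_cases hm with e | e | e
        · rw [e]; exact Or.inl (hb j)
        · rw [e]
          by_cases hjG : a j ∈ G
          · by_cases hjK : j ∈ K
            · exact old j hjK hjG
            · refine Or.inr (Or.inr ⟨j, fun hc => (Finset.mem_insert.1 hc).elim hj hjK, hjG, ?_⟩)
              rw [h.eq_one j (Or.inl hjK), pt_one]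
          · rw [h.eq_one j (Or.inr hjG), pt_one]
            exact Or.inl ((hVA j).resolve_left hjG)
        · refine Or.inr (Or.inl ⟨_, _, ?_, e, ?_⟩)
          · intro e'
            have : pt (b j) (a j) 0 = pt (b j) (a j) (T j) := by rw [pt_zero]; exact e'
            have := pt_inj (hS.ne (hL.sg j)) this
            linarith [h.one_le j]
          rw [← en j hj]; exact subset_iUnion (fun j => segment ℝ (b j) (pt (b j) (a j) (T' j))) j
      · rw [en i hik]
        exact old i ((Finset.mem_insert.1 hi).resolve_left hik) hiG

theorem exists_walls (hS : SegSys V Sg) (hL : Labels Sg a b) (h : St V Sg nx A G)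
    (hb : ∀ i, b i ∈ A) (hE : ExtensionsHit Sg V G) : ∃ x, Walls V Sg A G a b x := by
  have hVA : ∀ i, a i ∈ G ∨ a i ∈ A := fun i => h.cover _ (hS.mem' (hL.sg i))
  have key : ∀ K : Finset (Fin n), ∃ T, PreWalls Sg A G a b K T := by
    intro K
    induction K using Finset.induction_on with
    | empty => exact ⟨_, preWalls_empty hL⟩
    | insert k K hk ih =>
      obtain ⟨T, hT⟩ := ih
      exact hT.step hS hL hb hVA hE hk
  obtain ⟨T, hT⟩ := key Finset.univ
  have hne : ∀ i, b i ≠ a i := fun i => hS.ne (hL.sg i)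
  refine ⟨fun i => pt (b i) (a i) (T i), fun i e => ?_, fun i => ⟨?_, (hne i).symm⟩,
    fun i hi m hm => ?_,
    hT.sub, fun i hi => ?_, fun i j m hij h1 h2 => ?_,
    fun i hi => hT.germ i (Finset.mem_univ i) hi, fun i hi => ?_⟩
  · have : pt (b i) (a i) 0 = pt (b i) (a i) (T i) := by rw [pt_zero]; exact e
    have := pt_inj (hne i) this
    linarith [hT.one_le i]
  · exact (mem_segment_pt_iff (hT.one_le i)).2 ⟨1, zero_le_one, hT.one_le i, (pt_one _ _).symm⟩
  · obtain ⟨t, t0, t1, rfl⟩ := mem_openSegment_pt.1 hm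
    have h1 := hT.one_le i
    rw [pt_pt]
    rcases lt_or_ge (T i * t) 1 with g | g
    · have hop : openSegment ℝ (b i) (a i) ⊆ G := by
        rcases h.seg _ _ (hL.sg i) with e | e | e
        · exact e
        · exact absurd hi (h.notMem_of_vertex (by rw [← e.2]; exact h.maps _ e.1))
        · exact absurd hi (h.notMem_of_vertex e.1)
      exact hop (pt_mem_openSegment (by positivity) g)
    · exact hT.mem i hi _ g (by nlinarith)
  · rw [hT.eq_one i (Or.inr hi), pt_one]
  · exact (hT.meet i j m hij h1 h2).imp And.left And.left
  · rcases hT.straight i (Finset.mem_univ i) hi with g | g | ⟨j, hj, -⟩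
    · exact Or.inl g
    · exact Or.inr g
    · exact absurd (Finset.mem_univ j) hj

end

/-! ### Convex cells of the free region -/

/-- The points of a line near an inner point of a segment of this line lie in the segment. -/
theorem eventually_mem_openSegment {e p q : Plane} (he : e ∈ openSegment ℝ p q) (hpq : p ≠ q) :
    ∀ᶠ m in 𝓝 e, ori p q m = 0 → m ∈ openSegment ℝ p q := by
  obtain ⟨t, t0, t1, rfl⟩ := mem_openSegment_pt.1 he
  have hD : (q 0 - p 0) ^ 2 + (q 1 - p 1) ^ 2 ≠ 0 := by
    intro hc
    apply hpq
    apply plane_ext <;> nlinarith [sq_nonneg (q 0 - p 0), sq_nonneg (q 1 - p 1)]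
  -- The parameter of the orthogonal projection to the line, a continuous left inverse of `pt p q`.
  set f : Plane → ℝ := fun m => ((m 0 - p 0) * (q 0 - p 0) + (m 1 - p 1) * (q 1 - p 1)) /
    ((q 0 - p 0) ^ 2 + (q 1 - p 1) ^ 2) with hf
  have hfc : Continuous f := by
    rw [hf]; exact Continuous.div_const (by fun_prop) _
  have hft : ∀ s, f (pt p q s) = s := by
    intro s
    simp only [hf, pt_apply]
    rw [div_eq_iff hD]; ring
  have h1 : ∀ᶠ m in 𝓝 (pt p q t), f m ∈ Ioo (0 : ℝ) 1 := by
    refine hfc.continuousAt.eventually (Ioo_mem_nhds ?_ ?_) <;> rw [hft] <;> assumption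
  filter_upwards [h1] with m hm hl
  obtain ⟨s, rfl⟩ := mem_line_of_ori_eq_zero hpq hl
  rw [hft] at hm
  exact pt_mem_openSegment hm.1 hm.2

/-- A straight obstacle through `e` either blocks both rays on the bounding line of a half disc or
enters the half disc. -/
theorem not_halfFree_of_straight {F : Set Plane} {e p q : Plane} (he : e ∈ openSegment ℝ p q)
    (hpq : p ≠ q) (hd : ∀ m ∈ openSegment ℝ p q, m ∉ F) : ¬ HalfFree F F e := by
  rintro ⟨r, hr, s, hs, h1, h2⟩
  have hn := eventually_mem_openSegment he hpq
  have hel : ori p q e = 0 := ori_of_mem_segment (openSegment_subset_segment _ _ _ he)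
  have hep : e ≠ p := fun h => left_notMem_openSegment hpq (h ▸ he)
  by_cases h0 : ori e p r = 0
  · obtain ⟨c, rfl⟩ := mem_line_of_ori_eq_zero hep h0
    obtain ⟨t, ht, ht'⟩ := (h2.and ((tendsto_pt_zero e (pt e p c)).eventually hn)).exists
    refine hd _ (ht' ?_) ht
    rw [ori_pt, ori_pt, hel]; simp
  · have hσ : s * ori e r p ≠ 0 := by rw [ori_swap']; simp [hs, h0]
    obtain ⟨t, ht, ht1, ht2⟩ := exists_small_pt (r := p) (h1.and hn) hσ
    refine hd _ (ht2 (by rw [ori_pt, hel]; simp)) (ht1 ?_)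
    rw [ori_pt]; simp only [ori_self_left, mul_zero, zero_add]; linarith

/-- A convex connected component of the open set `F`. -/
structure IsCell (F C : Set Plane) : Prop where
  isOpen : IsOpen C
  convex : Convex ℝ C
  nonempty : C.Nonempty
  sub : C ⊆ F
  closed : ∀ y ∈ closure C, y ∈ F → y ∈ C

theorem isCell_connectedComponentIn {F : Set Plane} (hF : IsOpen F)
    (hH : ∀ e, e ∉ F → ¬ HalfFree F F e) {c : Plane} (hc : c ∈ F) :
    IsCell F (connectedComponentIn F c) where
  isOpen := hF.connectedComponentIn
  convex := convex_connectedComponentIn hF hH c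
  nonempty := ⟨c, mem_connectedComponentIn hc⟩
  sub := connectedComponentIn_subset F c
  closed y hy hyF := by
    have ho : IsOpen (connectedComponentIn F y) := hF.connectedComponentIn
    obtain ⟨z, hz1, hz2⟩ := mem_closure_iff.1 hy _ ho (mem_connectedComponentIn hyF)
    rw [connectedComponentIn_eq hz2, ← connectedComponentIn_eq hz1]
    exact mem_connectedComponentIn hyF

namespace IsCell
variable {F C : Set Plane}

theorem subset_of_convex (h : IsCell F C) {H : Set Plane} (hH : Convex ℝ H) (hF : H ⊆ F)
    (hne : (H ∩ C).Nonempty) : H ⊆ C := by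
  refine subset_of_avoid_frontier hH.isPreconnected (disjoint_left.2 fun y hy hf => ?_) hne
  rw [h.isOpen.frontier_eq] at hf
  exact hf.2 (h.closed y hf.1 (hF hy))

theorem disjoint_of_not_eq {C' : Set Plane} (h : IsCell F C) (h' : IsCell F C') (hne : C ≠ C') :
    Disjoint C C' := by
  rw [disjoint_iff_inter_eq_empty]
  by_contra hc
  have hc := nonempty_iff_ne_empty.2 hc
  exact hne ((h'.subset_of_convex h.convex h.sub hc).antisymm
    (h.subset_of_convex h'.convex h'.sub (by rwa [inter_comm])))

theorem closure_side {p q : Plane} {τ : ℝ} (hs : ∀ c ∈ C, 0 < τ * ori p q c) {y : Plane}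
    (hy : y ∈ closure C) : 0 ≤ τ * ori p q y := by
  have hcl : IsClosed {y | 0 ≤ τ * ori p q y} :=
    isClosed_le continuous_const (continuous_const.mul (continuous_ori p q))
  exact closure_minimal (fun c hc => (hs c hc).le) hcl hy

/-- A free half disc at a boundary point of a cell lies in the cell. -/
theorem eventually_mem (h : IsCell F C) {p q e : Plane} {τ : ℝ} (he : e ∈ closure C)
    (hs : ∀ c ∈ C, 0 < τ * ori p q c) (hn : ∀ᶠ m in 𝓝 e, 0 < τ * ori p q m → m ∈ F) :
    ∀ᶠ m in 𝓝 e, 0 < τ * ori p q m → m ∈ C := by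
  obtain ⟨ε, ε0, hε⟩ := Metric.eventually_nhds_iff_ball.1 hn
  have hconv : Convex ℝ {m | 0 < τ * ori p q m} := by
    intro x hx y hy s t hs ht hst
    simp only [mem_ofPred_eq] at hx hy ⊢
    rw [ori_combo hst]
    rcases hs.eq_or_lt with e | e
    · subst e
      have : t = 1 := by linarith
      rw [this]; simpa using hy
    · nlinarith [mul_pos e hx, mul_nonneg ht hy.le]
  have hsub : Metric.ball e ε ∩ {m | 0 < τ * ori p q m} ⊆ C := by
    refine h.subset_of_convex ((convex_ball e ε).inter hconv) (fun m hm => hε m hm.1 hm.2) ?_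
    obtain ⟨c, c1, c2⟩ := Metric.mem_closure_iff.1 he ε ε0
    exact ⟨c, ⟨by rw [Metric.mem_ball, dist_comm]; exact c2, hs c c1⟩, c1⟩
  filter_upwards [Metric.ball_mem_nhds e ε0] with m hm hm' using hsub ⟨hm, hm'⟩

/-- At an end `e` of a chord of a cell there is an obstacle bounding the cell. -/
theorem exists_obstacle {ι : Type*} [Finite ι] {O : ι → Set Plane} (h : IsCell F C)
    (hO : ∀ i, IsClosed (O i)) (hcov : ∀ y ∈ closure C, y ∉ F → ∃ i, y ∈ O i) {q e : Plane} {τ : ℝ}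
    (hτ : τ ≠ 0) (hqe : q ≠ e) (he : e ∈ closure C)
    (hs : ∀ c ∈ C, 0 < τ * ori q e c) (hH : ¬ HalfFree F F e) :
    ∃ i, e ∈ O i ∧ ∃ g ∈ O i, g ∈ closure C ∧ g ≠ e ∧
      (0 < τ * ori q e g ∨ ∃ t, 1 < t ∧ g = pt q e t) := by
  have hr : ∀ m, ori e (pt q e 2) m = ori q e m := by
    intro m; simp only [ori, pt_apply]; ring
  have hU : ∀ᶠ m in 𝓝 e, ∀ i, e ∉ O i → m ∉ O i := by
    rw [eventually_all]
    intro i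
    by_cases hi : e ∈ O i
    · exact Eventually.of_forall fun m hc => absurd hi hc
    · exact (show ∀ᶠ m in 𝓝 e, m ∈ (O i)ᶜ from (hO i).isOpen_compl.mem_nhds hi).mono fun m hm _ => hm
  obtain ⟨ε, ε0, hε⟩ := Metric.eventually_nhds_iff_ball.1 hU
  -- As `e` is not half free, some point `m` near `e`, on the positive side or on the chord beyond
  -- `e`, is not free. A segment from a nearby point of the cell to `m` leaves the cell at the
  -- desired `g`, and in the ball every obstacle passes through `e`.
  have hm : ∃ m ∈ Metric.ball e ε, m ∉ F ∧ (0 < τ * ori q e m ∨ ∃ t, 1 < t ∧ m = pt q e t) := by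
    by_contra hcon
    push Not at hcon
    refine hH ⟨pt q e 2, ?_, τ, hτ, ?_, ?_⟩
    · intro hc
      have : pt q e 2 = pt q e 1 := by rw [hc, pt_one]
      have := pt_inj hqe this
      norm_num at this
    · filter_upwards [Metric.ball_mem_nhds e ε0] with m hm hm'
      by_contra hF
      rw [hr] at hm'
      exact (not_lt.2 (hcon m hm hF).1) hm'
    · filter_upwards [(tendsto_pt_zero e (pt q e 2)).eventually (Metric.ball_mem_nhds e ε0),
        self_mem_nhdsWithin] with t ht ht0
      have ht0 : 0 < t := ht0
      by_contra hF
      refine (hcon _ ht hF).2 (1 + t) (by linarith) ?_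
      apply plane_ext <;> simp only [pt_apply] <;> ring
  obtain ⟨m, hmb, hmF, hmD⟩ := hm
  obtain ⟨c, c1, c2⟩ := Metric.mem_closure_iff.1 he ε ε0
  rw [dist_comm] at c2
  obtain ⟨g, hg, hgf⟩ := exists_mem_frontier (convex_segment (𝕜 := ℝ) c m).isPreconnected
    ⟨c, left_mem_segment ℝ _ _, c1⟩ ⟨m, right_mem_segment ℝ _ _, fun hc => hmF (h.sub hc)⟩
  rw [h.isOpen.frontier_eq] at hgf
  have hgF : g ∉ F := fun hc => hgf.2 (h.closed g hgf.1 hc)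
  have hgb : g ∈ Metric.ball e ε := (convex_ball e ε).segment_subset c2 hmb hg
  have hgD : 0 < τ * ori q e g ∨ ∃ t, 1 < t ∧ g = pt q e t := by
    obtain ⟨t, t0, t1, rfl⟩ := mem_segment_pt.1 hg
    rcases t1.lt_or_eq with t1 | rfl
    · left
      rw [ori_pt]
      have h1 := hs c c1
      have h2 : 0 ≤ τ * ori q e m := by
        rcases hmD with hm | ⟨t', -, rfl⟩
        · exact hm.le
        · rw [ori_pt]; simp
      nlinarith [mul_pos (sub_pos.2 t1) h1, mul_nonneg t0 h2]
    · rwa [pt_one]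
  obtain ⟨i, hi⟩ := hcov g hgf.1 hgF
  refine ⟨i, by_contra fun hc => hε g hgb i hc hi, g, hi, hgf.1, ?_, hgD⟩
  rintro rfl
  rcases hgD with hg | ⟨t, t1, e⟩
  · simp at hg
  · have : pt q g 1 = pt q g t := by rw [pt_one]; exact e
    have := pt_inj hqe this
    linarith

end IsCell

/-- The free region between the walls. -/
def freeRegion (G : Set Plane) {n : ℕ} (b x : Fin n → Plane) : Set Plane :=
  G \ ⋃ j, segment ℝ (b j) (x j)

namespace Walls
variable {V : Finset Plane} {Sg : Plane → Plane → Prop} {nx : Plane → Plane} {A : Finset Plane}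
  {G : Set Plane} {n : ℕ} {a b x : Fin n → Plane}

theorem notMem_free {i : Fin n} {m : Plane} (hm : m ∈ segment ℝ (b i) (x i)) :
    m ∉ freeRegion G b x := fun hc => hc.2 (mem_iUnion.2 ⟨i, hm⟩)

theorem isOpen_free (h : St V Sg nx A G) : IsOpen (freeRegion G b x) :=
  h.isOpen.sdiff (isClosed_iUnion_of_finite fun _ => isClosed_segment _ _)

theorem sub_wall (hW : Walls V Sg A G a b x) (hL : Labels Sg a b) {y y' : Plane} (hy : Sg y y') :
    ∃ i, segment ℝ y y' ⊆ segment ℝ (b i) (x i) := by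
  obtain ⟨i, hi⟩ := hL.cover y y' hy
  refine ⟨i, ?_⟩
  have : segment ℝ (b i) (a i) ⊆ segment ℝ (b i) (x i) :=
    (convex_segment _ _).segment_subset (left_mem_segment ℝ _ _) (hW.tip i).1
  rcases hi with ⟨rfl, rfl⟩ | ⟨rfl, rfl⟩
  · rwa [segment_symm]
  · exact this

theorem free_sub (hW : Walls V Sg A G a b x) (hL : Labels Sg a b) :
    freeRegion G b x ⊆ G \ segUnion Sg := by
  rintro m ⟨h1, h2⟩
  refine ⟨h1, ?_⟩
  rintro ⟨y, y', hy, hm⟩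
  obtain ⟨i, hi⟩ := hW.sub_wall hL hy
  exact h2 (mem_iUnion.2 ⟨i, hi hm⟩)

/-- At vertices this is the invariant of the polygon. Every other point in the closure of `G` that
is not free is inside a straight piece of walls or inside an edge. -/
theorem not_halfFree (hW : Walls V Sg A G a b x) (hL : Labels Sg a b) (h : St V Sg nx A G)
    (hb : ∀ i, b i ∈ A) (hAP : ∀ y ∈ A, ¬ HalfFree (G \ segUnion Sg) G y) :
    ∀ e, e ∉ freeRegion G b x → ¬ HalfFree (freeRegion G b x) (freeRegion G b x) e := by
  intro e he hf
  have hsub : freeRegion G b x ⊆ G := sdiff_subset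
  by_cases heA : e ∈ A
  · exact hAP e heA (hf.mono (hW.free_sub hL) hsub)
  by_cases heG : e ∈ G
  · have : e ∈ ⋃ j, segment ℝ (b j) (x j) := by
      by_contra hc; exact he ⟨heG, hc⟩
    obtain ⟨j, hj⟩ := mem_iUnion.1 this
    rcases mem_segment_cases hj with g | g | g
    · exact heA (g ▸ hb j)
    · by_cases hj' : a j ∈ G
      · rcases hW.straight j hj' with k | ⟨p, q, hpq, k1, k2⟩
        · exact heA (g ▸ k)
        · rw [← g] at k1
          exact not_halfFree_of_straight k1 hpq (fun m hm hc =>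
            hc.2 (k2 (openSegment_subset_segment _ _ _ hm))) hf
      · rw [hW.visited j hj'] at g
        exact hj' (g ▸ heG)
    · exact not_halfFree_of_straight g (hW.ne j) (fun m hm =>
        notMem_free (openSegment_subset_segment _ _ _ hm)) hf
  · by_cases hcl : e ∈ closure G
    · obtain ⟨p, hp, hm⟩ := h.front e hcl heG
      rcases mem_segment_cases hm with g | g | g
      · exact heA (g ▸ hp)
      · exact heA (g ▸ h.maps p hp)
      · exact not_halfFree_of_straight g (h.ne p hp).symm (fun m hm hc =>
          (h.disj p hp).le_bot ⟨hc.1, openSegment_subset_segment _ _ _ hm⟩) hf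
    · obtain ⟨r, hr, s, hs, h1, h2⟩ := hf
      obtain ⟨t, ht, ht'⟩ := (h2.and ((tendsto_pt_zero e r).eventually
        (isClosed_closure.isOpen_compl.mem_nhds hcl))).exists
      exact ht' (subset_closure ht.1)

end Walls

/-! ### Every unvisited tip touches a cell with a real edge -/

/-- A visited state together with a system of walls. -/
structure WallSetup (V : Finset Plane) (Sg : Plane → Plane → Prop) (nx : Plane → Plane)
    (A : Finset Plane) (G : Set Plane) {n : ℕ} (a b x : Fin n → Plane) : Prop where
  st : St V Sg nx A G
  sys : SegSys V Sg
  lab : Labels Sg a b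
  walls : Walls V Sg A G a b x
  base : ∀ i, b i ∈ A
  ap : ∀ y ∈ A, ¬ HalfFree (G \ segUnion Sg) G y

/-- No edge other than a segment of the system bounds `C`. -/
def NoRealEdge (Sg : Plane → Plane → Prop) (nx : Plane → Plane) (A : Finset Plane)
    (C : Set Plane) : Prop :=
  ∀ p ∈ A, ¬ Sg p (nx p) → ∀ m ∈ openSegment ℝ p (nx p), m ∉ closure C

/-- `C` lies on the negative side (with respect to `τ`) of the wall `k` and touches it in more
than one point. -/
def NegWall {n : ℕ} (b x : Fin n → Plane) (C : Set Plane) (τ : ℝ) (k : Fin n) : Prop :=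
  (∀ c ∈ C, τ * ori (b k) (x k) c < 0) ∧ ∃ s s' : ℝ, 0 ≤ s ∧ s < s' ∧ s' ≤ 1 ∧
    pt (b k) (x k) s ∈ closure C ∧ pt (b k) (x k) s' ∈ closure C

namespace WallSetup
variable {V : Finset Plane} {Sg : Plane → Plane → Prop} {nx : Plane → Plane} {A : Finset Plane}
  {G : Set Plane} {n : ℕ} {a b x : Fin n → Plane} {C : Set Plane} {τ : ℝ}

theorem not_halfFree (h : WallSetup V Sg nx A G a b x) {e : Plane} (he : e ∉ freeRegion G b x) :
    ¬ HalfFree (freeRegion G b x) (freeRegion G b x) e :=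
  h.walls.not_halfFree h.lab h.st h.base h.ap e he

/-- An obstacle with two points in the closure of the cell is a wall or part of one, since a real
edge would have an inner point in the closure. -/
theorem exists_wall (h : WallSetup V Sg nx A G a b x) (hC : IsCell (freeRegion G b x) C)
    (hbad : NoRealEdge Sg nx A C) {q e : Plane} (hτ : τ ≠ 0) (hqe : q ≠ e) (he : e ∈ closure C)
    (hs : ∀ c ∈ C, 0 < τ * ori q e c) (heF : e ∉ freeRegion G b x) :
    ∃ k, e ∈ segment ℝ (b k) (x k) ∧ ∃ g ∈ segment ℝ (b k) (x k), g ∈ closure C ∧ g ≠ e ∧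
      (0 < τ * ori q e g ∨ ∃ t, 1 < t ∧ g = pt q e t) := by
  obtain ⟨i, hi, g, hg, hgC, hge, hD⟩ := hC.exists_obstacle
    (O := Sum.elim (fun j => segment ℝ (b j) (x j))
      (fun p : {p // p ∈ A} => segment ℝ p.1 (nx p.1)))
    (by rintro (j | p) <;> exact isClosed_segment _ _)
    (by
      intro y hy hyF
      by_cases hyG : y ∈ G
      · have : y ∈ ⋃ j, segment ℝ (b j) (x j) := by
          by_contra hc; exact hyF ⟨hyG, hc⟩
        obtain ⟨j, hj⟩ := mem_iUnion.1 this
        exact ⟨Sum.inl j, hj⟩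
      · obtain ⟨p, hp, hm⟩ := h.st.front y
          (closure_mono (hC.sub.trans sdiff_subset) hy) hyG
        exact ⟨Sum.inr ⟨p, hp⟩, hm⟩) hτ hqe he hs (h.not_halfFree heF)
  rcases i with k | ⟨p, hp⟩
  · exact ⟨k, hi, g, hg, hgC, hge, hD⟩
  · have hi : e ∈ segment ℝ p (nx p) := hi
    have hg : g ∈ segment ℝ p (nx p) := hg
    by_cases hsg : Sg p (nx p)
    · obtain ⟨k, hk⟩ := h.walls.sub_wall h.lab hsg
      exact ⟨k, hk hi, g, hk hg, hgC, hge, hD⟩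
    · exfalso
      have hm : pt e g (1 / 2) ∈ closure C := hC.convex.closure.segment_subset he hgC
        (pt_mem_segment (by norm_num) (by norm_num))
      refine hbad p hp hsg _ ?_ hm
      obtain ⟨s, s0, s1, rfl⟩ := mem_segment_pt.1 hi
      obtain ⟨s', s0', s1', rfl⟩ := mem_segment_pt.1 hg
      have hne : s ≠ s' := fun hc => hge (by rw [hc])
      rw [pt_pt_pt]
      rcases lt_or_gt_of_ne hne with g | g <;>
        exact pt_mem_openSegment (by linarith) (by linarith)

/-- A wall that bounds the cell behind `e` has the cell on its negative side. -/
theorem neg_of_behind (hC : IsCell (freeRegion G b x) C) {q e g : Plane}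
    (hq : q ∈ closure C) (he : e ∈ closure C) (hgC : g ∈ closure C)
    (hs : ∀ c ∈ C, 0 < τ * ori q e c) {k : Fin n} {u u' : ℝ} (h0 : 0 ≤ u') (hlt : u' < u)
    (h1 : u ≤ 1) (ee : e = pt (b k) (x k) u) (eg : g = pt (b k) (x k) u')
    (hD : 0 < τ * ori q e g ∨ ∃ t, 1 < t ∧ g = pt q e t) :
    ∀ c ∈ C, τ * ori (b k) (x k) c < 0 := by
  -- If `g` is on the positive side of `q e`, then `q` is on the negative side of `g e`, and the
  -- cell lies on the side of `q`. If `g` prolongs the chord, then `g e` is the same line in the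
  -- reverse direction.
  have key : ∀ c ∈ C, τ * ori g e c < 0 := by
    rcases hD with hD | ⟨t, t1, e1⟩
    · have hqg : τ * ori g e q < 0 := by
        have : ori g e q = -ori q e g := by simp only [ori]; ring
        rw [this]; linarith
      have hge : g ≠ e := by rintro rfl; simp at hqg
      obtain ⟨m, hm⟩ : (openSegment ℝ g e).Nonempty := 
        ⟨_, pt_mem_openSegment (t := 1 / 2) (by norm_num) (by norm_num)⟩
      have hmC : m ∉ C := by
        intro hc
        refine Walls.notMem_free (i := k) ?_ (hC.sub hc)
        refine (convex_segment _ _).openSegment_subset (x := g) (y := e) ?_ ?_ hm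
        · rw [eg]; exact pt_mem_segment h0 (by linarith)
        · rw [ee]; exact pt_mem_segment (by linarith) h1
      have hcl : ∀ σ : ℝ, (∀ c ∈ C, 0 < σ * ori g e c) → 0 ≤ σ * ori g e q := fun σ hσ =>
        IsCell.closure_side hσ hq
      rcases one_side hC.convex hC.isOpen hge hgC he hm hmC with hp | hp
      · have := hcl 1 (fun c hc => by rw [one_mul]; exact hp c hc)
        intro c hc
        have h2 := hp c hc
        have : τ < 0 := by nlinarith
        nlinarith
      · have := hcl (-1) (fun c hc => by have := hp c hc; linarith)
        intro c hc
        have h2 := hp c hc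
        have : 0 < τ := by nlinarith
        nlinarith
    · intro c hc
      have : ori g e c = (1 - t) * ori q e c := by
        rw [e1]; simp only [ori, pt_apply]; ring
      rw [this]
      nlinarith [hs c hc, mul_pos (sub_pos.2 t1) (hs c hc)]
  intro c hc
  have := key c hc
  rw [ee, eg, ori_pt_pt] at this
  have h2 : τ * ((u - u') * ori (b k) (x k) c) = (u - u') * (τ * ori (b k) (x k) c) := by ring
  rw [h2] at this
  by_contra hcon
  nlinarith [mul_nonneg (sub_pos.2 hlt).le (not_lt.1 hcon)]

/-- Extreme parameters of the contact of the closure of a cell with a segment. -/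
theorem exists_last {p q : Plane} {s : ℝ} (hs0 : 0 ≤ s) (hs1 : s ≤ 1) (hs : pt p q s ∈ closure C) :
    ∃ v, s ≤ v ∧ v ≤ 1 ∧ pt p q v ∈ closure C ∧ ∀ w, v < w → w ≤ 1 → pt p q w ∉ closure C := by
  set E : Set ℝ := {t | 0 ≤ t ∧ t ≤ 1 ∧ pt p q t ∈ closure C} with hE
  have hEc : IsClosed E := by
    have : E = Icc 0 1 ∩ (fun t => pt p q t) ⁻¹' closure C := by
      ext t; simp only [hE, mem_ofPred_eq, mem_inter_iff, mem_Icc, mem_preimage]; tauto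
    rw [this]; exact isClosed_Icc.inter (isClosed_closure.preimage (continuous_pt p q))
  have hb : BddAbove E := ⟨1, fun t ht => ht.2.1⟩
  obtain ⟨h0, h1, h2⟩ := hEc.csSup_mem ⟨s, hs0, hs1, hs⟩ hb
  have h3 : s ≤ sSup E := le_csSup hb (show s ∈ E from ⟨hs0, hs1, hs⟩)
  refine ⟨sSup E, h3, h1, h2, fun w hw hw1 hc => ?_⟩
  exact absurd (le_csSup hb (show w ∈ E from ⟨by linarith, hw1, hc⟩)) (not_le.2 hw)

theorem exists_first {p q : Plane} {s : ℝ} (hs0 : 0 ≤ s) (hs1 : s ≤ 1) (hs : pt p q s ∈ closure C) :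
    ∃ v, 0 ≤ v ∧ v ≤ s ∧ pt p q v ∈ closure C ∧ ∀ w, 0 ≤ w → w < v → pt p q w ∉ closure C := by
  obtain ⟨v, v1, v2, v3, v4⟩ := exists_last (C := C) (p := q) (q := p) (s := 1 - s) (by linarith)
    (by linarith) (by rwa [← pt_symm])
  refine ⟨1 - v, by linarith, by linarith, by rwa [← pt_symm], fun w w0 w1 => ?_⟩
  rw [pt_symm]
  exact v4 _ (by linarith) (by linarith)

/-- Follow the wall `l` back to its first contact `e` with the cell, where another wall `k` takes
over the boundary. As `e` is not the end of `l`, it is the end of `k`; so `k` touches the cell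
behind `e` and is negative too. -/
theorem negWall_next (h : WallSetup V Sg nx A G a b x) (hC : IsCell (freeRegion G b x) C)
    (hbad : NoRealEdge Sg nx A C) (hτ : τ ≠ 0) {l : Fin n} (hl : NegWall b x C τ l) :
    ∃ k, NegWall b x C τ k ∧ ∃ s s' : ℝ, 0 ≤ s ∧ s < s' ∧ s' ≤ 1 ∧ x k = pt (b l) (x l) s ∧
      x k ∈ closure C ∧ pt (b l) (x l) s' ∈ closure C := by
  obtain ⟨hside, s₀, s', h0, hlt, h1, hs₀, hs'⟩ := hl
  obtain ⟨s, s0, s1, hs, hmin⟩ := exists_first h0 (by linarith) hs₀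
  set q := pt (b l) (x l) s' with hq
  set e := pt (b l) (x l) s with he
  have hqe : q ≠ e := fun hc => by
    have := pt_inj (h.walls.ne l) hc; linarith
  have hori : ∀ c, ori q e c = (s - s') * ori (b l) (x l) c := fun c => ori_pt_pt _ _ _ _ _
  have hqs : ∀ c ∈ C, 0 < τ * ori q e c := by
    intro c hc
    rw [hori]
    nlinarith [hside c hc]
  have hel : e ∈ segment ℝ (b l) (x l) := pt_mem_segment s0 (by linarith)
  obtain ⟨k, hk, g, hgk, hgC, hge, hD⟩ := h.exists_wall hC hbad hτ hqe hs hqs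
    (Walls.notMem_free hel)
  have hkl : k ≠ l := by
    rintro rfl
    obtain ⟨w, w0, w1, rfl⟩ := mem_segment_pt.1 hgk
    rcases hD with hD | ⟨t, t1, et⟩
    · rw [hori, ori_pt] at hD; simp at hD
    · rw [hq, he, pt_pt_pt] at et
      have := pt_inj (h.walls.ne k) et
      exact hmin w w0 (by nlinarith) hgC
  have hek : e = x k := by
    rcases h.walls.meet k l e hkl hk hel with g | g
    · exact g
    · exfalso
      have : pt (b l) (x l) s = pt (b l) (x l) 1 := by rw [pt_one]; exact g
      have := pt_inj (h.walls.ne l) this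
      linarith
  obtain ⟨u, u0, u1, eg⟩ := mem_segment_pt.1 hgk
  have hu : u < 1 := u1.lt_of_ne (by
    rintro rfl; apply hge; rw [eg, pt_one, hek])
  have ee : e = pt (b k) (x k) 1 := by rw [pt_one, hek]
  refine ⟨k, ⟨neg_of_behind hC hs' hs hgC hqs u0 hu le_rfl ee eg hD, u, 1, u0, hu,
    le_rfl, eg ▸ hgC, ee ▸ hs⟩, s, s', s0, by linarith, h1, hek.symm, hek ▸ hs, hs'⟩

/-- The map of `negWall_next` is injective, since two walls through the same point share an end
there. On the finite set of negative walls it is therefore surjective. -/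
theorem negWall_prev (h : WallSetup V Sg nx A G a b x) (hC : IsCell (freeRegion G b x) C)
    (hbad : NoRealEdge Sg nx A C) (hτ : τ ≠ 0) {k : Fin n} (hk : NegWall b x C τ k) :
    ∃ l, NegWall b x C τ l ∧ ∃ s s' : ℝ, 0 ≤ s ∧ s < s' ∧ s' ≤ 1 ∧ x k = pt (b l) (x l) s ∧
      x k ∈ closure C ∧ pt (b l) (x l) s' ∈ closure C := by
  choose f hf s s' h0 h1 h2 h3 h5 h4 using
    fun l : {l // NegWall b x C τ l} => h.negWall_next hC hbad hτ l.2
  set φ : {l // NegWall b x C τ l} → {l // NegWall b x C τ l} := fun l => ⟨f l, hf l⟩ with hφ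
  have hinj : Function.Injective φ := by
    intro l l' e
    have e : f l = f l' := congrArg Subtype.val e
    by_contra hne
    have hne : l.1 ≠ l'.1 := fun hc => hne (Subtype.ext hc)
    have hx : ∀ j : {l // NegWall b x C τ l}, x (f j) ≠ x j.1 := by
      intro j hc
      have : pt (b j.1) (x j.1) (s j) = pt (b j.1) (x j.1) 1 := by rw [pt_one, ← h3, hc]
      have := pt_inj (h.walls.ne j.1) this
      linarith [h1 j, h2 j]
    have hm : ∀ j : {l // NegWall b x C τ l}, x (f j) ∈ segment ℝ (b j.1) (x j.1) := by
      intro j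
      rw [h3]; exact pt_mem_segment (h0 j) (by linarith [h1 j, h2 j])
    rcases h.walls.meet l.1 l'.1 (x (f l)) hne (hm l) (by rw [e]; exact hm l') with g | g
    · exact hx l g
    · rw [e] at g; exact hx l' g
  obtain ⟨l, hl⟩ := Finite.surjective_of_injective hinj ⟨k, hk⟩
  have hl : f l = k := congrArg Subtype.val hl
  exact ⟨l.1, l.2, s l, s' l, h0 l, h1 l, h2 l, by rw [← hl]; exact h3 l,
    by rw [← hl]; exact h5 l, h4 l⟩

/-- A negative wall cannot run on from the end of the contact with a positive wall. -/
theorem negWall_false (h : WallSetup V Sg nx A G a b x) (hC : IsCell (freeRegion G b x) C)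
    (hτ : τ ≠ 0) {i l : Fin n} (hi : ∀ c ∈ C, 0 < τ * ori (b i) (x i) c)
    (hl : NegWall b x C τ l) {v₀ v s s' : ℝ} (hv0 : 0 ≤ v₀) (hv : v₀ < v) (hv1 : v ≤ 1)
    (hq : pt (b i) (x i) v₀ ∈ closure C) (hs0 : 0 ≤ s) (hss : s < s') (hs1 : s' ≤ 1)
    (hee : pt (b i) (x i) v = pt (b l) (x l) s) (hh : pt (b l) (x l) s' ∈ closure C) : False := by
  obtain ⟨c₀, hc₀⟩ := hC.nonempty
  have hil : i ≠ l := by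
    rintro rfl
    linarith [hi c₀ hc₀, hl.1 c₀ hc₀]
  set q := pt (b i) (x i) v₀ with hqd
  set e := pt (b i) (x i) v with hed
  set m := pt (b l) (x l) s' with hmd
  have o1 : ∀ c, ori q e c = (v - v₀) * ori (b i) (x i) c := fun c => ori_pt_pt _ _ _ _ _
  have o2 : ∀ c, ori e m c = (s' - s) * ori (b l) (x l) c := by
    intro c; rw [hee]; exact ori_pt_pt _ _ _ _ _
  have k1 : 0 ≤ τ * ori (b i) (x i) m := IsCell.closure_side hi hh
  have k2 : 0 ≤ -τ * ori (b l) (x l) q := IsCell.closure_side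
    (fun c hc => by have := hl.1 c hc; linarith) hq
  -- The two side conditions make the continuation of `l` collinear with the wall `i`. Running back,
  -- it overlaps the wall `i`; running on, it has the cell on its positive side.
  have hz : ori q e m = 0 := by
    have e1 : ori e m q = ori q e m := by simp only [ori]; ring
    have e2 : 0 ≤ τ * ori q e m := by rw [o1]; nlinarith
    have e3 : τ * ori q e m ≤ 0 := by rw [← e1, o2]; nlinarith
    exact (mul_eq_zero.1 (le_antisymm e3 e2)).resolve_left hτ
  have hqe : q ≠ e := fun hc => by
    have := pt_inj (h.walls.ne i) hc; linarith
  obtain ⟨c, hc⟩ := mem_line_of_ori_eq_zero hqe hz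
  rcases lt_trichotomy c 1 with g | g | g
  · obtain ⟨ε, ε0, ε1, ε2⟩ : ∃ ε : ℝ, 0 < ε ∧ ε < 1 ∧ ε * (1 - c) ≤ 1 := by
      refine ⟨min (1 / 2) (1 / (1 - c)), lt_min (by norm_num) (by have := sub_pos.2 g; positivity),
        (min_le_left _ _).trans_lt (by norm_num), ?_⟩
      calc min (1 / 2) (1 / (1 - c)) * (1 - c) ≤ 1 / (1 - c) * (1 - c) :=
            mul_le_mul_of_nonneg_right (min_le_right _ _) (by linarith)
        _ = 1 := div_mul_cancel₀ _ (by linarith)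
    have w1 : pt e m ε = pt (b i) (x i) (v - ε * (1 - c) * (v - v₀)) := by
      rw [hc, hed, hqd]; apply plane_ext <;> simp only [pt_apply] <;> ring
    have w2 : pt e m ε = pt (b l) (x l) (s + ε * (s' - s)) := by
      rw [hee, hmd, pt_pt_pt]
    have hpos : 0 < ε * (1 - c) := mul_pos ε0 (sub_pos.2 g)
    rcases h.walls.meet i l (pt e m ε) hil
      (by rw [w1]; exact pt_mem_segment (by nlinarith) (by nlinarith))
      (by rw [w2]; exact pt_mem_segment (by nlinarith) (by nlinarith)) with k | k
    · rw [w1] at k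
      have : pt (b i) (x i) (v - ε * (1 - c) * (v - v₀)) = pt (b i) (x i) 1 := by rw [k, pt_one]
      have := pt_inj (h.walls.ne i) this
      nlinarith
    · rw [w2] at k
      have : pt (b l) (x l) (s + ε * (s' - s)) = pt (b l) (x l) 1 := by rw [k, pt_one]
      have := pt_inj (h.walls.ne l) this
      nlinarith
  · rw [g, pt_one, hee] at hc
    have := pt_inj (h.walls.ne l) hc
    linarith
  · have e1 : ori e m c₀ = (c - 1) * ori q e c₀ := by
      rw [hc]; simp only [ori, pt_apply]; ring
    rw [o1, o2] at e1
    have p1 := hi c₀ hc₀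
    have p2 := hl.1 c₀ hc₀
    have e2 : (s' - s) * (τ * ori (b l) (x l) c₀) =
        (c - 1) * (v - v₀) * (τ * ori (b i) (x i) c₀) := by linear_combination τ * e1
    have p3 : 0 < (c - 1) * (v - v₀) * (τ * ori (b i) (x i) c₀) :=
      mul_pos (mul_pos (by linarith) (by linarith)) p1
    nlinarith

/-- A cell without real edges on the positive side of the wall `i` is bounded by a wall that starts
or runs on at the end of the wall `i`. -/
theorem end_wall (h : WallSetup V Sg nx A G a b x) (hC : IsCell (freeRegion G b x) C)
    (hbad : NoRealEdge Sg nx A C) (hτ : τ ≠ 0) {i : Fin n}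
    (hi : ∀ c ∈ C, 0 < τ * ori (b i) (x i) c) {v₀ v₁ : ℝ} (hv0 : 0 ≤ v₀) (hv : v₀ < v₁)
    (hv1 : v₁ ≤ 1) (hq : pt (b i) (x i) v₀ ∈ closure C) (hq' : pt (b i) (x i) v₁ ∈ closure C) :
    ∃ k, k ≠ i ∧ ∃ u u' : ℝ, 0 ≤ u ∧ u < u' ∧ u' ≤ 1 ∧ x i = pt (b k) (x k) u ∧
      pt (b k) (x k) u' ∈ closure C ∧ x i ∈ closure C ∧
      (0 < τ * ori (b i) (x i) (pt (b k) (x k) u') ∨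
        ∃ t, 1 < t ∧ pt (b k) (x k) u' = pt (pt (b i) (x i) v₀) (x i) t) := by
  obtain ⟨v, w1, w2, hev, hmax⟩ := exists_last (by linarith) hv1 hq'
  have hne := h.walls.ne
  set q := pt (b i) (x i) v₀ with hqd
  set e := pt (b i) (x i) v with hed
  have o1 : ∀ c, ori q e c = (v - v₀) * ori (b i) (x i) c := fun c => ori_pt_pt _ _ _ _ _
  have hqe : q ≠ e := fun hc => by
    have := pt_inj (hne i) hc; linarith
  have hqs : ∀ c ∈ C, 0 < τ * ori q e c := by
    intro c hc
    rw [o1]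
    nlinarith [hi c hc]
  have hei : e ∈ segment ℝ (b i) (x i) := pt_mem_segment (by linarith) w2
  obtain ⟨k, hk, g, hgk, hgC, hge, hD⟩ := h.exists_wall hC hbad hτ hqe hev hqs
    (Walls.notMem_free hei)
  have hki : k ≠ i := by
    rintro rfl
    obtain ⟨w, w0, w1', rfl⟩ := mem_segment_pt.1 hgk
    rcases hD with hD | ⟨t, t1, et⟩
    · rw [o1, ori_pt] at hD; simp at hD
    · rw [hqd, hed, pt_pt_pt] at et
      have := pt_inj (hne k) et
      exact hmax w (by nlinarith) w1' hgC
  obtain ⟨u', u0', u1', eg⟩ := mem_segment_pt.1 hgk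
  obtain ⟨u, u0, u1, ee⟩ := mem_segment_pt.1 hk
  -- Otherwise `k` is negative. If `e` is not its end, `k` itself contradicts `negWall_false`; if it
  -- is, the negative wall on which `k` ends does.
  have huu : u < u' := by
    by_contra hcon
    have hlt : u' < u := (not_lt.1 hcon).lt_of_ne (by
      rintro rfl; exact hge (by rw [eg, ee]))
    have hneg : NegWall b x C τ k :=
      ⟨neg_of_behind hC hq hev hgC hqs u0' hlt u1 ee eg hD, u', u, u0', hlt, u1,
        eg ▸ hgC, ee ▸ hev⟩
    obtain ⟨l, hl, s, s', s0, s1, s2, hx, hxk, hh⟩ := h.negWall_prev hC hbad hτ hneg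
    rcases u1.lt_or_eq with g1 | g1
    · exact h.negWall_false hC hτ hi hneg hv0 (by linarith) w2 hq u0 g1 le_rfl ee
        (by rwa [pt_one])
    · refine h.negWall_false hC hτ hi hl hv0 (by linarith) w2 hq s0 s1 s2 ?_ hh
      rw [← hx, ← hed, ee, g1, pt_one]
  have hex : e = x i := by
    rcases h.walls.meet k i e hki hk hei with g | g
    · exfalso
      have : pt (b k) (x k) u = pt (b k) (x k) 1 := by rw [pt_one, ← ee]; exact g
      have := pt_inj (hne k) this
      linarith
    · exact g
  refine ⟨k, hki, u, u', u0, huu, u1', by rw [← hex]; exact ee, eg ▸ hgC, hex ▸ hev, ?_⟩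
  rw [← eg, ← hex]
  refine hD.imp_left fun hD => ?_
  rw [o1] at hD
  have : τ * ((v - v₀) * ori (b i) (x i) g) = (v - v₀) * (τ * ori (b i) (x i) g) := by ring
  rw [this] at hD
  rw [hex]
  exact pos_of_mul_pos_right hD (by linarith)

end WallSetup

namespace WallSetup
variable {V : Finset Plane} {Sg : Plane → Plane → Prop} {nx : Plane → Plane} {A : Finset Plane}
  {G : Set Plane} {n : ℕ} {a b x : Fin n → Plane} {C : Set Plane} {τ : ℝ}

/-- One of two cells on both sides of a wall has a real edge. -/
theorem sides_false (h : WallSetup V Sg nx A G a b x) {C' : Set Plane}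
    (hC : IsCell (freeRegion G b x) C) (hC' : IsCell (freeRegion G b x) C')
    (hbad : NoRealEdge Sg nx A C) (hbad' : NoRealEdge Sg nx A C') {i : Fin n} (hiG : a i ∈ G)
    (hi : ∀ c ∈ C, 0 < 1 * ori (b i) (x i) c) (hi' : ∀ c ∈ C', 0 < -1 * ori (b i) (x i) c)
    {v₀ v₁ w₀ w₁ : ℝ} (hv0 : 0 ≤ v₀) (hv : v₀ < v₁) (hv1 : v₁ ≤ 1)
    (hw0 : 0 ≤ w₀) (hw : w₀ < w₁) (hw1 : w₁ ≤ 1)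
    (hq : pt (b i) (x i) v₀ ∈ closure C) (hq₁ : pt (b i) (x i) v₁ ∈ closure C)
    (hq' : pt (b i) (x i) w₀ ∈ closure C') (hq₁' : pt (b i) (x i) w₁ ∈ closure C') : False := by
  have hne := h.walls.ne
  obtain ⟨k, hki, u, u', u0, u1, u2, ex, hg, hxC, hD⟩ :=
    h.end_wall hC hbad one_ne_zero hi hv0 hv hv1 hq hq₁
  obtain ⟨k', hki', r, r', r0, r1, r2, ex', hg', hxC', hD'⟩ :=
    h.end_wall hC' hbad' (neg_ne_zero.2 one_ne_zero) hi' hw0 hw hw1 hq' hq₁'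
  -- The point `x i` is not the end of either wall, so distinct walls could not meet there.
  have hkk : k' = k := by
    by_contra hc
    have hx : ∀ (j : Fin n) (s s' : ℝ), s < s' → s' ≤ 1 → x i = pt (b j) (x j) s → x i ≠ x j := by
      intro j s s' s1 s2 e e'
      have : pt (b j) (x j) s = pt (b j) (x j) 1 := by rw [pt_one, ← e, e']
      have := pt_inj (hne j) this
      linarith
    rcases h.walls.meet k' k (x i) hc (by rw [ex']; exact pt_mem_segment r0 (by linarith))
      (by rw [ex]; exact pt_mem_segment u0 (by linarith)) with g | g
    · exact hx k' r r' r1 r2 ex' g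
    · exact hx k u u' u1 u2 ex g
  subst hkk
  have hru : r = u := pt_inj (hne k') (ex'.symm.trans ex)
  subst hru
  have ho : ∀ s, ori (b i) (x i) (pt (b k') (x k') s) =
      (s - r) * (ori (b i) (x i) (x k') - ori (b i) (x i) (b k')) := by
    intro s
    have e0 : ori (b i) (x i) (pt (b k') (x k') r) = 0 := by rw [← ex]; simp
    rw [ori_pt] at e0 ⊢
    linear_combination e0
  -- One cell makes this wall go on to the left or straight, the other to the right or straight;
  -- hence it goes straight on.
  have hcol : ∃ t, 1 < t ∧ pt (b k') (x k') u' = pt (pt (b i) (x i) v₀) (x i) t := by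
    rcases hD with hD | hD
    · exfalso
      rw [ho] at hD
      rcases hD' with hD' | ⟨t, t1, et⟩
      · rw [ho] at hD'
        have : 0 < ori (b i) (x i) (x k') - ori (b i) (x i) (b k') := by nlinarith
        nlinarith [mul_pos (sub_pos.2 r1) this]
      · have : ori (b i) (x i) (pt (b k') (x k') r') = 0 := by
          rw [et, ori_pt, ori_pt]; simp
        rw [ho] at this
        rcases mul_eq_zero.1 this with e | e
        · linarith
        · rw [e] at hD; simp at hD
    · exact hD
  obtain ⟨t, t1, et⟩ := hcol
  have hr0 : r = 0 := by
    by_contra hr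
    have hr : 0 < r := r0.lt_of_ne (Ne.symm hr)
    -- the wall `k'` would overlap the wall `i`
    obtain ⟨ε, ε0, ε1, ε2⟩ : ∃ ε : ℝ, 0 < ε ∧ ε * (u' - r) < r ∧ ε * (t - 1) ≤ 1 := by
      have d1 : 0 < u' - r := by linarith
      have d2 : 0 < t - 1 := by linarith
      refine ⟨min (r / (2 * (u' - r))) (1 / (t - 1)), lt_min (by positivity) (by positivity), ?_, ?_⟩
      · calc _ ≤ r / (2 * (u' - r)) * (u' - r) :=
              mul_le_mul_of_nonneg_right (min_le_left _ _) d1.le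
          _ = r / 2 := by field_simp
          _ < r := by linarith
      · calc _ ≤ 1 / (t - 1) * (t - 1) := mul_le_mul_of_nonneg_right (min_le_right _ _) d2.le
          _ = 1 := div_mul_cancel₀ _ d2.ne'
    have e1 : pt (x i) (pt (b k') (x k') u') (-ε) = pt (b k') (x k') (r - ε * (u' - r)) := by
      rw [ex, pt_pt_pt]; congr 1; ring
    have e2 : pt (x i) (pt (b k') (x k') u') (-ε) =
        pt (b i) (x i) (1 - ε * (t - 1) * (1 - v₀)) := by
      rw [et]; apply plane_ext <;> simp only [pt_apply] <;> ring
    have hpos : 0 < ε * (t - 1) := mul_pos ε0 (by linarith)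
    have hpos' : 0 < ε * (u' - r) := mul_pos ε0 (by linarith)
    rcases h.walls.meet k' i (pt (x i) (pt (b k') (x k') u') (-ε)) hki
      (by rw [e1]; exact pt_mem_segment (by linarith) (by nlinarith))
      (by rw [e2]; exact pt_mem_segment (by nlinarith) (by nlinarith)) with g | g
    · have : pt (b k') (x k') (r - ε * (u' - r)) = pt (b k') (x k') 1 := by
        rw [← e1, g, pt_one]
      have := pt_inj (hne k') this
      nlinarith
    · have : pt (b i) (x i) (1 - ε * (t - 1) * (1 - v₀)) = pt (b i) (x i) 1 := by
        rw [← e2, g, pt_one]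
      have := pt_inj (hne i) this
      nlinarith
  -- So the wall starts at the vertex `x i` and continues the wall `i`. The cell contains a half
  -- disc at this vertex, and the ray back along the wall `i` starts in `G`, which makes the vertex
  -- half free.
  have hxA : x i ∈ A := by
    rw [ex, hr0, pt_zero]; exact h.base k'
  have hqx : pt (b i) (x i) v₀ ≠ x i := fun hc => by
    have : pt (b i) (x i) v₀ = pt (b i) (x i) 1 := by rw [pt_one]; exact hc
    have := pt_inj (hne i) this; linarith
  obtain ⟨c₀, hc₀⟩ := hC.nonempty
  set q := pt (b i) (x i) v₀ with hqd
  set g := pt (b k') (x k') u' with hgd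
  have og : ∀ m, ori q g m = t * (1 - v₀) * ori (b i) (x i) m := by
    intro m; rw [et, hqd]; simp only [ori, pt_apply]; ring
  have hpos : 0 < t * (1 - v₀) := mul_pos (by linarith) (by linarith)
  have p0 := hi c₀ hc₀
  have hc := eventually_mem_of_chord hC.convex hC.isOpen (p := q) (q := g) hq hg hc₀ (m := x i)
    (by rw [og]; nlinarith) (by
      rw [et]
      have := pt_between (p := q) (q := x i) (a := 0) (b := t) (c := 1) one_pos t1
      rwa [pt_zero, pt_one] at this)
  refine h.ap (x i) hxA ⟨q, hqx, -1, by norm_num, ?_, ?_⟩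
  · filter_upwards [hc] with m hm hm'
    refine h.walls.free_sub h.lab (hC.sub (hm ?_))
    have e1 : ori (x i) q m = -(1 - v₀) * ori (b i) (x i) m := by
      rw [hqd]; simp only [ori, pt_apply]; ring
    rw [e1] at hm'
    have : 0 < ori (b i) (x i) m := by
      by_contra hcon
      nlinarith [mul_nonneg (sub_nonneg.2 (show v₀ ≤ 1 by linarith)) (neg_nonneg.2 (not_lt.1 hcon))]
    rw [og, og]
    exact mul_pos (mul_pos hpos (by linarith)) (mul_pos hpos this)
  · have : ∀ᶠ s : ℝ in 𝓝[>] 0, s ∈ Ioo (0:ℝ) 1 := Ioo_mem_nhdsGT one_pos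
    filter_upwards [this] with s hs
    apply h.walls.isOpen i hiG
    have e1 : pt (x i) q s = pt (b i) (x i) (1 - s * (1 - v₀)) := by
      rw [hqd]; apply plane_ext <;> simp only [pt_apply] <;> ring
    rw [e1]
    refine pt_mem_openSegment ?_ ?_ <;> nlinarith [hs.1, hs.2]

/-- The cell beside the tip of a wall. -/
theorem exists_side_cell (h : WallSetup V Sg nx A G a b x) (hτ : τ ≠ 0) {i : Fin n}
    (hiG : a i ∈ G) : ∃ C, IsCell (freeRegion G b x) C ∧ a i ∈ closure C ∧
      (∀ c ∈ C, 0 < τ * ori (b i) (x i) c) ∧ ∃ v₀ v₁ : ℝ, 0 ≤ v₀ ∧ v₀ < v₁ ∧ v₁ ≤ 1 ∧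
        pt (b i) (x i) v₀ ∈ closure C ∧ pt (b i) (x i) v₁ ∈ closure C := by
  have hne := h.walls.ne i
  obtain ⟨ta, ta0, ta1, ea⟩ := mem_segment_pt.1 (h.walls.tip i).1
  have ta0 : 0 < ta := ta0.lt_of_ne (by
    rintro rfl; apply (h.walls.tip i).2; rw [ea, pt_zero])
  -- Just before the tip there are no wall ends, hence no other wall touches the wall `i`, and half
  -- discs on either side are free.
  have hav : ∀ᶠ t in 𝓝[<] ta, ∀ j, pt (b i) (x i) t ≠ x j := by
    rw [eventually_all]
    intro j
    by_cases hj : x j = a i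
    · filter_upwards [self_mem_nhdsWithin] with t ht hc
      have ht : t < ta := ht
      have := pt_inj hne (hc.trans (hj.trans ea))
      linarith
    · have ht : Tendsto (fun t => pt (b i) (x i) t) (𝓝[<] ta) (𝓝 (a i)) := by
        rw [ea]; exact ((continuous_pt (b i) (x i)).tendsto ta).mono_left nhdsWithin_le_nhds
      exact ht.eventually (isOpen_ne.mem_nhds (Ne.symm hj))
  obtain ⟨t₀, ht₀, hIoo⟩ := mem_nhdsLT_iff_exists_Ioo_subset.1 hav
  have ht₀ : t₀ < ta := ht₀
  have hfree : ∀ t, t₀ < t → 0 < t → t < ta → ∀ᶠ m in 𝓝 (pt (b i) (x i) t),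
      0 < τ * ori (b i) (x i) m → m ∈ freeRegion G b x := by
    intro t h1 h2 h3
    have hG : pt (b i) (x i) t ∈ G :=
      h.walls.isOpen i hiG (pt_mem_openSegment h2 (by linarith))
    have hj : ∀ᶠ m in 𝓝 (pt (b i) (x i) t), ∀ j, j ≠ i → m ∉ segment ℝ (b j) (x j) := by
      rw [eventually_all]
      intro j
      by_cases hj : j = i
      · exact Eventually.of_forall fun m hc => absurd hj hc
      · have : pt (b i) (x i) t ∈ (segment ℝ (b j) (x j))ᶜ := by
          intro hc
          rcases h.walls.meet i j _ (Ne.symm hj) (pt_mem_segment h2.le (by linarith)) hc with g | g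
          · exact hIoo ⟨h1, h3⟩ i g
          · exact hIoo ⟨h1, h3⟩ j g
        filter_upwards [(isClosed_segment _ _).isOpen_compl.mem_nhds this] with m hm _ using hm
    filter_upwards [h.st.isOpen.mem_nhds hG, hj] with m m1 m2 m3
    refine ⟨m1, fun hc => ?_⟩
    obtain ⟨j, hmj⟩ := mem_iUnion.1 hc
    by_cases e : j = i
    · subst e
      rw [ori_of_mem_segment hmj, mul_zero] at m3
      exact lt_irrefl _ m3
    · exact m2 j e hmj
  set s := max t₀ 0 with hs
  have hs0 : 0 ≤ s := le_max_right _ _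
  have hst : t₀ ≤ s := le_max_left _ _
  have hsa : s < ta := max_lt ht₀ ta0
  set m₀ := pt (b i) (x i) ((s + ta) / 2) with hm₀
  obtain ⟨ε, ε0, hε⟩ := Metric.eventually_nhds_iff_ball.1
    (hfree ((s + ta) / 2) (by linarith) (by linarith) (by linarith))
  obtain ⟨y, hy⟩ := exists_ori_pos hne
  have hline : ∀ t u, ori (b i) (x i) (pt (pt (b i) (x i) t) y u) = u * ori (b i) (x i) y := by
    intro t u; rw [ori_pt, ori_pt]; simp
  -- points of the wall inside the ball are limits of points of the half ball
  set H := Metric.ball m₀ ε ∩ {m | 0 < τ * ori (b i) (x i) m} with hH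
  have hlim : ∀ t, pt (b i) (x i) t ∈ Metric.ball m₀ ε → pt (b i) (x i) t ∈ closure H := by
    intro t ht
    rw [mem_closure_iff_nhds]
    intro U hU
    obtain ⟨u, hu, hu'⟩ := exists_small_pt (r := y) (Q := fun m => m ∈ U ∩ Metric.ball m₀ ε)
      (inter_mem hU (Metric.isOpen_ball.mem_nhds ht)) hτ
    refine ⟨_, hu'.1, hu'.2, ?_⟩
    simp only [mem_ofPred_eq]
    rw [hline]
    have := mul_pos hu hy
    linarith [this]
  have hHF : H ⊆ freeRegion G b x := fun m hm => hε m hm.1 hm.2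
  have hHc : Convex ℝ H := by
    refine (convex_ball _ _).inter ?_
    rcases lt_or_gt_of_ne hτ with g | g
    · have : {m | 0 < τ * ori (b i) (x i) m} = {m | ori (b i) (x i) m < 0} := by
        ext m; simp only [mem_ofPred_eq]; constructor <;> intro hh <;> nlinarith
      rw [this]; exact convex_ori_neg _ _
    · have : {m | 0 < τ * ori (b i) (x i) m} = {m | 0 < ori (b i) (x i) m} := by
        ext m; simp only [mem_ofPred_eq]; constructor <;> intro hh <;> nlinarith
      rw [this]; exact convex_ori_pos _ _
  obtain ⟨c, hc⟩ : H.Nonempty := by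
    have := hlim ((s + ta) / 2) (Metric.mem_ball_self ε0)
    exact closure_nonempty_iff.1 ⟨_, this⟩
  set C := connectedComponentIn (freeRegion G b x) c with hCd
  have hC : IsCell (freeRegion G b x) C := isCell_connectedComponentIn (Walls.isOpen_free h.st)
    (fun e he => h.not_halfFree he) (hHF hc)
  have hHC : H ⊆ C := hC.subset_of_convex hHc hHF ⟨c, hc, mem_connectedComponentIn (hHF hc)⟩
  -- another point of the wall in the ball
  obtain ⟨v, hv1, hv2⟩ : ∃ v, (s + ta) / 2 < v ∧ v ≤ 1 ∧ pt (b i) (x i) v ∈ Metric.ball m₀ ε := by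
    have hcont : ∀ᶠ v in 𝓝[>] ((s + ta) / 2), pt (b i) (x i) v ∈ Metric.ball m₀ ε :=
      ((continuous_pt (b i) (x i)).continuousAt.eventually
        (Metric.ball_mem_nhds m₀ ε0)).filter_mono nhdsWithin_le_nhds
    have h2 : ∀ᶠ v in 𝓝[>] ((s + ta) / 2), v ∈ Ioo ((s + ta) / 2) ta :=
      Ioo_mem_nhdsGT (by linarith)
    obtain ⟨v, v1, v2⟩ := (hcont.and h2).exists
    exact ⟨v, v2.1, by linarith [v2.2], v1⟩
  have hm₀C : m₀ ∈ closure C := closure_mono hHC (hlim _ (Metric.mem_ball_self ε0))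
  have hvC : pt (b i) (x i) v ∈ closure C := closure_mono hHC (hlim _ hv2.2)
  have hmv : m₀ ≠ pt (b i) (x i) v := fun hcc => by
    have := pt_inj hne hcc; linarith
  have hside : ∀ c ∈ C, 0 < τ * ori (b i) (x i) c := by
    have hmid := pt_between (p := b i) (q := x i) (a := (s + ta) / 2) (b := v)
      (c := ((s + ta) / 2 + v) / 2) (by linarith) (by linarith)
    have o : ∀ m, ori m₀ (pt (b i) (x i) v) m = (v - (s + ta) / 2) * ori (b i) (x i) m :=
      fun m => ori_pt_pt _ _ _ _ _
    have hcC := hc.2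
    simp only [mem_ofPred_eq] at hcC
    have hv' : 0 < v - (s + ta) / 2 := by linarith
    rcases one_side hC.convex hC.isOpen hmv hm₀C hvC hmid (fun hcc =>
      Walls.notMem_free (pt_mem_segment (by linarith) (by linarith)) (hC.sub hcc)) with g | g
    · intro d hd
      have g1 := g c (hHC hc)
      have g2 := g d hd
      rw [o] at g1 g2
      have g1 := pos_of_mul_pos_right g1 hv'.le
      have g2 := pos_of_mul_pos_right g2 hv'.le
      have : 0 < τ := by by_contra hcon; nlinarith
      exact mul_pos this g2
    · intro d hd
      have g1 := g c (hHC hc)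
      have g2 := g d hd
      rw [o] at g1 g2
      have g1 : ori (b i) (x i) c < 0 := by by_contra hcon; nlinarith
      have g2 : ori (b i) (x i) d < 0 := by by_contra hcon; nlinarith
      have : τ < 0 := by by_contra hcon; nlinarith
      exact mul_pos_of_neg_of_neg this g2
  refine ⟨C, hC, ?_, hside, (s + ta) / 2, v, by linarith, hv1, hv2.1, hm₀C, hvC⟩
  -- The contact of the cell with the wall cannot end before the tip: the free half disc at its last
  -- point belongs to the cell.
  by_contra hcon
  obtain ⟨w, w1, w2, w3, w4⟩ := exists_last (C := C) (p := b i) (q := a i) (s := (s + ta) / 2 / ta)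
    (by positivity) ((div_le_one ta0).2 (by linarith)) (by
      rw [ea, pt_pt, mul_div_cancel₀ _ ta0.ne']; exact hm₀C)
  have hw : w < 1 := w2.lt_of_ne (by
    rintro rfl; rw [pt_one] at w3; exact hcon w3)
  have hw' : (s + ta) / 2 ≤ ta * w := by
    rw [div_le_iff₀ ta0] at w1; linarith
  rw [ea, pt_pt] at w3
  have hn := hC.eventually_mem w3 hside (hfree (ta * w) (by linarith) (by linarith) (by nlinarith))
  obtain ⟨δ, δ0, hδ⟩ := Metric.eventually_nhds_iff_ball.1 hn
  have hcont : ∀ᶠ v in 𝓝[>] w, pt (b i) (x i) (ta * v) ∈ Metric.ball (pt (b i) (x i) (ta * w)) δ := by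
    have hc : Continuous fun v : ℝ => pt (b i) (x i) (ta * v) :=
      (continuous_pt (b i) (x i)).comp (continuous_const.mul continuous_id)
    exact (hc.continuousAt.eventually (Metric.ball_mem_nhds _ δ0)).filter_mono nhdsWithin_le_nhds
  have h2 : ∀ᶠ v in 𝓝[>] w, v ∈ Ioo w 1 := Ioo_mem_nhdsGT hw
  obtain ⟨v', v1, v2⟩ := (hcont.and h2).exists
  refine w4 v' v2.1 v2.2.le ?_
  rw [ea, pt_pt, mem_closure_iff_nhds]
  intro U hU
  obtain ⟨u, hu, hu'⟩ := exists_small_pt (r := y) (Q := fun m => m ∈ U ∩ Metric.ball _ δ)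
    (inter_mem hU (Metric.isOpen_ball.mem_nhds v1)) hτ
  refine ⟨_, hu'.1, hδ _ hu'.2 ?_⟩
  rw [hline]
  have := mul_pos hu hy
  linarith [this]

/-- Walls consist of vertices, points of `G` and points of segments; an inner point of a real edge
is none of these. -/
theorem notMem_wall_of_edge (h : WallSetup V Sg nx A G a b x) {p : Plane} (hp : p ∈ A)
    (hs : ¬ Sg p (nx p)) {m : Plane} (hm : m ∈ openSegment ℝ p (nx p)) (j : Fin n) :
    m ∉ segment ℝ (b j) (x j) := by
  have hmG : m ∉ G := fun hc =>
    (h.st.disj p hp).le_bot ⟨hc, openSegment_subset_segment _ _ _ hm⟩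
  have hmA : m ∉ A := fun hc => h.st.vertex_notMem_open hp hc hm
  have hmS : m ∉ segUnion Sg := by
    rintro ⟨c, d, hcd, hmc⟩
    have key : ∀ c d, Sg c d → m ∈ segment ℝ c d → c ∈ A → nx c ≠ d := by
      intro c d hcd hmc hc e
      have hpc : p ≠ c := by rintro rfl; exact hs (e ▸ hcd)
      exact (h.st.simple p hp c hc hpc).le_bot ⟨hm, by rwa [e]⟩
    rcases h.st.seg c d hcd with e | e | e
    · have hv : ∀ y ∈ V, m ≠ y := by
        rintro y hy rfl
        exact (h.st.cover m hy).elim hmG hmA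
      rcases mem_segment_cases hmc with g | g | g
      · exact hv c (h.sys.mem hcd) g
      · exact hv d (h.sys.mem' hcd) g
      · exact hmG (e g)
    · exact key c d hcd hmc e.1 e.2
    · exact key d c (h.sys.symm hcd) (by rwa [segment_symm]) e.1 e.2
  intro hmj
  by_cases hj : a j ∈ G
  · rcases mem_segment_cases hmj with g | g | g
    · exact hmA (g ▸ h.base j)
    · rw [g] at hmG hmS
      exact (h.walls.sub j).elim hmG hmS
    · exact hmG (h.walls.isOpen j hj g)
  · rw [h.walls.visited j hj] at hmj
    exact hmS ⟨b j, a j, h.lab.sg j, hmj⟩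

/-- Near inner points of a real edge the free region is exactly the left side, so contact with a
cell spreads along the whole edge. -/
theorem edge_mem_closure (h : WallSetup V Sg nx A G a b x) (hC : IsCell (freeRegion G b x) C)
    {p : Plane} (hp : p ∈ A) (hs : ¬ Sg p (nx p)) {m : Plane} (hm : m ∈ openSegment ℝ p (nx p))
    (hmC : m ∈ closure C) : p ∈ closure C ∧ nx p ∈ closure C ∧ ∀ c ∈ C, 0 < ori p (nx p) c := by
  have hne : p ≠ nx p := (h.st.ne p hp).symm
  have hfree : ∀ e ∈ openSegment ℝ p (nx p),
      ∀ᶠ y in 𝓝 e, (y ∈ freeRegion G b x ↔ 0 < ori p (nx p) y) := by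
    intro e he
    have hj : ∀ᶠ y in 𝓝 e, ∀ j, y ∉ segment ℝ (b j) (x j) := by
      rw [eventually_all]
      intro j
      exact (isClosed_segment _ _).isOpen_compl.mem_nhds (h.notMem_wall_of_edge hp hs he j)
    filter_upwards [h.st.loc p hp e he, hj] with y y1 y2
    rw [← y1]
    exact ⟨fun hy => hy.1, fun hy => ⟨hy, fun hc => (mem_iUnion.1 hc).elim y2⟩⟩
  have hball : ∀ e ∈ openSegment ℝ p (nx p), e ∈ closure C → ∃ ε > 0,
      Metric.ball e ε ∩ {y | 0 < ori p (nx p) y} ⊆ C ∧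
      ∃ c ∈ C, 0 < ori p (nx p) c := by
    intro e he heC
    obtain ⟨ε, ε0, hε⟩ := Metric.eventually_nhds_iff_ball.1 (hfree e he)
    obtain ⟨c, c1, c2⟩ := Metric.mem_closure_iff.1 heC ε ε0
    rw [dist_comm] at c2
    have c3 := (hε c c2).1 (hC.sub c1)
    exact ⟨ε, ε0, hC.subset_of_convex ((convex_ball e ε).inter (convex_ori_pos _ _))
      (fun y hy => (hε y hy.1).2 hy.2) ⟨c, ⟨c2, c3⟩, c1⟩, c, c1, c3⟩
  obtain ⟨y, hy⟩ := exists_ori_pos hne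
  have hstep : ∀ v, 0 < v → v < 1 → pt p (nx p) v ∈ closure C → ∃ δ > 0, ∀ w, |w - v| < δ →
      pt p (nx p) w ∈ closure C := by
    intro v v0 v1 hv
    obtain ⟨ε, ε0, hε, -⟩ := hball _ (pt_mem_openSegment v0 v1) hv
    obtain ⟨δ, δ0, hδ⟩ := Metric.eventually_nhds_iff.1
      ((continuous_pt p (nx p)).continuousAt.eventually (Metric.ball_mem_nhds (pt p (nx p) v) ε0))
    refine ⟨δ, δ0, fun w hw => ?_⟩
    have hwb := hδ (y := w) (by rwa [Real.dist_eq])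
    rw [mem_closure_iff_nhds]
    intro U hU
    obtain ⟨u, hu, hu'⟩ := exists_small_pt (r := y) (Q := fun m => m ∈ U ∩ Metric.ball _ ε)
      (inter_mem hU (Metric.isOpen_ball.mem_nhds hwb)) (one_ne_zero (α := ℝ))
    refine ⟨_, hu'.1, hε ⟨hu'.2, ?_⟩⟩
    simp only [mem_ofPred_eq]
    rw [ori_pt, ori_pt]
    simp only [ori_self_left, ori_self_right, mul_zero, add_zero, zero_add]
    rw [mul_one] at hu
    exact mul_pos hu hy
  obtain ⟨t, t0, t1, rfl⟩ := mem_openSegment_pt.1 hm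
  have hp' : p ∈ closure C := by
    obtain ⟨v, v0, v1, v2, v3⟩ := exists_first t0.le t1.le hmC
    rcases v0.eq_or_lt with e | e
    · rwa [← e, pt_zero] at v2
    · exfalso
      obtain ⟨δ, δ0, hδ⟩ := hstep v e (by linarith) v2
      have hmin : 0 < min (δ / 2) v := lt_min (by linarith) e
      refine v3 (v - min (δ / 2) v) (by linarith [min_le_right (δ / 2) v]) (by linarith)
        (hδ _ ?_)
      rw [abs_lt]; constructor <;> linarith [min_le_left (δ / 2) v]
  have hq' : nx p ∈ closure C := by
    obtain ⟨v, v0, v1, v2, v3⟩ := exists_last t0.le t1.le hmC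
    rcases v1.eq_or_lt with e | e
    · rwa [e, pt_one] at v2
    · exfalso
      obtain ⟨δ, δ0, hδ⟩ := hstep v (by linarith) e v2
      have hmin : 0 < min (δ / 2) (1 - v) := lt_min (by linarith) (by linarith)
      refine v3 (v + min (δ / 2) (1 - v)) (by linarith)
        (by linarith [min_le_right (δ / 2) (1 - v)]) (hδ _ ?_)
      rw [abs_lt]; constructor <;> linarith [min_le_left (δ / 2) (1 - v)]
  refine ⟨hp', hq', ?_⟩
  obtain ⟨-, -, -, c, c1, c2⟩ := hball _ hm hmC
  rcases one_side hC.convex hC.isOpen hne hp' hq' hm (fun hc => (h.st.disj p hp).le_bot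
    ⟨(hC.sub hc).1, openSegment_subset_segment _ _ _ hm⟩) with g | g
  · exact g
  · exact absurd (g c c1) (not_lt.2 c2.le)

/-- Every tip lies in the closure of a cell that is bounded by a real edge. -/
theorem exists_good_cell (h : WallSetup V Sg nx A G a b x) {i : Fin n} (hiG : a i ∈ G) :
    ∃ C, IsCell (freeRegion G b x) C ∧ a i ∈ closure C ∧ ∃ p ∈ A, ¬ Sg p (nx p) ∧
      p ∈ closure C ∧ nx p ∈ closure C ∧ ∀ c ∈ C, 0 < ori p (nx p) c := by
  have good : ∀ C, IsCell (freeRegion G b x) C → ¬ NoRealEdge Sg nx A C →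
      ∃ p ∈ A, ¬ Sg p (nx p) ∧ p ∈ closure C ∧ nx p ∈ closure C ∧ ∀ c ∈ C, 0 < ori p (nx p) c := by
    intro C hC hg
    unfold NoRealEdge at hg
    push Not at hg
    obtain ⟨p, hp, hs, m, hm, hmC⟩ := hg
    exact ⟨p, hp, hs, h.edge_mem_closure hC hp hs hm hmC⟩
  obtain ⟨C, hC, haC, hside, v₀, v₁, h0, h1, h2, h3, h4⟩ :=
    h.exists_side_cell (τ := 1) one_ne_zero hiG
  obtain ⟨C', hC', haC', hside', w₀, w₁, k0, k1, k2, k3, k4⟩ :=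
    h.exists_side_cell (τ := -1) (neg_ne_zero.2 one_ne_zero) hiG
  by_cases hb : NoRealEdge Sg nx A C
  · by_cases hb' : NoRealEdge Sg nx A C'
    · exact (h.sides_false hC hC' hb hb' hiG hside hside' h0 h1 h2 k0 k1 k2 h3 h4 k3 k4).elim
    · exact ⟨C', hC', haC', good C' hC' hb'⟩
  · exact ⟨C, hC, haC, good C hC hb⟩

end WallSetup

/-! ### Inserting the remaining tips over their base edges -/

theorem triInt_subset_of_mem_closure {C : Set Plane} (hC : Convex ℝ C) (ho : IsOpen C)
    {p q z : Plane} (hp : p ∈ closure C) (hq : q ∈ closure C) (hz : z ∈ closure C)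
    (hpos : 0 < ori p q z) : triInt p q z ⊆ C := by
  have hne : C.Nonempty := closure_nonempty_iff.1 ⟨p, hp⟩
  have h1 : triInt p q z ⊆ closure C := fun y hy =>
    tri_subset_of_convex hpos hC.closure hp hq hz ⟨hy.1.le, hy.2.1.le, hy.2.2.le⟩
  have h2 := interior_maximal h1 (isOpen_triInt p q z)
  rwa [hC.interior_closure_eq_interior_of_nonempty_interior (by rwa [ho.interior_eq]),
    ho.interior_eq] at h2

theorem eventually_triInt_left {p q z m : Plane} (ho : 0 < ori p q z)
    (hm : m ∈ openSegment ℝ p z) : ∀ᶠ y in 𝓝 m, ori p z y < 0 → y ∈ triInt p q z := by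
  obtain ⟨t, t0, t1, rfl⟩ := mem_openSegment_pt.1 hm
  have h1 : 0 < ori p q (pt p z t) := by rw [ori_pt]; simp only [ori_self_left]; nlinarith
  have h2 : 0 < ori q z (pt p z t) := by
    rw [ori_pt, ← ori_rot p q z]; simp only [ori_self_right]; nlinarith
  filter_upwards [eventually_ori_pos h1, eventually_ori_pos h2] with y y1 y2 y3
  exact ⟨y1, y2, by rw [ori_swap]; linarith⟩

theorem eventually_triInt_right {p q z m : Plane} (ho : 0 < ori p q z)
    (hm : m ∈ openSegment ℝ z q) : ∀ᶠ y in 𝓝 m, ori z q y < 0 → y ∈ triInt p q z := by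
  obtain ⟨t, t0, t1, rfl⟩ := mem_openSegment_pt.1 hm
  have h1 : 0 < ori p q (pt z q t) := by rw [ori_pt]; simp only [ori_self_right]; nlinarith
  have h2 : 0 < ori z p (pt z q t) := by
    rw [ori_pt, ori_rot z p q]; simp only [ori_self_left]; nlinarith
  filter_upwards [eventually_ori_pos h1, eventually_ori_pos h2] with y y1 y2 y3
  exact ⟨y1, by rw [ori_swap]; linarith, y2⟩

/-- A segment through `m` that avoids a half disc at `m` runs along the boundary of the half
disc. -/
theorem ori_eq_zero_of_avoid {D : Set Plane} {u v m c d : Plane}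
    (hn : ∀ᶠ y in 𝓝 m, ori u v y < 0 → y ∈ D) (hmu : ori u v m = 0)
    (hmc : m ∈ openSegment ℝ c d) (hav : ∀ y ∈ openSegment ℝ c d, y ∉ D) :
    ori u v c = 0 ∧ ori u v d = 0 := by
  have key : ∀ c d, m ∈ openSegment ℝ c d → (∀ y ∈ openSegment ℝ c d, y ∉ D) →
      ¬ ori u v c < 0 := by
    intro c d hmc hav hneg
    obtain ⟨ε, ε0, ε1, hε⟩ := exists_pt_of_eventually c hn one_pos
    refine hav (pt m c ε) ?_ (hε (by rw [ori_pt, hmu]; nlinarith))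
    obtain ⟨t, t0, t1, rfl⟩ := mem_openSegment_pt.1 hmc
    have : pt (pt c d t) c ε = pt c d (t * (1 - ε)) := by
      apply plane_ext <;> simp only [pt_apply] <;> ring
    rw [this]
    exact pt_mem_openSegment (by nlinarith) (by nlinarith)
  have h1 := not_lt.1 (key c d hmc hav)
  have h2 := not_lt.1 (key d c (by rwa [openSegment_symm]) (by rwa [openSegment_symm]))
  obtain ⟨t, t0, t1, rfl⟩ := mem_openSegment_pt.1 hmc
  rw [ori_pt] at hmu
  constructor
  · by_contra hc
    have := h1.lt_of_ne (Ne.symm hc)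
    nlinarith [mul_pos (sub_pos.2 t1) this, mul_nonneg t0.le h2]
  · by_contra hc
    have := h2.lt_of_ne (Ne.symm hc)
    nlinarith [mul_pos t0 this, mul_nonneg (sub_pos.2 t1).le h1]

theorem mem_segment_of_overlap {u v m c d : Plane} (huv : u ≠ v) (hm : m ∈ openSegment ℝ u v)
    (hmc : m ∈ openSegment ℝ c d) (hc : ori u v c = 0) (hd : ori u v d = 0)
    (hu : u ∉ openSegment ℝ c d) (hv : v ∉ openSegment ℝ c d) :
    c ∈ segment ℝ u v ∧ d ∈ segment ℝ u v := by
  obtain ⟨α, rfl⟩ := mem_line_of_ori_eq_zero huv hc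
  obtain ⟨β, rfl⟩ := mem_line_of_ori_eq_zero huv hd
  obtain ⟨μ, m0, m1, rfl⟩ := mem_openSegment_pt.1 hm
  have key : ∀ α β : ℝ, α < μ → μ < β → u ∉ openSegment ℝ (pt u v α) (pt u v β) →
      v ∉ openSegment ℝ (pt u v α) (pt u v β) → 0 ≤ α ∧ β ≤ 1 := by
    intro α β h1 h2 h3 h4
    constructor
    · by_contra hcon
      apply h3
      have := pt_between (p := u) (q := v) (a := α) (b := β) (c := 0) (by linarith) (by linarith)
      rwa [pt_zero] at this
    · by_contra hcon
      apply h4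
      have := pt_between (p := u) (q := v) (a := α) (b := β) (c := 1) (by linarith) (by linarith)
      rwa [pt_one] at this
  rcases between_of_mem huv hmc with g | g | g
  · have := key α β g.1 g.2 hu hv
    exact ⟨pt_mem_segment this.1 (by linarith), pt_mem_segment (by linarith) this.2⟩
  · have := key β α g.1 g.2 (by rwa [openSegment_symm]) (by rwa [openSegment_symm])
    exact ⟨pt_mem_segment (by linarith) this.2, pt_mem_segment this.1 (by linarith)⟩
  · rw [g.1, g.2]; exact ⟨pt_mem_segment m0.le m1.le, pt_mem_segment m0.le m1.le⟩

/-- The remaining tips are distributed over convex free sets, each based on an edge. -/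
structure TipState (V : Finset Plane) (Sg : Plane → Plane → Prop) (nx : Plane → Plane)
    (A : Finset Plane) (G : Set Plane) (C : Plane → Set Plane) (P : Plane → Plane) : Prop
    extends St V Sg nx A G where
  convex : ∀ z ∈ V, z ∈ G → Convex ℝ (C z)
  isOpenC : ∀ z ∈ V, z ∈ G → IsOpen (C z)
  sub : ∀ z ∈ V, z ∈ G → C z ⊆ G \ segUnion Sg
  mem : ∀ z ∈ V, z ∈ G → P z ∈ A
  notSg : ∀ z ∈ V, z ∈ G → ¬ Sg (P z) (nx (P z))
  tipMem : ∀ z ∈ V, z ∈ G → z ∈ closure (C z)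
  leftMem : ∀ z ∈ V, z ∈ G → P z ∈ closure (C z)
  rightMem : ∀ z ∈ V, z ∈ G → nx (P z) ∈ closure (C z)
  pos : ∀ z ∈ V, z ∈ G → 0 < ori (P z) (nx (P z)) z
  eqC : ∀ z ∈ V, z ∈ G → ∀ z' ∈ V, z' ∈ G → P z = P z' → C z = C z'
  disjC : ∀ z ∈ V, z ∈ G → ∀ z' ∈ V, z' ∈ G → P z ≠ P z' → Disjoint (C z) (C z')
  -- The sides of the triangle over the base thus lie in `G`, and tips on them belong to the same
  -- base, so the tip nearest to the base has none on its sides. Chords between tips are included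
  -- since they become sides later.
  chord : ∀ z ∈ V, z ∈ G → ∀ y, (y = P z ∨ y = nx (P z) ∨ (y ∈ V ∧ y ∈ G ∧ P y = P z ∧ y ≠ z)) →
    openSegment ℝ y z ⊆ G ∧ ∀ m ∈ V, m ∈ openSegment ℝ y z → P m = P z

namespace TipState
variable {V : Finset Plane} {Sg : Plane → Plane → Prop} {nx : Plane → Plane} {A : Finset Plane}
  {G : Set Plane} {C : Plane → Set Plane} {P : Plane → Plane}

theorem triInt_sub (h : TipState V Sg nx A G C P) {z : Plane} (hz : z ∈ V) (hzG : z ∈ G) :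
    triInt (P z) (nx (P z)) z ⊆ C z :=
  triInt_subset_of_mem_closure (h.convex z hz hzG) (h.isOpenC z hz hzG) (h.leftMem z hz hzG)
    (h.rightMem z hz hzG) (h.tipMem z hz hzG) (h.pos z hz hzG)

theorem tri_cases {p q z m : Plane} (ho : 0 < ori p q z) (hm : m ∈ tri p q z) :
    m ∈ triInt p q z ∨ m ∈ segment ℝ p q ∨ m ∈ openSegment ℝ p z ∨ m ∈ openSegment ℝ z q ∨
      m = z := by
  by_cases h1 : ori p q m = 0
  · exact Or.inr (Or.inl (mem_segment_of_tri ho hm h1))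
  by_cases h2 : ori q z m = 0
  · rcases mem_segment_cases (mem_segment_of_tri₂ ho hm h2) with g | g | g
    · exact Or.inr (Or.inl (g ▸ right_mem_segment ℝ _ _))
    · exact Or.inr (Or.inr (Or.inr (Or.inr g)))
    · rw [openSegment_symm] at g; exact Or.inr (Or.inr (Or.inr (Or.inl g)))
  by_cases h3 : ori z p m = 0
  · rcases mem_segment_cases (mem_segment_of_tri₃ ho hm h3) with g | g | g
    · exact Or.inr (Or.inl (g ▸ left_mem_segment ℝ _ _))
    · exact Or.inr (Or.inr (Or.inr (Or.inr g)))
    · exact Or.inr (Or.inr (Or.inl g))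
  exact Or.inl ⟨hm.1.lt_of_ne (Ne.symm h1), hm.2.1.lt_of_ne (Ne.symm h2),
    hm.2.2.lt_of_ne (Ne.symm h3)⟩

theorem tri_sub (h : TipState V Sg nx A G C P) {z : Plane} (hz : z ∈ V) (hzG : z ∈ G) {m : Plane}
    (hm : m ∈ tri (P z) (nx (P z)) z) (hms : m ∉ segment ℝ (P z) (nx (P z))) : m ∈ G := by
  rcases tri_cases (h.pos z hz hzG) hm with g | g | g | g | g
  · exact (h.sub z hz hzG (h.triInt_sub hz hzG g)).1
  · exact absurd g hms
  · exact (h.chord z hz hzG _ (Or.inl rfl)).1 g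
  · rw [openSegment_symm] at g
    exact (h.chord z hz hzG _ (Or.inr (Or.inl rfl))).1 g
  · exact g ▸ hzG

/-- The tip nearest to the base is the only one in its triangle. -/
theorem eq_of_mem_tri (h : TipState V Sg nx A G C P) (hS : SegSys V Sg) {z : Plane} (hz : z ∈ V)
    (hzG : z ∈ G) (hmin : ∀ y ∈ V, y ∈ G → P y = P z →
      ori (P z) (nx (P z)) z ≤ ori (P z) (nx (P z)) y) {y : Plane} (hy : y ∈ V) (hyG : y ∈ G)
    (hyT : y ∈ tri (P z) (nx (P z)) z) : y = z := by
  have hpos := h.pos z hz hzG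
  rcases tri_cases hpos hyT with g | g | g | g | g
  · exact absurd (hS.mem_segUnion hy) (h.sub z hz hzG (h.triInt_sub hz hzG g)).2
  · exact ((h.disj _ (h.mem z hz hzG)).le_bot ⟨hyG, g⟩).elim
  · have h1 := hmin y hy hyG ((h.chord z hz hzG _ (Or.inl rfl)).2 y hy g)
    obtain ⟨t, t0, t1, rfl⟩ := mem_openSegment_pt.1 g
    rw [ori_pt] at h1; simp only [ori_self_left] at h1
    nlinarith
  · rw [openSegment_symm] at g
    have h1 := hmin y hy hyG ((h.chord z hz hzG _ (Or.inr (Or.inl rfl))).2 y hy g)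
    obtain ⟨t, t0, t1, rfl⟩ := mem_openSegment_pt.1 g
    rw [ori_pt] at h1; simp only [ori_self_right] at h1
    nlinarith
  · exact g

/-- A segment in `G` that avoids the inside of the triangle of `z` and does not contain `z` runs
along one of its sides when it meets the triangle. -/
theorem along_side (h : TipState V Sg nx A G C P) {z : Plane} (hz : z ∈ V)
    (hzG : z ∈ G) {c d m : Plane} (hcd : openSegment ℝ c d ⊆ G)
    (hav : ∀ y ∈ openSegment ℝ c d, y ∉ triInt (P z) (nx (P z)) z) (hzo : z ∉ openSegment ℝ c d)
    (hm : m ∈ openSegment ℝ c d) (hmT : m ∈ tri (P z) (nx (P z)) z) :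
    (c ∈ segment ℝ (P z) z ∧ d ∈ segment ℝ (P z) z) ∨
      (c ∈ segment ℝ z (nx (P z)) ∧ d ∈ segment ℝ z (nx (P z))) := by
  have hpos := h.pos z hz hzG
  have hpA := h.mem z hz hzG
  have hno : ∀ y ∈ A, y ∉ openSegment ℝ c d := fun y hy hc => h.notMem_of_vertex hy (hcd hc)
  have hne := ne_of_ori_ne hpos.ne'
  rcases tri_cases hpos hmT with g | g | g | g | g
  · exact absurd g (hav m hm)
  · exact ((h.disj _ hpA).le_bot ⟨hcd hm, g⟩).elim
  · left
    obtain ⟨h1, h2⟩ := ori_eq_zero_of_avoid (eventually_triInt_left hpos g)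
      (ori_of_mem_segment (openSegment_subset_segment _ _ _ g)) hm hav
    exact mem_segment_of_overlap hne.2.2 g hm h1 h2 (hno _ hpA) hzo
  · right
    obtain ⟨h1, h2⟩ := ori_eq_zero_of_avoid (eventually_triInt_right hpos g)
      (ori_of_mem_segment (openSegment_subset_segment _ _ _ g)) hm hav
    exact mem_segment_of_overlap hne.2.1.symm g hm h1 h2 hzo (hno _ (h.maps _ hpA))
  · exact absurd (g ▸ hm) hzo

/-- The triangle of the nearest tip contains no other unvisited endpoint. A diagonal that meets it
avoids its inside, hence runs along a side, and is that whole side. -/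
theorem insert_tip (h : TipState V Sg nx A G C P) (hS : SegSys V Sg) {z : Plane} (hz : z ∈ V)
    (hzG : z ∈ G) (hmin : ∀ y ∈ V, y ∈ G → P y = P z →
      ori (P z) (nx (P z)) z ≤ ori (P z) (nx (P z)) y) :
    St V Sg (insNext nx (P z) z) (insert z A) (G \ tri (P z) (nx (P z)) z) := by
  have hpos := h.pos z hz hzG
  have hpA := h.mem z hz hzG
  refine h.toSt.insert hS hpA (fun hc => h.notMem_of_vertex hc hzG) hpos
    (fun m hm => h.tri_sub hz hzG hm.1 hm.2) (h.notSg z hz hzG)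
    (fun y hy hyG hyT => h.eq_of_mem_tri hS hz hzG hmin hy hyG hyT) ?_
  intro a b hab habG
  by_cases hd : Disjoint (openSegment ℝ a b) (tri (P z) (nx (P z)) z)
  · exact Or.inl hd
  right
  obtain ⟨m, hm, hmT⟩ := Set.not_disjoint_iff.1 hd
  have hab' := hS.ne hab
  have hends : ∀ u, u ∈ A → (∀ y ∈ V, y ∈ segment ℝ u z → y = u ∨ y = z) →
      a ∈ segment ℝ u z → b ∈ segment ℝ u z → (a = u ∧ b = z) ∨ (a = z ∧ b = u) := by
    intro u hu hcl ha hb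
    rcases hcl a (hS.mem hab) ha with e | e <;> rcases hcl b (hS.mem' hab) hb with e' | e'
    · exact absurd (e.trans e'.symm) hab'
    · exact Or.inl ⟨e, e'⟩
    · exact Or.inr ⟨e, e'⟩
    · exact absurd (e.trans e'.symm) hab'
  have hcl : ∀ u, (u = P z ∨ u = nx (P z)) → u ∈ A → segment ℝ u z ⊆ tri (P z) (nx (P z)) z →
      ∀ y ∈ V, y ∈ segment ℝ u z → y = u ∨ y = z := by
    intro u hu huA hT y hy hyu
    rcases mem_segment_cases hyu with e | e | e
    · exact Or.inl e
    · exact Or.inr e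
    · right
      have hyG : y ∈ G := (h.chord z hz hzG u (hu.imp_right Or.inl)).1 e
      exact h.eq_of_mem_tri hS hz hzG hmin hy hyG (hT hyu)
  have hconv := convex_tri (P z) (nx (P z)) z
  rcases h.along_side hz hzG habG (fun y hy hc =>
      (h.sub z hz hzG (h.triInt_sub hz hzG hc)).2
        ⟨a, b, hab, openSegment_subset_segment _ _ _ hy⟩)
      (fun hc => hS.notMem_open hab hz hc) hm hmT with ⟨ha, hb⟩ | ⟨ha, hb⟩
  · rcases hends _ hpA (hcl _ (Or.inl rfl) hpA
      (hconv.segment_subset (left_mem_tri hpos.le) (right_mem_tri hpos.le))) ha hb with e | e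
    · exact Or.inl e
    · exact Or.inr (Or.inl e)
  · rw [segment_symm] at ha hb
    rcases hends _ (h.maps _ hpA) (hcl _ (Or.inr rfl) (h.maps _ hpA)
      (hconv.segment_subset (mid_mem_tri hpos.le) (right_mem_tri hpos.le))) ha hb with e | e
    · exact Or.inr (Or.inr (Or.inr e))
    · exact Or.inr (Or.inr (Or.inl e))

end TipState

theorem mem_closure_inter_of_openSegment {C H : Set Plane} (hC : Convex ℝ C) (ho : IsOpen C)
    {c y : Plane} (hc : c ∈ C) (hy : y ∈ closure C) (hH : openSegment ℝ c y ⊆ H) :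
    y ∈ closure (C ∩ H) := by
  have : y ∈ closure (openSegment ℝ c y) := by
    rw [closure_openSegment]; exact right_mem_segment ℝ _ _
  exact closure_mono (subset_inter (openSegment_subset_of_mem_closure hC ho hc hy) hH) this

theorem openSegment_ori_pos {p q c y : Plane} (hc : 0 < ori p q c) (hy : 0 ≤ ori p q y) :
    openSegment ℝ c y ⊆ {m | 0 < ori p q m} := by
  intro m hm
  obtain ⟨t, t0, t1, rfl⟩ := mem_openSegment_pt.1 hm
  simp only [mem_ofPred_eq]; rw [ori_pt]; nlinarith

theorem exists_mem_of_closure_ori_pos {C : Set Plane} {p q y : Plane} (hy : y ∈ closure C)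
    (h : 0 < ori p q y) : ∃ c ∈ C, 0 < ori p q c := by
  obtain ⟨c, c1, c2⟩ := mem_closure_iff.1 hy _ (isOpen_lt continuous_const (continuous_ori p q)) h
  exact ⟨c, c2, c1⟩

/-- A chord with points of the convex set on both sides contains a point of the set. -/
theorem exists_mem_chord {C : Set Plane} (hC : Convex ℝ C) (ho : IsOpen C) {u v y y' : Plane}
    (hu : u ∈ closure C) (hv : v ∈ closure C) (hy : y ∈ closure C) (hy' : y' ∈ closure C)
    (h1 : 0 < ori u v y) (h2 : ori u v y' < 0) : ∃ m ∈ openSegment ℝ u v, m ∈ C := by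
  by_contra hcon
  push Not at hcon
  have huv := (ne_of_ori_ne h1.ne').1
  have hm : pt u v (1 / 2) ∈ openSegment ℝ u v := pt_mem_openSegment (by norm_num) (by norm_num)
  obtain ⟨c, c1, c2⟩ := exists_mem_of_closure_ori_pos hy h1
  obtain ⟨d, d1, d2⟩ := exists_mem_of_closure_ori_pos (p := v) (q := u) hy'
    (by rw [ori_swap]; linarith)
  rw [ori_swap] at d2
  rcases one_side hC ho huv hu hv hm (hcon _ hm) with g | g
  · linarith [g d d1]
  · linarith [g c c1]

namespace TipState
variable {V : Finset Plane} {Sg : Plane → Plane → Prop} {nx : Plane → Plane} {A : Finset Plane}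
  {G : Set Plane} {C : Plane → Set Plane} {P : Plane → Plane}

/-- The new bases after inserting `z` behind `p`. -/
noncomputable def newBase (P : Plane → Plane) (p z y : Plane) : Plane :=
  if P y = p then (if 0 < ori p z y then p else z) else P y

/-- The new convex sets after inserting `z` between `p` and `q`. -/
noncomputable def newCell (C : Plane → Set Plane) (P : Plane → Plane) (p q z y : Plane) :
    Set Plane :=
  if P y = p then (if 0 < ori p z y then C z ∩ {m | 0 < ori p z m} else
    C z ∩ ({m | 0 < ori z p m} ∩ {m | 0 < ori z q m})) else C y

/-- Tips of the same base to the left of `p z` get the new edge `p z`, the others get `z q`; the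
cell is divided along the corresponding lines. A new edge that serves as a base is not a segment,
because the old cell has points on both sides of it and hence on it. -/
theorem step (h : TipState V Sg nx A G C P) (hS : SegSys V Sg) {z : Plane} (hz : z ∈ V)
    (hzG : z ∈ G) (hmin : ∀ y ∈ V, y ∈ G → P y = P z →
      ori (P z) (nx (P z)) z ≤ ori (P z) (nx (P z)) y) :
    TipState V Sg (insNext nx (P z) z) (insert z A) (G \ tri (P z) (nx (P z)) z)
      (newCell C P (P z) (nx (P z)) z) (newBase P (P z) z) := by
  have hst := h.insert_tip hS hz hzG hmin
  have hpos := h.pos z hz hzG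
  have hpA := h.mem z hz hzG
  have hzA : z ∉ A := fun hc => h.notMem_of_vertex hc hzG
  have hCc := h.convex z hz hzG
  have hCo := h.isOpenC z hz hzG
  have hCs := h.sub z hz hzG
  have hpC := h.leftMem z hz hzG
  have hqC := h.rightMem z hz hzG
  have hzC := h.tipMem z hz hzG
  have htri := h.triInt_sub hz hzG
  have hchp := h.chord z hz hzG _ (Or.inl rfl)
  have hchq := h.chord z hz hzG _ (Or.inr (Or.inl rfl))
  have halong := fun {c d m : Plane} => h.along_side hz hzG (c := c) (d := d) (m := m)
  set p := P z with hp
  set q := nx p with hq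
  have hpz : p ≠ z := fun hc => hzA (hc ▸ hpA)
  have hqA : q ∈ A := h.maps p hpA
  have np : insNext nx p z p = z := insNext_left nx hpz
  have nz : insNext nx p z z = q := insNext_new nx p z
  have nn : ∀ y ∈ A, y ≠ p → insNext nx p z y = nx y := fun y hy hyp =>
    insNext_of_ne nx (fun hc => hzA (hc ▸ hy)) hyp
  have hpq : 0 < ori z p q := by rw [ori_rot]; exact hpos
  have hzq : ori p z q < 0 := by rw [ori_swap]; linarith
  have hTcl : tri p q z ⊆ closure (C z) := tri_subset_of_convex hpos hCc.closure hpC hqC hzC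
  have hzT : z ∈ tri p q z := right_mem_tri hpos.le
  -- the three kinds of remaining tips
  have kinds : ∀ y ∈ V, y ∈ G \ tri p q z →
      (P y ≠ p ∧ newBase P p z y = P y ∧ newCell C P p q z y = C y ∧
        insNext nx p z (P y) = nx (P y)) ∨
      (P y = p ∧ 0 < ori p z y ∧ newBase P p z y = p ∧
        newCell C P p q z y = C z ∩ {m | 0 < ori p z m}) ∨
      (P y = p ∧ ori p z y ≤ 0 ∧ 0 < ori z q y ∧ newBase P p z y = z ∧
        newCell C P p q z y = C z ∩ ({m | 0 < ori z p m} ∩ {m | 0 < ori z q m})) := by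
    intro y hy hyG
    by_cases h1 : P y = p
    · by_cases h2 : 0 < ori p z y
      · exact Or.inr (Or.inl ⟨h1, h2, by simp [newBase, h1, h2], by simp [newCell, h1, h2]⟩)
      · refine Or.inr (Or.inr ⟨h1, not_lt.1 h2, ?_, by simp [newBase, h1, h2],
          by simp [newCell, h1, h2]⟩)
        by_contra h3
        have h4 := h.pos y hy hyG.1
        rw [h1] at h4
        exact hyG.2 ⟨h4.le, by rw [ori_swap]; linarith, by rw [ori_swap]; linarith⟩
    · exact Or.inl ⟨h1, by simp [newBase, h1], by simp [newCell, h1], nn _ (h.mem y hy hyG.1) h1⟩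
  have hCy : ∀ y ∈ V, y ∈ G → P y = p → C y = C z := fun y hy hyG e => h.eqC y hy hyG z hz hzG e
  have hyz : ∀ y, y ∈ G \ tri p q z → y ≠ z := fun y hy e => hy.2 (e ▸ hzT)
  have hC1 : ∀ y ∈ V, y ∈ G → P y = p → 0 < ori p z y → ∃ c ∈ C z, 0 < ori p z c := by
    intro y hy hyG e h2
    have := h.tipMem y hy hyG
    rw [hCy y hy hyG e] at this
    exact exists_mem_of_closure_ori_pos this h2
  have hC2 : ∀ y ∈ V, y ∈ G → P y = p → ori p z y ≤ 0 → 0 < ori z q y →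
      ∃ c ∈ C z, 0 < ori z p c ∧ 0 < ori z q c := by
    intro y hy hyG e h2 h3
    have hyC := h.tipMem y hy hyG
    rw [hCy y hy hyG e] at hyC
    have hm : pt y q (1 / 2) ∈ closure (C z) := hCc.closure.segment_subset hyC hqC
      (pt_mem_segment (by norm_num) (by norm_num))
    have m1 : 0 < ori z p (pt y q (1 / 2)) := by
      rw [ori_pt]; have := ori_swap p z y; nlinarith
    have m2 : 0 < ori z q (pt y q (1 / 2)) := by rw [ori_pt, ori_self_right]; nlinarith
    obtain ⟨c, ⟨c1, c2⟩, c3⟩ := mem_closure_iff.1 hm _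
      ((isOpen_lt continuous_const (continuous_ori z p)).inter
        (isOpen_lt continuous_const (continuous_ori z q))) ⟨m1, m2⟩
    exact ⟨c, c3, c1, c2⟩
  have hdT : ∀ y ∈ V, y ∈ G → P y ≠ p → Disjoint (C y) (tri p q z) := by
    intro y hy hyG e
    have := (h.disjC y hy hyG z hz hzG e).closure_right (h.isOpenC y hy hyG)
    exact this.mono_right hTcl
  have tip : ∀ y ∈ V, y ∈ G \ tri p q z → Convex ℝ (newCell C P p q z y) ∧
      IsOpen (newCell C P p q z y) ∧ newCell C P p q z y ⊆ (G \ tri p q z) \ segUnion Sg ∧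
      newBase P p z y ∈ insert z A ∧
      ¬ Sg (newBase P p z y) (insNext nx p z (newBase P p z y)) ∧
      y ∈ closure (newCell C P p q z y) ∧ newBase P p z y ∈ closure (newCell C P p q z y) ∧
      insNext nx p z (newBase P p z y) ∈ closure (newCell C P p q z y) ∧
      0 < ori (newBase P p z y) (insNext nx p z (newBase P p z y)) y := by
    intro y hy hyG
    have hyC := h.tipMem y hy hyG.1
    rcases kinds y hy hyG with ⟨k1, k2, k3, k4⟩ | ⟨k1, k2, k3, k4⟩ | ⟨k1, k2, k5, k3, k4⟩
    · rw [k2, k3, k4]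
      exact ⟨h.convex y hy hyG.1, h.isOpenC y hy hyG.1, fun m hm =>
        ⟨⟨(h.sub y hy hyG.1 hm).1, fun hc => (hdT y hy hyG.1 k1).le_bot ⟨hm, hc⟩⟩,
          (h.sub y hy hyG.1 hm).2⟩, Finset.mem_insert_of_mem (h.mem y hy hyG.1),
        h.notSg y hy hyG.1, hyC, h.leftMem y hy hyG.1, h.rightMem y hy hyG.1, h.pos y hy hyG.1⟩
    · rw [hCy y hy hyG.1 k1] at hyC
      obtain ⟨c, c1, c2⟩ := hC1 y hy hyG.1 k1 k2
      have cl : ∀ w ∈ closure (C z), 0 ≤ ori p z w → w ∈ closure (C z ∩ {m | 0 < ori p z m}) :=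
        fun w hw hw' => mem_closure_inter_of_openSegment hCc hCo c1 hw (openSegment_ori_pos c2 hw')
      rw [k3, k4, np]
      refine ⟨hCc.inter (convex_ori_pos _ _), hCo.inter
        (isOpen_lt continuous_const (continuous_ori _ _)), fun m hm =>
        ⟨⟨(hCs hm.1).1, fun hc => ?_⟩, (hCs hm.1).2⟩, Finset.mem_insert_of_mem hpA, fun hs => ?_,
        cl y hyC k2.le, cl p hpC (by simp), cl z hzC (by simp), k2⟩
      · have h1 := hm.2
        have h2 := hc.2.2
        simp only [mem_ofPred_eq] at h1
        rw [ori_swap] at h2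
        linarith
      · obtain ⟨m, m1, m2⟩ := exists_mem_chord hCc hCo hpC hzC hyC hqC k2 hzq
        exact (hCs m2).2 ⟨p, z, hs, openSegment_subset_segment _ _ _ m1⟩
    · rw [hCy y hy hyG.1 k1] at hyC
      obtain ⟨c, c1, c2, c3⟩ := hC2 y hy hyG.1 k1 k2 k5
      have cl : ∀ w ∈ closure (C z), 0 ≤ ori z p w → 0 ≤ ori z q w →
          w ∈ closure (C z ∩ ({m | 0 < ori z p m} ∩ {m | 0 < ori z q m})) :=
        fun w hw hw1 hw2 => mem_closure_inter_of_openSegment hCc hCo c1 hw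
          (subset_inter (openSegment_ori_pos c2 hw1) (openSegment_ori_pos c3 hw2))
      rw [k3, k4, nz]
      refine ⟨hCc.inter ((convex_ori_pos _ _).inter (convex_ori_pos _ _)), hCo.inter
        ((isOpen_lt continuous_const (continuous_ori _ _)).inter
          (isOpen_lt continuous_const (continuous_ori _ _))), fun m hm =>
        ⟨⟨(hCs hm.1).1, fun hc => ?_⟩, (hCs hm.1).2⟩, Finset.mem_insert_self _ _, fun hs => ?_,
        cl y hyC (by rw [ori_swap]; linarith) k5.le, cl z hzC (by simp) (by simp),
        cl q hqC hpq.le (by simp), k5⟩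
      · have h1 := hm.2.2
        have h2 := hc.2.1
        simp only [mem_ofPred_eq] at h1
        rw [ori_swap] at h2
        linarith
      · obtain ⟨m, m1, m2⟩ := exists_mem_chord hCc hCo hzC hqC hyC hpC k5
          (by rw [ori_swap']; linarith)
        exact (hCs m2).2 ⟨z, q, hs, openSegment_subset_segment _ _ _ m1⟩
  have baseA : ∀ y ∈ V, y ∈ G → P y ≠ z := fun y hy hyG e => hzA (e ▸ h.mem y hy hyG)
  refine ⟨hst, fun y hy hyG => (tip y hy hyG).1, fun y hy hyG => (tip y hy hyG).2.1,
    fun y hy hyG => (tip y hy hyG).2.2.1, fun y hy hyG => (tip y hy hyG).2.2.2.1,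
    fun y hy hyG => (tip y hy hyG).2.2.2.2.1, fun y hy hyG => (tip y hy hyG).2.2.2.2.2.1,
    fun y hy hyG => (tip y hy hyG).2.2.2.2.2.2.1, fun y hy hyG => (tip y hy hyG).2.2.2.2.2.2.2.1,
    fun y hy hyG => (tip y hy hyG).2.2.2.2.2.2.2.2, ?_, ?_, ?_⟩
  · intro y hy hyG y' hy' hyG'
    have b1 := baseA y hy hyG.1
    have b2 := baseA y' hy' hyG'.1
    rcases kinds y hy hyG with ⟨k1, k2, k3, -⟩ | ⟨k1, -, k2, k3⟩ | ⟨k1, -, -, k2, k3⟩ <;>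
    rcases kinds y' hy' hyG' with ⟨l1, l2, l3, -⟩ | ⟨l1, -, l2, l3⟩ | ⟨l1, -, -, l2, l3⟩ <;>
    rw [k2, l2, k3, l3] <;> intro e
    · exact h.eqC y hy hyG.1 y' hy' hyG'.1 e
    · exact absurd e k1
    · exact absurd e b1
    · exact absurd e.symm l1
    · rfl
    · exact absurd e hpz
    · exact absurd e.symm b2
    · exact absurd e.symm hpz
    · rfl
  · intro y hy hyG y' hy' hyG'
    have d1 : ∀ w ∈ V, w ∈ G → P w ≠ p → Disjoint (C w) (C z) := fun w hw hwG e =>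
      h.disjC w hw hwG z hz hzG e
    have d2 : Disjoint (C z ∩ {m | 0 < ori p z m})
        (C z ∩ ({m | 0 < ori z p m} ∩ {m | 0 < ori z q m})) := by
      rw [disjoint_left]
      intro m h1 h2
      have h1 := h1.2
      have h2 := h2.2.1
      simp only [mem_ofPred_eq] at h1 h2
      rw [ori_swap] at h1
      linarith
    rcases kinds y hy hyG with ⟨k1, k2, k3, -⟩ | ⟨k1, -, k2, k3⟩ | ⟨k1, -, -, k2, k3⟩ <;>
    rcases kinds y' hy' hyG' with ⟨l1, l2, l3, -⟩ | ⟨l1, -, l2, l3⟩ | ⟨l1, -, -, l2, l3⟩ <;>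
    rw [k2, l2, k3, l3] <;> intro e
    · exact h.disjC y hy hyG.1 y' hy' hyG'.1 e
    · exact (d1 y hy hyG.1 k1).mono_right inter_subset_left
    · exact (d1 y hy hyG.1 k1).mono_right inter_subset_left
    · exact ((d1 y' hy' hyG'.1 l1).mono_right inter_subset_left).symm
    · exact absurd rfl e
    · exact d2
    · exact ((d1 y' hy' hyG'.1 l1).mono_right inter_subset_left).symm
    · exact d2.symm
    · exact absurd rfl e
  · intro y hy hyG w hw
    -- it suffices to find the chord in the old state and to keep it off the triangle
    rcases kinds y hy hyG with ⟨k1, k2, k3, k4⟩ | ⟨k1, k2, k3, k4⟩ | ⟨k1, k2, k5, k3, k4⟩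
    · rw [k2, k4] at hw
      have hw' : w = P y ∨ w = nx (P y) ∨ (w ∈ V ∧ w ∈ G ∧ P w = P y ∧ w ≠ y) := by
        rcases hw with e | e | ⟨w1, w2, w3, w4⟩
        · exact Or.inl e
        · exact Or.inr (Or.inl e)
        · refine Or.inr (Or.inr ⟨w1, w2.1, ?_, w4⟩)
          rcases kinds w w1 w2 with ⟨-, l2, -⟩ | ⟨-, -, l2, -⟩ | ⟨-, -, -, l2, -⟩
          · rw [← w3, l2]
          · rw [l2] at w3; exact absurd w3.symm k1
          · rw [l2] at w3; exact absurd w3.symm (baseA y hy hyG.1)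
      obtain ⟨g1, g2⟩ := h.chord y hy hyG.1 w hw'
      have hwC : w ∈ closure (C y) := by
        rcases hw' with e | e | ⟨w1, w2, w3, w4⟩
        · rw [e]; exact h.leftMem y hy hyG.1
        · rw [e]; exact h.rightMem y hy hyG.1
        · rw [← h.eqC w w1 w2 y hy hyG.1 w3]; exact h.tipMem w w1 w2
      -- The old chord property puts every tip on a chord into the group of that chord, and `z` is
      -- in another group.
      have hzo : z ∉ openSegment ℝ w y := fun hc => k1 (g2 z hz hc).symm
      have hno : ∀ m ∈ openSegment ℝ w y, m ∉ tri p q z := by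
        intro m hm hmT
        have hav : ∀ m ∈ openSegment ℝ w y, m ∉ triInt p q z := by
          intro m hm hc
          have hmC : m ∈ closure (C y) := (h.convex y hy hyG.1).closure.segment_subset hwC
            (h.tipMem y hy hyG.1) (openSegment_subset_segment _ _ _ hm)
          have hd := (h.disjC y hy hyG.1 z hz hzG k1).closure_left hCo
          exact hd.le_bot ⟨hmC, htri hc⟩
        have hyne := hyz y hyG
        have hyA : ∀ u ∈ A, y ≠ u := fun u hu e => h.notMem_of_vertex hu (e ▸ hyG.1)
        rcases halong g1 hav hzo hm hmT with ⟨-, h2⟩ | ⟨-, h2⟩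
        · rcases mem_segment_cases h2 with e | e | e
          · exact hyA p hpA e
          · exact hyne e
          · exact k1 (hchp.2 y hy e)
        · rcases mem_segment_cases h2 with e | e | e
          · exact hyne e
          · exact hyA q hqA e
          · rw [openSegment_symm] at e; exact k1 (hchq.2 y hy e)
      refine ⟨fun m hm => ⟨g1 hm, hno m hm⟩, fun m hmV hm => ?_⟩
      have hmP := g2 m hmV hm
      rw [k2]
      simp [newBase, hmP, k1]
    · rw [k3, np] at hw
      have hw' : (w = P y ∨ w = nx (P y) ∨ (w ∈ V ∧ w ∈ G ∧ P w = P y ∧ w ≠ y)) ∧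
          0 ≤ ori p z w := by
        rcases hw with e | e | ⟨w1, w2, w3, w4⟩
        · exact ⟨Or.inl (e.trans k1.symm), by rw [e]; simp⟩
        · refine ⟨Or.inr (Or.inr ⟨e ▸ hz, e ▸ hzG, ?_, ?_⟩), by rw [e]; simp⟩
          · rw [e, k1]
          · rw [e]; exact (hyz y hyG).symm
        · rcases kinds w w1 w2 with ⟨l1, l2, -⟩ | ⟨l1, l5, l2, -⟩ | ⟨-, -, -, l2, -⟩
          · rw [l2] at w3; exact absurd w3 l1
          · exact ⟨Or.inr (Or.inr ⟨w1, w2.1, l1.trans k1.symm, w4⟩), l5.le⟩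
          · rw [l2] at w3; exact absurd w3.symm hpz
      obtain ⟨g1, g2⟩ := h.chord y hy hyG.1 w hw'.1
      have hside : openSegment ℝ w y ⊆ {m | 0 < ori p z m} := by
        rw [openSegment_symm]; exact openSegment_ori_pos k2 hw'.2
      refine ⟨fun m hm => ⟨g1 hm, fun hc => ?_⟩, fun m hmV hm => ?_⟩
      · have h1 := hside hm
        have h2 := hc.2.2
        simp only [mem_ofPred_eq] at h1
        rw [ori_swap] at h2
        linarith
      · have h1 := hside hm
        simp only [mem_ofPred_eq] at h1
        rw [k3]
        simp [newBase, g2 m hmV hm, k1, h1]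
    · rw [k3, nz] at hw
      have hw' : (w = P y ∨ w = nx (P y) ∨ (w ∈ V ∧ w ∈ G ∧ P w = P y ∧ w ≠ y)) ∧
          0 ≤ ori z q w ∧ 0 ≤ ori z p w := by
        rcases hw with e | e | ⟨w1, w2, w3, w4⟩
        · refine ⟨Or.inr (Or.inr ⟨e ▸ hz, e ▸ hzG, ?_, ?_⟩), by rw [e]; simp, by rw [e]; simp⟩
          · rw [e, k1]
          · rw [e]; exact (hyz y hyG).symm
        · exact ⟨Or.inr (Or.inl (by rw [e, k1])), by rw [e]; simp, by rw [e]; exact hpq.le⟩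
        · rcases kinds w w1 w2 with ⟨l1, l2, -⟩ | ⟨l1, l5, l2, -⟩ | ⟨l1, l5, l6, l2, -⟩
          · rw [l2] at w3; exact absurd w3 (baseA w w1 w2.1)
          · rw [l2] at w3; exact absurd w3 hpz
          · exact ⟨Or.inr (Or.inr ⟨w1, w2.1, l1.trans k1.symm, w4⟩), l6.le,
              by rw [ori_swap]; linarith⟩
      obtain ⟨g1, g2⟩ := h.chord y hy hyG.1 w hw'.1
      have hside : openSegment ℝ w y ⊆ {m | 0 < ori z q m} := by
        rw [openSegment_symm]; exact openSegment_ori_pos k5 hw'.2.1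
      refine ⟨fun m hm => ⟨g1 hm, fun hc => ?_⟩, fun m hmV hm => ?_⟩
      · have h1 := hside hm
        have h2 := hc.2.1
        simp only [mem_ofPred_eq] at h1
        rw [ori_swap] at h2
        linarith
      · have h1 : ori p z m ≤ 0 := by
          obtain ⟨t, t0, t1, rfl⟩ := mem_openSegment_pt.1 hm
          rw [ori_pt, ori_swap p z w]
          nlinarith [hw'.2.2]
        rw [k3]
        simp [newBase, g2 m hmV hm, k1, not_lt.2 h1]

/-- All tips can be inserted. -/
theorem exists_complete (hS : SegSys V Sg) (N : ℕ) : ∀ (nx : Plane → Plane) (A : Finset Plane)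
    (G : Set Plane) (C : Plane → Set Plane) (P : Plane → Plane), TipState V Sg nx A G C P →
    A ⊆ V → (V \ A).card ≤ N → ∃ nx' G', St V Sg nx' V G' := by
  induction N with
  | zero =>
    intro nx A G C P h hAV hN
    have : V \ A = ∅ := Finset.card_eq_zero.1 (Nat.le_zero.1 hN)
    have hA : A = V := hAV.antisymm (Finset.sdiff_eq_empty_iff_subset.1 this)
    subst hA
    exact ⟨nx, G, h.toSt⟩
  | succ N ih =>
    intro nx A G C P h hAV hN
    by_cases hne : ∃ z ∈ V, z ∈ G
    · obtain ⟨z₀, hz₀, hz₀G⟩ := hne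
      obtain ⟨z, hz, hmin⟩ := (V.filter fun y => y ∈ G ∧ P y = P z₀).exists_min_image
        (fun y => ori (P z₀) (nx (P z₀)) y) ⟨z₀, by simp [hz₀, hz₀G]⟩
      simp only [Finset.mem_filter] at hz hmin
      have hs := h.step hS hz.1 hz.2.1 (by
        intro y hy hyG e
        rw [hz.2.2] at e ⊢
        exact hmin y ⟨hy, hyG, e⟩)
      refine ih _ _ _ _ _ hs (Finset.insert_subset hz.1 hAV) ?_
      have hzA : z ∉ A := fun hc => h.notMem_of_vertex hc hz.2.1
      have : (V \ insert z A).card < (V \ A).card := by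
        apply Finset.card_lt_card
        rw [Finset.ssubset_iff_of_subset (Finset.sdiff_subset_sdiff le_rfl
          (Finset.subset_insert z A))]
        exact ⟨z, by simp [hz.1, hzA], by simp⟩
      omega
    · push Not at hne
      have hA : A = V := hAV.antisymm fun y hy => (h.cover y hy).resolve_left (hne y hy)
      subst hA
      exact ⟨nx, G, h.toSt⟩

end TipState

/-! ### Assigning the tips to cells -/

namespace WallSetup
variable {V : Finset Plane} {Sg : Plane → Plane → Prop} {nx : Plane → Plane} {A : Finset Plane}
  {G : Set Plane} {n : ℕ} {a b x : Fin n → Plane} {C : Set Plane}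

theorem exists_index (h : WallSetup V Sg nx A G a b x) {z : Plane} (hz : z ∈ V) (hzG : z ∈ G) :
    ∃ i, a i = z := by
  obtain ⟨z', hz'⟩ := h.sys.mate z hz
  obtain ⟨i, e | e⟩ := h.lab.cover z z' hz'
  · exact ⟨i, e.1.symm⟩
  · exact absurd hzG (h.st.notMem_of_vertex (e.1 ▸ h.base i))

theorem cell_sub (h : WallSetup V Sg nx A G a b x) (hC : IsCell (freeRegion G b x) C) :
    C ⊆ G \ segUnion Sg := hC.sub.trans (h.walls.free_sub h.lab)

/-- Chords of a cell that end at a tip lie in `G`. -/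
theorem chord_subset (h : WallSetup V Sg nx A G a b x) (hC : IsCell (freeRegion G b x) C)
    {y₁ y₂ : Plane} (h₁ : y₁ ∈ closure C) (h₂ : y₂ ∈ closure C) (hG : y₂ ∈ G) :
    openSegment ℝ y₁ y₂ ⊆ G := by
  by_cases hne : y₁ = y₂
  · rw [hne, openSegment_same]; exact singleton_subset_iff.2 hG
  intro m hm
  by_contra hmG
  obtain ⟨c, hc⟩ := hC.nonempty
  have hD : ori y₁ y₂ c ≠ 0 := by
    rcases one_side hC.convex hC.isOpen hne h₁ h₂ hm (fun hc => hmG (hC.sub hc).1) with g | g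
    · exact (g c hc).ne'
    · exact (g c hc).ne
  obtain ⟨μ, m0, m1, rfl⟩ := mem_openSegment_pt.1 hm
  have hcl : closure Gᶜ = Gᶜ := h.st.isOpen.isClosed_compl.closure_eq
  -- At the last point `w` of the chord outside `G`, the cell gives a free half disc and the chord
  -- beyond `w` runs in `G`. So `w` is half free, although it is a vertex or an inner point of an
  -- edge.
  obtain ⟨v, v1, v2, v3, v4⟩ := exists_last (C := Gᶜ) (p := y₁) (q := y₂) m0.le m1.le
    (by rw [hcl]; exact hmG)
  rw [hcl] at v3
  have v2 : v < 1 := v2.lt_of_ne (by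
    rintro rfl; rw [pt_one] at v3; exact v3 hG)
  set w := pt y₁ y₂ v with hw
  have hwo : w ∈ openSegment ℝ y₁ y₂ := pt_mem_openSegment (by linarith) v2
  have hhf : HalfFree (G \ segUnion Sg) G w := by
    refine ⟨y₂, ?_, ori y₁ y₂ c, hD, ?_, ?_⟩
    · intro e
      have : pt y₁ y₂ 1 = pt y₁ y₂ v := by rw [pt_one]; exact e
      have := pt_inj hne this
      linarith
    · filter_upwards [eventually_mem_of_chord hC.convex hC.isOpen h₁ h₂ hc hD hwo] with z hz hz'
      refine h.cell_sub hC (hz ?_)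
      have e1 : ori w y₂ z = (1 - v) * ori y₁ y₂ z := by
        rw [hw]; simp only [ori, pt_apply]; ring
      rw [e1] at hz'
      have e2 : ori y₁ y₂ c * ((1 - v) * ori y₁ y₂ z) = (1 - v) * (ori y₁ y₂ c * ori y₁ y₂ z) := by
        ring
      rw [e2] at hz'
      exact pos_of_mul_pos_right hz' (by linarith)
    · have : ∀ᶠ s : ℝ in 𝓝[>] 0, s ∈ Ioo (0:ℝ) 1 := Ioo_mem_nhdsGT one_pos
      filter_upwards [this] with s hs
      have e1 : pt w y₂ s = pt y₁ y₂ (v + s * (1 - v)) := by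
        rw [hw]; apply plane_ext <;> simp only [pt_apply] <;> ring
      have := v4 (v + s * (1 - v)) (by nlinarith [hs.1]) (by nlinarith [hs.2])
      rw [hcl] at this
      rw [e1]
      exact not_not.1 this
  have hwcl : w ∈ closure G := closure_mono (hC.sub.trans sdiff_subset)
    (hC.convex.closure.segment_subset h₁ h₂ (openSegment_subset_segment _ _ _ hwo))
  obtain ⟨p, hp, hwp⟩ := h.st.front w hwcl v3
  rcases mem_segment_cases hwp with e | e | e
  · exact h.ap w (e ▸ hp) hhf
  · exact h.ap w (e ▸ h.st.maps p hp) hhf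
  · exact not_halfFree_of_straight e (h.st.ne p hp).symm (fun m hm hc =>
      (h.st.disj p hp).le_bot ⟨hc, openSegment_subset_segment _ _ _ hm⟩)
      (hhf.mono sdiff_subset le_rfl)

/-- A tip on the line of the base would lie on the edge, or its chord to the far end of the edge
would contain the other end; but chords to a tip lie in `G`. -/
theorem ori_pos_of_tip (h : WallSetup V Sg nx A G a b x) (hC : IsCell (freeRegion G b x) C)
    {p z : Plane} (hp : p ∈ A) (hpC : p ∈ closure C) (hqC : nx p ∈ closure C)
    (hs : ∀ c ∈ C, 0 < ori p (nx p) c) (hzC : z ∈ closure C) (hzG : z ∈ G) :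
    0 < ori p (nx p) z := by
  have h0 : 0 ≤ ori p (nx p) z := by
    have := IsCell.closure_side (τ := 1) (fun c hc => by rw [one_mul]; exact hs c hc) hzC
    rwa [one_mul] at this
  refine h0.lt_of_ne fun e => ?_
  obtain ⟨t, rfl⟩ := mem_line_of_ori_eq_zero (h.st.ne p hp).symm e.symm
  rcases lt_or_ge t 0 with g | g
  · refine h.st.notMem_of_vertex hp (h.chord_subset hC hqC hzC hzG ?_)
    have := pt_between (p := p) (q := nx p) (a := t) (b := 1) (c := 0) g one_pos
    rwa [pt_zero, pt_one, openSegment_symm] at this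
  rcases le_or_gt t 1 with g' | g'
  · exact (h.st.disj p hp).le_bot ⟨hzG, pt_mem_segment g g'⟩
  · refine h.st.notMem_of_vertex (h.st.maps p hp) (h.chord_subset hC hpC hzC hzG ?_)
    have := pt_between (p := p) (q := nx p) (a := 0) (b := t) (c := 1) one_pos g'
    rwa [pt_zero, pt_one] at this

/-- A tip inside a chord of a cell has its segment on the chord. -/
theorem mate_of_mem_chord (h : WallSetup V Sg nx A G a b x) (hC : IsCell (freeRegion G b x) C)
    {y₁ y₂ m m' : Plane} (hne : y₁ ≠ y₂) (h₁ : y₁ ∈ closure C) (h₂ : y₂ ∈ closure C) (hG : y₂ ∈ G)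
    (hV₁ : y₁ ∈ V) (hV₂ : y₂ ∈ V) (hm : m ∈ openSegment ℝ y₁ y₂) (hmm : Sg m m') : m' = y₁ := by
  have hmG : m ∈ G := h.chord_subset hC h₁ h₂ hG hm
  obtain ⟨i, rfl⟩ := h.exists_index (h.sys.mem hmm) hmG
  obtain rfl := h.sys.mate_unique hmm (h.sys.symm (h.lab.sg i))
  obtain ⟨c, hc⟩ := hC.nonempty
  have hmC : a i ∉ C := fun hc => Walls.notMem_free (h.walls.tip i).1 (hC.sub hc)
  -- The tip is not in the cell, so the cell lies strictly on one side of the chord. The walls pass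
  -- straight through the tip and avoid the cell, so the segment is collinear with the chord. Its
  -- other end is a vertex and thus not inside the chord; as no segment contains an endpoint in its
  -- interior, it is `y₁`.
  obtain ⟨t, t1, ht⟩ := h.walls.germ i hmG
  have hmo : a i ∈ openSegment ℝ (b i) (pt (b i) (a i) t) := by
    have := pt_between (p := b i) (q := a i) (a := 0) (b := t) (c := 1) one_pos t1
    rwa [pt_zero, pt_one] at this
  have hav : ∀ y ∈ openSegment ℝ (b i) (pt (b i) (a i) t), y ∉ C := fun y hy hc =>
    (hC.sub hc).2 (ht (openSegment_subset_segment _ _ _ hy))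
  have hD : ori y₁ y₂ c ≠ 0 := by
    rcases one_side hC.convex hC.isOpen hne h₁ h₂ hm hmC with g | g
    · exact (g c hc).ne'
    · exact (g c hc).ne
  have hch := eventually_mem_of_chord hC.convex hC.isOpen h₁ h₂ hc hD hm
  have hml : ori y₁ y₂ (a i) = 0 := ori_of_mem_segment (openSegment_subset_segment _ _ _ hm)
  have hcol : ori y₁ y₂ (b i) = 0 := by
    rcases lt_or_gt_of_ne hD with g | g
    · refine (ori_eq_zero_of_avoid ?_ hml hmo hav).1
      filter_upwards [hch] with y hy hn
      exact hy (mul_pos_of_neg_of_neg g hn)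
    · have := (ori_eq_zero_of_avoid (u := y₂) (v := y₁) ?_ (by rw [ori_swap, hml, neg_zero])
        hmo hav).1
      · rw [ori_swap, this, neg_zero]
      · filter_upwards [hch] with y hy hn
        rw [ori_swap] at hn
        exact hy (mul_pos g (by linarith))
  obtain ⟨s, es⟩ := mem_line_of_ori_eq_zero hne hcol
  obtain ⟨μ, m0, m1, em⟩ := mem_openSegment_pt.1 hm
  have hb1 : s ≤ 0 ∨ 1 < s := by
    by_contra hcon
    push Not at hcon
    rcases hcon.2.lt_or_eq with g | g
    · exact h.st.notMem_of_vertex (h.base i) (h.chord_subset hC h₁ h₂ hG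
        (by rw [es]; exact pt_mem_openSegment hcon.1 g))
    · rw [g, pt_one] at es
      exact h.st.notMem_of_vertex (h.base i) (es ▸ hG)
  have hsg := h.lab.sg i
  rcases hb1 with g | g
  · rcases g.lt_or_eq with g | g
    · exfalso
      refine h.sys.notMem_open hsg hV₁ ?_
      have := pt_between (p := y₁) (q := y₂) (a := s) (b := μ) (c := 0) g m0
      rwa [pt_zero, ← es, ← em] at this
    · rw [es, g, pt_zero]
  · exfalso
    refine h.sys.notMem_open hsg hV₂ ?_
    have := pt_between (p := y₁) (q := y₂) (a := μ) (b := s) (c := 1) m1 g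
    rwa [pt_one, ← es, ← em, openSegment_symm] at this

/-- Two cells with a common real edge coincide. -/
theorem cell_unique {C' : Set Plane} (hC : IsCell (freeRegion G b x) C)
    (hC' : IsCell (freeRegion G b x) C') {p q : Plane} (hp : p ∈ closure C)
    (hq : q ∈ closure C) (hs : ∀ c ∈ C, 0 < ori p q c) (hp' : p ∈ closure C')
    (hq' : q ∈ closure C') (hs' : ∀ c ∈ C', 0 < ori p q c) : C = C' := by
  by_contra hne
  have hd := hC.disjoint_of_not_eq hC' hne
  obtain ⟨c, hc⟩ := hC.nonempty
  obtain ⟨c', hc'⟩ := hC'.nonempty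
  have hm : pt p q (1 / 2) ∈ openSegment ℝ p q := pt_mem_openSegment (by norm_num) (by norm_num)
  have h1 := eventually_mem_of_chord hC.convex hC.isOpen hp hq hc (hs c hc).ne' hm
  have h2 := eventually_mem_of_chord hC'.convex hC'.isOpen hp' hq' hc' (hs' c' hc').ne' hm
  obtain ⟨t, t0, -, g1, g2⟩ := exists_pt_of_eventually c (h1.and h2) one_pos
  have hpos : 0 < ori p q (pt (pt p q (1 / 2)) c t) := by
    rw [ori_pt, ori_of_mem_segment (openSegment_subset_segment _ _ _ hm)]
    have := mul_pos t0 (hs c hc)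
    linarith
  exact hd.le_bot ⟨g1 (mul_pos (hs c hc) hpos), g2 (mul_pos (hs' c' hc') hpos)⟩

/-- A cell with a base edge starting at `p`. -/
structure GoodCell (Sg : Plane → Plane → Prop) (nx : Plane → Plane) (A : Finset Plane)
    (G : Set Plane) (b x : Fin n → Plane) (C : Set Plane) (p : Plane) : Prop
    extends IsCell (freeRegion G b x) C where
  mem : p ∈ A
  notSg : ¬ Sg p (nx p)
  left : p ∈ closure C
  right : nx p ∈ closure C
  side : ∀ c ∈ C, 0 < ori p (nx p) c

/-- `m` lies on the chord from its mate, an end of the base edge of the cell of `y`, to `y`. -/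
def Blocks (V : Finset Plane) (Sg : Plane → Plane → Prop) (nx : Plane → Plane) (G : Set Plane)
    (φ : Plane → Set Plane) (E : Set Plane → Plane) (m y : Plane) : Prop :=
  y ∈ V ∧ y ∈ G ∧ ∃ β, Sg m β ∧ m ∈ openSegment ℝ β y ∧ (β = E (φ y) ∨ β = nx (E (φ y)))

/-- Any choice of good cells satisfies everything except that tips on a chord share its base. By
`mate_of_mem_chord` such a tip has the other end of the chord as its mate, an end of the base edge.
It is reassigned to the cell of the chord. -/
theorem exists_tipState (h : WallSetup V Sg nx A G a b x) (hAV : A ⊆ V) :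
    ∃ C P, TipState V Sg nx A G C P := by
  have hE : ∀ C : Set Plane, ∃ p, (∃ p', GoodCell Sg nx A G b x C p') →
      GoodCell Sg nx A G b x C p := by
    intro C
    by_cases hc : ∃ p', GoodCell Sg nx A G b x C p'
    · obtain ⟨p, hp⟩ := hc; exact ⟨p, fun _ => hp⟩
    · exact ⟨0, fun h' => absurd h' hc⟩
  choose E hE using hE
  have hφ : ∀ z, ∃ C, z ∈ V → z ∈ G → z ∈ closure C ∧ GoodCell Sg nx A G b x C (E C) := by
    intro z
    by_cases hz : z ∈ V ∧ z ∈ G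
    · obtain ⟨i, rfl⟩ := h.exists_index hz.1 hz.2
      obtain ⟨C, hC, haC, p, hp, hs, h1, h2, h3⟩ := h.exists_good_cell hz.2
      exact ⟨C, fun _ _ => ⟨haC, hE C ⟨p, hC, hp, hs, h1, h2, h3⟩⟩⟩
    · exact ⟨∅, fun h1 h2 => absurd ⟨h1, h2⟩ hz⟩
  choose φ hφ using hφ
  -- facts on blocking tips
  have hBcl : ∀ y β, y ∈ V → y ∈ G → (β = E (φ y) ∨ β = nx (E (φ y))) →
      β ∈ closure (φ y) ∧ β ∈ A := by
    intro y β hy hyG hβ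
    have hg := (hφ y hy hyG).2
    rcases hβ with rfl | rfl
    · exact ⟨hg.left, hg.mem⟩
    · exact ⟨hg.right, h.st.maps _ hg.mem⟩
  have hBmem : ∀ m y, Blocks V Sg nx G φ E m y → m ∈ closure (φ y) := by
    rintro m y ⟨hy, hyG, β, hsg, hm, hβ⟩
    exact (hφ y hy hyG).2.convex.closure.segment_subset (hBcl y β hy hyG hβ).1
      (hφ y hy hyG).1 (openSegment_subset_segment _ _ _ hm)
  -- Two such points lie on the ray from the mate of `m` through `m`. The nearer one would be a tip
  -- inside the chord to the farther one and so have the same mate as `m`, hence be `m`.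
  have hBuniq : ∀ m y y', Blocks V Sg nx G φ E m y → Blocks V Sg nx G φ E m y' → y = y' := by
    have key : ∀ m y y', Blocks V Sg nx G φ E m y → Blocks V Sg nx G φ E m y' →
        ∀ β, Sg m β → y ∉ openSegment ℝ β y' := by
      rintro m y y' ⟨hy, hyG, β₁, hsg, hm, -⟩ ⟨hy', hyG', β', hsg', hm', hβ'⟩ β hβ hyo
      obtain rfl := h.sys.mate_unique hβ hsg
      obtain rfl := h.sys.mate_unique hβ hsg'
      obtain ⟨yb, hyb⟩ := h.sys.mate y hy
      have hb := hBcl y' β' hy' hyG' hβ'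
      have hne : β' ≠ y' := fun e => h.st.notMem_of_vertex hb.2 (e ▸ hyG')
      obtain rfl := h.mate_of_mem_chord (hφ y' hy' hyG').2.toIsCell hne hb.1 (hφ y' hy' hyG').1
        hyG' (hAV hb.2) hy' hyo hyb
      have hym : y = m := h.sys.mate_unique (h.sys.symm hβ) (h.sys.symm hyb)
      rw [hym] at hm
      exact right_notMem_openSegment (h.sys.ne hβ).symm hm
    rintro m y y' hB hB'
    obtain ⟨hy, hyG, β, hsg, hm, -⟩ := id hB
    obtain ⟨hy', hyG', β', hsg', hm', -⟩ := id hB'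
    obtain rfl := h.sys.mate_unique hsg hsg'
    have k1 := key m y y' hB hB' β' hsg
    have k2 := key m y' y hB' hB β' hsg
    obtain ⟨s, s0, s1, es⟩ := mem_openSegment_pt.1 hm
    obtain ⟨t, t0, t1, et⟩ := mem_openSegment_pt.1 hm'
    have hne : m ≠ β' := h.sys.ne hsg
    have ey : y = pt β' m (1 / s) := by
      rw [es, pt_pt, mul_one_div_cancel s0.ne', pt_one]
    have ey' : y' = pt β' m (1 / t) := by
      rw [et, pt_pt, mul_one_div_cancel t0.ne', pt_one]
    rcases lt_trichotomy (1 / s) (1 / t) with g | g | g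
    · refine absurd ?_ k1
      rw [ey, ey']
      have := pt_between (p := β') (q := m) (a := 0) (b := 1 / t) (c := 1 / s) (by positivity) g
      rwa [pt_zero] at this
    · rw [ey, ey', g]
    · refine absurd ?_ k2
      rw [ey, ey']
      have := pt_between (p := β') (q := m) (a := 0) (b := 1 / s) (c := 1 / t) (by positivity) g
      rwa [pt_zero] at this
  -- the final assignment
  set ψ : Plane → Set Plane := fun m =>
    if hB : ∃ y, Blocks V Sg nx G φ E m y then φ hB.choose else φ m with hψ
  have ψB : ∀ m y, Blocks V Sg nx G φ E m y → ψ m = φ y := by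
    intro m y hB
    have hex : ∃ y, Blocks V Sg nx G φ E m y := ⟨y, hB⟩
    simp only [hψ, dif_pos hex]
    rw [hBuniq m _ _ hex.choose_spec hB]
  have ψN : ∀ m, (¬ ∃ y, Blocks V Sg nx G φ E m y) → ψ m = φ m := by
    intro m hB; simp only [hψ, dif_neg hB]
  have hψg : ∀ z ∈ V, z ∈ G → z ∈ closure (ψ z) ∧ GoodCell Sg nx A G b x (ψ z) (E (ψ z)) := by
    intro z hz hzG
    by_cases hB : ∃ y, Blocks V Sg nx G φ E z y
    · obtain ⟨y, hB⟩ := hB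
      rw [ψB z y hB]
      exact ⟨hBmem z y hB, (hφ y hB.1 hB.2.1).2⟩
    · rw [ψN z hB]; exact hφ z hz hzG
  have heq : ∀ z ∈ V, z ∈ G → ∀ z' ∈ V, z' ∈ G → E (ψ z) = E (ψ z') → ψ z = ψ z' := by
    intro z hz hzG z' hz' hzG' e
    have g := (hψg z hz hzG).2
    have g' := (hψg z' hz' hzG').2
    rw [← e] at g'
    exact cell_unique g.toIsCell g'.toIsCell g.left g.right g.side
      g'.left g'.right g'.side
  refine ⟨ψ, fun z => E (ψ z), h.st, fun z hz hzG => (hψg z hz hzG).2.convex,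
    fun z hz hzG => (hψg z hz hzG).2.isOpen, fun z hz hzG => h.cell_sub (hψg z hz hzG).2.toIsCell,
    fun z hz hzG => (hψg z hz hzG).2.mem, fun z hz hzG => (hψg z hz hzG).2.notSg,
    fun z hz hzG => (hψg z hz hzG).1, fun z hz hzG => (hψg z hz hzG).2.left,
    fun z hz hzG => (hψg z hz hzG).2.right, fun z hz hzG => ?_, heq, ?_, ?_⟩
  · obtain ⟨h1, g⟩ := hψg z hz hzG
    exact h.ori_pos_of_tip g.toIsCell g.mem g.left g.right g.side h1 hzG
  · intro z hz hzG z' hz' hzG' hne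
    exact (hψg z hz hzG).2.toIsCell.disjoint_of_not_eq (hψg z' hz' hzG').2.toIsCell
      fun e => hne (by rw [e])
  · intro z hz hzG y hy
    obtain ⟨hzC, g⟩ := hψg z hz hzG
    have hyC : y ∈ closure (ψ z) ∧ y ∈ V ∧ y ≠ z := by
      rcases hy with e | e | ⟨h1, h2, h3, h4⟩
      · rw [e]; exact ⟨g.left, hAV g.mem, fun e =>
          h.st.notMem_of_vertex g.mem (by rw [e]; exact hzG)⟩
      · rw [e]
        exact ⟨g.right, hAV (h.st.maps _ g.mem), fun e =>
          h.st.notMem_of_vertex (h.st.maps _ g.mem) (by rw [e]; exact hzG)⟩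
      · refine ⟨?_, h1, h4⟩
        rw [← heq y h1 h2 z hz hzG h3]; exact (hψg y h1 h2).1
    refine ⟨h.chord_subset g.toIsCell hyC.1 hzC hzG, fun m hmV hm => ?_⟩
    have hmG : m ∈ G := h.chord_subset g.toIsCell hyC.1 hzC hzG hm
    obtain ⟨β, hβ⟩ := h.sys.mate m hmV
    obtain rfl := h.mate_of_mem_chord g.toIsCell hyC.2.2 hyC.1 hzC hzG hyC.2.1 hz hm hβ
    -- the mate lies on the base edge
    have hβA : β ∈ A := by
      obtain ⟨i, rfl⟩ := h.exists_index hmV hmG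
      rw [h.sys.mate_unique (h.sys.symm (h.lab.sg i)) hβ]; exact h.base i
    have hβE : β = E (ψ z) ∨ β = nx (E (ψ z)) := by
      rcases hy with e | e | ⟨-, h2, -⟩
      · exact Or.inl e
      · exact Or.inr e
      · exact absurd h2 (h.st.notMem_of_vertex hβA)
    have hmz : m ≠ z := by
      rintro rfl; exact right_notMem_openSegment hyC.2.2 hm
    by_cases hB : ∃ y, Blocks V Sg nx G φ E z y
    -- If `z` was itself reassigned, it lies strictly between its mate `γ` and `w`, both in the
    -- closure of the cell, and `γ` is the other end of the base edge. The cell is on one side of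
    -- the line `β z`, but `γ` and `w` are strictly on different sides.
    · exfalso
      obtain ⟨w, hB⟩ := hB
      have eψ := ψB z w hB
      obtain ⟨hw, hwG, γ, hγ, hzo, hγE⟩ := hB
      rw [← eψ] at hγE
      have hβγ : β ≠ γ := by
        rintro rfl
        exact hmz (h.sys.mate_unique (h.sys.symm hγ) (h.sys.symm hβ))
      have hwC : w ∈ closure (ψ z) := by rw [eψ]; exact (hφ w hw hwG).1
      have hγC : γ ∈ closure (ψ z) := by
        rcases hγE with e | e <;> rw [e]
        exacts [g.left, g.right]
      have hwpos := h.ori_pos_of_tip g.toIsCell g.mem g.left g.right g.side hwC hwG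
      have hnz : ori γ β w ≠ 0 := by
        rcases hβE with e | e <;> rcases hγE with e' | e'
        · exact absurd (e.trans e'.symm) hβγ
        · rw [e, e', ori_swap]; exact neg_ne_zero.2 hwpos.ne'
        · rw [e, e']; exact hwpos.ne'
        · exact absurd (e.trans e'.symm) hβγ
      obtain ⟨t, t0, t1, et⟩ := mem_openSegment_pt.1 hzo
      have o1 : ori β z γ = t * ori γ β w := by
        rw [et]; simp only [ori, pt_apply]; ring
      have o2 : (1 - t) * ori β z γ + t * ori β z w = 0 := by
        rw [← ori_pt, ← et, ori_self_right]
      have hmC : m ∉ ψ z := fun hc => (h.cell_sub g.toIsCell hc).2 (h.sys.mem_segUnion hmV)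
      have hγ0 : ori β z γ ≠ 0 := by rw [o1]; exact mul_ne_zero t0.ne' hnz
      have hcl : ∀ τ : ℝ, (∀ c ∈ ψ z, 0 < τ * ori β z c) → False := by
        intro τ hτ
        have c1 := IsCell.closure_side hτ hγC
        have c2 := IsCell.closure_side hτ hwC
        have c3 : (1 - t) * (τ * ori β z γ) + t * (τ * ori β z w) = 0 := by
          linear_combination τ * o2
        have c4 : τ * ori β z γ ≠ 0 := by
          obtain ⟨c, hc⟩ := g.nonempty
          have := hτ c hc
          exact mul_ne_zero (by rintro rfl; simp at this) hγ0
        have c5 := c1.lt_of_ne (Ne.symm c4)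
        nlinarith [mul_pos (sub_pos.2 t1) c5, mul_nonneg t0.le c2]
      rcases one_side g.convex g.isOpen hyC.2.2 hyC.1 hzC hm hmC with k | k
      · exact hcl 1 fun c hc => by rw [one_mul]; exact k c hc
      · exact hcl (-1) fun c hc => by have := k c hc; linarith
    · have e := ψN z hB
      have hBm : Blocks V Sg nx G φ E m z := ⟨hz, hzG, β, hβ, hm, by rwa [← e]⟩
      change E (ψ m) = E (ψ z)
      rw [ψB m z hBm, e]

/-- A visited state can be completed. -/
theorem exists_complete (h : WallSetup V Sg nx A G a b x) (hAV : A ⊆ V) :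
    ∃ nx' G', St V Sg nx' V G' := by
  obtain ⟨C, P, hT⟩ := h.exists_tipState hAV
  exact TipState.exists_complete h.sys _ nx A G C P hT hAV le_rfl

end WallSetup

/-! ### The complete state and its cyclic order -/

theorem exists_complete_state {V : Finset Plane} {Sg : Plane → Plane → Prop} (hS : SegSys V Sg)
    (hnc : ∀ p q : Plane, p ≠ q → ∃ y ∈ V, ori p q y ≠ 0) (hV : V.Nonempty) {n : ℕ}
    {a b : Fin n → Plane} {trace : Fin n → Set Plane} (hR : Routes V Sg a b trace)
    (hL : Labels Sg a b) : ∃ nx G, St V Sg nx V G := by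
  obtain ⟨nx, A, G, hst, hAV, hb, hap, hE⟩ := exists_visited hS hnc hV hR
  obtain ⟨x, hW⟩ := exists_walls hS hL hst hb hE
  exact WallSetup.exists_complete ⟨hst, hS, hL, hW, hb, hap⟩ hAV

/-- The orbit of a vertex under the injective map `nx` is periodic and closed, so by `trans` it
exhausts `A`. The length is at least 3 because neither `nx` nor its square fixes a vertex. -/
theorem PolyRegion.exists_enumeration {nx : Plane → Plane} {A : Finset Plane} {G : Set Plane}
    (h : PolyRegion nx A G) : ∃ (m : ℕ) (f : Fin m → Plane), 3 ≤ m ∧ Function.Injective f ∧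
      range f = (A : Set Plane) ∧ ∀ i, f (finRotate m i) = nx (f i) := by
  obtain ⟨p, hp⟩ := h.nonempty
  have hmem : ∀ i, nx^[i] p ∈ A := by
    intro i
    induction i with
    | zero => exact hp
    | succ i ih => rw [Function.iterate_succ_apply']; exact h.maps _ ih
  have hper : ∃ k, 0 < k ∧ nx^[k] p = p := by
    obtain ⟨i, j, hij, e⟩ : ∃ i j : ℕ, i < j ∧ nx^[i] p = nx^[j] p := by
      obtain ⟨i, -, j, -, hne, e⟩ := Set.infinite_univ.exists_ne_map_eq_of_mapsTo
        (f := fun i : ℕ => nx^[i] p) (fun i _ => hmem i) A.finite_toSet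
      rcases lt_or_gt_of_ne hne with g | g
      · exact ⟨i, j, g, e⟩
      · exact ⟨j, i, g, e.symm⟩
    refine ⟨j - i, by omega, ?_⟩
    have : ∀ i d : ℕ, nx^[i] p = nx^[i + d] p → p = nx^[d] p := by
      intro i d
      induction i with
      | zero => intro e; simpa using e
      | succ i ih =>
        intro e
        apply ih
        apply h.inj _ (hmem i) _ (hmem _)
        rw [← Function.iterate_succ_apply' nx, ← Function.iterate_succ_apply' nx, e]
        congr 1; omega
    exact (this i (j - i) (by rw [e]; congr 2; omega)).symm
  obtain ⟨k, k0, hk⟩ := hper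
  have hpp : p ∈ Function.periodicPts nx := ⟨k, k0, hk⟩
  set m := Function.minimalPeriod nx p with hm
  have m0 : 0 < m := Function.minimalPeriod_pos_of_mem_periodicPts hpp
  have hmp : nx^[m] p = p := Function.isPeriodicPt_minimalPeriod nx p
  have hinj : Function.Injective fun i : Fin m => nx^[(i : ℕ)] p := fun i j e =>
    Fin.ext (Function.iterate_injOn_Iio_minimalPeriod i.2 j.2 e)
  have hrot : ∀ i : Fin m, nx^[((finRotate m i : Fin m) : ℕ)] p = nx (nx^[(i : ℕ)] p) := by
    clear_value m
    obtain ⟨l, rfl⟩ := Nat.exists_eq_succ_of_ne_zero m0.ne'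
    intro i
    rw [← Function.iterate_succ_apply' nx]
    by_cases hi : i = Fin.last l
    · subst hi
      rw [finRotate_last]
      exact hmp.symm
    · rw [coe_finRotate_of_ne_last hi]
  have himg : Finset.univ.image (fun i : Fin m => nx^[(i : ℕ)] p) = A := by
    refine h.trans _ ?_ ⟨p, Finset.mem_image.2 ⟨⟨0, m0⟩, Finset.mem_univ _, rfl⟩⟩ ?_
    · intro y hy
      obtain ⟨i, -, rfl⟩ := Finset.mem_image.1 hy
      exact hmem i
    · intro y hy
      obtain ⟨i, -, rfl⟩ := Finset.mem_image.1 hy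
      exact Finset.mem_image.2 ⟨finRotate m i, Finset.mem_univ _, hrot i⟩
  refine ⟨m, fun i => nx^[(i : ℕ)] p, ?_, hinj, ?_, hrot⟩
  · have hc : A.card = m := by
      rw [← himg, Finset.card_image_of_injective _ hinj, Finset.card_univ, Fintype.card_fin]
    have h3 : ({p, nx p, nx (nx p)} : Finset Plane).card = 3 := by
      rw [Finset.card_eq_three]
      exact ⟨p, nx p, nx (nx p), (h.ne p hp).symm, (h.nx_nx_ne hp).symm,
        (h.ne _ (h.maps p hp)).symm, rfl⟩
    rw [← hc, ← h3]
    apply Finset.card_le_card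
    intro y hy
    simp only [Finset.mem_insert, Finset.mem_singleton] at hy
    rcases hy with rfl | rfl | rfl
    · exact hp
    · exact h.maps p hp
    · exact h.maps _ (h.maps p hp)
  · rw [← himg]; simp

/-! ### Translation to polygons, escape routes and rays -/

section
variable {S : Finset (Sym2 Plane)}

/-- The frontier of `G` consists of edge points, so a component of the complement of the boundary
that meets `G` stays in `G` and is bounded. Thus `G` is part of the interior. -/
theorem exists_circumscribing {V : Finset Plane} (hV : (V : Set Plane) = endpoints S)
    {nx : Plane → Plane} {G : Set Plane} (h : St V (fun y y' => s(y, y') ∈ S) nx V G) :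
    ∃ (m : ℕ) (P : Polygon Plane m), IsCircumscribingPolygon P S := by
  obtain ⟨m, f, h3, hinj, hrange, hrot⟩ := h.toPolyRegion.exists_enumeration
  have hfV : ∀ i, f i ∈ V := fun i => by
    have : f i ∈ (V : Set Plane) := hrange ▸ mem_range_self i
    exact this
  set P : Polygon Plane m := ⟨f⟩ with hP
  have hedge : ∀ i, P.edgeSet ℝ i = segment ℝ (f i) (nx (f i)) := by
    intro i
    rw [← hrot]; exact affineSegment_eq_segment ℝ _ _
  have hbd : P.boundary ℝ = ⋃ i, segment ℝ (f i) (nx (f i)) := by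
    unfold Polygon.boundary; exact iUnion_congr hedge
  have hGint : G ⊆ polygonInterior P := by
    intro y hy
    have hyb : y ∉ P.boundary ℝ := by
      rw [hbd]
      intro hc
      obtain ⟨i, hi⟩ := mem_iUnion.1 hc
      exact (h.disj _ (hfV i)).le_bot ⟨hy, hi⟩
    refine ⟨hyb, h.bdd.subset ?_⟩
    refine subset_of_avoid_frontier isPreconnected_connectedComponentIn ?_
      ⟨y, mem_connectedComponentIn hyb, hy⟩
    rw [disjoint_left]
    intro z hz hzf
    obtain ⟨p, hp, hzp⟩ := h.toPolyRegion.frontier_subset hzf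
    have hp' : p ∈ range f := by rw [hrange]; exact hp
    obtain ⟨i, rfl⟩ := hp'
    refine connectedComponentIn_subset _ _ hz ?_
    rw [hbd]; exact mem_iUnion.2 ⟨i, hzp⟩
  refine ⟨m, P, ⟨h3, hinj, ?_⟩, ?_, ?_⟩
  · intro i j hij
    rw [hedge, hedge]
    change _ = {f i, f (finRotate m i)} ∩ {f j, f (finRotate m j)}
    rw [hrot, hrot]
    have hne : f i ≠ f j := fun e => hij (hinj e)
    ext y
    constructor
    · rintro ⟨h1, h2⟩
      constructor
      · rcases mem_segment_cases h1 with e | e | e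
        · exact Or.inl e
        · exact Or.inr e
        · exact ((h.simple _ (hfV i) _ (hfV j) hne).le_bot ⟨e, h2⟩).elim
      · rcases mem_segment_cases h2 with e | e | e
        · exact Or.inl e
        · exact Or.inr e
        · exact ((h.simple _ (hfV j) _ (hfV i) hne.symm).le_bot ⟨e, h1⟩).elim
    · rintro ⟨h1, h2⟩
      have key : ∀ p q : Plane, y ∈ ({p, q} : Set Plane) → y ∈ segment ℝ p q := by
        rintro p q (rfl | rfl)
        · exact left_mem_segment ℝ _ _
        · exact right_mem_segment ℝ _ _
      exact ⟨key _ _ h1, key _ _ h2⟩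
  · rw [← hV, ← hrange]
  · intro e he
    induction e with
    | _ y y' =>
      have key : ∀ y y', y ∈ V → nx y = y' → ∃ i, s(y, y') = s(P i, P (finRotate m i)) := by
        intro y y' hy e
        have hy' : y ∈ range f := by rw [hrange]; exact hy
        obtain ⟨i, rfl⟩ := hy'
        exact ⟨i, by change _ = s(f i, f (finRotate m i)); rw [hrot, e]⟩
      rcases h.seg y y' he with g | g | g
      · right
        rw [segPts_mk]
        rintro z ⟨hz, hz'⟩
        apply hGint
        simp only [SetLike.mem_coe, Sym2.mem_iff, not_or] at hz'
        rcases mem_segment_cases hz with e | e | e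
        · exact absurd e hz'.1
        · exact absurd e hz'.2
        · exact g e
      · exact Or.inl (key y y' g.1 g.2)
      · rw [Sym2.eq_swap]; exact Or.inl (key y' y g.1 g.2)

theorem segSys_of_isDisjointSegments (hS : IsDisjointSegments S) {V : Finset Plane}
    (hV : (V : Set Plane) = endpoints S) : SegSys V (fun y y' => s(y, y') ∈ S) := by
  have hmem : ∀ y, y ∈ V ↔ ∃ e ∈ S, y ∈ e := fun y => by
    rw [← Finset.mem_coe, hV]; rfl
  refine ⟨fun {a b} h => by rwa [Sym2.eq_swap], fun {a b} h e => hS.1 _ h e,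
    fun {a b} h => (hmem a).2 ⟨_, h, Sym2.mem_mk_left a b⟩, fun a ha => ?_, ?_⟩
  · obtain ⟨e, he, hae⟩ := (hmem a).1 ha
    obtain ⟨b, rfl⟩ := hae
    exact ⟨b, he⟩
  · intro a b c d y hab hcd h1 h2
    have : s(a, b) = s(c, d) := by
      by_contra hne
      have := hS.2 _ hab _ hcd hne
      rw [segPts_mk, segPts_mk] at this
      exact this.le_bot ⟨h1, h2⟩
    rcases Sym2.eq_iff.1 this with e | e
    · exact Or.inl ⟨e.1.symm, e.2.symm⟩
    · exact Or.inr ⟨e.2.symm, e.1.symm⟩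

theorem exists_ori_ne_of_not_collinear {s : Set Plane} (hnc : ¬ Collinear ℝ s) {p q : Plane}
    (hpq : p ≠ q) : ∃ y ∈ s, ori p q y ≠ 0 := by
  by_contra hcon
  push Not at hcon
  refine hnc ((collinear_iff_exists_forall_eq_smul_vadd _).2 ⟨p, q - p, fun y hy => ?_⟩)
  obtain ⟨t, rfl⟩ := mem_line_of_ori_eq_zero hpq (hcon y hy)
  exact ⟨t, by rw [pt, vadd_eq_add, add_comm]⟩

theorem exists_circumscribing_of_escape (hS : IsDisjointSegments S)
    (hnc : ¬ Collinear ℝ (endpoints S)) (h : AdmitsEscapeRoutes S) :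
    ∃ (m : ℕ) (P : Polygon Plane m), IsCircumscribingPolygon P S := by
  obtain ⟨a, b, trace, hrange, hshot, hdisj⟩ := h
  set V : Finset Plane := S.biUnion fun e => e.toFinset with hVd
  have hV : (V : Set Plane) = endpoints S := by
    ext y; simp [hVd, endpoints]
  have hsys := segSys_of_isDisjointSegments hS hV
  have hmem : ∀ i, s(a i, b i) ∈ S := fun i => by
    rw [← Finset.mem_coe, hrange]; exact mem_range_self i
  -- The labels map onto `S` and are as many as its elements, so no segment is listed twice.
  have hinj : Function.Injective fun i => s(a i, b i) := by
    have hsurj : Function.Surjective fun i : Fin S.card => (⟨s(a i, b i), hmem i⟩ : S) := by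
      rintro ⟨e, he⟩
      have : e ∈ range fun i => s(a i, b i) := by rw [← hrange]; exact he
      obtain ⟨i, hi⟩ := this
      exact ⟨i, Subtype.ext hi⟩
    have hbij := (Fintype.bijective_iff_surjective_and_card _).2 ⟨hsurj, by simp⟩
    intro i j e
    exact hbij.1 (Subtype.ext e)
  have hR : Routes V (fun y y' => s(y, y') ∈ S) a b trace := by
    refine ⟨hmem, fun i j e => hinj ?_, hshot, fun i c d hcd hc hd => ?_⟩
    · by_contra hne
      have := hS.2 _ (hmem i) _ (hmem j) hne
      rw [segPts_mk, segPts_mk] at this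
      exact this.le_bot ⟨right_mem_segment ℝ _ _, by rw [e]; exact right_mem_segment ℝ _ _⟩
    · have hne : s(c, d) ≠ s(a i, b i) := by
        intro e
        rcases Sym2.eq_iff.1 e with g | g
        · exact hd g.2
        · exact hc g.1
      have := hdisj i _ hcd hne
      rwa [segPts_mk] at this
  have hL : Labels (fun y y' => s(y, y') ∈ S) a b := by
    refine ⟨fun i => by rw [Sym2.eq_swap]; exact hmem i, fun y y' hy => ?_, fun i j hij => ?_⟩
    · have : s(y, y') ∈ range fun i => s(a i, b i) := by rw [← hrange]; exact hy
      obtain ⟨i, hi⟩ := this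
      rcases Sym2.eq_iff.1 hi with g | g
      · exact ⟨i, Or.inl ⟨g.1.symm, g.2.symm⟩⟩
      · exact ⟨i, Or.inr ⟨g.2.symm, g.1.symm⟩⟩
    · have := hS.2 _ (hmem i) _ (hmem j) fun e => hij (hinj e)
      rwa [segPts_mk, segPts_mk, segment_symm, segment_symm ℝ (a j)] at this
  have hne : V.Nonempty := by
    rw [← Finset.coe_nonempty, hV]
    by_contra hc
    rw [Set.not_nonempty_iff_eq_empty.1 hc] at hnc
    exact hnc (collinear_empty ℝ Plane)
  obtain ⟨nx, G, hst⟩ := exists_complete_state hsys (fun p q hpq => by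
    obtain ⟨y, hy, hy'⟩ := exists_ori_ne_of_not_collinear hnc hpq
    rw [← hV] at hy
    exact ⟨y, hy, hy'⟩) hne hR hL
  exact exists_circumscribing hV hst

/-- The segment is oriented away from the origin of the ray, so that its extension stays in the ray.
-/
theorem exists_orientation {r : Set Plane} {p d : Plane} (hr : r = rayFrom p d) {e : Sym2 Plane}
    (hd : ¬ e.IsDiag) (he : segPts e ⊆ r) : ∃ a b, e = s(a, b) ∧ rayFrom b (b - a) ⊆ r := by
  have key : ∀ y y' : Plane, y ∈ r → y' ∈ r → y ≠ y' →
      (rayFrom y (y - y') ⊆ r) ∨ (rayFrom y' (y' - y) ⊆ r) := by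
    intro y y' hy hy' hne
    rw [hr] at hy hy' ⊢
    obtain ⟨s, s0, rfl⟩ := hy
    obtain ⟨t, t0, rfl⟩ := hy'
    have hray : ∀ s t : ℝ, 0 ≤ s → t ≤ s →
        rayFrom (p + s • d) (p + s • d - (p + t • d)) ⊆ rayFrom p d := by
      rintro s t s0 hts x ⟨u, u0, rfl⟩
      refine ⟨s + u * (s - t), by nlinarith, ?_⟩
      module
    rcases le_total t s with g | g
    · exact Or.inl (hray s t s0 g)
    · exact Or.inr (hray t s t0 g)
  induction e with
  | _ y y' =>
    rw [segPts_mk] at he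
    have hne : y ≠ y' := fun e => hd e
    rcases key y y' (he (left_mem_segment ℝ _ _)) (he (right_mem_segment ℝ _ _)) hne with g | g
    · exact ⟨y', y, Sym2.eq_swap, g⟩
    · exact ⟨y, y', rfl, g⟩

/-- Disjoint rays contain different segments, so by counting the rays correspond to the segments. In
any order the shots never stop one another, and all foreign segments lie in other rays. -/
theorem admitsEscapeRoutes_of_extensible (hS : IsDisjointSegments S) (h : ExtensibleToRays S) :
    AdmitsEscapeRoutes S := by
  obtain ⟨R, hcard, hray, hdis, hseg⟩ := h
  have hch : ∀ r : R, ∃ a b, s(a, b) ∈ S ∧ segPts s(a, b) ⊆ r.1 ∧ rayFrom b (b - a) ⊆ r.1 := by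
    rintro ⟨r, hr⟩
    obtain ⟨e, he, her⟩ := hseg r hr
    obtain ⟨p, d, -, hrd⟩ := hray r hr
    obtain ⟨a, b, rfl, hab⟩ := exists_orientation hrd (hS.1 e he) her
    exact ⟨a, b, he, her, hab⟩
  choose a b hab hsub hrs using hch
  set φ : Fin S.card ≃ R := (finCongr hcard.symm).trans R.equivFin.symm with hφ
  have hrd : ∀ r r' : R, r ≠ r' → Disjoint r.1 r'.1 := fun r r' hne =>
    hdis r.1 r.2 r'.1 r'.2 fun e => hne (Subtype.ext e)
  have hinj : Function.Injective fun r : R => (⟨s(a r, b r), hab r⟩ : S) := by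
    intro r r' e
    have e : s(a r, b r) = s(a r', b r') := congrArg Subtype.val e
    by_contra hne
    have h1 : a r ∈ segPts s(a r, b r) := by rw [segPts_mk]; exact left_mem_segment ℝ _ _
    exact (hrd r r' hne).le_bot ⟨hsub r h1, hsub r' (e ▸ h1)⟩
  have hbij := (Fintype.bijective_iff_injective_and_card
    fun r : R => (⟨s(a r, b r), hab r⟩ : S)).2 ⟨hinj, by simpa using hcard⟩
  have hsurj : ∀ e ∈ S, ∃ r : R, s(a r, b r) = e := by
    intro e he
    obtain ⟨r, hr⟩ := hbij.2 ⟨e, he⟩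
    exact ⟨r, congrArg Subtype.val hr⟩
  refine ⟨fun i => a (φ i), fun i => b (φ i),
    fun i => rayFrom (b (φ i)) (b (φ i) - a (φ i)), ?_, ?_, ?_⟩
  · ext e
    constructor
    · intro he
      obtain ⟨r, hr⟩ := hsurj e he
      refine ⟨φ.symm r, ?_⟩
      simp only [Equiv.apply_symm_apply]; exact hr
    · rintro ⟨i, rfl⟩
      exact hab (φ i)
  · intro i
    ext x
    constructor
    · rintro ⟨t, t0, rfl⟩
      refine ⟨t, t0, rfl, fun u u0 _ hc => ?_⟩
      simp only [mem_iUnion] at hc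
      obtain ⟨j, hj, hc⟩ := hc
      have hne : φ i ≠ φ j := fun e => hj.ne (φ.injective e).symm
      exact (hrd _ _ hne).le_bot ⟨hrs _ ⟨u, u0, rfl⟩, hrs _ hc⟩
    · rintro ⟨t, t0, rfl, -⟩
      exact ⟨t, t0, rfl⟩
  · intro i e he hne
    obtain ⟨r, rfl⟩ := hsurj e he
    have hne' : φ i ≠ r := by rintro rfl; exact hne rfl
    exact (hrd _ _ hne').mono (hrs _) (hsub r)

end

end CircumscribingPolygon

theorem mainTheorem5 (S : Finset (Sym2 Plane)) (hS : IsDisjointSegments S)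
    (hnc : ¬ Collinear ℝ (endpoints S)) :
    (AdmitsEscapeRoutes S →
      ∃ (m : ℕ) (P : Polygon Plane m), IsCircumscribingPolygon P S) ∧
    (ExtensibleToRays S →
      ∃ (m : ℕ) (P : Polygon Plane m), IsCircumscribingPolygon P S) := by
  exact ⟨exists_circumscribing_of_escape hS hnc, fun h =>
    exists_circumscribing_of_escape hS hnc (admitsEscapeRoutes_of_extensible hS h)⟩
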